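/- **Setting.** Let $(X,\omega)$ be a symplectic $4$-manifold, $(L,h)$ a smooth hermitian complex line bundle on $X$ with a hermitian connection $\nabla$ of curvature $F^\nabla=-\sqrt{-1}\,\omega$, and $\pi\colon\mathbb S=\{u\in L;\ h(u,u)=1\}\to X$ its unit circle bundle, on which $e^{\sqrt{-1}\tau}\in S^1$ acts by multiplication, with (real) connection form $\Gamma^\nabla$ equal to $1$ on the generator of the action. Let $g$ be a Riemannian metric on $X$, and $\hat g=(\Gamma^\nabla)^2+\pi^*g$ the induced metric on $\mathbb S$. Let $B$ be a smooth surface, $\mu\colon X\to B$ a proper smooth map with connected (nonempty) fibers $X_w=\mu^{-1}(w)$, and $B^{\rm rg}\subset B$ an open set with finite complement that consists of regular values of $\mu$ whose fibers are Lagrangian. For $m\ge 1$, $BS_m$ is the set of $b\in B$ such that the connection induced by $\nabla$ on $L^{\otimes m}$ has trivial holonomy along all loops in $X_b$, and $BS_m^{\rm str}=BS_m\setminus\bigcup_{1\le l<m}BS_l$. Let $b\in B$, let $W$ be an open neighborhood of $b$ with $W\setminus\{b\}\subset B^{\rm rg}$, put $U=\mu^{-1}(W)$, let $\gamma\in\Omega^1(U)$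 be smooth with $\omega|_U=d\gamma$, let $\zeta\colon W\to\mathbb R^2$ be continuous with $\zeta(b)=0$ and $\zeta|_{W\setminus\{b\}}$ a smooth open embedding, and let $K>0$, $0<\delta<1$, $0<\sigma<R$. Write $g_0=d\xi_1^2+d\xi_2^2$, $\mathcal B(\rho)=\{\xi\in\mathbb R^2;\ \|\xi\|<\rho\}$, $r=\|\zeta\circ\mu\|\colon U\to\mathbb R$. Let $V_f=\ker d\mu$, let $V_f^\perp$ be its $g$-orthogonal complement, $\gamma_f,\gamma_\perp$ the restrictions of $\gamma$ to $V_f,V_f^\perp$, and $g_\perp$ the restriction of $g$ to $V_f^\perp$. Conditions $(\star1)$–$(\star7)$ on $(g,b,W,R,\gamma,\zeta,\sigma,\delta,K)$ are: 1. The restriction $H^1(U)\to H^1(X_b)$ is an isomorphism, with coefficients $\mathbb Z$ and with coefficients $\mathbb R$. 2. $L|_U$ is trivial as a complex line bundle. 3. There are $1$-cycles $e_{1,w},e_{2,w}$ in $X_w$ $(w\in W)$ that generate $H_1(X_w,\mathbb Z)$ and whose classes in $H_1(U,\mathbb Z)$ do not depend on $w$, such that the functions $\Psi_i(w)=\int_{e_{i,w}}\gamma$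 on $W$ are continuous, $\Psi_i(b)=0$, and $b$ is isolated in $\{w\in W;\ \Psi_1(w)=\Psi_2(w)=0\}$. 4. $|\gamma_\perp|_g\le\delta$ and $|\gamma_\perp|_{(\zeta\circ\mu)^*g_0}\le\delta$ where $0<r<3R$; $(1+\delta)^{-1}(\zeta\circ\mu)^*g_0\le g_\perp\le(1+\delta)(\zeta\circ\mu)^*g_0$ on $V_f^\perp$ and $(1+\delta)^{-1}r^2\le|\gamma_f|_g^2\le(1+\delta)r^2$ where $\sigma\le r<3R$; and $|\gamma_f|_g^2\le\delta$ on $\{r\le\sigma\}\cap\mu^{-1}(B^{\rm rg})$. 5. $\overline{\mathcal B(3R)}\subset\zeta(W)$. 6. With respect to the intrinsic distances (infima of $g$-lengths of curves inside the set), $\sup_{w\in\zeta^{-1}(\mathcal B(3R))}\operatorname{diam}X_w<\delta$ and $\operatorname{diam}\{r\le\sigma\}<\delta$. 7. With $\nu_g,\nu_{g_0}$ the Riemannian measures, $(1+\delta)^{-1}\nu_{g_0}\le K\,(\zeta\circ\mu)_*\nu_g\le(1+\delta)\nu_{g_0}$ on $\mathcal B(R)$. An *$m$-fold angular coordinate*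 on $\mathbb S|_U$ adapted to $\gamma$ is a map $\theta\colon\mathbb S|_U\to S^1$, differentiable along every differentiable curve, with $\theta(u\cdot e^{\sqrt{-1}\tau})=e^{\sqrt{-1}m\tau}\theta(u)$ and $d\theta=\sqrt{-1}\,m\,(\Gamma^\nabla+\pi^*\gamma)\,\theta$. Equivalently, there are an $m$-fold covering $p_m\colon\tilde U_m\to U$ with deck group $\mathbb Z/m\mathbb Z$ and an $S^1$-equivariant $m$-fold covering $\hat p_m\colon S^1\times\tilde U_m\to\mathbb S|_U$ over $p_m$ with $\hat p_m^*\hat g=(dt-p_m^*\gamma)^2+p_m^*g$ and $\theta(\hat p_m(e^{\sqrt{-1}t},y))=e^{\sqrt{-1}mt}$; for $m=1$ it is a trivialization $\mathbb S|_U\cong S^1\times U$ with $\hat g=(dt-\gamma)^2+g$. For such $\theta$ put $$\phi\colon\mathbb S|_U\to S^1\times\mathbb R^2,\qquad \phi(u)=\bigl(\theta(u),\,\zeta(\mu(\pi(u)))\bigr).$$ (For $m=1$ this is $\phi(e^{\sqrt{-1}t},x)=(e^{\sqrt{-1}t},\zeta\circ\mu(x))$; in general it is induced by $(e^{\sqrt{-1}t},y)\mapsto(e^{\sqrt{-1}t},\zeta\circ\mu\circ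 p_m(y))$ and the identification $(S^1\times\mathbb R^2)/(\mathbb Z/m\mathbb Z)\cong S^1\times\mathbb R^2$, $(e^{\sqrt{-1}t},\xi)\mapsto(e^{\sqrt{-1}mt},\xi)$.) Equip $S^1\times\mathbb R^2$ with the metric $$\hat g_{0,m}=\frac{dt^2}{m^2(1+\|\xi\|^2)}+d\xi_1^2+d\xi_2^2$$ and the $S^1$-action $(e^{\sqrt{-1}t},\xi)\cdot e^{\sqrt{-1}\tau}=(e^{\sqrt{-1}(t+m\tau)},\xi)$. **Theorem.** Let $m\ge1$, $R\ge4\sqrt2\,(3-2\sqrt2)^{-1}$ and $\varepsilon>0$. There are constants $\delta_0,\sigma_0>0$, depending only on $m,R,\varepsilon$, such that the following holds for all data as above satisfying $(\star1)$–$(\star7)$ with $\delta\le\delta_0$, $\sigma\le\sigma_0$, and with $b\in BS_m^{\rm str}$, and for all $q\in\mu^{-1}(b)$ and $p\in\pi^{-1}(q)$. The ball $B_g(q,R)$ is contained in $U$; there is an $m$-fold angular coordinate $\theta$ on $\mathbb S|_U$ adapted to $\gamma$ with $\phi(p)=(1,0)$; and for every $m$-fold angular coordinate $\theta$ adapted to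 $\gamma$, $\phi$ maps $\pi^{-1}(B_g(q,R))$ into $S^1\times\mathcal B(\sqrt{1+\delta}\,R+\sigma)$ and $$\phi\colon\bigl(\pi^{-1}(B_g(q,R)),d_{\hat g}\bigr)\to\bigl(S^1\times\mathcal B(\sqrt{1+\delta}\,R+\sigma),d_{\hat g_{0,m}}\bigr)$$ is an $S^1$-equivariant Borel $\varepsilon$-isometry, that is: $\phi$ is $S^1$-equivariant and Borel; $|d_{\hat g_{0,m}}(\phi(u),\phi(u'))-d_{\hat g}(u,u')|<\varepsilon$ for all $u,u'\in\pi^{-1}(B_g(q,R))$; and every point of $S^1\times\mathcal B(\sqrt{1+\delta}\,R+\sigma)$ has distance $<\varepsilon$ from the image. Here $d_{\hat g}$ and $d_{\hat g_{0,m}}$ are the Riemannian distances of $\mathbb S$ and $S^1\times\mathbb R^2$. -/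

import Mathlib

open Set Filter Topology Manifold MeasureTheory Bundle
open scoped ContDiff ENNReal

noncomputable section

namespace BohrSommerfeld

/-- The Euclidean plane `ℝ²` and the Euclidean space `ℝ⁴` on which `4`-manifolds are modelled. -/
abbrev Plane := EuclideanSpace ℝ (Fin 2)

/-- See `Plane`. -/
abbrev Four := EuclideanSpace ℝ (Fin 4)

/-! ### Singular chains and cochains in low degree -/

section Singular

/-- Singular `n`-simplices of `Y`. -/
abbrev Simplex (n : ℕ) (Y : Type*) [TopologicalSpace Y] := C(stdSimplex ℝ (Fin (n + 1)), Y)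

variable {Y Z : Type*} [TopologicalSpace Y] [TopologicalSpace Z]

/-- The `i`-th face of a singular simplex. -/
def face {n : ℕ} (i : Fin (n + 2)) (s : Simplex (n + 1) Y) : Simplex n Y :=
  s.comp ⟨stdSimplex.map i.succAbove, stdSimplex.continuous_map _⟩

variable (Y) in
/-- The boundary map from singular `(n+1)`-chains to singular `n`-chains with coefficients `ℤ`. -/
def boundary (n : ℕ) : (Simplex (n + 1) Y →₀ ℤ) →+ (Simplex n Y →₀ ℤ) :=
  Finsupp.liftAddHom fun s =>
    ∑ i : Fin (n + 2), ((-1 : ℤ) ^ (i : ℕ)) • Finsupp.singleAddHom (face i s)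

/-- The chain map induced by a continuous map. -/
def pushChain (f : C(Y, Z)) (n : ℕ) : (Simplex n Y →₀ ℤ) →+ (Simplex n Z →₀ ℤ) :=
  Finsupp.mapDomain.addMonoidHom fun s => f.comp s

lemma boundary_pushChain (f : C(Y, Z)) (n : ℕ) (c : Simplex (n + 1) Y →₀ ℤ) :
    boundary Z n (pushChain f (n + 1) c) = pushChain f n (boundary Y n c) := by
  have : (boundary Z n).comp (pushChain f (n + 1)) = (pushChain f n).comp (boundary Y n) := by
    ext s : 2
    simp [boundary, pushChain, Finsupp.mapDomain_single, map_sum, face, ContinuousMap.comp_assoc]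
  exact DFunLike.congr_fun this c

variable (Y) in
/-- Singular `1`-cycles. -/
abbrev Cycle₁ : AddSubgroup (Simplex 1 Y →₀ ℤ) := (boundary Y 0).ker

variable (Y) in
/-- The first singular homology group `H₁(Y, ℤ)`. -/
abbrev Homology₁ := Cycle₁ Y ⧸ ((boundary Y 1).range.addSubgroupOf (Cycle₁ Y))

/-- The homology class of a cycle. -/
abbrev Cycle₁.cls (e : Cycle₁ Y) : Homology₁ Y := QuotientAddGroup.mk e

/-- The image of a cycle under a continuous map. -/
def Cycle₁.push (f : C(Y, Z)) (e : Cycle₁ Y) : Cycle₁ Z :=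
  ⟨pushChain f 1 e.1, by
    rw [AddMonoidHom.mem_ker, boundary_pushChain, AddMonoidHom.mem_ker.1 e.2, map_zero]⟩

variable (Y) in
/-- The coboundary map on singular cochains with coefficients in `A`. -/
def coboundary (A : Type*) [AddCommGroup A] (n : ℕ) : (Simplex n Y → A) →+ (Simplex (n + 1) Y → A)
    where
  toFun c := fun s => ∑ i : Fin (n + 2), ((-1 : ℤ) ^ (i : ℕ)) • c (face i s)
  map_zero' := by ext; simp
  map_add' c c' := by ext; simp [smul_add, Finset.sum_add_distrib]

variable (Y) in
/-- The first singular cohomology group `H¹(Y, A)`. -/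
abbrev Cohomology₁ (A : Type*) [AddCommGroup A] :=
  (coboundary Y A 1).ker ⧸ ((coboundary Y A 0).range.addSubgroupOf (coboundary Y A 1).ker)

/-- The cochain map induced by a continuous map. -/
def pullCochain (A : Type*) [AddCommGroup A] (f : C(Y, Z)) (n : ℕ) :
    (Simplex n Z → A) →+ (Simplex n Y → A) where
  toFun c := fun s => c (f.comp s)
  map_zero' := rfl
  map_add' _ _ := rfl

lemma coboundary_pullCochain (A : Type*) [AddCommGroup A] (f : C(Y, Z)) (n : ℕ)
    (c : Simplex n Z → A) :
    coboundary Y A n (pullCochain A f n c) = pullCochain A f (n + 1) (coboundary Z A n c) := rfl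

/-- The induced map on cocycles. -/
def pullCocycle (A : Type*) [AddCommGroup A] (f : C(Y, Z)) :
    (coboundary Z A 1).ker →+ (coboundary Y A 1).ker :=
  ((pullCochain A f 1).comp (coboundary Z A 1).ker.subtype).codRestrict _ fun c => by
    rw [AddMonoidHom.mem_ker, AddMonoidHom.comp_apply, coboundary_pullCochain]
    have := AddMonoidHom.mem_ker.1 c.2
    simp [this]

/-- The induced map `f^* : H¹(Z, A) → H¹(Y, A)`. -/
def Cohomology₁.pull (A : Type*) [AddCommGroup A] (f : C(Y, Z)) :
    Cohomology₁ Z A →+ Cohomology₁ Y A :=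
  QuotientAddGroup.map _ _ (pullCocycle A f) (by
    rintro c ⟨k, hk⟩
    exact ⟨pullCochain A f 0 k, by
      rw [coboundary_pullCochain, hk]; rfl⟩)

/-- A singular `1`-simplex as a curve with parameter in `[0, 1]` (constant outside). -/
def Simplex.curve (s : Simplex 1 Y) (t : ℝ) : Y :=
  s (stdSimplexHomeomorphUnitInterval.symm (projIcc 0 1 zero_le_one t))

end Singular

/-! ### Piecewise `C¹` curves, length, distance -/

section Length

variable {E H M : Type*} [NormedAddCommGroup E] [NormedSpace ℝ E] [TopologicalSpace H]
  (I : ModelWithCorners ℝ E H) [TopologicalSpace M] [ChartedSpace H M]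

/-- `c` restricted to `[0, 1]` is a piecewise `C¹` curve. -/
def PiecewiseC1 (c : ℝ → M) : Prop :=
  ContinuousOn c (Icc 0 1) ∧ ∃ (n : ℕ) (t : ℕ → ℝ), Monotone t ∧ t 0 = 0 ∧ t n = 1 ∧
    ∀ i < n, ContMDiffOn 𝓘(ℝ, ℝ) I 1 c (Icc (t i) (t (i + 1)))

/-- The velocity of a curve. -/
def velocity (c : ℝ → M) (t : ℝ) : TangentSpace I (c t) :=
  mfderiv 𝓘(ℝ, ℝ) I c t (1 : ℝ)

/-- The length of a curve on `[0, 1]`, for a given norm `N` on tangent vectors. -/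
def curveLength (N : (x : M) → TangentSpace I x → ℝ) (c : ℝ → M) : ℝ≥0∞ :=
  ∫⁻ t in Icc (0 : ℝ) 1, ENNReal.ofReal (N (c t) (velocity I c t))

/-- The infimum of the lengths of the piecewise `C¹` curves from `x` to `y` contained in `A`;
for `A = univ` this is the usual distance, in general it is the intrinsic distance of `A`. -/
def lengthDist (N : (x : M) → TangentSpace I x → ℝ) (A : Set M) (x y : M) : ℝ≥0∞ :=
  ⨅ (c : ℝ → M) (_ : PiecewiseC1 I c ∧ c 0 = x ∧ c 1 = y ∧ ∀ t ∈ Icc (0 : ℝ) 1, c t ∈ A),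
    curveLength I N c

/-- The intrinsic diameter of `A`. -/
def lengthDiam (N : (x : M) → TangentSpace I x → ℝ) (A : Set M) : ℝ≥0∞ :=
  ⨆ x ∈ A, ⨆ y ∈ A, lengthDist I N A x y

end Length

/-! ### The limit space `S¹ × ℝ²` -/

/-- The norm of the metric `dt² / (m² (1 + ‖ξ‖²)) + dξ₁² + dξ₂²` in the coordinates `(t, ξ)`. -/
def modelNorm (m : ℕ) (p : ℝ × Plane) (v : TangentSpace 𝓘(ℝ, ℝ × Plane) p) : ℝ :=
  let w : ℝ × Plane := v
  √(w.1 ^ 2 / ((m : ℝ) ^ 2 * (1 + ‖p.2‖ ^ 2)) + ‖w.2‖ ^ 2)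

/-- The Riemannian distance on `S¹ × ℝ²` of `dt² / (m² (1 + ‖ξ‖²)) + dξ₁² + dξ₂²`: the infimum of
the lengths of the curves `(e^{i c₁}, c₂)`. -/
def modelDist (m : ℕ) (p p' : Circle × Plane) : ℝ≥0∞ :=
  ⨅ (t : ℝ) (t' : ℝ) (_ : Circle.exp t = p.1 ∧ Circle.exp t' = p'.1),
    lengthDist 𝓘(ℝ, ℝ × Plane) (modelNorm m) univ (t, p.2) (t', p'.2)

/-- The action of `S¹` on `S¹ × ℝ²` given by `(e^{it}, ξ) · e^{iτ} = (e^{i(t + mτ)}, ξ)`. -/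
def modelRot (m : ℕ) (a : Circle) (p : Circle × Plane) : Circle × Plane := (a ^ m * p.1, p.2)

/-- `φ` restricts to an `S¹`-equivariant Borel `ε`-isometry from `(D, d)` to `(D₀, d₀)`. The last
two fields say that `|d₀ (φ u) (φ u') - d u u'| < ε` (so both distances are finite), and that `D₀`
is contained in the `ε`-neighbourhood of the image. -/
structure IsEquivariantBorelIsometry {P Q : Type*} [TopologicalSpace P] [TopologicalSpace Q]
    (rot : Circle → P → P) (rot₀ : Circle → Q → Q) (d : P → P → ℝ≥0∞) (d₀ : Q → Q → ℝ≥0∞)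
    (D : Set P) (D₀ : Set Q) (ε : ℝ) (φ : P → Q) : Prop where
  mapsTo : MapsTo φ D D₀
  equivariant : ∀ a, ∀ u ∈ D, rot a u ∈ D ∧ φ (rot a u) = rot₀ a (φ u)
  borel : @Measurable D Q (borel D) (borel Q) (fun u => φ u)
  almost_isometric : ∀ u ∈ D, ∀ u' ∈ D,
    d₀ (φ u) (φ u') < d u u' + ENNReal.ofReal ε ∧ d u u' < d₀ (φ u) (φ u') + ENNReal.ofReal ε
  almost_onto : ∀ y ∈ D₀, ∃ u ∈ D, d₀ (φ u) y < ENNReal.ofReal ε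

/-! ### Differential forms and Riemannian metrics on a `4`-manifold -/

section Manifold

variable {X : Type*} [TopologicalSpace X] [ChartedSpace Four X]

variable (X) in
/-- (Not necessarily smooth) `1`-forms on `X`. -/
abbrev OneForm := (x : X) → TangentSpace (𝓡 4) x →L[ℝ] ℝ

variable (X) in
/-- (Not necessarily smooth or alternating) covariant `2`-tensors on `X`. -/
abbrev TwoTensor := (x : X) → TangentSpace (𝓡 4) x →L[ℝ] TangentSpace (𝓡 4) x →L[ℝ] ℝ

variable [IsManifold (𝓡 4) ∞ X]

/-- The derivative `V f` at `x` of a function in the direction of a vector field. -/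
abbrev lieD (V : (x : X) → TangentSpace (𝓡 4) x) (f : X → ℝ) (x : X) : ℝ :=
  mvfderiv (𝓡 4) f x (V x)

/-- A smooth vector field near `x`. -/
abbrev SmoothFieldAt (V : (x : X) → TangentSpace (𝓡 4) x) (x : X) : Prop :=
  ContMDiffAt (𝓡 4) ((𝓡 4).prod 𝓘(ℝ, Four)) ∞ (fun y => TotalSpace.mk' Four y (V y)) x

/-- The Lie bracket of vector fields. -/
abbrev bracket (V W : (x : X) → TangentSpace (𝓡 4) x) : (x : X) → TangentSpace (𝓡 4) x :=
  VectorField.mlieBracket (𝓡 4) V W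

/-- Smoothness of a `1`-form on a set. -/
def OneForm.SmoothOn (γ : OneForm X) (U : Set X) : Prop :=
  ContMDiffOn (𝓡 4) ((𝓡 4).prod 𝓘(ℝ, Four →L[ℝ] ℝ)) ∞
    (fun x => TotalSpace.mk' (Four →L[ℝ] ℝ) (E := fun x : X => TangentSpace (𝓡 4) x →L[ℝ] ℝ)
      x (γ x)) U

/-- `Ω = dγ` on the open set `U`. -/
def IsExteriorDerivOn (γ : OneForm X) (Ω : TwoTensor X) (U : Set X) : Prop :=
  ∀ x ∈ U, ∀ V W : (x : X) → TangentSpace (𝓡 4) x, SmoothFieldAt V x → SmoothFieldAt W x →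
    lieD V (fun y => γ y (W y)) x - lieD W (fun y => γ y (V y)) x - γ x (bracket V W x)
      = Ω x (V x) (W x)

/-- Symplectic forms. -/
structure IsSymplectic (Ω : TwoTensor X) : Prop where
  smooth : ContMDiff (𝓡 4) ((𝓡 4).prod 𝓘(ℝ, Four →L[ℝ] Four →L[ℝ] ℝ)) ∞
    (fun x => TotalSpace.mk' (Four →L[ℝ] Four →L[ℝ] ℝ)
      (E := fun x : X => TangentSpace (𝓡 4) x →L[ℝ] TangentSpace (𝓡 4) x →L[ℝ] ℝ) x (Ω x))
  alternating : ∀ x v, Ω x v v = 0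
  nondegenerate : ∀ x v, (∀ w, Ω x v w = 0) → v = 0
  closed : ∀ x, ∀ V₀ V₁ V₂ : (x : X) → TangentSpace (𝓡 4) x,
    SmoothFieldAt V₀ x → SmoothFieldAt V₁ x → SmoothFieldAt V₂ x →
      lieD V₀ (fun y => Ω y (V₁ y) (V₂ y)) x - lieD V₁ (fun y => Ω y (V₀ y) (V₂ y)) x
        + lieD V₂ (fun y => Ω y (V₀ y) (V₁ y)) x
        - Ω x (bracket V₀ V₁ x) (V₂ x) + Ω x (bracket V₀ V₂ x) (V₁ x)
        - Ω x (bracket V₁ V₂ x) (V₀ x) = 0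

variable (X) in
/-- Smooth Riemannian metrics on `X`. -/
abbrev Metric := ContMDiffRiemannianMetric (𝓡 4) ∞ Four (fun x : X => TangentSpace (𝓡 4) x)

/-- The norm of tangent vectors with respect to `g`. -/
def Metric.norm (g : Metric X) (x : X) (v : TangentSpace (𝓡 4) x) : ℝ := √(g.inner x v v)

/-- `ν` is the Riemannian measure of `g`: in every chart it is `√(det g_ij) dx₁⋯dx₄`. -/
def Metric.IsVolume (g : Metric X) (ν : @Measure X (borel X)) : Prop :=
  ∀ x₀ : X, ∀ A ⊆ (chartAt Four x₀).source, MeasurableSet[borel X] A →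
    ν A = ∫⁻ y in chartAt Four x₀ '' A, ENNReal.ofReal √(Matrix.det (Matrix.of fun i j : Fin 4 =>
      g.inner ((chartAt Four x₀).symm y)
        (mfderiv 𝓘(ℝ, Four) (𝓡 4) (chartAt Four x₀).symm y (EuclideanSpace.single i (1 : ℝ)))
        (mfderiv 𝓘(ℝ, Four) (𝓡 4) (chartAt Four x₀).symm y (EuclideanSpace.single j (1 : ℝ)))))

/-- The integral of a `1`-form along a curve with parameter in `[0, 1]`. -/
def OneForm.integral (γ : OneForm X) (c : ℝ → X) : ℝ :=
  ∫ t in (0 : ℝ)..1, γ (c t) (velocity (𝓡 4) c t)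

/-- The integral of a `1`-form on `X` over a `1`-cycle of a subspace of `X`. -/
def OneForm.integralCycle (γ : OneForm X) {A : Set X} (e : Cycle₁ A) : ℝ :=
  e.1.sum fun s n => (n : ℝ) * γ.integral (fun t => (s.curve t : X))

/-! ### Prequantum line bundles -/

variable {L : X → Type*} [TopologicalSpace (TotalSpace ℂ L)] [∀ x, NormedAddCommGroup (L x)]
  [∀ x, InnerProductSpace ℂ (L x)] [FiberBundle ℂ L] [VectorBundle ℝ ℂ L] [VectorBundle ℂ ℂ L]
  [ContMDiffVectorBundle ∞ ℂ L (𝓡 4)]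

/-- Smoothness of a section of `L` near `x`. -/
abbrev SmoothSectionAt (s : (x : X) → L x) (x : X) : Prop :=
  ContMDiffAt (𝓡 4) ((𝓡 4).prod 𝓘(ℝ, ℂ)) ∞ (fun y => TotalSpace.mk' ℂ y (s y)) x

/-- The hermitian metric `h` of `L` is smooth, and `∇` is a smooth hermitian connection on `L` with
curvature form `-√-1 Ω`, that is `∇_V ∇_W s - ∇_W ∇_V s - ∇_{[V, W]} s = -√-1 Ω(V, W) s`. In Mathlib's notation,
`(∇_V s)(x)` is `∇ s x (V x)`. -/
structure IsPrequantum (nabla : CovariantDerivative (𝓡 4) ℂ L) (Ω : TwoTensor X) : Prop where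
  smooth_metric : ∀ (s s' : (x : X) → L x) (x : X), SmoothSectionAt s x → SmoothSectionAt s' x →
    ContMDiffAt (𝓡 4) 𝓘(ℝ, ℂ) ∞ (fun y => inner ℂ (s y) (s' y)) x
  smooth : CovariantDerivative.ContMDiffCovariantDerivative nabla ∞
  complex_linear : ∀ (s : (x : X) → L x) (x : X), SmoothSectionAt s x →
    ∀ v, nabla (fun y => Complex.I • s y) x v = Complex.I • nabla s x v
  hermitian : ∀ (s s' : (x : X) → L x) (x : X), SmoothSectionAt s x → SmoothSectionAt s' x →
    ∀ v, mvfderiv (𝓡 4) (fun y => inner ℂ (s y) (s' y)) x v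
      = inner ℂ (nabla s x v) (s' x) + inner ℂ (s x) (nabla s' x v)
  curvature : ∀ (s : (x : X) → L x) (V W : (x : X) → TangentSpace (𝓡 4) x) (x : X),
    SmoothSectionAt s x → SmoothFieldAt V x → SmoothFieldAt W x →
      nabla (fun y => nabla s y (W y)) x (V x) - nabla (fun y => nabla s y (V y)) x (W x)
        - nabla s x (bracket V W x) = (-(Complex.I * (Ω x (V x) (W x) : ℂ))) • s x

variable (L) in
/-- The unit circle bundle `𝕊 = {u ∈ L; h(u, u) = 1}`. -/
def circleBundle : Set (TotalSpace ℂ L) := {u | ‖u.2‖ = 1}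

/-- The action of `S¹` on `L`. -/
def rot (a : Circle) (u : TotalSpace ℂ L) : TotalSpace ℂ L := ⟨u.proj, (a : ℂ) • u.2⟩

/-- The differential of the projection `L → X`. -/
def dproj (u : TotalSpace ℂ L) (v : TangentSpace ((𝓡 4).prod 𝓘(ℝ, ℂ)) u) :
    TangentSpace (𝓡 4) u.proj :=
  mfderiv ((𝓡 4).prod 𝓘(ℝ, ℂ)) (𝓡 4) (fun u' : TotalSpace ℂ L => u'.proj) u v

/-- The (real) connection form `Γ^∇` of `∇` on the unit circle bundle, equal to `1` on the generator
of the action of `S¹`. If `v` is the velocity of a curve `u(τ)` in the circle bundle over a curve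
`x(τ)`, then `Γ^∇(v) = Im h(u, ∇u/dτ)`. It is computed with a local section `s` of `L` through `u`,
by `h(s, u)' = h(∇_{x'} s, u) + h(s, ∇u/dτ)`; the result does not depend on the section. -/
def connectionForm (nabla : CovariantDerivative (𝓡 4) ℂ L) (u : TotalSpace ℂ L)
    (v : TangentSpace ((𝓡 4).prod 𝓘(ℝ, ℂ)) u) : ℝ :=
  let s : (x : X) → L x := FiberBundle.extend ℂ u.2
  (mvfderiv ((𝓡 4).prod 𝓘(ℝ, ℂ)) (fun u' : TotalSpace ℂ L => inner ℂ (s u'.proj) u'.2) u v).im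
    - (inner ℂ (nabla s u.proj (dproj u v)) u.2).im

/-- The norm of `ĝ = (Γ^∇)² + π^* g` on tangent vectors of the circle bundle. -/
def hatNorm (g : Metric X) (nabla : CovariantDerivative (𝓡 4) ℂ L) (u : TotalSpace ℂ L)
    (v : TangentSpace ((𝓡 4).prod 𝓘(ℝ, ℂ)) u) : ℝ :=
  √(connectionForm nabla u v ^ 2 + g.inner u.proj (dproj u v) (dproj u v))

/-- The Riemannian distance of `ĝ` on the circle bundle. -/
def hatDist (g : Metric X) (nabla : CovariantDerivative (𝓡 4) ℂ L) (u u' : TotalSpace ℂ L) :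
    ℝ≥0∞ :=
  lengthDist ((𝓡 4).prod 𝓘(ℝ, ℂ)) (hatNorm g nabla) (circleBundle L) u u'

/-- The Riemannian distance of `g` on `X`. -/
def Metric.dist (g : Metric X) (x y : X) : ℝ≥0∞ := lengthDist (𝓡 4) g.norm univ x y

/-- The holonomies of the connection along loops contained in `F`: the `a ∈ S¹` such that some
horizontal curve in the circle bundle over a piecewise `C¹` loop in `F` goes from `u` to `u · a`. -/
def holonomy (nabla : CovariantDerivative (𝓡 4) ℂ L) (F : Set X) : Set Circle :=
  {a | ∃ c : ℝ → TotalSpace ℂ L, PiecewiseC1 ((𝓡 4).prod 𝓘(ℝ, ℂ)) c ∧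
    (∀ t ∈ Icc (0 : ℝ) 1, c t ∈ circleBundle L ∧ (c t).proj ∈ F) ∧
    (∀ᵐ t, t ∈ Icc (0 : ℝ) 1 →
      connectionForm nabla (c t) (velocity ((𝓡 4).prod 𝓘(ℝ, ℂ)) c t) = 0) ∧
    c 1 = rot a (c 0)}

variable {B : Type*} [TopologicalSpace B] [ChartedSpace Plane B]

/-- The Bohr–Sommerfeld points of level `m`: the connection induced on `L^{⊗m}`, whose holonomy
along a loop is the `m`-th power of that of `∇`, has trivial holonomy on the fiber. -/
def BS (nabla : CovariantDerivative (𝓡 4) ℂ L) (μ : X → B) (m : ℕ) : Set B :=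
  {b | ∀ a ∈ holonomy nabla (μ ⁻¹' {b}), a ^ m = 1}

/-- The strict Bohr–Sommerfeld points of level `m`. -/
def strictBS (nabla : CovariantDerivative (𝓡 4) ℂ L) (μ : X → B) (m : ℕ) : Set B :=
  {b | b ∈ BS nabla μ m ∧ ∀ l, 1 ≤ l → l < m → b ∉ BS nabla μ l}

/-! ### The fibration and the tuple `(g, b, W, R, γ, ζ, σ, δ, K)` -/

/-- `μ : X → B` is a proper smooth map with connected fibers, and `Brg ⊆ B` is an open set with
finite complement, consisting of regular values whose fibers are Lagrangian. -/
structure IsFibration (Ω : TwoTensor X) (μ : X → B) (Brg : Set B) : Prop where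
  smooth : ContMDiff (𝓡 4) (𝓡 2) ∞ μ
  proper : IsProperMap μ
  connected : ∀ w, IsConnected (μ ⁻¹' {w})
  isOpen : IsOpen Brg
  finite_compl : Brgᶜ.Finite
  regular : ∀ x, μ x ∈ Brg → Function.Surjective (mfderiv (𝓡 4) (𝓡 2) μ x)
  lagrangian : ∀ x, μ x ∈ Brg → ∀ v v' : TangentSpace (𝓡 4) x,
    mfderiv (𝓡 4) (𝓡 2) μ x v = 0 → mfderiv (𝓡 4) (𝓡 2) μ x v' = 0 → Ω x v v' = 0

/-- The vertical space `V_f = ker dμ`. -/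
def vert (μ : X → B) (x : X) : Set (TangentSpace (𝓡 4) x) :=
  {v | mfderiv (𝓡 4) (𝓡 2) μ x v = 0}

/-- The orthogonal complement `V_f^⊥` with respect to `g`. -/
def horiz (g : Metric X) (μ : X → B) (x : X) : Set (TangentSpace (𝓡 4) x) :=
  {v | ∀ v' ∈ vert μ x, g.inner x v v' = 0}

/-- The norm of tangent vectors with respect to `(ζ ∘ μ)^* g₀`, with `g₀` the metric of `ℝ²`. -/
def baseNorm (μ : X → B) (ζ : B → Plane) (x : X) (v : TangentSpace (𝓡 4) x) : ℝ :=
  ‖mvfderiv (𝓡 4) (ζ ∘ μ) x v‖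

/-- The standing assumptions on `b`, `W`, `γ`, `ζ` and on the constants. -/
structure IsTuple (Ω : TwoTensor X) (μ : X → B) (Brg : Set B) (b : B) (W : Set B) (R : ℝ)
    (γ : OneForm X) (ζ : B → Plane) (σ δ K : ℝ) : Prop where
  isOpen : IsOpen W
  mem : b ∈ W
  regular : W \ {b} ⊆ Brg
  smooth_γ : γ.SmoothOn (μ ⁻¹' W)
  primitive : IsExteriorDerivOn γ Ω (μ ⁻¹' W)
  continuous_ζ : ContinuousOn ζ W
  ζ_b : ζ b = 0
  smooth_ζ : ContMDiffOn (𝓡 2) 𝓘(ℝ, Plane) ∞ ζ (W \ {b})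
  injective_ζ : InjOn ζ (W \ {b})
  local_diffeo_ζ : ∀ w ∈ W \ {b}, Function.Bijective (mfderiv (𝓡 2) 𝓘(ℝ, Plane) ζ w)
  R_pos : 0 < R
  σ_pos : 0 < σ
  δ_pos : 0 < δ
  K_pos : 0 < K
  δ_lt : δ < 1
  σ_lt : σ < R

/-- The inclusion of the fiber over `w ∈ W` into `μ⁻¹(W)`. -/
def fiberIncl {X B : Type*} [TopologicalSpace X] (μ : X → B) {W : Set B} {w : B} (hw : w ∈ W) :
    C(μ ⁻¹' {w}, μ ⁻¹' W) :=
  ⟨Set.inclusion (preimage_mono (singleton_subset_iff.2 hw)), continuous_inclusion _⟩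

variable (L) in
/-- The conditions on the tuple `(g, b, W, R, γ, ζ, σ, δ, K)`. -/
structure Conditions (g : Metric X) (μ : X → B) (Brg : Set B) (b : B) (W : Set B) (R : ℝ)
    (γ : OneForm X) (ζ : B → Plane) (σ δ K : ℝ) : Prop where
  /-- `H¹(μ⁻¹(W)) → H¹(X_b)` is an isomorphism, for integral and for real coefficients. -/
  cohomology : ∀ hb : b ∈ W, Function.Bijective (Cohomology₁.pull ℤ (fiberIncl μ hb)) ∧
    Function.Bijective (Cohomology₁.pull ℝ (fiberIncl μ hb))
  /-- `L` is trivial over `μ⁻¹(W)`. -/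
  trivial : ∃ s : (x : X) → L x, ∀ x ∈ μ ⁻¹' W, SmoothSectionAt s x ∧ s x ≠ 0
  /-- There are `1`-cycles `e_{1,w}, e_{2,w}` generating `H₁(X_w, ℤ)`, with constant classes in
  `H₁(μ⁻¹(W), ℤ)`, such that the functions `Ψ_i(w) = ∫_{e_{i,w}} γ` are continuous, vanish at `b`,
  and have `b` as an isolated common zero. -/
  cycles : ∃ e : Fin 2 → (w : W) → Cycle₁ (μ ⁻¹' {(w : B)}),
    (∀ i w, ∀ s ∈ (e i w).1.support, PiecewiseC1 (𝓡 4) fun t => (s.curve t : X)) ∧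
    (∀ w, AddSubgroup.closure (range fun i => Cycle₁.cls (e i w)) = ⊤) ∧
    (∀ i w w', Cycle₁.cls (Cycle₁.push (fiberIncl μ w.2) (e i w))
        = Cycle₁.cls (Cycle₁.push (fiberIncl μ w'.2) (e i w'))) ∧
    (∀ i, Continuous fun w => γ.integralCycle (e i w)) ∧
    ∀ w : W, (w : B) = b → (∀ i, γ.integralCycle (e i w) = 0) ∧
      ∀ᶠ w' in 𝓝 w, (∀ i, γ.integralCycle (e i w') = 0) → w' = w
  /-- `|γ_⊥|_g ≤ δ` and `|γ_⊥|_{(ζ ∘ μ)^* g₀} ≤ δ` where `0 < r < 3R`, with `r = ‖ζ ∘ μ‖`. -/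
  γ_horiz : ∀ x, μ x ∈ W → 0 < ‖ζ (μ x)‖ → ‖ζ (μ x)‖ < 3 * R → ∀ v ∈ horiz g μ x,
    |γ x v| ≤ δ * g.norm x v ∧ |γ x v| ≤ δ * baseNorm μ ζ x v
  /-- `(1 + δ)⁻¹ (ζ ∘ μ)^* g₀ ≤ g_⊥ ≤ (1 + δ) (ζ ∘ μ)^* g₀` where `σ ≤ r < 3R`. -/
  g_horiz : ∀ x, μ x ∈ W → σ ≤ ‖ζ (μ x)‖ → ‖ζ (μ x)‖ < 3 * R → ∀ v ∈ horiz g μ x,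
    (1 + δ)⁻¹ * baseNorm μ ζ x v ^ 2 ≤ g.norm x v ^ 2 ∧
      g.norm x v ^ 2 ≤ (1 + δ) * baseNorm μ ζ x v ^ 2
  /-- `(1 + δ)⁻¹ r² ≤ |γ_f|_g² ≤ (1 + δ) r²` where `σ ≤ r < 3R`. -/
  γ_vert : ∀ x, μ x ∈ W → σ ≤ ‖ζ (μ x)‖ → ‖ζ (μ x)‖ < 3 * R →
    (∃ v ∈ vert μ x, g.norm x v = 1 ∧ (1 + δ)⁻¹ * ‖ζ (μ x)‖ ^ 2 ≤ γ x v ^ 2) ∧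
    ∀ v ∈ vert μ x, γ x v ^ 2 ≤ (1 + δ) * ‖ζ (μ x)‖ ^ 2 * g.norm x v ^ 2
  /-- `|γ_f|_g² ≤ δ` where `r ≤ σ` (and `γ_f` is defined). -/
  γ_vert_small : ∀ x, μ x ∈ W → μ x ∈ Brg → ‖ζ (μ x)‖ ≤ σ →
    ∀ v ∈ vert μ x, γ x v ^ 2 ≤ δ * g.norm x v ^ 2
  /-- The closed ball of radius `3R` is contained in `ζ(W)`. -/
  ball_subset : Metric.closedBall (0 : Plane) (3 * R) ⊆ ζ '' W
  /-- The supremum of the intrinsic diameters of the fibers over `r < 3R` is less than `δ`. -/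
  diam_fiber : (⨆ w ∈ {w ∈ W | ‖ζ w‖ < 3 * R}, lengthDiam (𝓡 4) g.norm (μ ⁻¹' {w}))
    < ENNReal.ofReal δ
  /-- The intrinsic diameter of the region `r ≤ σ` is less than `δ`. -/
  diam_core : lengthDiam (𝓡 4) g.norm {x | μ x ∈ W ∧ ‖ζ (μ x)‖ ≤ σ} < ENNReal.ofReal δ
  /-- `(1 + δ)⁻¹ ν_{g₀} ≤ K ζ_* μ_* ν_g ≤ (1 + δ) ν_{g₀}` on the ball of radius `R`. -/
  volume : ∃ ν, g.IsVolume ν ∧ ∀ A ⊆ Metric.ball (0 : Plane) R, MeasurableSet A →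
    ENNReal.ofReal (1 + δ)⁻¹ * MeasureTheory.volume A
        ≤ ENNReal.ofReal K * ν {x | μ x ∈ W ∧ ζ (μ x) ∈ A} ∧
      ENNReal.ofReal K * ν {x | μ x ∈ W ∧ ζ (μ x) ∈ A}
        ≤ ENNReal.ofReal (1 + δ) * MeasureTheory.volume A

/-! ### The approximation map -/

/-- `θ` is an `m`-fold angular coordinate on the circle bundle over `U` adapted to `γ`: it satisfies
`θ(u · e^{iτ}) = e^{imτ} θ(u)`, and `θ = e^{imt}` locally, with `Γ^∇ = dt - γ`, i.e.
`dθ = i m (Γ^∇ + γ) θ` along curves in the circle bundle over `U`.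

For `m = 1` this is the same as a trivialization `u ↦ (θ(u), π(u))`, `𝕊|_U ≅ S¹ × U`, of the
principal bundle for which `ĝ = (dt - γ)² + g`. In general, put `Ũ = {u ∈ 𝕊|_U; θ(u) = 1}`, an
`m`-fold covering `p` of `U` whose deck transformations are given by the `m`-th roots of unity;
`p̂ : S¹ × Ũ → 𝕊|_U`, `(e^{it}, y) ↦ y · e^{it}`, is an `m`-fold covering with
`p̂^* ĝ = (dt - p^*γ)² + p^* g` and `θ(p̂(e^{it}, y)) = e^{imt}`. -/
structure IsAngle (nabla : CovariantDerivative (𝓡 4) ℂ L) (m : ℕ) (γ : OneForm X) (U : Set X)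
    (θ : TotalSpace ℂ L → Circle) : Prop where
  equivariant : ∀ u ∈ circleBundle L, u.proj ∈ U → ∀ a : Circle, θ (rot a u) = a ^ m * θ u
  deriv : ∀ (c : ℝ → TotalSpace ℂ L) (t : ℝ),
    (∀ᶠ τ in 𝓝 t, c τ ∈ circleBundle L ∧ (c τ).proj ∈ U) →
    MDifferentiableAt 𝓘(ℝ, ℝ) ((𝓡 4).prod 𝓘(ℝ, ℂ)) c t →
    HasDerivAt (fun τ => (θ (c τ) : ℂ))
      (Complex.I * m * (connectionForm nabla (c t) (velocity ((𝓡 4).prod 𝓘(ℝ, ℂ)) c t)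
        + γ (c t).proj (dproj (c t) (velocity ((𝓡 4).prod 𝓘(ℝ, ℂ)) c t)) : ℝ) * θ (c t)) t

/-- The approximation map: the map of `𝕊|_U = (S¹ × Ũ) / (ℤ/m)` to `S¹ × ℝ²` induced by
`(e^{it}, y) ↦ (e^{it}, ζ(μ(p(y))))` on `S¹ × Ũ`, where `(S¹ × ℝ²) / (ℤ/m)` is identified with
`S¹ × ℝ²` by `(e^{it}, ξ) ↦ (e^{imt}, ξ)`. -/
def approxMap (μ : X → B) (ζ : B → Plane) (θ : TotalSpace ℂ L → Circle) (u : TotalSpace ℂ L) :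
    Circle × Plane :=
  (θ u, ζ (μ u.proj))

end Manifold

end BohrSommerfeld

end

open BohrSommerfeld

open Set Filter Topology Manifold MeasureTheory Bundle
open scoped ContDiff ENNReal

noncomputable section

set_option linter.unusedSectionVars false

namespace BohrSommerfeld

/-! ### Piecewise `C¹` curves on an interval -/

section Curves

variable {E H M : Type*} [NormedAddCommGroup E] [NormedSpace ℝ E] [TopologicalSpace H]
  {I : ModelWithCorners ℝ E H} [TopologicalSpace M] [ChartedSpace H M]
  {E' H' M' : Type*} [NormedAddCommGroup E'] [NormedSpace ℝ E'] [TopologicalSpace H']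
  {I' : ModelWithCorners ℝ E' H'} [TopologicalSpace M'] [ChartedSpace H' M']

/-! All computations use a unit section `s` of L over U. With α = Im h(s, ∇s) (`potential`), a curve
in 𝕊 that lies over x(τ) at angle ψ(τ) from `s` has Γ = ψ' + α(x'). The curvature condition gives dα
= -ω, so η = α + γ (`totalForm`) is closed. Through θ(u) = h(s, u)^m f(π(u)), an m-fold angular
coordinate is the same as a unit function f on U with df = i m η f (`IsPhase`), and such an f exists
once the periods of mη lie in 2πℤ. On X_b the form γ integrates to zero over generating cycles, and
b ∈ BS_m says that the integrals of mα over loops lie in 2πℤ. The step from X_b to U is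
cohomological: the integral period cocycle extends to U because H¹(U, ℤ) → H¹(X_b, ℤ) is onto, and
the remaining real cocycle is exact because H¹(U, ℝ) → H¹(X_b, ℝ) is injective (`exists_phase`,
`Conditions.exists_angle`).

The model metric arises from a minimisation. The argument of θ moves at the rate m a with a = Γ +
γ(v). For a prescribed a, part of the rate can be produced by γ on a vertical vector, where |γ_f| is
close to r; the minimum of Γ² + |v_f|² is then about a²/(1 + r²). Cauchy–Schwarz gives one
inequality between ĝ and the model metric outside the core r < σ (`Conditions.model_le`), and the
minimising vertical vector gives the other (`Conditions.exists_lift_vector`).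

Model distance ≤ distance in 𝕊, up to an error: an almost shortest curve between two points over the
ball has its projection within r < 3R, because r grows at most at the rate √(1+δ) outside the core
and the fibration cannot be left before r becomes large (`Conditions.mem_of_length_le`). Its image
in the model is no longer controlled inside the core, so the plane is first mapped to itself by
`collapse`, which is C¹ and 1-Lipschitz, sends the core to a point and moves points by at most 2σ
(`Conditions.modelDist_le`).

Distance in 𝕊 ≤ model distance, up to an error: an almost shortest curve in the model is cut into n
short arcs, n depending only on R and the error. Each arc is replaced by its chord, and the chord is
lifted to 𝕊 at nearly the cost in the model; a passage through the core costs only O(δ) more, as the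
core has diameter less than δ (`Conditions.exists_lift_segment`). The lift ends at a point with the
same image under φ as the desired end point.

It remains to see that the fibers of φ are small (`Conditions.hatDist_le_of_fiber`), and here
strictness enters. Moving along short paths in a fiber of μ with θ kept constant is cheap, and short
loops act on the circle fiber by m-th roots of unity. Since the fibers of μ have diameter less than
δ, these roots generate the holonomy of η on the fiber. If they generated a proper subgroup of the
group of m-th roots of unity, of order l < m, then the periods of lη on that fiber would lie in 2πℤ.
They agree with the periods on X_b, where γ has zero integral over every loop
(`Conditions.integral_eq_zero`), so b would belong to BS_l. Hence all m-th roots of unity are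
reached, each by at most m² short moves.

Almost surjectivity follows by lifting a slightly shortened radial segment from p and rotating the
result (`Conditions.exists_modelDist_lt`). -/

variable (I) in
/-- `c` restricted to `[a, b]` is a piecewise `C¹` curve. -/
def PiecewiseC1On (c : ℝ → M) (a b : ℝ) : Prop :=
  ContinuousOn c (Icc a b) ∧ ∃ (n : ℕ) (t : ℕ → ℝ), Monotone t ∧ t 0 = a ∧ t n = b ∧
    ∀ i < n, ContMDiffOn 𝓘(ℝ, ℝ) I 1 c (Icc (t i) (t (i + 1)))

lemma PiecewiseC1.on {c : ℝ → M} (h : PiecewiseC1 I c) : PiecewiseC1On I c 0 1 := h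

namespace PiecewiseC1On

variable {c c' : ℝ → M} {a b d : ℝ}

lemma continuousOn (h : PiecewiseC1On I c a b) : ContinuousOn c (Icc a b) := h.1

lemma le (h : PiecewiseC1On I c a b) : a ≤ b := by
  obtain ⟨-, n, t, ht, rfl, rfl, -⟩ := h
  exact ht (Nat.zero_le n)

lemma refl (c : ℝ → M) (a : ℝ) : PiecewiseC1On I c a a :=
  ⟨by simp, 0, fun _ => a, monotone_const, rfl, rfl, by simp⟩

lemma of_contMDiffOn (hab : a ≤ b) (h : ContMDiffOn 𝓘(ℝ, ℝ) I 1 c (Icc a b)) :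
    PiecewiseC1On I c a b := by
  refine ⟨h.continuousOn, 1, fun i => if i = 0 then a else b, ?_, by simp, by simp, ?_⟩
  · intro i j hij
    by_cases hi : i = 0 <;> by_cases hj : j = 0 <;> simp_all
  · intro i hi
    obtain rfl : i = 0 := by omega
    simpa using h

/-- A property of subintervals that is stable under concatenation has to be checked only on
nondegenerate C¹ arcs. This spares all later arguments the bookkeeping of break points. -/
lemma induction (h : PiecewiseC1On I c a b) {P : ℝ → ℝ → Prop}
    (refl : ∀ x ∈ Icc a b, P x x)
    (arc : ∀ x y, a ≤ x → x < y → y ≤ b → ContMDiffOn 𝓘(ℝ, ℝ) I 1 c (Icc x y) → P x y)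
    (trans : ∀ x y z, a ≤ x → x ≤ y → y ≤ z → z ≤ b → P x y → P y z → P x z) : P a b := by
  obtain ⟨-, n, t, ht, rfl, rfl, hC⟩ := h
  have key : ∀ i, i ≤ n → P (t 0) (t i) := by
    intro i
    induction i with
    | zero => intro _; exact refl _ ⟨le_rfl, ht (Nat.zero_le n)⟩
    | succ i ih =>
      intro hi
      have h1 := ih (by omega)
      rcases (ht (Nat.le_succ i)).eq_or_lt with h2 | h2
      · rw [Nat.succ_eq_add_one] at h2
        rwa [← h2]
      · exact trans _ _ _ le_rfl (ht (Nat.zero_le i)) h2.le (ht hi) h1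
          (arc _ _ (ht (Nat.zero_le i)) h2 (ht hi) (hC i (by omega)))
  exact key n le_rfl

lemma congr (h : PiecewiseC1On I c a b) (hc : EqOn c' c (Icc a b)) : PiecewiseC1On I c' a b := by
  obtain ⟨h0, n, t, ht, rfl, rfl, hC⟩ := h
  refine ⟨h0.congr hc, n, t, ht, rfl, rfl, fun i hi => (hC i hi).congr fun y hy => hc ?_⟩
  exact ⟨(ht (Nat.zero_le i)).trans hy.1, hy.2.trans (ht hi)⟩

lemma trans (h : PiecewiseC1On I c a b) (h' : PiecewiseC1On I c b d) : PiecewiseC1On I c a d := by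
  have hab := h.le
  have hbd := h'.le
  obtain ⟨h0, n, t, ht, rfl, hn, hC⟩ := h
  obtain ⟨h0', n', t', ht', ht'0, rfl, hC'⟩ := h'
  refine ⟨?_, n + n', fun i => if i ≤ n then t i else t' (i - n), ?_, by simp, ?_, ?_⟩
  · rw [← Icc_union_Icc_eq_Icc hab hbd]
    exact h0.union_of_isClosed h0' isClosed_Icc isClosed_Icc
  · refine monotone_nat_of_le_succ fun i => ?_
    by_cases h1 : i + 1 ≤ n
    · simpa [h1, (Nat.le_succ i).trans h1] using ht (Nat.le_succ i)
    · by_cases h2 : i ≤ n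
      · simp only [h2, h1, if_true, if_false]
        calc t i ≤ t n := ht h2
          _ = t' 0 := by rw [hn, ht'0]
          _ ≤ _ := ht' (Nat.zero_le _)
      · simp only [h2, h1, if_false]
        exact ht' (by omega)
  · by_cases h1 : n' = 0
    · subst h1; simp [hn, ht'0]
    · simp [h1]
  · intro i hi
    by_cases h1 : i + 1 ≤ n
    · simpa [h1, (Nat.le_succ i).trans h1] using hC i (by omega)
    · by_cases h2 : i ≤ n
      · obtain rfl : i = n := by omega
        have := hC' 0 (by omega)
        simpa [hn, ← ht'0] using this
      · have := hC' (i - n) (by omega)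
        simp only [h2, h1, if_false]
        rwa [show i + 1 - n = i - n + 1 by omega]

lemma mono (h : PiecewiseC1On I c a b) {x y : ℝ} (hx : a ≤ x) (hxy : x ≤ y) (hy : y ≤ b) :
    PiecewiseC1On I c x y := by
  refine h.induction (P := fun a b => ∀ x y, a ≤ x → x ≤ y → y ≤ b → PiecewiseC1On I c x y)
    ?_ ?_ ?_ x y hx hxy hy
  · intro z _ x y h1 h2 h3
    obtain rfl : x = y := by linarith
    exact refl _ _
  · intro a b _ _ _ hC x y h1 h2 h3
    exact of_contMDiffOn h2 (hC.mono (Icc_subset_Icc h1 h3))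
  · intro a b d _ _ _ _ hP hP' x y h1 h2 h3
    by_cases hyb : y ≤ b
    · exact hP _ _ h1 h2 hyb
    by_cases hxb : b ≤ x
    · exact hP' _ _ hxb h2 h3
    push Not at hyb hxb
    exact (hP _ _ h1 hxb.le le_rfl).trans (hP' _ _ le_rfl hyb.le h3)

lemma comp (h : PiecewiseC1On I c a b) {G : M → M'} {A : Set M} (hG : ContMDiffOn I I' 1 G A)
    (hA : MapsTo c (Icc a b) A) : PiecewiseC1On I' (fun t => G (c t)) a b := by
  obtain ⟨h0, n, t, ht, rfl, rfl, hC⟩ := h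
  refine ⟨hG.continuousOn.comp h0 hA, n, t, ht, rfl, rfl, fun i hi => hG.comp (hC i hi) ?_⟩
  exact fun y hy => hA ⟨(ht (Nat.zero_le i)).trans hy.1, hy.2.trans (ht hi)⟩

lemma comp_mul_add (p q : ℝ) (hp : 0 < p) (h : PiecewiseC1On I c (p * a + q) (p * b + q)) :
    PiecewiseC1On I (fun t => c (p * t + q)) a b := by
  have key := h.induction
    (P := fun x y => PiecewiseC1On I (fun t => c (p * t + q)) ((x - q) / p) ((y - q) / p))
    (fun _ _ => refl _ _) ?_ (fun _ _ _ _ _ _ _ h1 h2 => h1.trans h2)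
  · convert key using 1 <;> field_simp <;> ring
  · intro x y _ hxy _ hC
    refine of_contMDiffOn (by gcongr) ?_
    have h1 : ContMDiff 𝓘(ℝ, ℝ) 𝓘(ℝ, ℝ) 1 (fun t : ℝ => p * t + q) := by
      rw [contMDiff_iff_contDiff]; fun_prop
    refine hC.comp h1.contMDiffOn fun t ht => ?_
    rw [mem_Icc, div_le_iff₀ hp, le_div_iff₀ hp] at ht
    constructor <;> linarith [ht.1, ht.2]

lemma comp_sub (q : ℝ) (h : PiecewiseC1On I c (q - b) (q - a)) :
    PiecewiseC1On I (fun t => c (q - t)) a b := by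
  have key := h.induction
    (P := fun x y => PiecewiseC1On I (fun t => c (q - t)) (q - y) (q - x))
    (fun _ _ => refl _ _) ?_ (fun _ _ _ _ _ _ _ h1 h2 => h2.trans h1)
  · simpa using key
  · intro x y _ hxy _ hC
    refine of_contMDiffOn (by linarith) ?_
    have h1 : ContMDiff 𝓘(ℝ, ℝ) 𝓘(ℝ, ℝ) 1 (fun t : ℝ => q - t) := by
      rw [contMDiff_iff_contDiff]; fun_prop
    refine hC.comp h1.contMDiffOn fun t ht => ?_
    constructor <;> linarith [ht.1, ht.2]

/-- The break points and the end points are finitely many, hence negligible for lengths and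
integrals. -/
lemma ae_contMDiffAt (h : PiecewiseC1On I c a b) :
    ∀ᵐ t, t ∈ Icc a b → t ∈ Ioo a b ∧ ContMDiffAt 𝓘(ℝ, ℝ) I 1 c t := by
  have hne : ∀ x : ℝ, ∀ᵐ t, t ≠ x := fun x => by
    simp [ae_iff]
  refine h.induction
    (P := fun a b => ∀ᵐ t, t ∈ Icc a b → t ∈ Ioo a b ∧ ContMDiffAt 𝓘(ℝ, ℝ) I 1 c t) ?_ ?_ ?_
  · intro x _
    filter_upwards [hne x] with t ht h
    exact absurd (le_antisymm h.2 h.1) ht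
  · intro x y _ _ _ hC
    filter_upwards [hne x, hne y] with t h1 h2 h
    have h3 : t ∈ Ioo x y := ⟨lt_of_le_of_ne h.1 (Ne.symm h1), lt_of_le_of_ne h.2 h2⟩
    exact ⟨h3, (hC t h).contMDiffAt (Icc_mem_nhds h3.1 h3.2)⟩
  · intro x y z _ hxy hyz _ h1 h2
    filter_upwards [h1, h2] with t h1 h2 h
    rcases le_total t y with hy | hy
    · have := h1 ⟨h.1, hy⟩
      exact ⟨⟨this.1.1, this.1.2.trans_le hyz⟩, this.2⟩
    · have := h2 ⟨hy, h.2⟩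
      exact ⟨⟨hxy.trans_lt this.1.1, this.1.2⟩, this.2⟩

lemma enorm_sub_le {f : ℝ → E} (h : PiecewiseC1On 𝓘(ℝ, E) f a b) :
    ‖f b - f a‖ₑ ≤ ∫⁻ t in Icc a b, ‖deriv f t‖ₑ := by
  refine h.induction (P := fun a b => ‖f b - f a‖ₑ ≤ ∫⁻ t in Icc a b, ‖deriv f t‖ₑ) ?_ ?_ ?_
  · simp
  · intro x y _ hxy _ hC
    exact enorm_sub_le_lintegral_deriv_of_contDiffOn_Icc (contMDiffOn_iff_contDiffOn.1 hC) hxy.le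
  · intro x y z _ hxy hyz _ h1 h2
    have hu : Icc x z = Icc x y ∪ Ioc y z := (Icc_union_Ioc_eq_Icc hxy hyz).symm
    rw [hu, lintegral_union measurableSet_Ioc
      (disjoint_left.2 fun t ht ht' => absurd ht.2 (not_le.2 ht'.1)),
      restrict_Ioc_eq_restrict_Icc]
    calc ‖f z - f x‖ₑ = ‖(f y - f x) + (f z - f y)‖ₑ := by congr 1; abel
      _ ≤ ‖f y - f x‖ₑ + ‖f z - f y‖ₑ := enorm_add_le _ _
      _ ≤ _ := add_le_add h1 h2

end PiecewiseC1On

/-! ### Lengths -/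

variable (I) in
/-- The length of a curve on `[a, b]`. -/
def lengthOn (N : (x : M) → TangentSpace I x → ℝ) (c : ℝ → M) (a b : ℝ) : ℝ≥0∞ :=
  ∫⁻ t in Icc a b, ENNReal.ofReal (N (c t) (velocity I c t))

/-- The two velocities live in tangent spaces at points that are equal only by a proof, so the
equality is transported along c t = c' t in the common model space. -/
lemma apply_velocity_congr {γ : Type*} (N : (x : M) → TangentSpace I x → γ) {c c' : ℝ → M} {t : ℝ}
    (h : c =ᶠ[𝓝 t] c') : N (c t) (velocity I c t) = N (c' t) (velocity I c' t) := by
  have h1 : c t = c' t := h.eq_of_nhds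
  have h2 : mfderiv 𝓘(ℝ, ℝ) I c t = mfderiv 𝓘(ℝ, ℝ) I c' t := h.mfderiv_eq
  unfold velocity
  have h3 : ∀ (x : M) (_ : x = c t) (v : E), N x v = N (c t) v := by
    rintro _ rfl v; rfl
  have h4 := h3 (c' t) h1.symm (mfderiv 𝓘(ℝ, ℝ) I c t (1 : ℝ))
  rw [h2] at h4 ⊢
  exact h4.symm

lemma lengthOn_add {N : (x : M) → TangentSpace I x → ℝ} {c : ℝ → M} {a b d : ℝ} (hab : a ≤ b)
    (hbd : b ≤ d) : lengthOn I N c a d = lengthOn I N c a b + lengthOn I N c b d := by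
  have hu : Icc a d = Icc a b ∪ Ioc b d := (Icc_union_Ioc_eq_Icc hab hbd).symm
  rw [lengthOn, hu, lintegral_union measurableSet_Ioc
      (disjoint_left.2 fun t ht ht' => absurd ht.2 (not_le.2 ht'.1)),
      restrict_Ioc_eq_restrict_Icc]
  rfl

lemma lengthOn_mono {N : (x : M) → TangentSpace I x → ℝ} {c : ℝ → M} {a b a' b' : ℝ} (h : a ≤ a')
    (h' : b' ≤ b) : lengthOn I N c a' b' ≤ lengthOn I N c a b :=
  lintegral_mono_set (Icc_subset_Icc h h')

lemma lengthOn_congr {N : (x : M) → TangentSpace I x → ℝ} {c c' : ℝ → M} {a b : ℝ}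
    (h : EqOn c c' (Ioo a b)) : lengthOn I N c a b = lengthOn I N c' a b := by
  unfold lengthOn
  rw [← restrict_Ioo_eq_restrict_Icc]
  refine setLIntegral_congr_fun measurableSet_Ioo fun t ht => ?_
  rw [apply_velocity_congr N (h.eventuallyEq_of_mem (Ioo_mem_nhds ht.1 ht.2))]

lemma velocity_comp_mul_add {c : ℝ → M} (p q t : ℝ)
    (hc : MDifferentiableAt 𝓘(ℝ, ℝ) I c (p * t + q)) :
    velocity I (fun s => c (p * s + q)) t = p • velocity I c (p * t + q) := by
  have h1 : HasMFDerivAt 𝓘(ℝ, ℝ) 𝓘(ℝ, ℝ) (fun s : ℝ => p * s + q) t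
      (ContinuousLinearMap.toSpanSingleton ℝ p) := by
    have := ((hasDerivAt_id t).const_mul p).add_const q
    rw [mul_one] at this
    exact this.hasFDerivAt.hasMFDerivAt
  have h2 := (hc.hasMFDerivAt.comp t h1).mfderiv
  unfold velocity
  have h3 : (fun s => c (p * s + q)) = c ∘ fun s : ℝ => p * s + q := rfl
  rw [h3]
  have h4 := congrArg (fun A => A (1 : ℝ)) h2
  refine h4.trans ?_
  have h5 : ∀ A : ℝ →L[ℝ] E, A ((1 : ℝ) • p) = p • A 1 := fun A => by
    rw [← map_smul, smul_eq_mul, smul_eq_mul, mul_comm]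
  exact h5 (mfderiv 𝓘(ℝ, ℝ) I c (p * t + q))

/-- A fibrewise positively homogeneous function on tangent vectors. -/
def Homogeneous (N : (x : M) → TangentSpace I x → ℝ) : Prop :=
  ∀ (x : M) (p : ℝ) (v : TangentSpace I x), N x (p • v) = |p| * N x v

/-- Negative p is allowed, so this also covers the reversal of curves. -/
lemma lengthOn_comp_mul_add {N : (x : M) → TangentSpace I x → ℝ} (hN : Homogeneous N) {c : ℝ → M}
    {a b p q : ℝ} (hp : p ≠ 0) {a' b' : ℝ} (hc : PiecewiseC1On I c a' b')
    (himg : (fun t : ℝ => p * t + q) '' Icc a b = Icc a' b') :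
    lengthOn I N (fun t => c (p * t + q)) a b = lengthOn I N c a' b' := by
  unfold lengthOn
  have hinj : InjOn (fun t : ℝ => p * t + q) (Icc a b) := by
    intro x _ y _ hxy
    simpa [hp] using hxy
  rw [← himg, lintegral_image_eq_lintegral_abs_deriv_mul measurableSet_Icc (f' := fun _ => p)
    (fun x _ => by
      simpa using (((hasDerivAt_id x).const_mul p).add_const q).hasDerivWithinAt) hinj]
  refine lintegral_congr_ae ?_
  have h1 := hc.ae_contMDiffAt
  rw [Filter.EventuallyEq, ae_restrict_iff' measurableSet_Icc]
  have hq : Measure.QuasiMeasurePreserving (fun t : ℝ => p * t + q) volume volume :=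
    ((measurePreserving_add_right volume q).quasiMeasurePreserving).comp
      ⟨by fun_prop, by
        rw [Real.map_volume_mul_left hp]
        exact Measure.smul_absolutelyContinuous⟩
  filter_upwards [hq.ae h1] with t ht htI
  have h2 := (ht (himg ▸ mem_image_of_mem _ htI)).2.mdifferentiableAt one_ne_zero
  rw [velocity_comp_mul_add p q t h2, hN, ENNReal.ofReal_mul (abs_nonneg p)]

lemma lengthOn_refl {N : (x : M) → TangentSpace I x → ℝ} {c : ℝ → M} {a : ℝ} :
    lengthOn I N c a a = 0 := by
  simp [lengthOn]

/-! ### The length distance as a pseudometric. -/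

section LengthDist

variable {N : (x : M) → TangentSpace I x → ℝ} {A : Set M}

lemma lengthDist_self (hN : Homogeneous N) {x : M} (hx : x ∈ A) : lengthDist I N A x x = 0 := by
  refine le_antisymm ?_ bot_le
  have h1 : PiecewiseC1 I (fun _ : ℝ => x) :=
    PiecewiseC1On.of_contMDiffOn zero_le_one contMDiffOn_const
  refine (iInf₂_le (fun _ : ℝ => x) ⟨h1, rfl, rfl, fun _ _ => hx⟩).trans ?_
  have h2 : ∀ t : ℝ, N x (velocity I (fun _ : ℝ => x) t) = 0 := by
    intro t
    have : velocity I (fun _ : ℝ => x) t = (0 : ℝ) • (0 : TangentSpace I x) := by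
      unfold velocity; rw [mfderiv_const, zero_smul]; rfl
    rw [this, hN]; simp
  simp [curveLength, h2]

/-- The infimum defining the distance only sees curves on [0, 1]; an affine change of parameter
admits any interval. A degenerate interval gives a constant curve and is treated separately. -/
lemma lengthDist_le (hN : Homogeneous N) {c : ℝ → M} {a b : ℝ} (hc : PiecewiseC1On I c a b)
    (hA : MapsTo c (Icc a b) A) : lengthDist I N A (c a) (c b) ≤ lengthOn I N c a b := by
  rcases hc.le.eq_or_lt with rfl | hab
  · rw [lengthDist_self hN (hA ⟨le_rfl, le_rfl⟩)]; exact bot_le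
  have hp : 0 < b - a := sub_pos.2 hab
  have himg : (fun t : ℝ => (b - a) * t + a) '' Icc 0 1 = Icc a b := by
    have := Set.image_mul_left_Icc' hp 0 1
    rw [show (fun t : ℝ => (b - a) * t + a) = (fun t => t + a) ∘ (fun t => (b - a) * t) from rfl,
      image_comp, this]
    simp
  have h1 : PiecewiseC1 I (fun t => c ((b - a) * t + a)) := by
    refine PiecewiseC1On.comp_mul_add (b - a) a hp ?_
    simpa using hc
  refine (iInf₂_le (fun t => c ((b - a) * t + a)) ⟨h1, by simp, by simp, fun t ht => hA ?_⟩).trans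
    (?_ : lengthOn I N (fun t => c ((b - a) * t + a)) 0 1 ≤ _)
  · exact (lengthOn_comp_mul_add hN hp.ne' hc himg).le
  · rw [← himg]; exact mem_image_of_mem (fun t : ℝ => (b - a) * t + a) ht

lemma exists_curve_of_lengthDist_lt {x y : M} {ℓ : ℝ≥0∞} (h : lengthDist I N A x y < ℓ) :
    ∃ c : ℝ → M, PiecewiseC1On I c 0 1 ∧ c 0 = x ∧ c 1 = y ∧ MapsTo c (Icc 0 1) A ∧
      lengthOn I N c 0 1 < ℓ := by
  simp only [lengthDist, iInf_lt_iff] at h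
  obtain ⟨c, ⟨h1, h2, h3, h4⟩, h5⟩ := h
  exact ⟨c, h1, h2, h3, h4, h5⟩

lemma lengthDist_comm_le (hN : Homogeneous N) (x y : M) :
    lengthDist I N A y x ≤ lengthDist I N A x y := by
  refine le_of_forall_gt fun ℓ hℓ => ?_
  obtain ⟨c, hc, rfl, rfl, hA, hl⟩ := exists_curve_of_lengthDist_lt hℓ
  have himg : (fun t : ℝ => (-1) * t + 1) '' Icc 0 1 = Icc 0 1 := by
    ext t; constructor
    · rintro ⟨s, hs, rfl⟩; constructor <;> simp only <;> linarith [hs.1, hs.2]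
    · intro ht; exact ⟨1 - t, ⟨by linarith [ht.2], by linarith [ht.1]⟩, by ring⟩
  have h1 : PiecewiseC1On I (fun t => c (-1 * t + 1)) 0 1 := by
    have := PiecewiseC1On.comp_sub (c := c) (a := 0) (b := 1) 1 (by simpa using hc)
    refine this.congr fun t _ => ?_
    congr 1; ring
  have h2 := lengthDist_le (A := A) hN h1 fun t ht => hA (himg ▸ mem_image_of_mem _ ht)
  rw [lengthOn_comp_mul_add hN (by norm_num) hc himg] at h2
  simp only [mul_zero, zero_add, mul_one, neg_add_cancel] at h2
  exact h2.trans_lt hl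

lemma lengthDist_comm (hN : Homogeneous N) (x y : M) :
    lengthDist I N A x y = lengthDist I N A y x :=
  le_antisymm (lengthDist_comm_le hN y x) (lengthDist_comm_le hN x y)

/-- Curves on `[0, 1]` that match can be joined to a curve on `[0, 2]`. -/
def joinCurves {α : Type*} (c c' : ℝ → α) (t : ℝ) : α := if t ≤ 1 then c t else c' (t - 1)

lemma joinCurves_eqOn_left {α : Type*} (c c' : ℝ → α) : EqOn (joinCurves c c') c (Icc 0 1) :=
  fun t ht => by simp [joinCurves, ht.2]

lemma joinCurves_eqOn_right {α : Type*} {c c' : ℝ → α} (h : c 1 = c' 0) :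
    EqOn (joinCurves c c') (fun t => c' (1 * t + (-1))) (Icc 1 2) := by
  intro t ht
  rcases ht.1.eq_or_lt with rfl | h1
  · simp [joinCurves, h]
  · simp [joinCurves, not_le.2 h1, sub_eq_add_neg]

lemma image_mul_add_Icc_one_two : (fun t : ℝ => 1 * t + (-1)) '' Icc 1 2 = Icc 0 1 := by
  have : (fun t : ℝ => 1 * t + (-1)) = fun t => t + (-1) := by ext; ring
  rw [this, Set.image_add_const_Icc]; norm_num

lemma PiecewiseC1On.join {c c' : ℝ → M} (hc : PiecewiseC1On I c 0 1)
    (hc' : PiecewiseC1On I c' 0 1) (h : c 1 = c' 0) :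
    PiecewiseC1On I (joinCurves c c') 0 2 := by
  refine (hc.congr (joinCurves_eqOn_left c c')).trans
    (PiecewiseC1On.congr (PiecewiseC1On.comp_mul_add 1 (-1) one_pos ?_) (joinCurves_eqOn_right h))
  convert hc' using 1 <;> norm_num

lemma mapsTo_joinCurves {α : Type*} {A : Set α} {c c' : ℝ → α} (h : c 1 = c' 0) (hA : MapsTo c (Icc 0 1) A)
    (hA' : MapsTo c' (Icc 0 1) A) : MapsTo (joinCurves c c') (Icc 0 2) A := by
  intro t ht
  rcases le_total t 1 with h1 | h1
  · rw [joinCurves_eqOn_left c c' ⟨ht.1, h1⟩]; exact hA ⟨ht.1, h1⟩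
  · rw [joinCurves_eqOn_right h ⟨h1, ht.2⟩]
    exact hA' (image_mul_add_Icc_one_two ▸ mem_image_of_mem _ (⟨h1, ht.2⟩ : t ∈ Icc (1 : ℝ) 2))

lemma lengthOn_joinCurves (hN : Homogeneous N) {c c' : ℝ → M}
    (hc' : PiecewiseC1On I c' 0 1) (h : c 1 = c' 0) :
    lengthOn I N (joinCurves c c') 0 2 = lengthOn I N c 0 1 + lengthOn I N c' 0 1 := by
  rw [lengthOn_add zero_le_one one_le_two,
    lengthOn_congr ((joinCurves_eqOn_left c c').mono Ioo_subset_Icc_self),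
    lengthOn_congr ((joinCurves_eqOn_right h).mono Ioo_subset_Icc_self),
    lengthOn_comp_mul_add hN one_ne_zero hc' image_mul_add_Icc_one_two]

lemma lengthDist_triangle (hN : Homogeneous N) (x y z : M) :
    lengthDist I N A x z ≤ lengthDist I N A x y + lengthDist I N A y z := by
  refine le_of_forall_gt fun ℓ hℓ => ?_
  obtain ⟨u, hu, v, hv, huv⟩ := ENNReal.exists_add_lt_of_add_lt hℓ
  obtain ⟨c, hc, rfl, hc1, hA, hl⟩ := exists_curve_of_lengthDist_lt hu
  obtain ⟨c', hc', hc'0, rfl, hA', hl'⟩ := exists_curve_of_lengthDist_lt hv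
  have h : c 1 = c' 0 := hc1.trans hc'0.symm
  have h2 := lengthDist_le (A := A) hN (hc.join hc' h) (mapsTo_joinCurves h hA hA')
  rw [lengthOn_joinCurves hN hc' h, joinCurves_eqOn_left c c' ⟨le_rfl, zero_le_one⟩,
    joinCurves_eqOn_right h ⟨one_le_two, le_rfl⟩] at h2
  norm_num at h2
  exact h2.trans_lt ((ENNReal.add_lt_add hl hl').trans huv)

end LengthDist

/-! ### Integrals of functions of the velocity -/

section Integrals

variable [IsManifold I 1 M] {c : ℝ → M} {a b : ℝ} {A : Set M} {Q : TangentBundle I M → ℝ}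

lemma exists_continuous_eqOn_velocity (hQ : ContinuousOn Q (TotalSpace.proj ⁻¹' A))
    (hab : a < b) (hc : ContMDiffOn 𝓘(ℝ, ℝ) I 1 c (Icc a b)) (hA : MapsTo c (Icc a b) A) :
    ∃ q : ℝ → ℝ, Continuous q ∧ ∀ t ∈ Ioo a b, Q ⟨c t, velocity I c t⟩ = q t := by
  -- The derivative within the closed interval is continuous up to its end points and agrees with
  -- the velocity in the interior, which provides the continuous extension.
  have h1 := hc.continuousOn_tangentMapWithin le_rfl (uniqueDiffOn_Icc hab).uniqueMDiffOn
  have h2 : Continuous (fun t : ℝ => (⟨t, (1 : ℝ)⟩ : TangentBundle 𝓘(ℝ, ℝ) ℝ)) :=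
    (tangentBundleModelSpaceHomeomorph 𝓘(ℝ, ℝ)).symm.continuous.comp
      (continuous_id.prodMk continuous_const)
  have h3 : ContinuousOn (fun t : ℝ => Q (tangentMapWithin 𝓘(ℝ, ℝ) I c (Icc a b) ⟨t, (1 : ℝ)⟩))
      (Icc a b) := by
    refine hQ.comp (h1.comp h2.continuousOn fun t ht => ht) fun t ht => hA ht
  refine ⟨_, (continuousOn_iff_continuous_domRestrict.1 h3).Icc_extend' (h := hab.le),
    fun t ht => ?_⟩
  rw [IccExtend_of_mem hab.le _ (Ioo_subset_Icc_self ht)]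
  simp only [domRestrict_apply, tangentMapWithin, velocity]
  rw [mfderivWithin_of_mem_nhds (Icc_mem_nhds ht.1 ht.2)]

lemma PiecewiseC1On.intervalIntegrable (hc : PiecewiseC1On I c a b)
    (hQ : ContinuousOn Q (TotalSpace.proj ⁻¹' A)) (hA : MapsTo c (Icc a b) A) :
    IntervalIntegrable (fun t => Q ⟨c t, velocity I c t⟩) volume a b := by
  refine hc.induction
    (P := fun a b => IntervalIntegrable (fun t => Q ⟨c t, velocity I c t⟩) volume a b)
    (fun _ _ => IntervalIntegrable.refl) ?_ (fun _ _ _ _ _ _ _ h1 h2 => h1.trans h2)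
  intro x y hx hxy hy hC
  obtain ⟨q, hq, hq'⟩ := exists_continuous_eqOn_velocity hQ hxy hC
    (hA.mono_left (Icc_subset_Icc hx hy))
  refine (hq.intervalIntegrable x y).congr_ae ?_
  rw [uIoc_of_le hxy.le, restrict_Ioc_eq_restrict_Icc, ← restrict_Ioo_eq_restrict_Icc]
  filter_upwards [self_mem_ae_restrict measurableSet_Ioo] with t ht
  exact (hq' t ht).symm

/-- The primitive along a curve of a continuous function of the velocity. -/
lemma PiecewiseC1On.primitive (hc : PiecewiseC1On I c a b)
    (hQ : ContinuousOn Q (TotalSpace.proj ⁻¹' A)) (hA : MapsTo c (Icc a b) A) :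
    PiecewiseC1On 𝓘(ℝ, ℝ) (fun s => ∫ t in a..s, Q ⟨c t, velocity I c t⟩) a b ∧
    ∀ᵐ t, t ∈ Icc a b → HasDerivAt (fun s => ∫ t in a..s, Q ⟨c t, velocity I c t⟩)
      (Q ⟨c t, velocity I c t⟩) t := by
  refine hc.induction (P := fun x y =>
    PiecewiseC1On 𝓘(ℝ, ℝ) (fun s => ∫ t in a..s, Q ⟨c t, velocity I c t⟩) x y ∧
    ∀ᵐ t, t ∈ Icc x y → HasDerivAt (fun s => ∫ t in a..s, Q ⟨c t, velocity I c t⟩)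
      (Q ⟨c t, velocity I c t⟩) t) ?_ ?_ ?_
  · intro x _
    refine ⟨PiecewiseC1On.refl _ _, ?_⟩
    have : ∀ᵐ t : ℝ, t ≠ x := by simp [ae_iff]
    filter_upwards [this] with t ht h
    exact absurd (le_antisymm h.2 h.1) ht
  · intro x y hx hxy hy hC
    obtain ⟨q, hq, hq'⟩ := exists_continuous_eqOn_velocity hQ hxy hC
      (hA.mono_left (Icc_subset_Icc hx hy))
    set Φ : ℝ → ℝ := fun s => ∫ t in a..s, Q ⟨c t, velocity I c t⟩ with hΦ
    have hint := hc.intervalIntegrable hQ hA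
    -- On a C¹ arc the integrand agrees with a continuous function in the interior, so the
    -- fundamental theorem of calculus applies to q instead.
    have heq : EqOn Φ (fun s => Φ x + ∫ t in x..s, q t) (Icc x y) := by
      intro s hs
      simp only [hΦ]
      have h1 : IntervalIntegrable (fun t => Q ⟨c t, velocity I c t⟩) volume a x :=
        hint.mono_set (by
          rw [uIcc_of_le hx, uIcc_of_le hc.le]; exact Icc_subset_Icc le_rfl (hxy.le.trans hy))
      have h2 : IntervalIntegrable (fun t => Q ⟨c t, velocity I c t⟩) volume x s :=
        hint.mono_set (by
          rw [uIcc_of_le hs.1, uIcc_of_le hc.le]; exact Icc_subset_Icc hx (hs.2.trans hy))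
      rw [← intervalIntegral.integral_add_adjacent_intervals h1 h2]
      congr 1
      rw [intervalIntegral.integral_of_le hs.1, intervalIntegral.integral_of_le hs.1,
        restrict_Ioc_eq_restrict_Icc, ← restrict_Ioo_eq_restrict_Icc]
      exact setIntegral_congr_fun measurableSet_Ioo fun t ht => hq' t ⟨ht.1, ht.2.trans_le hs.2⟩
    have hd : ∀ s, HasDerivAt (fun s => Φ x + ∫ t in x..s, q t) (q s) s := fun s =>
      (intervalIntegral.integral_hasDerivAt_right (hq.intervalIntegrable _ _)
        (hq.stronglyMeasurableAtFilter _ _) hq.continuousAt).const_add _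
    have hC1 : ContDiff ℝ 1 (fun s => Φ x + ∫ t in x..s, q t) := by
      rw [contDiff_one_iff_deriv]
      refine ⟨fun s => (hd s).differentiableAt, ?_⟩
      rwa [show deriv (fun s => Φ x + ∫ t in x..s, q t) = q from funext fun s => (hd s).deriv]
    refine ⟨PiecewiseC1On.of_contMDiffOn hxy.le ((contMDiff_iff_contDiff.2 hC1).contMDiffOn.congr heq), ?_⟩
    have hne : ∀ z : ℝ, ∀ᵐ t : ℝ, t ≠ z := fun z => by simp [ae_iff]
    filter_upwards [hne x, hne y] with t h1 h2 h
    have h3 : t ∈ Ioo x y := ⟨lt_of_le_of_ne h.1 (Ne.symm h1), lt_of_le_of_ne h.2 h2⟩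
    rw [hq' t h3]
    exact (hd t).congr_of_eventuallyEq (heq.eventuallyEq_of_mem (Icc_mem_nhds h3.1 h3.2))
  · intro x y z _ _ _ _ h1 h2
    refine ⟨h1.1.trans h2.1, ?_⟩
    filter_upwards [h1.2, h2.2] with t h1 h2 h
    rcases le_total t y with hy | hy
    exacts [h1 ⟨h.1, hy⟩, h2 ⟨hy, h.2⟩]

end Integrals

end Curves


/-! ### Subdivision of curves by length -/

section Subdivision

variable {E H M : Type*} [NormedAddCommGroup E] [NormedSpace ℝ E] [TopologicalSpace H]
  {I : ModelWithCorners ℝ E H} [TopologicalSpace M] [ChartedSpace H M] [IsManifold I 1 M]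
  {N : (x : M) → TangentSpace I x → ℝ} {c : ℝ → M} {a b : ℝ} {A : Set M}

lemma lengthOn_eq_integral (hN : ∀ x v, 0 ≤ N x v)
    (hQ : ContinuousOn (fun v : TangentBundle I M => N v.1 v.2) (TotalSpace.proj ⁻¹' A))
    (hc : PiecewiseC1On I c a b) (hA : MapsTo c (Icc a b) A) :
    lengthOn I N c a b = ENNReal.ofReal (∫ t in a..b, N (c t) (velocity I c t)) := by
  have h1 := hc.intervalIntegrable hQ hA
  rw [intervalIntegrable_iff_integrableOn_Icc_of_le hc.le] at h1
  rw [intervalIntegral.integral_of_le hc.le, ← integral_Icc_eq_integral_Ioc,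
    ofReal_integral_eq_lintegral_ofReal h1 (Eventually.of_forall fun t => hN _ _)]
  rfl

lemma lengthOn_ne_top (hN : ∀ x v, 0 ≤ N x v)
    (hQ : ContinuousOn (fun v : TangentBundle I M => N v.1 v.2) (TotalSpace.proj ⁻¹' A))
    (hc : PiecewiseC1On I c a b) (hA : MapsTo c (Icc a b) A) : lengthOn I N c a b ≠ ⊤ := by
  rw [lengthOn_eq_integral hN hQ hc hA]
  exact ENNReal.ofReal_ne_top

/-- A curve can be subdivided into `n` arcs of equal lengths. -/
lemma exists_subdivision (hN : ∀ x v, 0 ≤ N x v)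
    (hQ : ContinuousOn (fun v : TangentBundle I M => N v.1 v.2) (TotalSpace.proj ⁻¹' A))
    (hc : PiecewiseC1On I c 0 1) (hA : MapsTo c (Icc 0 1) A) {n : ℕ} (hn : 0 < n) {ℓ : ℝ}
    (hℓ : lengthOn I N c 0 1 ≤ ENNReal.ofReal ℓ) :
    ∃ τ : ℕ → ℝ, Monotone τ ∧ τ 0 = 0 ∧ τ n = 1 ∧
      ∀ i, lengthOn I N c (τ i) (τ (i + 1)) ≤ ENNReal.ofReal (ℓ / n) := by
  set Λ : ℝ → ℝ := fun s => ∫ t in (0 : ℝ)..s, N (c t) (velocity I c t) with hΛ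
  have hcont : ContinuousOn Λ (Icc 0 1) := (hc.primitive hQ hA).1.continuousOn
  have hΛ0 : Λ 0 = 0 := by simp [hΛ]
  have hint := hc.intervalIntegrable hQ hA
  have hsub : ∀ x y, 0 ≤ x → x ≤ y → y ≤ 1 →
      lengthOn I N c x y = ENNReal.ofReal (Λ y - Λ x) ∧ Λ x ≤ Λ y := by
    intro x y hx hxy hy
    have hI : ∀ z w, z ∈ Icc (0 : ℝ) 1 → w ∈ Icc (0 : ℝ) 1 →
        IntervalIntegrable (fun t => N (c t) (velocity I c t)) volume z w := by
      intro z w hz hw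
      refine hint.mono_set ?_
      rw [uIcc_of_le zero_le_one]
      exact uIcc_subset_Icc hz hw
    have h0 : (0 : ℝ) ∈ Icc (0 : ℝ) 1 := ⟨le_rfl, zero_le_one⟩
    have h1 : Λ y - Λ x = ∫ t in x..y, N (c t) (velocity I c t) :=
      intervalIntegral.integral_interval_sub_left (hI _ _ h0 ⟨hx.trans hxy, hy⟩)
        (hI _ _ h0 ⟨hx, hxy.trans hy⟩)
    rw [h1, ← sub_nonneg, h1]
    exact ⟨lengthOn_eq_integral hN hQ (hc.mono hx hxy hy)
      (hA.mono_left (Icc_subset_Icc hx hy)), intervalIntegral.integral_nonneg hxy fun _ _ => hN _ _⟩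
  -- `ENNReal.ofReal` truncates negative numbers, so the hypothesis bounds Λ 1 by ℓ only when Λ 1 is
  -- positive.
  have hL : Λ 1 ≤ ℓ ∨ Λ 1 = 0 := by
    have h1 := (hsub 0 1 le_rfl zero_le_one le_rfl)
    rw [h1.1, hΛ0, sub_zero] at hℓ
    rcases le_or_gt (Λ 1) 0 with h2 | h2
    · exact Or.inr (le_antisymm h2 (hΛ0 ▸ h1.2))
    · exact Or.inl ((ENNReal.ofReal_le_ofReal_iff' .. |>.1 hℓ).resolve_right (not_le.2 h2))
  have hΛ1 : 0 ≤ Λ 1 := hΛ0 ▸ (hsub 0 1 le_rfl zero_le_one le_rfl).2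
  have hn' : (0 : ℝ) < n := by exact_mod_cast hn
  -- Intermediate values of the length function give times at which the fraction i/n of the length
  -- has been covered.
  have hex : ∀ i : ℕ, i < n → ∃ s ∈ Icc (0 : ℝ) 1, Λ s = i / n * Λ 1 := by
    intro i hi
    have h1 : (i : ℝ) / n ≤ 1 := by
      rw [div_le_one hn']; exact_mod_cast hi.le
    have h2 : (i : ℝ) / n * Λ 1 ∈ Icc (Λ 0) (Λ 1) := ⟨by rw [hΛ0]; positivity, by nlinarith⟩
    obtain ⟨s, hs, hs'⟩ := intermediate_value_Icc zero_le_one hcont h2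
    exact ⟨s, hs, hs'⟩
  choose! s hs hs' using hex
  -- The value 1 from the index n on makes the bound on the arcs true for every i.
  set τ : ℕ → ℝ := fun i => if i = 0 then 0 else if i < n then s i else 1 with hτ
  have hτI : ∀ i, τ i ∈ Icc (0 : ℝ) 1 := by
    intro i
    simp only [hτ]
    split_ifs with h1 h2
    exacts [⟨le_rfl, zero_le_one⟩, hs i h2, ⟨zero_le_one, le_rfl⟩]
  have hτn : τ n = 1 := by simp [hτ, hn.ne']
  have hτΛ : ∀ i, i ≤ n → Λ (τ i) = i / n * Λ 1 := by
    intro i hi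
    rcases hi.eq_or_lt with rfl | hi
    · rw [hτn, div_self hn'.ne', one_mul]
    by_cases h1 : i = 0
    · simp [hτ, h1, hΛ0]
    · simp only [hτ, h1, hi, if_true, if_false]; exact hs' i hi
  have hτ1 : ∀ i, n ≤ i → τ i = 1 := by
    intro i hi
    simp [hτ, (hn.trans_le hi).ne', not_lt.2 hi]
  -- A curve of length zero needs its own subdivision, because the chosen times are only forced to
  -- increase when the length function takes distinct values there.
  by_cases hz : Λ 1 = 0
  · refine ⟨fun i => if i = 0 then 0 else 1, ?_, by simp, by simp [hn.ne'], fun i => ?_⟩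
    · refine monotone_nat_of_le_succ fun i => ?_
      by_cases h : i = 0 <;> simp [h]
    · by_cases h : i = 0
      · have := (hsub 0 1 le_rfl zero_le_one le_rfl).1
        simp [h, this, hz, hΛ0]
      · simp [h, lengthOn_refl]
  have hpos : 0 < Λ 1 := lt_of_le_of_ne hΛ1 (Ne.symm hz)
  have hℓ' : Λ 1 ≤ ℓ := hL.resolve_right hz
  have hmono : Monotone τ := by
    refine monotone_nat_of_le_succ fun i => ?_
    by_cases hi : n ≤ i + 1
    · rw [hτ1 _ hi]; exact (hτI i).2
    push Not at hi
    by_contra! hlt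
    have h1 := (hsub _ _ (hτI (i + 1)).1 hlt.le (hτI i).2).2
    rw [hτΛ i (by omega), hτΛ (i + 1) hi.le] at h1
    have h2 : (i : ℝ) / n < ((i + 1 : ℕ) : ℝ) / n := by
      gcongr; exact_mod_cast Nat.lt_succ_self i
    nlinarith
  refine ⟨τ, hmono, by simp [hτ], hτn, fun i => ?_⟩
  rw [(hsub _ _ (hτI i).1 (hmono (Nat.le_succ i)) (hτI (i + 1)).2).1]
  refine ENNReal.ofReal_le_ofReal ?_
  have hℓ0 : 0 ≤ ℓ := hΛ1.trans hℓ'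
  by_cases hi : n ≤ i
  · rw [hτ1 _ hi, hτ1 _ (by omega), sub_self]; positivity
  push Not at hi
  rw [hτΛ i hi.le, hτΛ (i + 1) hi, ← sub_mul, ← sub_div]
  push_cast
  rw [add_sub_cancel_left, one_div, inv_mul_eq_div]
  gcongr

end Subdivision

/-! ### The model -/

section Model

lemma modelNorm_nonneg (m : ℕ) (p : ℝ × Plane) (v) : 0 ≤ modelNorm m p v := Real.sqrt_nonneg _

lemma homogeneous_modelNorm (m : ℕ) : Homogeneous (modelNorm m) := by
  intro p a v
  have h1 : ∀ w : ℝ × Plane, modelNorm m p w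
      = √(w.1 ^ 2 / ((m : ℝ) ^ 2 * (1 + ‖p.2‖ ^ 2)) + ‖w.2‖ ^ 2) := fun _ => rfl
  have h2 : ∀ w : ℝ × Plane, modelNorm m p (a • w) = |a| * modelNorm m p w := by
    intro w
    rw [h1, h1, ← Real.sqrt_sq_eq_abs, ← Real.sqrt_mul (sq_nonneg a)]
    congr 1
    simp only [Prod.smul_fst, Prod.smul_snd, norm_smul, Real.norm_eq_abs, smul_eq_mul, mul_pow,
      sq_abs]
    ring
  exact h2 v

lemma continuous_modelNorm (m : ℕ) (hm : 0 < m) :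
    Continuous (fun v : TangentBundle 𝓘(ℝ, ℝ × Plane) (ℝ × Plane) => modelNorm m v.1 v.2) := by
  have h1 : Continuous fun q : (ℝ × Plane) × (ℝ × Plane) =>
      √(q.2.1 ^ 2 / ((m : ℝ) ^ 2 * (1 + ‖q.1.2‖ ^ 2)) + ‖q.2.2‖ ^ 2) := by
    refine Real.continuous_sqrt.comp (Continuous.add (Continuous.div (by fun_prop) (by fun_prop) ?_)
      (by fun_prop))
    intro q
    positivity
  exact h1.comp (tangentBundleModelSpaceHomeomorph 𝓘(ℝ, ℝ × Plane)).continuous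

lemma velocity_eq_deriv {E : Type*} [NormedAddCommGroup E] [NormedSpace ℝ E] (c : ℝ → E) (t : ℝ) :
    velocity 𝓘(ℝ, E) c t = deriv c t := by
  unfold velocity
  rw [mfderiv_eq_fderiv]
  rfl

lemma PiecewiseC1On.prodMk {E F : Type*} [NormedAddCommGroup E] [NormedSpace ℝ E]
    [NormedAddCommGroup F] [NormedSpace ℝ F] {f : ℝ → E} {f' : ℝ → F} {a b : ℝ}
    (h : PiecewiseC1On 𝓘(ℝ, E) f a b) (h' : PiecewiseC1On 𝓘(ℝ, F) f' a b) :
    PiecewiseC1On 𝓘(ℝ, E × F) (fun t => (f t, f' t)) a b := by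
  refine h.induction (P := fun x y => a ≤ x → y ≤ b →
    PiecewiseC1On 𝓘(ℝ, E × F) (fun t => (f t, f' t)) x y) (fun _ _ _ _ => refl _ _) ?_ ?_ le_rfl le_rfl
  · intro x y hx hxy hy hC _ _
    refine (h'.mono hx hxy.le hy).induction (P := fun z w => x ≤ z → w ≤ y →
      PiecewiseC1On 𝓘(ℝ, E × F) (fun t => (f t, f' t)) z w) (fun _ _ _ _ => refl _ _) ?_ ?_ le_rfl le_rfl
    · intro z w hz hzw hw hC' _ _
      refine of_contMDiffOn hzw.le ?_
      rw [contMDiffOn_iff_contDiffOn] at *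
      exact (hC.mono (Icc_subset_Icc hz hw)).prodMk hC'
    · intro z w v _ hzw hwv _ h1 h2 h3 h4
      exact (h1 h3 (hwv.trans h4)).trans (h2 (h3.trans hzw) h4)
  · intro x y z _ hxy hyz _ h1 h2 h3 h4
    exact (h1 h3 (hyz.trans h4)).trans (h2 (h3.trans hxy) h4)

lemma lengthDist_model_le_segment (m : ℕ) (hm : 0 < m) (t t' : ℝ) (ξ ξ' : Plane) :
    lengthDist 𝓘(ℝ, ℝ × Plane) (modelNorm m) univ (t, ξ) (t', ξ')
      ≤ ENNReal.ofReal (|t' - t| + ‖ξ' - ξ‖) := by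
  set c : ℝ → ℝ × Plane := fun s => (t, ξ) + s • ((t', ξ') - (t, ξ)) with hc
  have hd : ∀ s, HasDerivAt c ((t', ξ') - (t, ξ)) s := fun s => by
    have := ((hasDerivAt_id s).smul_const ((t', ξ') - (t, ξ))).const_add (t, ξ)
    rw [one_smul] at this
    exact this
  have hC : PiecewiseC1On 𝓘(ℝ, ℝ × Plane) c 0 1 := by
    refine PiecewiseC1On.of_contMDiffOn zero_le_one (ContDiff.contMDiff ?_).contMDiffOn
    fun_prop
  have h1 := lengthDist_le (A := univ) (homogeneous_modelNorm m) hC (mapsTo_univ _ _)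
  have h2 : c 0 = (t, ξ) := by simp [hc]
  have h3 : c 1 = (t', ξ') := by simp [hc]
  rw [h2, h3] at h1
  refine h1.trans ?_
  have h4 : ∀ s ∈ Icc (0 : ℝ) 1, ENNReal.ofReal (modelNorm m (c s) (velocity 𝓘(ℝ, ℝ × Plane) c s))
      ≤ ENNReal.ofReal (|t' - t| + ‖ξ' - ξ‖) := by
    intro s _
    refine ENNReal.ofReal_le_ofReal ?_
    rw [velocity_eq_deriv, (hd s).deriv]
    refine Real.sqrt_le_iff.2 ⟨by positivity, ?_⟩
    simp only [Prod.fst_sub, Prod.snd_sub]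
    have hm' : (1 : ℝ) ≤ m := by exact_mod_cast hm
    -- The weight of the angular coordinate is at most 1 since m ≥ 1.
    have h5 : (t' - t) ^ 2 / ((m : ℝ) ^ 2 * (1 + ‖(c s).2‖ ^ 2)) ≤ (t' - t) ^ 2 := by
      refine div_le_self (sq_nonneg _) ?_
      nlinarith [sq_nonneg ‖(c s).2‖, mul_self_nonneg ((m : ℝ) * ‖(c s).2‖)]
    have h6 := sq_abs (t' - t)
    nlinarith [mul_nonneg (abs_nonneg (t' - t)) (norm_nonneg (ξ' - ξ))]
  calc lengthOn 𝓘(ℝ, ℝ × Plane) (modelNorm m) c 0 1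
      ≤ ∫⁻ _ in Icc (0 : ℝ) 1, ENNReal.ofReal (|t' - t| + ‖ξ' - ξ‖) :=
        setLIntegral_mono measurable_const h4
    _ = _ := by simp

lemma modelDist_le_of_lift {m : ℕ} {p p' : Circle × Plane} {t t' : ℝ} (h : Circle.exp t = p.1)
    (h' : Circle.exp t' = p'.1) : modelDist m p p'
      ≤ lengthDist 𝓘(ℝ, ℝ × Plane) (modelNorm m) univ (t, p.2) (t', p'.2) :=
  iInf_le_of_le t (iInf_le_of_le t' (iInf_le _ ⟨h, h'⟩))

lemma exists_lift_near (z z' : Circle) :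
    ∃ t t' : ℝ, Circle.exp t = z ∧ Circle.exp t' = z' ∧ |t' - t| ≤ Real.pi := by
  obtain ⟨t, rfl⟩ : ∃ t, Circle.exp t = z := ⟨_, Circle.exp_arg z⟩
  refine ⟨t, t + Complex.arg (z' * (Circle.exp t)⁻¹ : Circle), rfl, ?_, ?_⟩
  · rw [Circle.exp_add, Circle.exp_arg]; simp
  · rw [add_sub_cancel_left]; exact Complex.abs_arg_le_pi _

/-- A rotation by at most half a turn and a straight segment suffice. This settles pairs of points
whose distance in the circle bundle is large. -/
lemma modelDist_le (m : ℕ) (hm : 0 < m) (p p' : Circle × Plane) :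
    modelDist m p p' ≤ ENNReal.ofReal (Real.pi + ‖p'.2 - p.2‖) := by
  obtain ⟨t, t', h, h', hpi⟩ := exists_lift_near p.1 p'.1
  refine (modelDist_le_of_lift h h').trans ((lengthDist_model_le_segment m hm _ _ _ _).trans ?_)
  gcongr

lemma exists_curve_of_modelDist_lt {m : ℕ} {p p' : Circle × Plane} {ℓ : ℝ≥0∞}
    (h : modelDist m p p' < ℓ) : ∃ c : ℝ → ℝ × Plane, PiecewiseC1On 𝓘(ℝ, ℝ × Plane) c 0 1 ∧
      Circle.exp (c 0).1 = p.1 ∧ (c 0).2 = p.2 ∧ Circle.exp (c 1).1 = p'.1 ∧ (c 1).2 = p'.2 ∧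
      lengthOn 𝓘(ℝ, ℝ × Plane) (modelNorm m) c 0 1 < ℓ := by
  simp only [modelDist, iInf_lt_iff] at h
  obtain ⟨t, t', ⟨h1, h2⟩, h⟩ := h
  obtain ⟨c, hc, hc0, hc1, -, hl⟩ := exists_curve_of_lengthDist_lt h
  exact ⟨c, hc, by rw [hc0, h1], by rw [hc0], by rw [hc1, h2], by rw [hc1], hl⟩

/-- The displacement of a curve in the region `‖ξ‖ ≤ ρ` of the model is bounded by its length. -/
lemma sqrt_le_length_model {m : ℕ} (hm : 0 < m) {c : ℝ → ℝ × Plane} {a b ρ ℓ : ℝ}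
    (hc : PiecewiseC1On 𝓘(ℝ, ℝ × Plane) c a b) (hρ : ∀ t ∈ Icc a b, ‖(c t).2‖ ≤ ρ) (hℓ0 : 0 ≤ ℓ)
    (hℓ : lengthOn 𝓘(ℝ, ℝ × Plane) (modelNorm m) c a b ≤ ENNReal.ofReal ℓ) :
    √(((c b).1 - (c a).1) ^ 2 / ((m : ℝ) ^ 2 * (1 + ρ ^ 2)) + ‖(c b).2 - (c a).2‖ ^ 2) ≤ ℓ := by
  have hρ0 : 0 ≤ ρ := (norm_nonneg _).trans (hρ a ⟨le_rfl, hc.le⟩)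
  have hm' : (0 : ℝ) < m := by exact_mod_cast hm
  -- The weight is frozen at its smallest value on the region, the one at radius ρ. The resulting
  -- flat norm is bounded by the model norm there, and for a flat norm displacement is at most
  -- length.
  set k : ℝ := (√((m : ℝ) ^ 2 * (1 + ρ ^ 2)))⁻¹ with hk
  have hk2 : k ^ 2 = ((m : ℝ) ^ 2 * (1 + ρ ^ 2))⁻¹ := by
    rw [hk, inv_pow, Real.sq_sqrt (by positivity)]
  set T : ℝ × Plane →L[ℝ] WithLp 2 (ℝ × Plane) :=
    ((WithLp.prodContinuousLinearEquiv 2 ℝ ℝ Plane).symm : ℝ × Plane →L[ℝ] WithLp 2 (ℝ × Plane)).comp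
      ((k • ContinuousLinearMap.fst ℝ ℝ Plane).prod (ContinuousLinearMap.snd ℝ ℝ Plane)) with hT
  have hTn : ∀ w : ℝ × Plane, ‖T w‖ = √(w.1 ^ 2 / ((m : ℝ) ^ 2 * (1 + ρ ^ 2)) + ‖w.2‖ ^ 2) := by
    intro w
    rw [WithLp.prod_norm_eq_of_L2]
    congr 2
    simp only [hT, ContinuousLinearMap.comp_apply]
    change ‖k • w.1‖ ^ 2 = _
    rw [Real.norm_eq_abs, sq_abs, smul_eq_mul, mul_pow, hk2]
    ring
  have h1 : PiecewiseC1On 𝓘(ℝ, WithLp 2 (ℝ × Plane)) (fun t => T (c t)) a b :=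
    hc.comp (A := univ) T.contMDiff.contMDiffOn (mapsTo_univ _ _)
  have h2 := h1.enorm_sub_le
  have h3 : ∫⁻ t in Icc a b, ‖deriv (fun t => T (c t)) t‖ₑ
      ≤ lengthOn 𝓘(ℝ, ℝ × Plane) (modelNorm m) c a b := by
    refine lintegral_mono_ae ?_
    refine (ae_restrict_iff' measurableSet_Icc).2 ?_
    filter_upwards [hc.ae_contMDiffAt] with t ht htI
    have h4 : DifferentiableAt ℝ c t :=
      (contMDiffAt_iff_contDiffAt.1 (ht htI).2).differentiableAt one_ne_zero
    have h5 : deriv (fun t => T (c t)) t = T (deriv c t) :=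
      (T.hasFDerivAt.comp_hasDerivAt t h4.hasDerivAt).deriv
    rw [h5, velocity_eq_deriv, ← ofReal_norm, hTn]
    refine ENNReal.ofReal_le_ofReal (Real.sqrt_le_sqrt ?_)
    have := hρ t htI
    gcongr
  have h4 := h2.trans (h3.trans hℓ)
  rw [← map_sub, ← ofReal_norm, ENNReal.ofReal_le_ofReal_iff hℓ0, hTn] at h4
  exact h4

end Model


/-! ### Derivatives along curves -/

section AlongCurves

variable {E H M : Type*} [NormedAddCommGroup E] [NormedSpace ℝ E] [TopologicalSpace H]
  {I : ModelWithCorners ℝ E H} [TopologicalSpace M] [ChartedSpace H M]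
  {F : Type*} [NormedAddCommGroup F] [NormedSpace ℝ F]

lemma hasDerivAt_comp_velocity {G : M → F} {c : ℝ → M} {t : ℝ}
    (hG : MDifferentiableAt I 𝓘(ℝ, F) G (c t)) (hc : MDifferentiableAt 𝓘(ℝ, ℝ) I c t) :
    HasDerivAt (fun τ => G (c τ)) (mvfderiv I G (c t) (velocity I c t)) t := by
  obtain ⟨A, hA⟩ : ∃ A : ℝ →L[ℝ] F, A = (mfderiv I 𝓘(ℝ, F) G (c t)).comp
      (mfderiv 𝓘(ℝ, ℝ) I c t) := ⟨_, rfl⟩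
  have h : HasFDerivAt (fun τ => G (c τ)) A t := by
    rw [hA]
    exact hasMFDerivAt_iff_hasFDerivAt.1 (hG.hasMFDerivAt.comp t hc.hasMFDerivAt)
  have h2 := h.hasDerivAt
  rw [hA] at h2
  exact h2

lemma velocity_comp {E' H' M' : Type*} [NormedAddCommGroup E'] [NormedSpace ℝ E']
    [TopologicalSpace H'] {I' : ModelWithCorners ℝ E' H'} [TopologicalSpace M'] [ChartedSpace H' M']
    {G : M → M'} {c : ℝ → M} {t : ℝ} (hG : MDifferentiableAt I I' G (c t))
    (hc : MDifferentiableAt 𝓘(ℝ, ℝ) I c t) :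
    velocity I' (fun τ => G (c τ)) t = mfderiv I I' G (c t) (velocity I c t) :=
  mfderiv_comp_apply t hG hc 1

end AlongCurves

/-! ### Prequantum bundles along curves -/

section Bundle

variable {X : Type*} [TopologicalSpace X] [ChartedSpace Four X] [IsManifold (𝓡 4) ∞ X]
  {L : X → Type*} [TopologicalSpace (TotalSpace ℂ L)] [∀ x, NormedAddCommGroup (L x)]
  [∀ x, InnerProductSpace ℂ (L x)] [FiberBundle ℂ L] [VectorBundle ℝ ℂ L] [VectorBundle ℂ ℂ L]
  [ContMDiffVectorBundle ∞ ℂ L (𝓡 4)]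
  {nabla : CovariantDerivative (𝓡 4) ℂ L} {Ω : TwoTensor X}

/-- The hermitian product of a section and a point of the bundle. -/
def pairing (s : (x : X) → L x) (u : TotalSpace ℂ L) : ℂ := inner ℂ (s u.proj) u.2

/-- The extension of the vector with coordinate 1 is the local frame of the trivialization, and the
trivialization is complex linear on fibers. -/
lemma eq_extend_smul {x₀ : X} {u : TotalSpace ℂ L}
    (hu : u.proj ∈ (trivializationAt ℂ L x₀).baseSet) :
    u.2 = (trivializationAt ℂ L x₀ u).2 •
      FiberBundle.extend ℂ ((trivializationAt ℂ L x₀).symm x₀ 1) u.proj := by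
  set t := trivializationAt ℂ L x₀ with ht
  have h5 : FiberBundle.extend ℂ (t.symm x₀ 1) u.proj = t.symm u.proj 1 := by
    simp only [FiberBundle.extend, ← ht]
    rw [t.apply_mk_symm (FiberBundle.mem_baseSet_trivializationAt' x₀)]
  rw [h5, ← t.symmₗ_apply (R := ℂ) hu, ← map_smul, t.symmₗ_apply hu, smul_eq_mul, mul_one]
  exact (t.symm_apply_apply_mk hu u.2).symm

/-- Smoothness of the hermitian metric is only assumed on sections. Locally the pairing is the fiber
coordinate times the product of `s` with the frame, both of which are smooth. -/
lemma contMDiffAt_pairing (h : IsPrequantum nabla Ω) {s : (x : X) → L x} {u : TotalSpace ℂ L}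
    (hs : SmoothSectionAt s u.proj) :
    ContMDiffAt ((𝓡 4).prod 𝓘(ℝ, ℂ)) 𝓘(ℝ, ℂ) ∞ (pairing s) u := by
  set t := trivializationAt ℂ L u.proj with ht
  have hx : u.proj ∈ t.baseSet := FiberBundle.mem_baseSet_trivializationAt' u.proj
  have hu : u ∈ t.source := t.mem_source.2 hx
  set τ : (x : X) → L x := FiberBundle.extend ℂ (t.symm u.proj 1) with hτ
  have hτs : SmoothSectionAt τ u.proj := FiberBundle.contMDiffAt_extend (𝓡 4) ℂ _
  have h1 := h.smooth_metric s τ u.proj hs hτs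
  have h2 : ContMDiffAt ((𝓡 4).prod 𝓘(ℝ, ℂ)) 𝓘(ℝ, ℂ) ∞
      (fun u' : TotalSpace ℂ L => inner ℂ (s u'.proj) (τ u'.proj)) u :=
    h1.comp u (contMDiffAt_proj L)
  have h3 : ContMDiffAt ((𝓡 4).prod 𝓘(ℝ, ℂ)) 𝓘(ℝ, ℂ) ∞ (fun u' : TotalSpace ℂ L => (t u').2) u :=
    ((t.contMDiffOn (IB := 𝓡 4) (n := ∞)).contMDiffAt (t.open_source.mem_nhds hu)).snd
  have h4 : ContDiff ℝ ∞ (fun p : ℂ × ℂ => p.1 * p.2) := contDiff_mul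
  refine (h4.contMDiff.contMDiffAt.comp u (h3.prodMk_space h2)).congr_of_eventuallyEq ?_
  filter_upwards [t.open_source.mem_nhds hu] with u' hu'
  rw [pairing, eq_extend_smul (t.mem_source.1 hu'), inner_smul_right]
  rfl

/-- A smooth unit section over `U`. -/
structure IsUnitSection (s : (x : X) → L x) (U : Set X) : Prop where
  smooth : ∀ x ∈ U, SmoothSectionAt s x
  norm : ∀ x ∈ U, ‖s x‖ = 1

lemma exists_unitSection (h : IsPrequantum nabla Ω) {U : Set X}
    (hs : ∃ s : (x : X) → L x, ∀ x ∈ U, SmoothSectionAt s x ∧ s x ≠ 0) :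
    ∃ s : (x : X) → L x, IsUnitSection s U := by
  obtain ⟨s, hs⟩ := hs
  refine ⟨(fun x => ‖s x‖⁻¹) • s, fun x hx => ?_, fun x hx => ?_⟩
  · have h1 := h.smooth_metric s s x (hs x hx).1 (hs x hx).1
    have h2 : ContMDiffAt (𝓡 4) 𝓘(ℝ, ℝ) ∞ (fun y => ‖s y‖⁻¹) x := by
      have h3 : ContDiffAt ℝ ∞ (fun z : ℂ => (√z.re)⁻¹) (inner ℂ (s x) (s x)) := by
        have h4 : 0 < (inner ℂ (s x) (s x)).re := by
          have := inner_self_eq_norm_sq (𝕜 := ℂ) (s x)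
          have h5 := norm_pos_iff.2 (hs x hx).2
          change 0 < RCLike.re (inner ℂ (s x) (s x))
          rw [this]; positivity
        refine ContDiffAt.inv (ContDiffAt.sqrt ?_ h4.ne') (Real.sqrt_pos.2 h4).ne'
        exact Complex.reCLM.contDiff.contDiffAt
      refine (h3.contMDiffAt.comp x h1).congr_of_eventuallyEq (Eventually.of_forall fun y => ?_)
      have := inner_self_eq_norm_sq (𝕜 := ℂ) (s y)
      change _ = (√(RCLike.re (inner ℂ (s y) (s y))))⁻¹
      rw [this, Real.sqrt_sq (norm_nonneg _)]
    exact h2.smul_section (hs x hx).1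
  · have := norm_ne_zero_iff.2 (hs x hx).2
    simp [norm_smul, this]

variable (nabla) in
/-- The connection form of `nabla` with respect to a section. -/
def potential (s : (x : X) → L x) : OneForm X := fun x =>
  Complex.imCLM.comp (((innerSL ℂ (s x)).restrictScalars ℝ).comp (nabla s x))

lemma potential_apply (s : (x : X) → L x) (x : X) (v : TangentSpace (𝓡 4) x) :
    potential nabla s x v = (inner ℂ (s x) (nabla s x v)).im := rfl

lemma SmoothSectionAt.complex_smul {s : (x : X) → L x} {x : X} (hs : SmoothSectionAt s x)
    {f : X → ℂ} (hf : ContMDiffAt (𝓡 4) 𝓘(ℝ, ℂ) ∞ f x) :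
    SmoothSectionAt (fun y => f y • s y) x := by
  rw [SmoothSectionAt, contMDiffAt_section] at *
  have h4 : ContDiff ℝ ∞ (fun p : ℂ × ℂ => p.1 * p.2) := contDiff_mul
  refine (h4.contMDiff.contMDiffAt.comp x (hf.prodMk_space hs)).congr_of_eventuallyEq ?_
  filter_upwards [(trivializationAt ℂ L x).open_baseSet.mem_nhds
    (FiberBundle.mem_baseSet_trivializationAt' x)] with y hy
  exact ((trivializationAt ℂ L x).linear ℂ hy).map_smul (f y) (s y)

lemma eq_pairing_smul {s : (x : X) → L x} {u : TotalSpace ℂ L} (hs : ‖s u.proj‖ = 1) :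
    u.2 = pairing s u • s u.proj := by
  have hx : u.proj ∈ (trivializationAt ℂ L u.proj).baseSet :=
    FiberBundle.mem_baseSet_trivializationAt' u.proj
  have h1 := eq_extend_smul (u := u) hx
  have h2 := eq_extend_smul (u := (⟨u.proj, s u.proj⟩ : TotalSpace ℂ L)) hx
  simp only at h2
  set e : L u.proj := FiberBundle.extend ℂ ((trivializationAt ℂ L u.proj).symm u.proj 1) u.proj
  set a : ℂ := (trivializationAt ℂ L u.proj u).2
  set b : ℂ := (trivializationAt ℂ L u.proj ⟨u.proj, s u.proj⟩).2
  have hb : b ≠ 0 := by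
    intro hb
    rw [h2, hb, zero_smul, norm_zero] at hs
    exact zero_ne_one hs
  have h3 : u.2 = (a / b) • s u.proj := by
    rw [h1, h2, smul_smul, div_mul_cancel₀ _ hb]
  have h4 : pairing s u = a / b := by
    rw [pairing, h3, inner_smul_right, inner_self_eq_norm_sq_to_K, hs]; simp
  rw [h4]; exact h3

lemma norm_pairing {s : (x : X) → L x} {u : TotalSpace ℂ L} (hs : ‖s u.proj‖ = 1)
    (hu : u ∈ circleBundle L) : ‖pairing s u‖ = 1 := by
  have h1 : ‖u.2‖ = 1 := hu
  rwa [eq_pairing_smul hs, norm_smul, hs, mul_one] at h1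

lemma pairing_rot (s : (x : X) → L x) (a : Circle) (u : TotalSpace ℂ L) :
    pairing s (rot a u) = a * pairing s u := by
  exact inner_smul_right (𝕜 := ℂ) (s u.proj) u.2 (a : ℂ)

/-! ### The connection form of a unit section and its differential. -/

section Potential

variable [T2Space X] {U : Set X} {s : (x : X) → L x} {x : X}

/-- Smoothness of the connection speaks of globally smooth sections, so the local section is
multiplied by a bump function that equals 1 near the point; covariant derivatives are local. -/
lemma smoothSectionAt_nabla (h : IsPrequantum nabla Ω) (hU : IsOpen U)
    (hs : ∀ y ∈ U, SmoothSectionAt s y) (hx : x ∈ U) {V : (x : X) → TangentSpace (𝓡 4) x}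
    (hV : SmoothFieldAt V x) : SmoothSectionAt (fun y => nabla s y (V y)) x := by
  obtain ⟨χ, -, hχ⟩ := (SmoothBumpFunction.nhds_basis_tsupport (I := 𝓡 4) x).mem_iff.1
    (hU.mem_nhds hx)
  have h1 : ContMDiffOn (𝓡 4) ((𝓡 4).prod 𝓘(ℝ, ℂ)) ∞ (fun y => TotalSpace.mk' ℂ y (s y)) U :=
    fun y hy => (hs y hy).contMDiffWithinAt
  have h2 := ContMDiffOn.smul_section_of_tsupport χ.contMDiff.contMDiffOn hU hχ h1
  have h3 := h.smooth.contMDiff.contMDiff (σ := (χ : X → ℝ) • s) h2.contMDiffOn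
  have h4 : SmoothSectionAt (fun y => nabla ((χ : X → ℝ) • s) y (V y)) x :=
    ((h3.contMDiffAt univ_mem).clm_bundle_apply hV)
  refine h4.congr_of_eventuallyEq ?_
  have h5 : ∀ᶠ y in 𝓝 x, ∀ᶠ z in 𝓝 y, χ z = 1 := χ.eventuallyEq_one.eventually_nhds
  filter_upwards [h5, hU.mem_nhds hx] with y hy hyU
  have h6 : nabla s y = nabla ((χ : X → ℝ) • s) y := by
    refine nabla.isCovariantDerivativeOnUniv.congr_of_eventuallyEq
      ((hs y hyU).mdifferentiableAt (by simp)) ((h2 y).mdifferentiableAt (by simp)) univ_mem ?_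
    filter_upwards [hy] with z hz
    simp [hz]
  simp only [h6]

/-- Differentiating h(s, s) = 1 shows that h(s, ∇s) is purely imaginary, and the fibers are complex
lines. -/
lemma nabla_eq_smul (h : IsPrequantum nabla Ω) (hU : IsOpen U) (hs : IsUnitSection s U)
    (hx : x ∈ U) (v : TangentSpace (𝓡 4) x) :
    nabla s x v = (Complex.I * (potential nabla s x v : ℂ)) • s x := by
  have h1 := h.hermitian s s x (hs.smooth x hx) (hs.smooth x hx) v
  have h2 : (fun y => inner ℂ (s y) (s y)) =ᶠ[𝓝 x] fun _ => (1 : ℂ) := by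
    filter_upwards [hU.mem_nhds hx] with y hy
    rw [inner_self_eq_norm_sq_to_K, hs.norm y hy]; simp
  have h3 : mvfderiv (𝓡 4) (fun y => inner ℂ (s y) (s y)) x = 0 := by
    have h4 : mfderiv (𝓡 4) 𝓘(ℝ, ℂ) (fun y => inner ℂ (s y) (s y)) x = 0 :=
      h2.mfderiv_eq.trans mfderiv_const
    ext v
    exact congrArg (fun A : TangentSpace (𝓡 4) x →L[ℝ] ℂ => A v) h4
  rw [h3, zero_apply] at h1
  have h4 : (inner ℂ (s x) (nabla s x v)).re = 0 := by
    have h5 := congrArg Complex.re h1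
    rw [Complex.add_re, ← inner_conj_symm (nabla s x v) (s x), Complex.conj_re,
      Complex.zero_re] at h5
    linarith
  have h6 : nabla s x v = inner ℂ (s x) (nabla s x v) • s x :=
    eq_pairing_smul (u := (⟨x, nabla s x v⟩ : TotalSpace ℂ L)) (hs.norm x hx)
  have h7 : inner ℂ (s x) (nabla s x v) = Complex.I * (potential nabla s x v : ℂ) := by
    apply Complex.ext <;> simp [h4, potential_apply]
  rwa [h7] at h6

lemma contMDiffAt_potential (h : IsPrequantum nabla Ω) (hU : IsOpen U)
    (hs : ∀ y ∈ U, SmoothSectionAt s y) (hx : x ∈ U) {V : (x : X) → TangentSpace (𝓡 4) x}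
    (hV : SmoothFieldAt V x) :
    ContMDiffAt (𝓡 4) 𝓘(ℝ, ℝ) ∞ (fun y => potential nabla s y (V y)) x :=
  Complex.imCLM.contDiff.contMDiff.contMDiffAt.comp x
    (h.smooth_metric s _ x (hs x hx) (smoothSectionAt_nabla h hU hs hx hV))

/-- This is dα = -Ω. With ∇s = iα s the quadratic terms α(V)α(W) cancel in the commutator, and the
curvature becomes i dα. -/
lemma potential_exteriorDeriv (h : IsPrequantum nabla Ω) (hU : IsOpen U) (hs : IsUnitSection s U)
    (hx : x ∈ U) {V W : (x : X) → TangentSpace (𝓡 4) x} (hV : SmoothFieldAt V x)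
    (hW : SmoothFieldAt W x) :
    lieD V (fun y => potential nabla s y (W y)) x - lieD W (fun y => potential nabla s y (V y)) x
      - potential nabla s x (bracket V W x) = - Ω x (V x) (W x) := by
  have hc := h.curvature s V W x (hs.smooth x hx) hV hW
  have hIs : SmoothSectionAt (fun y => Complex.I • s y) x :=
    (hs.smooth x hx).complex_smul contMDiffAt_const
  -- Leibniz rule for α(W) · (i s), which represents ∇_W s near x.
  have key : ∀ {V W : (x : X) → TangentSpace (𝓡 4) x}, SmoothFieldAt V x → SmoothFieldAt W x →
      nabla (fun y => nabla s y (W y)) x (V x) = (-(potential nabla s x (W x) *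
        potential nabla s x (V x) : ℂ) + Complex.I *
        (lieD V (fun y => potential nabla s y (W y)) x : ℂ)) • s x := by
    intro V W hV hW
    have ha := contMDiffAt_potential h hU hs.smooth hx hW
    set a : X → ℝ := fun y => potential nabla s y (W y) with ha'
    have h1 : nabla (fun y => nabla s y (W y)) x = nabla (a • fun y => Complex.I • s y) x := by
      refine nabla.isCovariantDerivativeOnUniv.congr_of_eventuallyEq
        ((smoothSectionAt_nabla h hU hs.smooth hx hW).mdifferentiableAt (by simp))
        ((ha.smul_section hIs).mdifferentiableAt (by simp)) univ_mem ?_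
      filter_upwards [hU.mem_nhds hx] with y hy
      rw [nabla_eq_smul h hU hs hy, Pi.smul_apply', mul_comm, mul_smul]
      exact Complex.coe_smul _ _
    have h2 := nabla.isCovariantDerivativeOnUniv.leibniz (hIs.mdifferentiableAt (by simp))
      (ha.mdifferentiableAt (by simp)) (mem_univ x)
    rw [h1]
    change nabla.toFun _ x (V x) = _
    rw [h2, add_apply, smul_apply,
      ContinuousLinearMap.smulRight_apply]
    rw [h.complex_linear s x (hs.smooth x hx), nabla_eq_smul h hU hs hx, smul_smul,
      ← Complex.coe_smul, ← Complex.coe_smul, smul_smul, smul_smul, ← add_smul]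
    congr 1
    have hI := Complex.I_mul_I
    linear_combination (a x : ℂ) * (potential nabla s x (V x) : ℂ) * hI
  rw [key hV hW, key hW hV, nabla_eq_smul h hU hs hx, ← sub_smul, ← sub_smul] at hc
  have hne : s x ≠ 0 := by
    intro h0
    have := hs.norm x hx
    rw [h0, norm_zero] at this
    exact zero_ne_one this
  have h1 := smul_left_injective ℂ hne hc
  have h2 := congrArg Complex.im h1
  simpa using h2

end Potential

end Bundle


/-! ### Coordinate fields of charts, and one-forms in coordinates. -/

section Forms

variable {X : Type*} [TopologicalSpace X] [ChartedSpace Four X] [IsManifold (𝓡 4) ∞ X]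

/-- The differential of the chart at `x₀`. -/
def chartDeriv (x₀ x : X) : TangentSpace (𝓡 4) x →L[ℝ] Four :=
  mfderiv (𝓡 4) 𝓘(ℝ, Four) (chartAt Four x₀) x

/-- Constant vector fields. -/
def constField (a : Four) : (y : Four) → TangentSpace 𝓘(ℝ, Four) y := fun _ => a

/-- The coordinate vector fields of the chart at `x₀`. -/
def chartField (x₀ : X) (a : Four) : (x : X) → TangentSpace (𝓡 4) x :=
  VectorField.mpullback (𝓡 4) 𝓘(ℝ, Four) (chartAt Four x₀) (constField a)

lemma contMDiffAt_chartAt {x₀ x : X} (hx : x ∈ (chartAt Four x₀).source) :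
    ContMDiffAt (𝓡 4) 𝓘(ℝ, Four) ∞ (chartAt Four x₀) x :=
  (contMDiffOn_chart (I := 𝓡 4) (n := ∞) (x := x₀)).contMDiffAt
    ((chartAt Four x₀).open_source.mem_nhds hx)

lemma isInvertible_mfderiv_chartAt {x₀ x : X} (hx : x ∈ (chartAt Four x₀).source) :
    (mfderiv (𝓡 4) 𝓘(ℝ, Four) (chartAt Four x₀) x).IsInvertible := by
  have := isInvertible_mfderiv_extChartAt (I := 𝓡 4) (x := x₀) (y := x) (by simpa using hx)
  have h2 : (extChartAt (𝓡 4) x₀ : X → Four) = chartAt Four x₀ := by simp [extChartAt]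
  rw [h2] at this
  exact this

lemma contMDiffAt_constField (a y : Four) :
    ContMDiffAt 𝓘(ℝ, Four) (𝓘(ℝ, Four).prod 𝓘(ℝ, Four)) ∞
      (fun y : Four => (TotalSpace.mk' Four y (constField a y) : TangentBundle 𝓘(ℝ, Four) Four))
      y := by
  rw [contMDiffAt_section]
  refine (contMDiffAt_const (c := a)).congr_of_eventuallyEq (Eventually.of_forall fun z => ?_)
  exact congrArg Prod.snd
    (trivializationAt_model_space_apply (I := 𝓘(ℝ, Four)) ⟨z, constField a z⟩ y)

lemma smoothFieldAt_chartField {x₀ x : X} (hx : x ∈ (chartAt Four x₀).source) (a : Four) :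
    SmoothFieldAt (chartField x₀ a) x :=
  ContMDiffAt.mpullback_vectorField_preimage (n := ∞) (contMDiffAt_constField a _)
    (contMDiffAt_chartAt hx) (isInvertible_mfderiv_chartAt hx) le_rfl

lemma two_le_inf : (2 : WithTop ℕ∞) ≤ (∞ : WithTop ℕ∞) := by
  have : ((2 : ℕ∞) : WithTop ℕ∞) ≤ ((⊤ : ℕ∞) : WithTop ℕ∞) := WithTop.coe_le_coe.2 le_top
  exact this

lemma bracket_chartField {x₀ x : X} (hx : x ∈ (chartAt Four x₀).source) (a a' : Four) :
    bracket (chartField x₀ a) (chartField x₀ a') x = 0 := by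
  have : IsManifold (𝓡 4) (minSmoothness ℝ 2) X := IsManifold.of_le (n := ∞)
    (by simpa using two_le_inf)
  have h := VectorField.mpullback_mlieBracket (I := 𝓡 4) (I' := 𝓘(ℝ, Four)) (n := ∞)
    (f := chartAt Four x₀) (x₀ := x) (V := constField a) (W := constField a')
    ((contMDiffAt_constField a _).mdifferentiableAt (by simp))
    ((contMDiffAt_constField a' _).mdifferentiableAt (by simp)) (contMDiffAt_chartAt hx)
    (by simpa using two_le_inf)
  refine h.symm.trans ?_
  have h2 : VectorField.mlieBracket 𝓘(ℝ, Four) (constField a) (constField a') = 0 := by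
    rw [← VectorField.mlieBracketWithin_univ, VectorField.mlieBracketWithin_eq_lieBracketWithin]
    have h3 : VectorField.lieBracketWithin ℝ (fun _ : Four => a) (fun _ : Four => a') univ = 0 := by
      rw [VectorField.lieBracketWithin_univ]
      ext1 y
      simp [VectorField.lieBracket]
    exact h3
  rw [h2, VectorField.mpullback_zero]
  rfl

lemma mdifferentiableAt_chartAt_symm {x₀ : X} {y : Four} (hy : y ∈ (chartAt Four x₀).target) :
    MDifferentiableAt 𝓘(ℝ, Four) (𝓡 4) (chartAt Four x₀).symm y :=
  mdifferentiableAt_atlas_symm (I := 𝓡 4) (chart_mem_atlas Four x₀) hy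

lemma mfderiv_chartAt_symm_apply {x₀ : X} {y : Four} (hy : y ∈ (chartAt Four x₀).target) (a : Four) :
    mfderiv 𝓘(ℝ, Four) (𝓡 4) (chartAt Four x₀).symm y a
      = chartField x₀ a ((chartAt Four x₀).symm y) := by
  set e := chartAt Four x₀
  have hx : e.symm y ∈ e.source := e.map_target hy
  have h1 := (mdifferentiable_chart (I := 𝓡 4) x₀).comp_symm_deriv hy
  have h2 : (mfderiv (𝓡 4) 𝓘(ℝ, Four) e (e.symm y)) (mfderiv 𝓘(ℝ, Four) (𝓡 4) e.symm y a) = a :=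
    DFunLike.congr_fun h1 a
  exact (((isInvertible_mfderiv_chartAt (x₀ := x₀) hx).inverse_apply_eq).2 h2.symm).symm

lemma chartField_mfderiv {x₀ x : X} (hx : x ∈ (chartAt Four x₀).source) (v : TangentSpace (𝓡 4) x) :
    chartField x₀ (chartDeriv x₀ x v) x = v :=
  ((isInvertible_mfderiv_chartAt (x₀ := x₀) hx).inverse_apply_eq).2 rfl

lemma chartField_eq_sum (x₀ x : X) (a : Four) :
    chartField x₀ a x = ∑ i, a i • chartField x₀ (EuclideanSpace.single i 1) x := by
  have h : a = ∑ i, a i • EuclideanSpace.single i (1 : ℝ) := by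
    ext j
    simp [Finset.sum_apply, Pi.single_apply]
  have h2 : ∀ A : Four →L[ℝ] Four, A a = ∑ i, a i • A (EuclideanSpace.single i (1 : ℝ)) := by
    intro A
    conv_lhs => rw [h]
    simp
  exact h2 (mfderiv (𝓡 4) 𝓘(ℝ, Four) (chartAt Four x₀) x).inverse

lemma continuousOn_mfderiv_chartAt (x₀ : X) :
    ContinuousOn (fun v : TangentBundle (𝓡 4) X =>
      chartDeriv x₀ v.1 v.2)
      (TotalSpace.proj ⁻¹' (chartAt Four x₀).source) := by
  have h1 := (contMDiffOn_chart (I := 𝓡 4) (n := ∞) (x := x₀)).continuousOn_tangentMapWithin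
    (by simp) (chartAt Four x₀).open_source.uniqueMDiffOn
  have h2 := ((tangentBundleModelSpaceHomeomorph 𝓘(ℝ, Four)).continuous.comp_continuousOn h1).snd
  refine h2.congr fun v hv => ?_
  simp only [Function.comp_apply, tangentMapWithin]
  rw [mfderivWithin_of_mem_nhds ((chartAt Four x₀).open_source.mem_nhds hv)]
  rfl

/-- A `1`-form whose values on smooth vector fields are smooth. -/
def OneForm.EvalSmoothOn (η : OneForm X) (U : Set X) : Prop :=
  ∀ x ∈ U, ∀ V : (x : X) → TangentSpace (𝓡 4) x, SmoothFieldAt V x →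
    ContMDiffAt (𝓡 4) 𝓘(ℝ, ℝ) ∞ (fun y => η y (V y)) x

lemma OneForm.SmoothOn.evalSmoothOn {η : OneForm X} {U : Set X} (h : η.SmoothOn U) (hU : IsOpen U) :
    η.EvalSmoothOn U := fun _ hx _ hV =>
  contMDiffAt_section .. |>.1 (((h.contMDiffAt (hU.mem_nhds hx)).clm_bundle_apply
    (F₂ := ℝ) (E₂ := Bundle.Trivial X ℝ)) hV)

/-- Near a point the form is the sum of the coordinate differentials times its values on the
coordinate fields, all of them continuous. -/
lemma OneForm.EvalSmoothOn.continuousOn {η : OneForm X} {U : Set X} (h : η.EvalSmoothOn U) :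
    ContinuousOn (fun v : TangentBundle (𝓡 4) X => η v.1 v.2) (TotalSpace.proj ⁻¹' U) := by
  intro v hv
  refine ContinuousAt.continuousWithinAt ?_
  set x₀ : X := v.1
  have hx₀ : x₀ ∈ (chartAt Four x₀).source := mem_chart_source Four x₀
  have hp : ContinuousAt (fun w : TangentBundle (𝓡 4) X => w.1) v :=
    (FiberBundle.continuous_proj Four (TangentSpace (𝓡 4))).continuousAt
  have hnhds : ∀ᶠ w : TangentBundle (𝓡 4) X in 𝓝 v, w.1 ∈ (chartAt Four x₀).source :=
    hp.eventually ((chartAt Four x₀).open_source.mem_nhds hx₀)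
  have h1 : ContinuousAt (fun w : TangentBundle (𝓡 4) X => ∑ i,
      (chartDeriv x₀ w.1 w.2) i *
        η w.1 (chartField x₀ (EuclideanSpace.single i 1) w.1)) v := by
    refine tendsto_finsetSum _ fun i _ => ContinuousAt.mul ?_ ?_
    · have := (continuousOn_mfderiv_chartAt x₀).continuousAt hnhds
      exact ContinuousAt.comp (g := fun a : Four => a i) (by fun_prop) this
    · exact ContinuousAt.comp (g := fun x => η x (chartField x₀ (EuclideanSpace.single i 1) x))
        (h x₀ hv _ (smoothFieldAt_chartField hx₀ _)).continuousAt hp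
  refine h1.congr ?_
  filter_upwards [hnhds] with w hw
  conv_rhs => rw [← chartField_mfderiv hw w.2, chartField_eq_sum, map_sum]
  exact Finset.sum_congr rfl fun i _ => (map_smul (η w.1) _ _).symm

end Forms

/-! ### Continuity and homogeneity of the Riemannian norm. -/

section Forms

variable {X : Type*} [TopologicalSpace X] [ChartedSpace Four X] [IsManifold (𝓡 4) ∞ X]

lemma Metric.contMDiffAt_inner (g : Metric X) {x : X} {V W : (x : X) → TangentSpace (𝓡 4) x}
    (hV : SmoothFieldAt V x) (hW : SmoothFieldAt W x) :
    ContMDiffAt (𝓡 4) 𝓘(ℝ, ℝ) ∞ (fun y => g.inner y (V y) (W y)) x :=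
  contMDiffAt_section .. |>.1 ((g.contMDiff x).clm_bundle_apply₂
    (F₃ := ℝ) (E₃ := Bundle.Trivial X ℝ) hV hW)

lemma continuous_proj_tangentBundle : Continuous fun w : TangentBundle (𝓡 4) X => w.1 :=
  FiberBundle.continuous_proj Four (TangentSpace (𝓡 4))

lemma Metric.inner_self_nonneg (g : Metric X) (x : X) (v : TangentSpace (𝓡 4) x) :
    0 ≤ g.inner x v v := by
  by_cases hv : v = 0
  · rw [hv]; simp
  · exact (g.pos x v hv).le

lemma Metric.norm_nonneg (g : Metric X) (x : X) (v : TangentSpace (𝓡 4) x) : 0 ≤ g.norm x v :=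
  Real.sqrt_nonneg _

lemma Metric.norm_sq (g : Metric X) (x : X) (v : TangentSpace (𝓡 4) x) :
    g.norm x v ^ 2 = g.inner x v v := Real.sq_sqrt (g.inner_self_nonneg x v)

lemma Metric.homogeneous_norm (g : Metric X) : Homogeneous g.norm := by
  intro x p v
  rw [Metric.norm, Metric.norm, ← Real.sqrt_sq_eq_abs, ← Real.sqrt_mul (sq_nonneg p)]
  congr 1
  simp only [map_smul, smul_apply, smul_eq_mul]
  ring

lemma Metric.continuous_inner (g : Metric X) :
    Continuous fun v : TangentBundle (𝓡 4) X => g.inner v.1 v.2 v.2 := by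
  rw [continuous_iff_continuousAt]
  intro v
  set x₀ : X := v.1
  have hx₀ : x₀ ∈ (chartAt Four x₀).source := mem_chart_source Four x₀
  have hp : ContinuousAt (fun w : TangentBundle (𝓡 4) X => w.1) v :=
    continuous_proj_tangentBundle.continuousAt
  have hnhds : ∀ᶠ w : TangentBundle (𝓡 4) X in 𝓝 v, w.1 ∈ (chartAt Four x₀).source :=
    hp.eventually ((chartAt Four x₀).open_source.mem_nhds hx₀)
  have hc : ∀ i, ContinuousAt (fun w : TangentBundle (𝓡 4) X => (chartDeriv x₀ w.1 w.2) i) v :=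
    fun i => ContinuousAt.comp (g := fun a : Four => a i) (by fun_prop)
      ((continuousOn_mfderiv_chartAt x₀).continuousAt hnhds)
  have h1 : ContinuousAt (fun w : TangentBundle (𝓡 4) X => ∑ i, ∑ j,
      (chartDeriv x₀ w.1 w.2) i * ((chartDeriv x₀ w.1 w.2) j *
        g.inner w.1 (chartField x₀ (EuclideanSpace.single j 1) w.1)
          (chartField x₀ (EuclideanSpace.single i 1) w.1))) v := by
    refine tendsto_finsetSum _ fun i _ => tendsto_finsetSum _ fun j _ =>
      (hc i).mul ((hc j).mul ?_)
    exact ContinuousAt.comp (g := fun x => g.inner x (chartField x₀ (EuclideanSpace.single j 1) x)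
      (chartField x₀ (EuclideanSpace.single i 1) x))
      (g.contMDiffAt_inner (smoothFieldAt_chartField hx₀ _)
        (smoothFieldAt_chartField hx₀ _)).continuousAt hp
  refine h1.congr ?_
  filter_upwards [hnhds] with w hw
  have h2 : w.2 = ∑ i, (chartDeriv x₀ w.1 w.2) i •
      chartField x₀ (EuclideanSpace.single i 1) w.1 :=
    (chartField_mfderiv hw w.2).symm.trans (chartField_eq_sum _ _ _)
  have h3 : ∀ (A : TangentSpace (𝓡 4) w.1 →L[ℝ] TangentSpace (𝓡 4) w.1 →L[ℝ] ℝ),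
      A w.2 w.2 = ∑ i, ∑ j, (chartDeriv x₀ w.1 w.2) i * ((chartDeriv x₀ w.1 w.2) j *
        A (chartField x₀ (EuclideanSpace.single j 1) w.1)
          (chartField x₀ (EuclideanSpace.single i 1) w.1)) := by
    intro A
    have h4 : ∀ v', A w.2 v' = ∑ j, (chartDeriv x₀ w.1 w.2) j *
        A (chartField x₀ (EuclideanSpace.single j 1) w.1) v' := by
      intro v'
      conv_lhs => rw [h2]
      rw [map_sum, sum_apply]
      simp only [map_smul, smul_apply, smul_eq_mul]
    conv_lhs => rw [h2]
    rw [map_sum]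
    simp only [map_smul, smul_eq_mul]
    refine Finset.sum_congr rfl fun i _ => ?_
    rw [← Finset.mul_sum, ← h4, ← h2]
  exact (h3 (g.inner w.1)).symm

lemma Metric.continuous_norm (g : Metric X) :
    Continuous fun v : TangentBundle (𝓡 4) X => g.norm v.1 v.2 :=
  Real.continuous_sqrt.comp g.continuous_inner

end Forms

/-! ### Local primitives of closed one-forms. -/

section LocalPrimitive

variable {X : Type*} [TopologicalSpace X] [ChartedSpace Four X] [IsManifold (𝓡 4) ∞ X]

/-- A `1`-form in the coordinates of the chart at `x₀`. -/
def chartForm (η : OneForm X) (x₀ : X) (y : Four) : Four →L[ℝ] ℝ :=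
  ∑ i, η ((chartAt Four x₀).symm y) (chartField x₀ (EuclideanSpace.single i 1)
    ((chartAt Four x₀).symm y)) • EuclideanSpace.proj i

lemma chartForm_apply (η : OneForm X) (x₀ : X) (y a : Four) :
    chartForm η x₀ y a
      = η ((chartAt Four x₀).symm y) (chartField x₀ a ((chartAt Four x₀).symm y)) := by
  rw [chartField_eq_sum x₀ _ a, map_sum, chartForm, sum_apply]
  refine Finset.sum_congr rfl fun i _ => ?_
  rw [map_smul, smul_apply, smul_eq_mul, smul_eq_mul, mul_comm]
  rfl

lemma contMDiffAt_chartAt_symm {x₀ : X} {y : Four} (hy : y ∈ (chartAt Four x₀).target) :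
    ContMDiffAt 𝓘(ℝ, Four) (𝓡 4) ∞ (chartAt Four x₀).symm y :=
  (contMDiffOn_chart_symm (I := 𝓡 4) (n := ∞) (x := x₀)).contMDiffAt
    ((chartAt Four x₀).open_target.mem_nhds hy)

lemma differentiableAt_chartForm {η : OneForm X} {U : Set X} (h : η.EvalSmoothOn U) {x₀ : X}
    {y : Four} (hy : y ∈ (chartAt Four x₀).target) (hyU : (chartAt Four x₀).symm y ∈ U) :
    DifferentiableAt ℝ (chartForm η x₀) y := by
  unfold chartForm
  refine DifferentiableAt.fun_sum fun i _ => DifferentiableAt.smul_const ?_ _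
  have h1 := (h _ hyU _ (smoothFieldAt_chartField ((chartAt Four x₀).map_target hy)
    (EuclideanSpace.single i 1))).comp y (contMDiffAt_chartAt_symm hy)
  exact (contMDiffAt_iff_contDiffAt.1 h1).differentiableAt (by simp)

lemma fderiv_chartForm {η : OneForm X} {U : Set X} (h : η.EvalSmoothOn U) {x₀ : X}
    {y : Four} (hy : y ∈ (chartAt Four x₀).target) (hyU : (chartAt Four x₀).symm y ∈ U)
    (a a' : Four) : fderiv ℝ (chartForm η x₀) y a a' =
      lieD (chartField x₀ a) (fun x => η x (chartField x₀ a' x)) ((chartAt Four x₀).symm y) := by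
  have h1 : fderiv ℝ (chartForm η x₀) y a a' = fderiv ℝ (fun z => chartForm η x₀ z a') y a := by
    have := ((differentiableAt_chartForm h hy hyU).hasFDerivAt.clm_apply
      (hasFDerivAt_const a' y)).fderiv
    rw [this]
    simp
  have h2 : (fun z => chartForm η x₀ z a')
      = (fun x => η x (chartField x₀ a' x)) ∘ (chartAt Four x₀).symm :=
    funext fun z => chartForm_apply η x₀ z a'
  have h3 : MDifferentiableAt (𝓡 4) 𝓘(ℝ, ℝ) (fun x => η x (chartField x₀ a' x))
      ((chartAt Four x₀).symm y) :=
    (h _ hyU _ (smoothFieldAt_chartField ((chartAt Four x₀).map_target hy) a')).mdifferentiableAt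
      (by simp)
  rw [h1, h2, ← mfderiv_eq_fderiv]
  refine (mfderiv_comp_apply y h3 (mdifferentiableAt_chartAt_symm hy) a).trans ?_
  rw [mfderiv_chartAt_symm_apply hy]
  rfl

/-- A closed `1`-form has local primitives. -/
lemma exists_local_primitive {η : OneForm X} {U : Set X} (hU : IsOpen U) (h : η.EvalSmoothOn U)
    (hcl : IsExteriorDerivOn η 0 U) {x₀ : X} (hx₀ : x₀ ∈ U) :
    ∃ (k : X → ℝ) (r : ℝ), 0 < r ∧ Metric.ball (chartAt Four x₀ x₀) r ⊆
      (chartAt Four x₀).target ∩ (chartAt Four x₀).symm ⁻¹' U ∧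
      ∀ x ∈ (chartAt Four x₀).source, chartAt Four x₀ x ∈ Metric.ball (chartAt Four x₀ x₀) r →
        ContMDiffAt (𝓡 4) 𝓘(ℝ, ℝ) 1 k x ∧ ∀ v, mvfderiv (𝓡 4) k x v = η x v := by
  set e := chartAt Four x₀ with he
  have hx₀e : x₀ ∈ e.source := mem_chart_source Four x₀
  have hopen : IsOpen (e.target ∩ e.symm ⁻¹' U) := e.isOpen_inter_preimage_symm hU
  obtain ⟨r, hr, hball⟩ := Metric.isOpen_iff.1 hopen (e x₀)
    ⟨e.map_source hx₀e, by simpa [e.left_inv hx₀e] using hx₀⟩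
  have hdiff : DifferentiableOn ℝ (chartForm η x₀) (Metric.ball (e x₀) r) := fun y hy =>
    (differentiableAt_chartForm h (hball hy).1 (hball hy).2).differentiableWithinAt
  -- Poincaré lemma on a ball in the chart. Coordinate fields commute, so closedness says exactly
  -- that the derivative of the coordinate expression is symmetric.
  obtain ⟨f, hf⟩ := (convex_ball (e x₀) r).exists_forall_hasFDerivAt_of_fderiv_symmetric
    Metric.isOpen_ball hdiff (by
      intro y hy a a'
      rw [fderiv_chartForm h (hball hy).1 (hball hy).2, fderiv_chartForm h (hball hy).1 (hball hy).2]
      have hs : e.symm y ∈ e.source := e.map_target (hball hy).1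
      have := hcl _ (hball hy).2 _ _ (smoothFieldAt_chartField hs a) (smoothFieldAt_chartField hs a')
      rw [bracket_chartField hs, map_zero, sub_zero] at this
      exact sub_eq_zero.1 this)
  have hf1 : ContDiffOn ℝ 1 f (Metric.ball (e x₀) r) := by
    have h2 := (contDiffOn_succ_iff_fderiv_of_isOpen (𝕜 := ℝ) (n := 0) (f := f)
      (Metric.isOpen_ball (x := e x₀) (ε := r))).2
      ⟨fun y hy => (hf y hy).differentiableAt.differentiableWithinAt, by simp, by
        rw [contDiffOn_zero]
        exact hdiff.continuousOn.congr fun y hy => (hf y hy).fderiv⟩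
    simpa using h2
  refine ⟨f ∘ e, r, hr, hball, fun x hx hxr => ⟨?_, fun v => ?_⟩⟩
  · exact ((contMDiffAt_iff_contDiffAt.2 (hf1.contDiffAt (Metric.isOpen_ball.mem_nhds hxr))).comp x
      ((contMDiffAt_chartAt hx).of_le (by simp)))
  · have h1 := mfderiv_comp_apply (I'' := 𝓘(ℝ, ℝ)) x (hf _ hxr).hasMFDerivAt.mdifferentiableAt
      ((contMDiffAt_chartAt hx).mdifferentiableAt (by simp)) v
    refine h1.trans ?_
    rw [(hf _ hxr).hasMFDerivAt.mfderiv]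
    refine (chartForm_apply η x₀ (e x) (chartDeriv x₀ x v)).trans ?_
    rw [e.left_inv hx, chartField_mfderiv hx]

end LocalPrimitive

/-! ### Curves in the circle bundle -/

section Phases

lemma PiecewiseC1On.eq_of_deriv_eq_zero {E : Type*} [NormedAddCommGroup E] [NormedSpace ℝ E]
    {f : ℝ → E} {a b : ℝ} (h : PiecewiseC1On 𝓘(ℝ, E) f a b)
    (h0 : ∀ᵐ t, t ∈ Icc a b → deriv f t = 0) : f b = f a := by
  have h1 := h.enorm_sub_le
  have h2 : ∫⁻ t in Icc a b, ‖deriv f t‖ₑ = 0 := by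
    rw [← lintegral_zero (μ := volume.restrict (Icc a b))]
    refine lintegral_congr_ae ?_
    rw [Filter.EventuallyEq, ae_restrict_iff' measurableSet_Icc]
    filter_upwards [h0] with t ht hI
    simp [ht hI]
  rw [h2, nonpos_iff_eq_zero, enorm_eq_zero] at h1
  exact sub_eq_zero.1 h1

/-- A unit complex number, as a point of the circle. -/
def toCircle (z : ℂ) : Circle := if h : ‖z‖ = 1 then ⟨z, mem_sphere_zero_iff_norm.2 h⟩ else 1

lemma coe_toCircle {z : ℂ} (h : ‖z‖ = 1) : (toCircle z : ℂ) = z := by simp [toCircle, h]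

/-- The derivative of a curve in the unit circle. -/
lemma deriv_eq_of_norm_eq_one {z : ℝ → ℂ} {z' : ℂ} {t : ℝ} (hz : HasDerivAt z z' t)
    (h : ∀ᶠ τ in 𝓝 t, ‖z τ‖ = 1) :
    z' = Complex.I * ((starRingEnd ℂ (z t) * z').im : ℂ) * z t := by
  have h1 : HasDerivAt (fun τ => starRingEnd ℂ (z τ) * z τ)
      (starRingEnd ℂ z' * z t + starRingEnd ℂ (z t) * z') t :=
    (HasDerivAt.star hz).mul hz
  have hsq : ∀ w : ℂ, ‖w‖ = 1 → starRingEnd ℂ w * w = 1 := by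
    intro w hw
    rw [mul_comm, Complex.mul_conj, Complex.normSq_eq_norm_sq, hw]; simp
  have h2 : HasDerivAt (fun τ => starRingEnd ℂ (z τ) * z τ) 0 t := by
    refine (hasDerivAt_const t (1 : ℂ)).congr_of_eventuallyEq ?_
    filter_upwards [h] with τ hτ using hsq _ hτ
  have h3 := h1.unique h2
  have h4 : (starRingEnd ℂ (z t) * z').re = 0 := by
    have h5 := congrArg Complex.re h3
    simp at h5 ⊢
    linarith
  have h6 : starRingEnd ℂ (z t) * z' = Complex.I * ((starRingEnd ℂ (z t) * z').im : ℂ) := by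
    apply Complex.ext
    · simpa using h4
    · simp
  rw [← h6]
  have := hsq _ h.self_of_nhds
  linear_combination (-z') * this

/-- A piecewise `C¹` curve in the unit circle is the exponential of the primitive of its angular
velocity. -/
lemma PiecewiseC1On.eq_mul_exp {z : ℝ → ℂ} {φ : ℝ → ℝ} {a b : ℝ} (hz : PiecewiseC1On 𝓘(ℝ, ℂ) z a b)
    (hφ : PiecewiseC1On 𝓘(ℝ, ℝ) φ a b)
    (h : ∀ᵐ t, t ∈ Icc a b → HasDerivAt z (Complex.I * ((deriv φ t : ℝ) : ℂ) * z t) t) :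
    z b = z a * Complex.exp (Complex.I * (φ b - φ a : ℝ)) := by
  have hE : ContDiff ℝ 1 fun q : ℂ × ℝ => q.1 * Complex.exp (-(Complex.I * (q.2 : ℂ))) := by
    have : ContDiff ℝ 1 fun q : ℂ × ℝ => (q.2 : ℂ) := Complex.ofRealCLM.contDiff.comp contDiff_snd
    exact contDiff_fst.mul (Complex.contDiff_exp.comp (contDiff_const.mul this).neg)
  -- The product z e^{-iφ} has zero derivative almost everywhere, hence equal values at the end
  -- points.
  have h1 : PiecewiseC1On 𝓘(ℝ, ℂ) (fun t => z t * Complex.exp (-(Complex.I * (φ t : ℂ)))) a b :=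
    (hz.prodMk hφ).comp hE.contMDiff.contMDiffOn (mapsTo_univ _ _)
  have h2 := h1.eq_of_deriv_eq_zero (by
    filter_upwards [h, hφ.ae_contMDiffAt] with t ht hφt hI
    have h3 := ((contMDiffAt_iff_contDiffAt.1 (hφt hI).2).differentiableAt one_ne_zero).hasDerivAt
    have h4 := ((h3.ofReal_comp.const_mul Complex.I).neg).cexp
    refine (((ht hI).mul h4).congr_deriv ?_).deriv
    ring)
  have h5 : ∀ t, Complex.exp (-(Complex.I * (φ t : ℂ))) * Complex.exp (Complex.I * (φ t : ℂ)) = 1 :=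
    fun t => by rw [← Complex.exp_add]; simp
  have h6 : Complex.exp (Complex.I * (φ b - φ a : ℝ))
      = Complex.exp (Complex.I * (φ b : ℂ)) * Complex.exp (-(Complex.I * (φ a : ℂ))) := by
    rw [← Complex.exp_add]; congr 1; push_cast; ring
  rw [h6]
  linear_combination Complex.exp (Complex.I * (φ b : ℂ)) * h2 - z b * h5 b

end Phases

/-! ### The connection form along curves. -/

section BundleCurves

variable {X : Type*} [TopologicalSpace X] [ChartedSpace Four X] [IsManifold (𝓡 4) ∞ X]
  {L : X → Type*} [TopologicalSpace (TotalSpace ℂ L)] [∀ x, NormedAddCommGroup (L x)]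
  [∀ x, InnerProductSpace ℂ (L x)] [FiberBundle ℂ L] [VectorBundle ℝ ℂ L] [VectorBundle ℂ ℂ L]
  [ContMDiffVectorBundle ∞ ℂ L (𝓡 4)]
  {nabla : CovariantDerivative (𝓡 4) ℂ L} {Ω : TwoTensor X} {s : (x : X) → L x} {U : Set X}

lemma mdifferentiableAt_proj (u : TotalSpace ℂ L) :
    MDifferentiableAt ((𝓡 4).prod 𝓘(ℝ, ℂ)) (𝓡 4) (fun u' : TotalSpace ℂ L => u'.proj) u :=
  ((contMDiffAt_proj L (n := ∞)) : ContMDiffAt ((𝓡 4).prod 𝓘(ℝ, ℂ)) (𝓡 4) ∞ _ u).mdifferentiableAt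
    (by simp)

lemma dproj_velocity {c : ℝ → TotalSpace ℂ L} {t : ℝ}
    (hc : MDifferentiableAt 𝓘(ℝ, ℝ) ((𝓡 4).prod 𝓘(ℝ, ℂ)) c t) :
    dproj (c t) (velocity ((𝓡 4).prod 𝓘(ℝ, ℂ)) c t) = velocity (𝓡 4) (fun τ => (c τ).proj) t :=
  (velocity_comp (mdifferentiableAt_proj (c t)) hc).symm

lemma hasDerivAt_pairing (h : IsPrequantum nabla Ω) {c : ℝ → TotalSpace ℂ L} {t : ℝ}
    (hs : SmoothSectionAt s (c t).proj)
    (hc : MDifferentiableAt 𝓘(ℝ, ℝ) ((𝓡 4).prod 𝓘(ℝ, ℂ)) c t) :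
    HasDerivAt (fun τ => pairing s (c τ)) (deriv (fun τ => pairing s (c τ)) t) t :=
  (hasDerivAt_comp_velocity ((contMDiffAt_pairing h hs).mdifferentiableAt (by simp))
    hc).differentiableAt.hasDerivAt

/-- Trades the auxiliary extension in the definition of Γ for a fixed unit section: Γ is the angular
velocity relative to `s` plus α. With z = h(s, c), one has h(σ, c) = z h(σ, s), and the hermitian
property differentiates the second factor. -/
lemma connectionForm_velocity (h : IsPrequantum nabla Ω) (hU : IsOpen U) (hs : IsUnitSection s U)
    {c : ℝ → TotalSpace ℂ L} {t : ℝ} (hc : MDifferentiableAt 𝓘(ℝ, ℝ) ((𝓡 4).prod 𝓘(ℝ, ℂ)) c t)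
    (hcU : (c t).proj ∈ U) (hcS : c t ∈ circleBundle L) :
    connectionForm nabla (c t) (velocity ((𝓡 4).prod 𝓘(ℝ, ℂ)) c t)
      = (starRingEnd ℂ (pairing s (c t)) * deriv (fun τ => pairing s (c τ)) t).im
        + potential nabla s (c t).proj (velocity (𝓡 4) (fun τ => (c τ).proj) t) := by
  set σ : (x : X) → L x := FiberBundle.extend ℂ (c t).2 with hσ
  have hσs : SmoothSectionAt σ (c t).proj := FiberBundle.contMDiffAt_extend (𝓡 4) ℂ _
  set x := (c t).proj with hx
  set w := velocity (𝓡 4) (fun τ => (c τ).proj) t with hw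
  have hcp : MDifferentiableAt 𝓘(ℝ, ℝ) (𝓡 4) (fun τ => (c τ).proj) t :=
    (mdifferentiableAt_proj (c t)).comp t hc
  have h1 : mvfderiv ((𝓡 4).prod 𝓘(ℝ, ℂ)) (pairing σ) (c t) (velocity ((𝓡 4).prod 𝓘(ℝ, ℂ)) c t)
      = deriv (fun τ => pairing σ (c τ)) t :=
    (hasDerivAt_comp_velocity ((contMDiffAt_pairing h hσs).mdifferentiableAt (by simp)) hc).deriv.symm
  have h2 := hasDerivAt_pairing h (hs.smooth x hcU) hc
  have h3 : HasDerivAt (fun τ => inner ℂ (σ (c τ).proj) (s (c τ).proj))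
      (inner ℂ (nabla σ x w) (s x) + inner ℂ (σ x) (nabla s x w)) t := by
    have := hasDerivAt_comp_velocity (c := fun τ => (c τ).proj)
      ((h.smooth_metric σ s x hσs (hs.smooth x hcU)).mdifferentiableAt (by simp)) hcp
    rwa [h.hermitian σ s x hσs (hs.smooth x hcU)] at this
  have h4 : deriv (fun τ => pairing σ (c τ)) t = deriv (fun τ => pairing s (c τ)) t *
      inner ℂ (σ x) (s x) + pairing s (c t) *
        (inner ℂ (nabla σ x w) (s x) + inner ℂ (σ x) (nabla s x w)) := by
    refine HasDerivAt.deriv ((h2.mul h3).congr_of_eventuallyEq ?_)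
    filter_upwards [hcp.continuousAt.eventually (hU.mem_nhds hcU)] with τ hτ
    change inner ℂ (σ (c τ).proj) (c τ).2 = pairing s (c τ) * inner ℂ (σ (c τ).proj) (s (c τ).proj)
    conv_lhs => rw [eq_pairing_smul (hs.norm _ hτ)]
    rw [inner_smul_right]
  -- At the time t the extension passes through c t, so the terms containing ∇σ cancel.
  have hσx : σ x = pairing s (c t) • s x := by
    have : σ x = (c t).2 := FiberBundle.extend_apply_self ℂ (c t).2
    rw [this]; exact eq_pairing_smul (hs.norm _ hcU)
  have hz : starRingEnd ℂ (pairing s (c t)) * pairing s (c t) = 1 := by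
    rw [mul_comm, Complex.mul_conj, Complex.normSq_eq_norm_sq, norm_pairing (hs.norm _ hcU) hcS]
    simp
  have h5 : inner ℂ (nabla σ x w) (c t).2 = pairing s (c t) * inner ℂ (nabla σ x w) (s x) := by
    conv_lhs => rw [eq_pairing_smul (u := c t) (hs.norm _ hcU)]
    rw [inner_smul_right]
  have hss : inner ℂ (s x) (s x) = (1 : ℂ) := by
    rw [inner_self_eq_norm_sq_to_K, hs.norm _ hcU]; simp
  change (mvfderiv ((𝓡 4).prod 𝓘(ℝ, ℂ)) (pairing σ) (c t) (velocity ((𝓡 4).prod 𝓘(ℝ, ℂ)) c t)).im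
    - (inner ℂ (nabla σ x (dproj (c t) (velocity ((𝓡 4).prod 𝓘(ℝ, ℂ)) c t))) (c t).2).im = _
  rw [dproj_velocity hc, h1, h4, h5, hσx, inner_smul_left, inner_smul_left, hss, potential_apply,
    ← Complex.sub_im, ← Complex.add_im]
  congr 1
  linear_combination (inner ℂ (s x) (nabla s x w)) * hz

lemma homogeneous_hatNorm (g : Metric X) (nabla : CovariantDerivative (𝓡 4) ℂ L) :
    Homogeneous (hatNorm g nabla) := by
  intro u p v
  have h1 : connectionForm nabla u (p • v) = p * connectionForm nabla u v := by
    have h3 : ∀ y z : L u.proj, (inner ℂ (p • y) z).im = p * (inner ℂ y z).im := by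
      intro y z
      rw [← Complex.coe_smul, inner_smul_left, Complex.conj_ofReal, Complex.im_ofReal_mul]
    simp only [connectionForm, dproj, map_smul, h3, mul_sub, Complex.smul_im, smul_eq_mul]
  have h2 : dproj u (p • v) = p • dproj u v := map_smul _ _ _
  rw [hatNorm, hatNorm, h1, h2, ← Real.sqrt_sq_eq_abs, ← Real.sqrt_mul (sq_nonneg p)]
  congr 1
  simp only [map_smul, smul_apply, smul_eq_mul]
  ring

end BundleCurves

/-! ### Curves in the circle bundle as base curves with an angle. -/

section Lift

variable {X : Type*} [TopologicalSpace X] [ChartedSpace Four X] [IsManifold (𝓡 4) ∞ X]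
  {L : X → Type*} [TopologicalSpace (TotalSpace ℂ L)] [∀ x, NormedAddCommGroup (L x)]
  [∀ x, InnerProductSpace ℂ (L x)] [FiberBundle ℂ L] [VectorBundle ℝ ℂ L] [VectorBundle ℂ ℂ L]
  [ContMDiffVectorBundle ∞ ℂ L (𝓡 4)]
  {nabla : CovariantDerivative (𝓡 4) ℂ L} {Ω : TwoTensor X} {s : (x : X) → L x} {U : Set X}

/-- The point of the circle bundle over `x` with angle `t` with respect to the section `s`. -/
def liftPoint (s : (x : X) → L x) (x : X) (t : ℝ) : TotalSpace ℂ L := rot (Circle.exp t) ⟨x, s x⟩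

lemma liftPoint_mem (hs : IsUnitSection s U) {x : X} (hx : x ∈ U) (t : ℝ) :
    liftPoint s x t ∈ circleBundle L := by
  change ‖(Circle.exp t : ℂ) • s x‖ = 1
  rw [norm_smul, hs.norm x hx, Circle.norm_coe, one_mul]

lemma pairing_liftPoint (hs : IsUnitSection s U) {x : X} (hx : x ∈ U) (t : ℝ) :
    pairing s (liftPoint s x t) = Circle.exp t := by
  rw [liftPoint, pairing_rot]
  have : pairing s (⟨x, s x⟩ : TotalSpace ℂ L) = 1 := by
    change inner ℂ (s x) (s x) = (1 : ℂ)
    rw [inner_self_eq_norm_sq_to_K, hs.norm _ hx]; simp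
  rw [this, mul_one]

lemma eq_rot_of_mem (hs : IsUnitSection s U) {u : TotalSpace ℂ L} (hu : u ∈ circleBundle L)
    (hx : u.proj ∈ U) : u = rot (toCircle (pairing s u)) ⟨u.proj, s u.proj⟩ := by
  obtain ⟨x, v⟩ := u
  have h1 := eq_pairing_smul (u := (⟨x, v⟩ : TotalSpace ℂ L)) (hs.norm x hx)
  have h2 := coe_toCircle (norm_pairing (u := (⟨x, v⟩ : TotalSpace ℂ L)) (hs.norm x hx) hu)
  simp only [rot]
  congr 1
  rw [h2]; exact h1

lemma exists_liftPoint (hs : IsUnitSection s U) {u : TotalSpace ℂ L} (hu : u ∈ circleBundle L)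
    (hx : u.proj ∈ U) : ∃ t, u = liftPoint s u.proj t :=
  ⟨_, (eq_rot_of_mem hs hu hx).trans (by rw [liftPoint, Circle.exp_arg])⟩

lemma contMDiffOn_liftPoint (hs : IsUnitSection s U) {c : ℝ → X} {ψ : ℝ → ℝ} {A : Set ℝ}
    (hc : ContMDiffOn 𝓘(ℝ, ℝ) (𝓡 4) 1 c A) (hψ : ContMDiffOn 𝓘(ℝ, ℝ) 𝓘(ℝ, ℝ) 1 ψ A)
    (hA : MapsTo c A U) :
    ContMDiffOn 𝓘(ℝ, ℝ) ((𝓡 4).prod 𝓘(ℝ, ℂ)) 1 (fun t => liftPoint s (c t) (ψ t)) A := by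
  intro t ht
  have h1 : ContMDiffWithinAt 𝓘(ℝ, ℝ) ((𝓡 4).prod 𝓘(ℝ, ℂ)) 1
      (fun t => (⟨c t, s (c t)⟩ : TotalSpace ℂ L)) A t :=
    ((hs.smooth _ (hA ht)).of_le (by simp)).comp_contMDiffWithinAt t (hc t ht)
  rw [Bundle.contMDiffWithinAt_totalSpace] at h1 ⊢
  refine ⟨h1.1, ?_⟩
  have h2 : ContDiff ℝ 1 fun q : ℝ × ℂ => Complex.exp ((q.1 : ℂ) * Complex.I) * q.2 := by
    have : ContDiff ℝ 1 fun q : ℝ × ℂ => (q.1 : ℂ) := Complex.ofRealCLM.contDiff.comp contDiff_fst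
    exact (Complex.contDiff_exp.comp (this.mul contDiff_const)).mul contDiff_snd
  refine (h2.contMDiff.contMDiffAt.comp_contMDiffWithinAt t
    ((hψ t ht).prodMk_space h1.2)).congr_of_eventuallyEq ?_ ?_
  · filter_upwards [(hc.continuousOn t ht).eventually
      ((trivializationAt ℂ L (c t)).open_baseSet.mem_nhds
      (FiberBundle.mem_baseSet_trivializationAt' (c t)))] with τ hτ
    exact ((trivializationAt ℂ L (c t)).linear ℂ hτ).map_smul (Circle.exp (ψ τ) : ℂ) (s (c τ))
  · exact ((trivializationAt ℂ L (c t)).linear ℂ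
      (FiberBundle.mem_baseSet_trivializationAt' (c t))).map_smul (Circle.exp (ψ t) : ℂ) (s (c t))

lemma PiecewiseC1On.liftPoint (hs : IsUnitSection s U) {c : ℝ → X} {ψ : ℝ → ℝ} {a b : ℝ}
    (hc : PiecewiseC1On (𝓡 4) c a b) (hψ : PiecewiseC1On 𝓘(ℝ, ℝ) ψ a b)
    (hA : MapsTo c (Icc a b) U) :
    PiecewiseC1On ((𝓡 4).prod 𝓘(ℝ, ℂ)) (fun t => liftPoint s (c t) (ψ t)) a b := by
  refine hc.induction (P := fun x y => a ≤ x → y ≤ b → PiecewiseC1On ((𝓡 4).prod 𝓘(ℝ, ℂ))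
    (fun t => BohrSommerfeld.liftPoint s (c t) (ψ t)) x y) (fun _ _ _ _ => refl _ _) ?_ ?_ le_rfl le_rfl
  · intro x y hx hxy hy hC _ _
    refine (hψ.mono hx hxy.le hy).induction (P := fun z w => x ≤ z → w ≤ y →
      PiecewiseC1On ((𝓡 4).prod 𝓘(ℝ, ℂ)) (fun t => BohrSommerfeld.liftPoint s (c t) (ψ t)) z w)
      (fun _ _ _ _ => refl _ _) ?_ ?_ le_rfl le_rfl
    · intro z w hz hzw hw hC' _ _
      exact of_contMDiffOn hzw.le (contMDiffOn_liftPoint hs (hC.mono (Icc_subset_Icc hz hw)) hC'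
        (hA.mono_left (Icc_subset_Icc (hx.trans hz) (hw.trans hy))))
    · intro z w v hz hzw hwv hv h1 h2 h3 h4
      exact (h1 h3 (hwv.trans h4)).trans (h2 (h3.trans hzw) h4)
  · intro z w v hz hzw hwv hv h1 h2 h3 h4
    exact (h1 h3 (hwv.trans h4)).trans (h2 (h3.trans hzw) h4)

/-- In the trivialization by `s` the connection form is dψ + α. This is the basic formula for
lengths of lifts. -/
lemma connectionForm_liftPoint (h : IsPrequantum nabla Ω) (hU : IsOpen U) (hs : IsUnitSection s U)
    {c : ℝ → X} {ψ : ℝ → ℝ} {ψ' t : ℝ} (hc : ContMDiffAt 𝓘(ℝ, ℝ) (𝓡 4) 1 c t)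
    (hψ : ContMDiffAt 𝓘(ℝ, ℝ) 𝓘(ℝ, ℝ) 1 ψ t) (hψ' : HasDerivAt ψ ψ' t) (hcU : c t ∈ U) :
    MDifferentiableAt 𝓘(ℝ, ℝ) ((𝓡 4).prod 𝓘(ℝ, ℂ)) (fun t => liftPoint s (c t) (ψ t)) t ∧
    connectionForm nabla (liftPoint s (c t) (ψ t))
      (velocity ((𝓡 4).prod 𝓘(ℝ, ℂ)) (fun t => liftPoint s (c t) (ψ t)) t)
      = ψ' + potential nabla s (c t) (velocity (𝓡 4) c t) := by
  obtain ⟨A, hA, hcA⟩ := (contMDiffAt_iff_contMDiffOn_nhds (by simp)).1 hc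
  obtain ⟨A', hA', hψA⟩ := (contMDiffAt_iff_contMDiffOn_nhds (by simp)).1 hψ
  have hn : A ∩ A' ∩ c ⁻¹' U ∈ 𝓝 t :=
    inter_mem (inter_mem hA hA') (hc.continuousAt.preimage_mem_nhds (hU.mem_nhds hcU))
  have h1 : MDifferentiableAt 𝓘(ℝ, ℝ) ((𝓡 4).prod 𝓘(ℝ, ℂ)) (fun t => liftPoint s (c t) (ψ t)) t :=
    ((contMDiffOn_liftPoint hs (hcA.mono fun x hx => hx.1.1) (hψA.mono fun x hx => hx.1.2)
      fun x hx => hx.2).contMDiffAt hn).mdifferentiableAt one_ne_zero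
  refine ⟨h1, ?_⟩
  refine (connectionForm_velocity h hU hs h1 hcU (liftPoint_mem hs hcU _)).trans ?_
  congr 1
  have h2 : (fun τ => pairing s (liftPoint s (c τ) (ψ τ))) =ᶠ[𝓝 t]
      fun τ => Complex.exp (ψ τ * Complex.I) := by
    filter_upwards [hn] with τ hτ
    rw [pairing_liftPoint hs hτ.2, Circle.coe_exp]
  have h3 : HasDerivAt (fun τ => Complex.exp (ψ τ * Complex.I))
      (Complex.exp (ψ t * Complex.I) * (ψ' * Complex.I)) t :=
    ((hψ'.ofReal_comp).mul_const _).cexp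
  rw [h2.deriv_eq, h3.deriv, pairing_liftPoint hs hcU, Circle.coe_exp, ← mul_assoc, mul_comm
    (starRingEnd ℂ _), Complex.mul_conj, Complex.normSq_eq_norm_sq, Complex.norm_exp_ofReal_mul_I]
  simp

/-- The length of the lift of a curve to the circle bundle. -/
lemma hatDist_liftPoint_le (h : IsPrequantum nabla Ω) (hU : IsOpen U) (hs : IsUnitSection s U)
    (g : Metric X) {c : ℝ → X} {ψ ψ' : ℝ → ℝ} {a b : ℝ}
    (hc : PiecewiseC1On (𝓡 4) c a b) (hψ : PiecewiseC1On 𝓘(ℝ, ℝ) ψ a b)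
    (hψ' : ∀ᵐ t, t ∈ Icc a b → HasDerivAt ψ (ψ' t) t) (hA : MapsTo c (Icc a b) U) :
    hatDist g nabla (liftPoint s (c a) (ψ a)) (liftPoint s (c b) (ψ b)) ≤
      ∫⁻ t in Icc a b, ENNReal.ofReal √((ψ' t + potential nabla s (c t) (velocity (𝓡 4) c t)) ^ 2
        + g.norm (c t) (velocity (𝓡 4) c t) ^ 2) := by
  refine (lengthDist_le (homogeneous_hatNorm g nabla) (hc.liftPoint hs hψ hA)
    fun t ht => liftPoint_mem hs (hA ht) _).trans (le_of_eq ?_)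
  refine lintegral_congr_ae ?_
  rw [Filter.EventuallyEq, ae_restrict_iff' measurableSet_Icc]
  filter_upwards [hc.ae_contMDiffAt, hψ.ae_contMDiffAt, hψ'] with t h1 h2 h3 hI
  have h4 := connectionForm_liftPoint h hU hs (h1 hI).2 (h2 hI).2 (h3 hI) (hA hI)
  have h5 := dproj_velocity h4.1
  rw [hatNorm, h4.2, h5, Metric.norm_sq]
  rfl

/-- The angular velocity of a curve in the circle bundle. -/
lemma exists_pairing_lift (h : IsPrequantum nabla Ω) (hU : IsOpen U) (hs : IsUnitSection s U)
    {c : ℝ → TotalSpace ℂ L} {a b : ℝ} (hc : PiecewiseC1On ((𝓡 4).prod 𝓘(ℝ, ℂ)) c a b)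
    (hA : ∀ t ∈ Icc a b, c t ∈ circleBundle L ∧ (c t).proj ∈ U) :
    PiecewiseC1On (𝓡 4) (fun t => (c t).proj) a b ∧ ∃ φ : ℝ → ℝ, PiecewiseC1On 𝓘(ℝ, ℝ) φ a b ∧
      (∀ t ∈ Icc a b, pairing s (c t) = Circle.exp (φ t)) ∧
      ∀ᵐ t, t ∈ Icc a b → ∃ φ', HasDerivAt φ φ' t ∧
        MDifferentiableAt 𝓘(ℝ, ℝ) ((𝓡 4).prod 𝓘(ℝ, ℂ)) c t ∧
        connectionForm nabla (c t) (velocity ((𝓡 4).prod 𝓘(ℝ, ℂ)) c t) = φ' +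
          potential nabla s (c t).proj (velocity (𝓡 4) (fun τ => (c τ).proj) t) := by
  have hcp : PiecewiseC1On (𝓡 4) (fun t => (c t).proj) a b :=
    hc.comp (A := univ) (fun u _ => (contMDiffAt_proj L).contMDiffWithinAt) (mapsTo_univ _ _)
  have hz : PiecewiseC1On 𝓘(ℝ, ℂ) (fun t => pairing s (c t)) a b :=
    hc.comp (A := {u | u.proj ∈ U}) (fun u hu =>
      ((contMDiffAt_pairing h (hs.smooth _ hu)).of_le (by simp)).contMDiffWithinAt)
      fun t ht => (hA t ht).2
  refine ⟨hcp, ?_⟩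
  -- For unit z the number Im(z̄ z') is the angular velocity; its primitive is a continuous choice
  -- of the argument.
  set Q : TangentBundle 𝓘(ℝ, ℂ) ℂ → ℝ := fun v =>
    (starRingEnd ℂ (show ℂ from v.1) * (show ℂ from v.2)).im with hQ
  have hQc : Continuous Q := by
    have h1 : Continuous fun q : ℂ × ℂ => (starRingEnd ℂ q.1 * q.2).im := by fun_prop
    exact h1.comp (tangentBundleModelSpaceHomeomorph 𝓘(ℝ, ℂ)).continuous
  obtain ⟨φ₀, hφ0, hφ, hder⟩ : ∃ φ₀ : ℝ → ℝ, φ₀ a = 0 ∧ PiecewiseC1On 𝓘(ℝ, ℝ) φ₀ a b ∧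
      ∀ᵐ t, t ∈ Icc a b → HasDerivAt φ₀
        (starRingEnd ℂ (pairing s (c t)) * deriv (fun τ => pairing s (c τ)) t).im t := by
    obtain ⟨hφ, hφ'⟩ := hz.primitive (A := univ) hQc.continuousOn (mapsTo_univ _ _)
    refine ⟨_, intervalIntegral.integral_same, hφ, ?_⟩
    filter_upwards [hφ'] with t ht hI
    refine (ht hI).congr_deriv ?_
    exact congrArg (fun w : ℂ => (starRingEnd ℂ (pairing s (c t)) * w).im)
      (velocity_eq_deriv (fun t => pairing s (c t)) t)
  obtain ⟨t₀, ht₀⟩ : ∃ t₀ : ℝ, (Circle.exp t₀ : ℂ) = pairing s (c a) := by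
    have h1 := coe_toCircle (norm_pairing (hs.norm _ (hA a ⟨le_rfl, hc.le⟩).2) (hA a ⟨le_rfl, hc.le⟩).1)
    exact ⟨_, by rw [Circle.exp_arg, h1]⟩
  refine ⟨fun t => t₀ + φ₀ t, hφ.comp (A := univ) (G := fun x => t₀ + x)
    (ContDiff.contMDiff (by fun_prop)).contMDiffOn (mapsTo_univ _ _), fun t ht => ?_, ?_⟩
  · have hd : ∀ᵐ τ, τ ∈ Icc a b → HasDerivAt (fun t => pairing s (c t))
        (Complex.I * ((deriv φ₀ τ : ℝ) : ℂ) * pairing s (c τ)) τ := by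
      filter_upwards [hder, hc.ae_contMDiffAt] with τ h1 h2 hI
      have h3 := hasDerivAt_pairing h (hs.smooth _ (hA τ hI).2)
        ((h2 hI).2.mdifferentiableAt one_ne_zero)
      have h4 := deriv_eq_of_norm_eq_one h3 (by
        filter_upwards [Icc_mem_nhds (h2 hI).1.1 (h2 hI).1.2] with x hx
        exact norm_pairing (hs.norm _ (hA x hx).2) (hA x hx).1)
      rw [(h1 hI).deriv, ← h4]
      exact h3
    have h1 := (hz.mono le_rfl ht.1 ht.2).eq_mul_exp (hφ.mono le_rfl ht.1 ht.2)
      (hd.mono fun τ h1 hI => h1 ⟨hI.1, hI.2.trans ht.2⟩)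
    rw [h1, hφ0, ← ht₀, sub_zero, Circle.coe_exp, Circle.coe_exp, ← Complex.exp_add]
    congr 1
    push_cast; ring
  · filter_upwards [hder, hc.ae_contMDiffAt] with τ h1 h2 hI
    have h3 := (h2 hI).2.mdifferentiableAt one_ne_zero
    exact ⟨_, (h1 hI).const_add _, h3, connectionForm_velocity h hU hs h3 (hA τ hI).2 (hA τ hI).1⟩

end Lift

/-! ### Phases -/

section Phase

variable {X : Type*} [TopologicalSpace X] [ChartedSpace Four X] [IsManifold (𝓡 4) ∞ X]
  {U : Set X} {η : OneForm X} {m : ℕ} {f : X → ℂ}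

/-- `f` is a unit function on `U` with `df = i m η f`. -/
structure IsPhase (m : ℕ) (η : OneForm X) (U : Set X) (f : X → ℂ) : Prop where
  norm : ∀ x ∈ U, ‖f x‖ = 1
  deriv : ∀ (c : ℝ → X) (t : ℝ), c t ∈ U → MDifferentiableAt 𝓘(ℝ, ℝ) (𝓡 4) c t →
    HasDerivAt (fun τ => f (c τ)) (Complex.I * ((m * η (c t) (velocity (𝓡 4) c t) : ℝ) : ℂ) * f (c t)) t

lemma eq_of_hasDerivAt_zero {E : Type*} [NormedAddCommGroup E] [NormedSpace ℝ E] {z : ℝ → E}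
    (h : ∀ t ∈ Icc (0 : ℝ) 1, HasDerivAt z 0 t) : z 1 = z 0 :=
  constant_of_has_deriv_right_zero (fun t ht => (h t ht).continuousAt.continuousWithinAt)
    (fun t ht => (h t (Ico_subset_Icc_self ht)).hasDerivWithinAt) 1 ⟨zero_le_one, le_rfl⟩

/-- The straight segment in the chart at `x₀`. -/
def chartSegment (x₀ x : X) (t : ℝ) : X :=
  (chartAt Four x₀).symm (chartAt Four x₀ x₀ + t • (chartAt Four x₀ x - chartAt Four x₀ x₀))

lemma chartSegment_zero (x₀ x : X) : chartSegment x₀ x 0 = x₀ := by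
  rw [chartSegment, zero_smul, add_zero, (chartAt Four x₀).left_inv (mem_chart_source Four x₀)]

lemma chartSegment_one {x₀ x : X} (hx : x ∈ (chartAt Four x₀).source) :
    chartSegment x₀ x 1 = x := by
  rw [chartSegment, one_smul, add_sub_cancel, (chartAt Four x₀).left_inv hx]

lemma chartSegment_mem {x₀ x : X} {r : ℝ}
    (hball : Metric.ball (chartAt Four x₀ x₀) r ⊆ (chartAt Four x₀).target ∩
      (chartAt Four x₀).symm ⁻¹' U)
    (hxr : chartAt Four x₀ x ∈ Metric.ball (chartAt Four x₀ x₀) r)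
    {t : ℝ} (ht : t ∈ Icc (0 : ℝ) 1) :
    chartSegment x₀ x t ∈ (chartAt Four x₀).source ∧
    chartAt Four x₀ (chartSegment x₀ x t) ∈ Metric.ball (chartAt Four x₀ x₀) r ∧
    chartSegment x₀ x t ∈ U ∧ ContMDiffAt 𝓘(ℝ, ℝ) (𝓡 4) 1 (chartSegment x₀ x) t := by
  have hmem : chartAt Four x₀ x₀ + t • (chartAt Four x₀ x - chartAt Four x₀ x₀)
      ∈ Metric.ball (chartAt Four x₀ x₀) r := by
    rw [mem_ball_iff_norm, add_sub_cancel_left, norm_smul, Real.norm_eq_abs, abs_of_nonneg ht.1]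
    rw [mem_ball_iff_norm] at hxr
    nlinarith [norm_nonneg (chartAt Four x₀ x - chartAt Four x₀ x₀), ht.2]
  refine ⟨(chartAt Four x₀).map_target (hball hmem).1, ?_, (hball hmem).2, ?_⟩
  · rwa [chartSegment, (chartAt Four x₀).right_inv (hball hmem).1]
  · refine ((contMDiffAt_chartAt_symm (hball hmem).1).of_le (by simp)).comp t ?_
    exact (ContDiff.contMDiff (by fun_prop)).contMDiffAt

/-- Along a straight segment of the chart, f · exp(-i m k) has zero derivative. -/
lemma IsPhase.eq_local (hf : IsPhase m η U f) {x₀ : X} {k : X → ℝ} {r : ℝ}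
    (hball : Metric.ball (chartAt Four x₀ x₀) r ⊆ (chartAt Four x₀).target ∩
      (chartAt Four x₀).symm ⁻¹' U)
    (hk : ∀ x ∈ (chartAt Four x₀).source, chartAt Four x₀ x ∈ Metric.ball (chartAt Four x₀ x₀) r →
        ContMDiffAt (𝓡 4) 𝓘(ℝ, ℝ) 1 k x ∧ ∀ v, mvfderiv (𝓡 4) k x v = η x v)
    {x : X} (hx : x ∈ (chartAt Four x₀).source)
    (hxr : chartAt Four x₀ x ∈ Metric.ball (chartAt Four x₀ x₀) r) :
    f x = f x₀ * Complex.exp (Complex.I * (m * (k x - k x₀) : ℝ)) := by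
  have key : ∀ t ∈ Icc (0 : ℝ) 1, HasDerivAt (fun τ => f (chartSegment x₀ x τ) *
      Complex.exp (-(Complex.I * ((m * k (chartSegment x₀ x τ) : ℝ) : ℂ)))) 0 t := by
    intro t ht
    obtain ⟨h1, h2, h3, h4⟩ := chartSegment_mem hball hxr ht
    have h5 := hf.deriv _ t h3 (h4.mdifferentiableAt one_ne_zero)
    have h6 := hasDerivAt_comp_velocity ((hk _ h1 h2).1.mdifferentiableAt one_ne_zero)
      (h4.mdifferentiableAt one_ne_zero)
    rw [(hk _ h1 h2).2] at h6
    have h7 := (((h6.const_mul (m : ℝ)).ofReal_comp.const_mul Complex.I).neg).cexp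
    refine (h5.mul h7).congr_deriv ?_
    ring
  have h1 := eq_of_hasDerivAt_zero key
  simp only [chartSegment_zero, chartSegment_one hx] at h1
  have h5 : ∀ t : ℝ, Complex.exp (-(Complex.I * (t : ℂ))) * Complex.exp (Complex.I * (t : ℂ)) = 1 :=
    fun t => by rw [← Complex.exp_add]; simp
  have h6 : Complex.exp (Complex.I * (m * (k x - k x₀) : ℝ))
      = Complex.exp (Complex.I * ((m * k x : ℝ) : ℂ)) *
        Complex.exp (-(Complex.I * ((m * k x₀ : ℝ) : ℂ))) := by
    rw [← Complex.exp_add]; congr 1; push_cast; ring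
  rw [h6]
  linear_combination Complex.exp (Complex.I * ((m * k x : ℝ) : ℂ)) * h1 - f x * h5 (m * k x)

lemma eventually_chart_ball (x₀ : X) {r : ℝ} (hr : 0 < r) : ∀ᶠ x in 𝓝 x₀,
    x ∈ (chartAt Four x₀).source ∧ chartAt Four x₀ x ∈ Metric.ball (chartAt Four x₀ x₀) r :=
  Filter.Eventually.and ((chartAt Four x₀).open_source.mem_nhds (mem_chart_source Four x₀))
    (((chartAt Four x₀).continuousAt (mem_chart_source Four x₀)).eventually
      (Metric.ball_mem_nhds _ hr))

lemma contDiff_phase (C : ℂ) (m : ℕ) :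
    ContDiff ℝ 1 fun t : ℝ => C * Complex.exp (Complex.I * ((m * t : ℝ) : ℂ)) := by
  have : ContDiff ℝ 1 fun t : ℝ => ((m * t : ℝ) : ℂ) :=
    Complex.ofRealCLM.contDiff.comp (contDiff_const.mul contDiff_id)
  exact contDiff_const.mul (Complex.contDiff_exp.comp (contDiff_const.mul this))

/-- A phase is by definition only differentiable along curves; its local expression exp(i m k) makes
it a C¹ function. -/
lemma IsPhase.contMDiffAt (hf : IsPhase m η U f) (hU : IsOpen U) (h : η.EvalSmoothOn U)
    (hcl : IsExteriorDerivOn η 0 U) {x : X} (hx : x ∈ U) : ContMDiffAt (𝓡 4) 𝓘(ℝ, ℂ) 1 f x := by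
  obtain ⟨k, r, hr, hball, hk⟩ := exists_local_primitive hU h hcl hx
  have h1 := (contDiff_phase (f x) m).contMDiff.contMDiffAt.comp x
    (((hk x (mem_chart_source Four x) (Metric.mem_ball_self hr)).1).sub
      (contMDiffAt_const (c := k x)))
  refine h1.congr_of_eventuallyEq ?_
  filter_upwards [eventually_chart_ball x hr] with y hy
  exact hf.eq_local hball hk hy.1 hy.2

lemma OneForm.EvalSmoothOn.primitive (h : η.EvalSmoothOn U) {c : ℝ → X} {a b : ℝ}
    (hc : PiecewiseC1On (𝓡 4) c a b) (hA : MapsTo c (Icc a b) U) :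
    PiecewiseC1On 𝓘(ℝ, ℝ) (fun s => ∫ t in a..s, η (c t) (velocity (𝓡 4) c t)) a b ∧
    ∀ᵐ t, t ∈ Icc a b → HasDerivAt (fun s => ∫ t in a..s, η (c t) (velocity (𝓡 4) c t))
      (η (c t) (velocity (𝓡 4) c t)) t :=
  hc.primitive (Q := fun v => η v.1 v.2) h.continuousOn hA

lemma OneForm.EvalSmoothOn.intervalIntegrable (h : η.EvalSmoothOn U) {c : ℝ → X} {a b : ℝ}
    (hc : PiecewiseC1On (𝓡 4) c a b) (hA : MapsTo c (Icc a b) U) :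
    IntervalIntegrable (fun t => η (c t) (velocity (𝓡 4) c t)) volume a b :=
  hc.intervalIntegrable (Q := fun v => η v.1 v.2) h.continuousOn hA

lemma PiecewiseC1On.const_mul {φ : ℝ → ℝ} {a b : ℝ} (h : PiecewiseC1On 𝓘(ℝ, ℝ) φ a b) (p : ℝ) :
    PiecewiseC1On 𝓘(ℝ, ℝ) (fun t => p * φ t) a b :=
  h.comp (A := univ) (G := fun x => p * x) (ContDiff.contMDiff (by fun_prop)).contMDiffOn
    (mapsTo_univ _ _)

lemma PiecewiseC1On.add {φ ψ : ℝ → ℝ} {a b : ℝ} (h : PiecewiseC1On 𝓘(ℝ, ℝ) φ a b)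
    (h' : PiecewiseC1On 𝓘(ℝ, ℝ) ψ a b) : PiecewiseC1On 𝓘(ℝ, ℝ) (fun t => φ t + ψ t) a b :=
  (h.prodMk h').comp (A := univ) (G := fun x : ℝ × ℝ => x.1 + x.2)
    (ContDiff.contMDiff (by fun_prop)).contMDiffOn (mapsTo_univ _ _)

lemma PiecewiseC1On.neg {φ : ℝ → ℝ} {a b : ℝ} (h : PiecewiseC1On 𝓘(ℝ, ℝ) φ a b) :
    PiecewiseC1On 𝓘(ℝ, ℝ) (fun t => -φ t) a b :=
  h.comp (A := univ) (G := fun x => -x) (ContDiff.contMDiff (by fun_prop)).contMDiffOn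
    (mapsTo_univ _ _)

lemma PiecewiseC1On.affine (p q a b : ℝ) (hab : a ≤ b) :
    PiecewiseC1On 𝓘(ℝ, ℝ) (fun t => p * t + q) a b :=
  .of_contMDiffOn hab (ContDiff.contMDiff (by fun_prop)).contMDiffOn

/-- The variation of a phase along a curve. -/
lemma IsPhase.apply_curve (hf : IsPhase m η U f) (hU : IsOpen U) (h : η.EvalSmoothOn U)
    (hcl : IsExteriorDerivOn η 0 U) {c : ℝ → X} {a b : ℝ}
    (hc : PiecewiseC1On (𝓡 4) c a b) (hA : MapsTo c (Icc a b) U) :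
    f (c b) = f (c a) * Complex.exp (Complex.I *
      (m * ∫ t in a..b, η (c t) (velocity (𝓡 4) c t) : ℝ)) := by
  have hz : PiecewiseC1On 𝓘(ℝ, ℂ) (fun t => f (c t)) a b :=
    hc.comp (fun x hx => (hf.contMDiffAt hU h hcl hx).contMDiffWithinAt) hA
  obtain ⟨h1, h2⟩ := h.primitive hc hA
  have h3 := hz.eq_mul_exp (h1.const_mul m) (by
    filter_upwards [h2, hc.ae_contMDiffAt] with t ht hct hI
    have h4 := hf.deriv c t (hA hI) ((hct hI).2.mdifferentiableAt one_ne_zero)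
    rwa [((ht hI).const_mul (m : ℝ)).deriv])
  simpa using h3

end Phase

/-! ### The correspondence between angular coordinates and phases. -/

section Angle

variable {X : Type*} [TopologicalSpace X] [ChartedSpace Four X] [IsManifold (𝓡 4) ∞ X]
  {L : X → Type*} [TopologicalSpace (TotalSpace ℂ L)] [∀ x, NormedAddCommGroup (L x)]
  [∀ x, InnerProductSpace ℂ (L x)] [FiberBundle ℂ L] [VectorBundle ℝ ℂ L] [VectorBundle ℂ ℂ L]
  [ContMDiffVectorBundle ∞ ℂ L (𝓡 4)]
  {nabla : CovariantDerivative (𝓡 4) ℂ L} {Ω : TwoTensor X} {s : (x : X) → L x} {U : Set X}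
  {γ : OneForm X} {m : ℕ} {θ : TotalSpace ℂ L → Circle}

variable (nabla) in
/-- The sum of the connection form with respect to a section and of `γ`. -/
def totalForm (s : (x : X) → L x) (γ : OneForm X) : OneForm X := fun x => potential nabla s x + γ x

lemma totalForm_apply (x : X) (v : TangentSpace (𝓡 4) x) :
    totalForm nabla s γ x v = potential nabla s x v + γ x v := rfl

variable [T2Space X]

lemma evalSmoothOn_potential (h : IsPrequantum nabla Ω) (hU : IsOpen U) (hs : IsUnitSection s U) :
    (potential nabla s).EvalSmoothOn U :=
  fun _ hx _ hV => contMDiffAt_potential h hU hs.smooth hx hV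

lemma evalSmoothOn_totalForm (h : IsPrequantum nabla Ω) (hU : IsOpen U) (hs : IsUnitSection s U)
    (hγ : γ.SmoothOn U) : (totalForm nabla s γ).EvalSmoothOn U :=
  fun x hx V hV => (evalSmoothOn_potential h hU hs x hx V hV).add (hγ.evalSmoothOn hU x hx V hV)

/-- The differentials -Ω of α and Ω of γ cancel. -/
lemma closed_totalForm (h : IsPrequantum nabla Ω) (hU : IsOpen U) (hs : IsUnitSection s U)
    (hγ : γ.SmoothOn U) (hd : IsExteriorDerivOn γ Ω U) :
    IsExteriorDerivOn (totalForm nabla s γ) 0 U := by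
  intro x hx V W hV hW
  have h1 := potential_exteriorDeriv h hU hs hx hV hW
  have h2 := hd x hx V W hV hW
  have key : ∀ V W : (x : X) → TangentSpace (𝓡 4) x, SmoothFieldAt W x →
      lieD V (fun y => totalForm nabla s γ y (W y)) x
        = lieD V (fun y => potential nabla s y (W y)) x + lieD V (fun y => γ y (W y)) x := by
    intro V W hW
    have h3 := mfderiv_add ((evalSmoothOn_potential h hU hs x hx W hW).mdifferentiableAt (by simp))
      ((hγ.evalSmoothOn hU x hx W hW).mdifferentiableAt (by simp))
    exact congrArg (fun A : TangentSpace (𝓡 4) x →L[ℝ] ℝ => A (V x)) h3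
  rw [key V W hW, key W V hV, totalForm_apply]
  change _ = (0 : ℝ)
  linarith

/-- Along s ∘ c the angle relative to `s` is constant, so Γ reduces to α and Γ + γ to η. -/
lemma IsAngle.isPhase (hθ : IsAngle nabla m γ U θ) (h : IsPrequantum nabla Ω) (hU : IsOpen U)
    (hs : IsUnitSection s U) : IsPhase m (totalForm nabla s γ) U fun x => (θ ⟨x, s x⟩ : ℂ) where
  norm x _ := Circle.norm_coe _
  deriv c t hcU hc := by
    set ĉ : ℝ → TotalSpace ℂ L := fun τ => ⟨c τ, s (c τ)⟩ with hĉ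
    have h1 : MDifferentiableAt 𝓘(ℝ, ℝ) ((𝓡 4).prod 𝓘(ℝ, ℂ)) ĉ t :=
      MDifferentiableAt.comp (g := fun x => (⟨x, s x⟩ : TotalSpace ℂ L)) t
        ((hs.smooth _ hcU).mdifferentiableAt (by simp)) hc
    have hmem : ∀ x ∈ U, (⟨x, s x⟩ : TotalSpace ℂ L) ∈ circleBundle L := fun x hx => hs.norm x hx
    have hev : ∀ᶠ τ in 𝓝 t, c τ ∈ U := hc.continuousAt.eventually (hU.mem_nhds hcU)
    have h2 := hθ.deriv ĉ t (hev.mono fun τ hτ => ⟨hmem _ hτ, hτ⟩) h1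
    have h3 := connectionForm_velocity h hU hs h1 hcU (hmem _ hcU)
    have h4 : (fun τ => pairing s (ĉ τ)) =ᶠ[𝓝 t] fun _ => 1 := by
      filter_upwards [hev] with τ hτ
      change inner ℂ (s (c τ)) (s (c τ)) = (1 : ℂ)
      rw [inner_self_eq_norm_sq_to_K, hs.norm _ hτ]; simp
    rw [h4.deriv_eq, deriv_const, mul_zero, Complex.zero_im, zero_add] at h3
    rw [h3, dproj_velocity h1] at h2
    refine h2.congr_deriv ?_
    rw [totalForm_apply]
    push_cast
    ring

lemma IsAngle.apply_eq (hθ : IsAngle nabla m γ U θ) (hs : IsUnitSection s U) {u : TotalSpace ℂ L}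
    (hu : u ∈ circleBundle L) (hx : u.proj ∈ U) :
    (θ u : ℂ) = pairing s u ^ m * θ ⟨u.proj, s u.proj⟩ := by
  have h1 := eq_rot_of_mem hs hu hx
  have h2 := hθ.equivariant ⟨u.proj, s u.proj⟩ (hs.norm _ hx) hx (toCircle (pairing s u))
  rw [← h1] at h2
  rw [h2, Circle.coe_mul, Circle.coe_pow, coe_toCircle (norm_pairing (hs.norm _ hx) hu)]

lemma IsAngle.apply_liftPoint (hθ : IsAngle nabla m γ U θ) (hs : IsUnitSection s U) {x : X}
    (hx : x ∈ U) (t : ℝ) : θ (liftPoint s x t) = Circle.exp (m * t) * θ ⟨x, s x⟩ := by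
  have h2 := hθ.equivariant ⟨x, s x⟩ (hs.norm _ hx) hx (Circle.exp t)
  rw [liftPoint, h2, ← Circle.exp_natCast_mul]

/-- The angular coordinate of a phase. -/
lemma IsPhase.isAngle {f : X → ℂ} (hf : IsPhase m (totalForm nabla s γ) U f)
    (h : IsPrequantum nabla Ω) (hU : IsOpen U) (hs : IsUnitSection s U) :
    IsAngle nabla m γ U fun u => toCircle (pairing s u ^ m * f u.proj) where
  equivariant u hu hx a := by
    have h1 : ∀ u : TotalSpace ℂ L, u ∈ circleBundle L → u.proj ∈ U →
        ‖pairing s u ^ m * f u.proj‖ = 1 := fun u hu hx => by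
      rw [norm_mul, norm_pow, norm_pairing (hs.norm _ hx) hu, hf.norm _ hx]; simp
    have h2 : rot a u ∈ circleBundle L := by
      change ‖(a : ℂ) • u.2‖ = 1
      rw [norm_smul, Circle.norm_coe, one_mul]; exact hu
    ext
    rw [coe_toCircle (h1 _ h2 hx), Circle.coe_mul, coe_toCircle (h1 _ hu hx), pairing_rot, mul_pow,
      Circle.coe_pow, mul_assoc]
    rfl
  deriv c t hev hc := by
    obtain ⟨hcS, hcU⟩ := hev.self_of_nhds
    have h1 := hasDerivAt_pairing h (hs.smooth _ hcU) hc
    have h2 := deriv_eq_of_norm_eq_one h1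
      (hev.mono fun τ hτ => norm_pairing (hs.norm _ hτ.2) hτ.1)
    have h3 := connectionForm_velocity h hU hs hc hcU hcS
    have h4 := hf.deriv (fun τ => (c τ).proj) t hcU ((mdifferentiableAt_proj (c t)).comp t hc)
    have h5 : ∀ u : TotalSpace ℂ L, u ∈ circleBundle L → u.proj ∈ U →
        (toCircle (pairing s u ^ m * f u.proj) : ℂ) = pairing s u ^ m * f u.proj := fun u hu hx =>
      coe_toCircle (by
        rw [norm_mul, norm_pow, norm_pairing (hs.norm _ hx) hu, hf.norm _ hx]; simp)
    rw [h3, dproj_velocity hc, h5 _ hcS hcU]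
    have h6 := (h1.pow m).mul h4
    refine (h6.congr_of_eventuallyEq (hev.mono fun τ hτ => h5 _ hτ.1 hτ.2)).congr_deriv ?_
    rw [totalForm_apply]
    set q := (starRingEnd ℂ (pairing s (c t)) * _root_.deriv (fun τ => pairing s (c τ)) t).im
    rw [h2]
    rcases m with _ | m
    · simp
    · simp only [Pi.pow_apply, Nat.add_sub_cancel, pow_succ]
      push_cast
      ring

end Angle

/-! ### Primitives along simplices -/

section PrimitiveAtlas

/-- A family of local functions whose differences are locally constant. -/
structure PrimitiveAtlas (Y : Type*) [TopologicalSpace Y] where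
  /-- The domains. -/
  dom : Y → Set Y
  /-- The functions. -/
  fn : Y → Y → ℝ
  isOpen_dom : ∀ i, IsOpen (dom i)
  mem_dom : ∀ i, i ∈ dom i
  compat : ∀ i j, ∀ y ∈ dom i ∩ dom j, ∀ᶠ z in 𝓝 y, fn j z - fn i z = fn j y - fn i y

/-- The real numbers with the discrete topology. -/
def DiscreteReal := ℝ

instance : TopologicalSpace DiscreteReal := ⊥

instance : DiscreteTopology DiscreteReal := ⟨rfl⟩

variable {Y : Type*} [TopologicalSpace Y] (T : PrimitiveAtlas Y)

/-- The covering space of the local primitives. -/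
def PrimitiveAtlas.core : FiberBundleCore Y Y DiscreteReal where
  baseSet := T.dom
  isOpen_baseSet := T.isOpen_dom
  indexAt := id
  mem_baseSet_at := T.mem_dom
  coordChange i j y a := (show ℝ from a) + (T.fn j y - T.fn i y)
  coordChange_self i y _ a := by
    change (show ℝ from a) + (T.fn i y - T.fn i y) = a
    rw [sub_self, add_zero]
  continuousOn_coordChange i j := by
    rintro ⟨y, a⟩ ⟨hy, -⟩
    refine ContinuousAt.continuousWithinAt ?_
    have h0 : ContinuousAt (fun _ : Y × DiscreteReal =>
      (show DiscreteReal from (show ℝ from a) + (T.fn j y - T.fn i y))) (y, a) := continuousAt_const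
    refine h0.congr ?_
    have h1 : ∀ᶠ p : Y × DiscreteReal in 𝓝 (y, a), p.2 = a :=
      (continuousAt_snd (p := (y, (show DiscreteReal from a)))).preimage_mem_nhds
        (mem_nhds_discrete.2 (mem_singleton (show DiscreteReal from a)))
    have h2 : ∀ᶠ p : Y × DiscreteReal in 𝓝 (y, a),
        T.fn j p.1 - T.fn i p.1 = T.fn j y - T.fn i y :=
      (continuousAt_fst (p := (y, (show DiscreteReal from a)))).eventually (T.compat i j y hy)
    filter_upwards [h1, h2] with p hp1 hp2
    rw [hp1, hp2]
  coordChange_comp i j k y _ a := by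
    change (show ℝ from a) + (T.fn j y - T.fn i y) + (T.fn k y - T.fn j y)
      = (show ℝ from a) + (T.fn k y - T.fn i y)
    ring

/-- `h` is a primitive along `G`. -/
def PrimitiveAtlas.IsPrimitive {A : Type*} [TopologicalSpace A] (G : A → Y) (h : A → ℝ) : Prop :=
  ∀ a i, G a ∈ T.dom i → ∀ᶠ a' in 𝓝 a, h a' - T.fn i (G a') = h a - T.fn i (G a)

/-- Locally constant transition functions and a discrete fiber make the bundle of germs of
primitives a covering space, and maps from simply connected, locally path connected spaces lift to
it. -/
lemma PrimitiveAtlas.exists_isPrimitive {A : Type*} [TopologicalSpace A] [SimplyConnectedSpace A]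
    [LocallyPathConnectedSpace A] (G : C(A, Y)) : ∃ h : A → ℝ, T.IsPrimitive G h := by
  obtain ⟨a₀⟩ : Nonempty A := inferInstance
  have hcov : IsCoveringMap (π DiscreteReal T.core.Fiber) := FiberBundle.isCoveringMap
  obtain ⟨Γ, ⟨-, hΓ⟩, -⟩ := hcov.existsUnique_continuousMap_lifts G a₀
    (⟨G a₀, (0 : ℝ)⟩ : T.core.TotalSpace) rfl
  have hproj : ∀ a, (Γ a).1 = G a := fun a => congrFun hΓ a
  -- Passing to another chart adds the same difference to the local function and to the fiber
  -- coordinate, so their difference does not depend on the chart.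
  refine ⟨fun a => T.fn (Γ a).1 (Γ a).1 - (show ℝ from (Γ a).2), fun a i hi => ?_⟩
  have key : ∀ a, G a ∈ T.dom i → T.fn (Γ a).1 (Γ a).1 - (show ℝ from (Γ a).2) - T.fn i (G a)
      = - (show ℝ from (T.core.localTriv i (Γ a)).2) := by
    intro a ha
    rw [← hproj]
    change _ = - ((show ℝ from (Γ a).2) + (T.fn i (Γ a).1 - T.fn (Γ a).1 (Γ a).1))
    ring
  have h1 : ContinuousAt (fun a => (T.core.localTriv i (Γ a)).2) a := by
    refine continuousAt_snd.comp (ContinuousAt.comp (g := T.core.localTriv i) ?_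
      Γ.continuous.continuousAt)
    refine ContinuousOn.continuousAt (T.core.localTriv i).continuousOn
      ((T.core.localTriv i).open_source.mem_nhds ?_)
    rw [(T.core.localTriv i).mem_source]
    change (Γ a).1 ∈ T.dom i
    rwa [hproj]
  have h2 : ∀ᶠ a' in 𝓝 a, (T.core.localTriv i (Γ a')).2 = (T.core.localTriv i (Γ a)).2 :=
    h1.preimage_mem_nhds (mem_nhds_discrete.2 (mem_singleton _))
  filter_upwards [h2, G.continuous.continuousAt.eventually ((T.isOpen_dom i).mem_nhds hi)]
    with a' h3 h4
  rw [key a' h4, key a hi, h3]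

lemma eq_of_locally_constant {A : Type*} [TopologicalSpace A] [PreconnectedSpace A] {h : A → ℝ}
    (hh : ∀ a, ∀ᶠ a' in 𝓝 a, h a' = h a) (a a' : A) : h a = h a' :=
  IsLocallyConstant.apply_eq_of_preconnectedSpace
    ((IsLocallyConstant.iff_eventually_eq h).2 hh) a a'

variable {T}

lemma PrimitiveAtlas.IsPrimitive.sub_eq {A : Type*} [TopologicalSpace A] [PreconnectedSpace A]
    {G : A → Y} {h h' : A → ℝ} (H : T.IsPrimitive G h) (H' : T.IsPrimitive G h') (a a' : A) :
    h a - h a' = h' a - h' a' := by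
  have := eq_of_locally_constant (h := fun a => h a - h' a) (fun a => by
    filter_upwards [H a (G a) (T.mem_dom _), H' a (G a) (T.mem_dom _)] with b hb hb'
    linarith) a a'
  linarith

lemma PrimitiveAtlas.IsPrimitive.comp {A B : Type*} [TopologicalSpace A] [TopologicalSpace B]
    {G : A → Y} {h : A → ℝ} (H : T.IsPrimitive G h) {k : B → A} (hk : Continuous k) :
    T.IsPrimitive (G ∘ k) (h ∘ k) := fun b i hi =>
  hk.continuousAt.eventually (H (k b) i hi)

instance (n : ℕ) : SimplyConnectedSpace (stdSimplex ℝ (Fin (n + 1))) :=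
  haveI := (convex_stdSimplex ℝ (Fin (n + 1))).contractibleSpace
    ⟨_, single_mem_stdSimplex ℝ (0 : Fin (n + 1))⟩
  inferInstance

instance (n : ℕ) : LocallyPathConnectedSpace (stdSimplex ℝ (Fin (n + 1))) :=
  (convex_stdSimplex ℝ (Fin (n + 1))).locallyPathConnectedSpace

variable (T)

/-- A primitive along a singular simplex. -/
def PrimitiveAtlas.prim {n : ℕ} (s : Simplex n Y) : stdSimplex ℝ (Fin (n + 1)) → ℝ :=
  (T.exists_isPrimitive s).choose

lemma PrimitiveAtlas.isPrimitive_prim {n : ℕ} (s : Simplex n Y) : T.IsPrimitive s (T.prim s) :=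
  (T.exists_isPrimitive s).choose_spec

/-- The period cochain: the variation of primitives along singular `1`-simplices. -/
def PrimitiveAtlas.period (s : Simplex 1 Y) : ℝ :=
  T.prim s (stdSimplex.vertex 1) - T.prim s (stdSimplex.vertex 0)

variable {T}

lemma PrimitiveAtlas.IsPrimitive.period_eq {s : Simplex 1 Y} {h : stdSimplex ℝ (Fin 2) → ℝ}
    (H : T.IsPrimitive s h) : T.period s = h (stdSimplex.vertex 1) - h (stdSimplex.vertex 0) :=
  (T.isPrimitive_prim s).sub_eq H _ _

variable (T)

/-- A primitive along a 2-simplex restricts to primitives along its faces, and the alternating sum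
of the variations over the faces telescopes. -/
lemma PrimitiveAtlas.coboundary_period : coboundary Y ℝ 1 T.period = 0 := by
  ext s
  have h1 : ∀ i, T.period (face i s)
      = T.prim s (stdSimplex.vertex (i.succAbove 1)) - T.prim s (stdSimplex.vertex (i.succAbove 0)) := by
    intro i
    have := ((T.isPrimitive_prim s).comp (stdSimplex.continuous_map (S := ℝ) i.succAbove))
    have h2 := PrimitiveAtlas.IsPrimitive.period_eq (s := face i s) this
    rw [h2]
    simp only [Function.comp_apply, stdSimplex.map_vertex]
  change ∑ i : Fin 3, ((-1 : ℤ) ^ (i : ℕ)) • T.period (face i s) = 0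
  simp only [h1, Fin.sum_univ_three]
  have h2 : (Fin.succAbove 2 1 : Fin 3) = 1 := rfl
  simp [h2]

end PrimitiveAtlas

/-! ### Integral representatives of cohomology classes -/

section Periods

variable {Y Z : Type*} [TopologicalSpace Y] [TopologicalSpace Z]

/-- The value of a cochain on a chain. -/
def evalChain {n : ℕ} (A : Simplex n Y → ℝ) : (Simplex n Y →₀ ℤ) →+ ℝ :=
  Finsupp.liftAddHom fun s => zmultiplesHom ℝ (A s)

lemma evalChain_single {n : ℕ} (A : Simplex n Y → ℝ) (s : Simplex n Y) (k : ℤ) :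
    evalChain A (Finsupp.single s k) = k * A s := by
  simp [evalChain]

lemma evalChain_eq_sum {n : ℕ} (A : Simplex n Y → ℝ) (c : Simplex n Y →₀ ℤ) :
    evalChain A c = c.sum fun s k => (k : ℝ) * A s := by
  simp only [evalChain, Finsupp.liftAddHom_apply]
  refine Finsupp.sum_congr fun s _ => ?_
  simp

lemma evalChain_boundary {n : ℕ} (A : Simplex n Y → ℝ) (c : Simplex (n + 1) Y →₀ ℤ) :
    evalChain A (boundary Y n c) = evalChain (coboundary Y ℝ n A) c := by
  have : (evalChain A).comp (boundary Y n) = evalChain (coboundary Y ℝ n A) := by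
    ext s : 2
    simp [boundary, evalChain, coboundary]
  exact DFunLike.congr_fun this c

lemma evalChain_pushChain {n : ℕ} (f : C(Y, Z)) (A : Simplex n Z → ℝ) (c : Simplex n Y →₀ ℤ) :
    evalChain A (pushChain f n c) = evalChain (fun s => A (f.comp s)) c := by
  have : (evalChain A).comp (pushChain f n) = evalChain (fun s => A (f.comp s)) := by
    ext s : 2
    simp [pushChain, evalChain, Finsupp.mapDomain_single]
  exact DFunLike.congr_fun this c

lemma evalChain_eq_of_cls_eq {A : Simplex 1 Y → ℝ} (hA : coboundary Y ℝ 1 A = 0) {e e' : Cycle₁ Y}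
    (h : Cycle₁.cls e = Cycle₁.cls e') : evalChain A e.1 = evalChain A e'.1 := by
  rw [QuotientAddGroup.eq] at h
  obtain ⟨c, hc⟩ := h
  have h1 := evalChain_boundary A c
  rw [hA, hc] at h1
  have h2 : evalChain (0 : Simplex 2 Y → ℝ) c = 0 := by simp [evalChain_eq_sum]
  rw [h2] at h1
  simp at h1
  linarith

/-- If the values of a cocycle on generators of `H₁` belong to a group, then so do all values on
cycles. -/
lemma evalChain_mem {A : Simplex 1 Y → ℝ} (hA : coboundary Y ℝ 1 A = 0) {ι : Type*}
    {e : ι → Cycle₁ Y} (he : AddSubgroup.closure (range fun i => Cycle₁.cls (e i)) = ⊤)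
    {G : AddSubgroup ℝ} (hG : ∀ i, evalChain A (e i).1 ∈ G) (z : Cycle₁ Y) :
    evalChain A z.1 ∈ G := by
  have hz : Cycle₁.cls z ∈ AddSubgroup.closure (range fun i => Cycle₁.cls (e i)) := by
    rw [he]; trivial
  suffices h : ∀ q ∈ AddSubgroup.closure (range fun i => Cycle₁.cls (e i)),
      ∀ z : Cycle₁ Y, Cycle₁.cls z = q → evalChain A z.1 ∈ G from h _ hz z rfl
  intro q hq
  induction hq using AddSubgroup.closure_induction with
  | mem q hq =>
    obtain ⟨i, rfl⟩ := hq
    intro z hz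
    rw [evalChain_eq_of_cls_eq hA hz]
    exact hG i
  | zero =>
    intro z hz
    rw [evalChain_eq_of_cls_eq hA (e' := 0) hz]
    simp
  | add q q' _ _ h h' =>
    intro z hz
    obtain ⟨y, rfl⟩ := QuotientAddGroup.mk_surjective q
    obtain ⟨y', rfl⟩ := QuotientAddGroup.mk_surjective q'
    rw [evalChain_eq_of_cls_eq hA (e' := y + y') hz]
    simpa using G.add_mem (h y rfl) (h' y' rfl)
  | neg q _ h =>
    intro z hz
    obtain ⟨y, rfl⟩ := QuotientAddGroup.mk_surjective q
    rw [evalChain_eq_of_cls_eq hA (e' := -y) hz]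
    simpa using G.neg_mem (h y rfl)

/-- A point as a singular `0`-simplex. -/
def pointSimplex (y : Y) : Simplex 0 Y := ContinuousMap.const _ y

lemma simplex_zero_eq (s : Simplex 0 Y) : s = pointSimplex (s (stdSimplex.vertex 0)) := by
  ext p
  rw [Subsingleton.elim p (stdSimplex.vertex 0)]
  rfl

lemma face_zero_eq (s : Simplex 1 Y) : face 0 s = pointSimplex (s (stdSimplex.vertex 1)) := by
  rw [simplex_zero_eq (face 0 s)]
  congr 1
  change s (stdSimplex.map _ _) = _
  rw [stdSimplex.map_vertex]; rfl

lemma face_one_eq (s : Simplex 1 Y) : face 1 s = pointSimplex (s (stdSimplex.vertex 0)) := by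
  rw [simplex_zero_eq (face 1 s)]
  congr 1
  change s (stdSimplex.map _ _) = _
  rw [stdSimplex.map_vertex]; rfl

lemma coboundary_zero_apply (A : Type*) [AddCommGroup A] (k : Simplex 0 Y → A) (s : Simplex 1 Y) :
    coboundary Y A 0 k s = k (pointSimplex (s (stdSimplex.vertex 1)))
      - k (pointSimplex (s (stdSimplex.vertex 0))) := by
  change ∑ i : Fin 2, ((-1 : ℤ) ^ (i : ℕ)) • k (face i s) = _
  rw [Fin.sum_univ_two, face_zero_eq, face_one_eq]
  simp [sub_eq_add_neg]

lemma boundary_single (s : Simplex 1 Y) (n : ℤ) : boundary Y 0 (Finsupp.single s n) =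
    Finsupp.single (pointSimplex (s (stdSimplex.vertex 1))) n
      - Finsupp.single (pointSimplex (s (stdSimplex.vertex 0))) n := by
  have : boundary Y 0 (Finsupp.single s n)
      = ∑ i : Fin 2, ((-1 : ℤ) ^ (i : ℕ)) • Finsupp.single (face i s) n := by
    rw [boundary, Finsupp.liftAddHom_apply_single, AddMonoidHom.finsetSum_apply]
    rfl
  rw [this, Fin.sum_univ_two, face_zero_eq, face_one_eq]
  simp [sub_eq_add_neg]

lemma coboundary_coboundary (k : Simplex 0 Y → ℝ) : coboundary Y ℝ 1 (coboundary Y ℝ 0 k) = 0 := by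
  ext s
  change ∑ i : Fin 3, ((-1 : ℤ) ^ (i : ℕ)) • coboundary Y ℝ 0 k (face i s) = 0
  have h1 : ∀ (i : Fin 3) (j : Fin 2), face i s (stdSimplex.vertex j)
      = s (stdSimplex.vertex (i.succAbove j)) := by
    intro i j
    change s (stdSimplex.map _ _) = _
    rw [stdSimplex.map_vertex]
  have h2 : (Fin.succAbove 2 1 : Fin 3) = 1 := rfl
  have h3 : (Fin.succAbove 2 0 : Fin 3) = 0 := rfl
  simp only [coboundary_zero_apply, h1, Fin.sum_univ_three]
  simp [h2, h3]

lemma evalChain_coboundary_of_cycle (k : Simplex 0 Y → ℝ) (e : Cycle₁ Y) :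
    evalChain (coboundary Y ℝ 0 k) e.1 = 0 := by
  rw [← evalChain_boundary, AddMonoidHom.mem_ker.1 e.2, map_zero]

/-- A cocycle with integral periods is cohomologous to an integral cocycle. -/
lemma exists_integral_cocycle {A : Simplex 1 Y → ℝ} (hA : coboundary Y ℝ 1 A = 0)
    (hint : ∀ z : Cycle₁ Y, ∃ n : ℤ, evalChain A z.1 = n) {y₀ : Y}
    (hpath : ∀ y, ∃ s : Simplex 1 Y, s (stdSimplex.vertex 0) = y₀ ∧ s (stdSimplex.vertex 1) = y) :
    ∃ (κ : Simplex 1 Y → ℤ) (k : Simplex 0 Y → ℝ), coboundary Y ℤ 1 κ = 0 ∧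
      A = (fun s => (κ s : ℝ)) + coboundary Y ℝ 0 k := by
  choose p hp0 hp1 using hpath
  -- The potential is the value of A on a chosen path from the base point.
  set k : Simplex 0 Y → ℝ := fun y => A (p (y (stdSimplex.vertex 0))) with hk
  have hint' : ∀ s : Simplex 1 Y, ∃ n : ℤ, A s - coboundary Y ℝ 0 k s = n := by
    intro s
    -- The simplex is closed up by the chosen paths to its two end points; A minus the coboundary of
    -- k is the value of A on this cycle.
    obtain ⟨n, hn⟩ := hint ⟨Finsupp.single s 1 - Finsupp.single (p (s (stdSimplex.vertex 1))) 1
      + Finsupp.single (p (s (stdSimplex.vertex 0))) 1, by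
        rw [AddMonoidHom.mem_ker, map_add, map_sub, boundary_single, boundary_single,
          boundary_single, hp0, hp1, hp0, hp1]
        abel⟩
    refine ⟨n, ?_⟩
    rw [← hn, map_add, map_sub, evalChain_single, evalChain_single, evalChain_single,
      coboundary_zero_apply]
    simp only [hk, pointSimplex, ContinuousMap.const_apply]
    push_cast
    ring
  choose κ hκ using hint'
  have hAk : A = (fun s => (κ s : ℝ)) + coboundary Y ℝ 0 k := by
    ext s
    rw [Pi.add_apply, ← hκ s]; ring
  refine ⟨κ, k, ?_, hAk⟩
  have h1 : coboundary Y ℝ 1 (fun s => (κ s : ℝ)) = 0 := by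
    rw [hAk, map_add, coboundary_coboundary, add_zero] at hA
    exact hA
  ext s
  have h2 := congrFun h1 s
  change ∑ i : Fin 3, ((-1 : ℤ) ^ (i : ℕ)) • (κ (face i s) : ℝ) = 0 at h2
  change ∑ i : Fin 3, ((-1 : ℤ) ^ (i : ℕ)) • κ (face i s) = 0
  simp only [zsmul_eq_mul, smul_eq_mul] at h2 ⊢
  exact_mod_cast h2

/-- Extension of an integral decomposition from a subspace. -/
lemma exists_integral_decomposition (f : C(Z, Y))
    (hZ : Function.Surjective (Cohomology₁.pull ℤ f))
    (hR : Function.Injective (Cohomology₁.pull ℝ f)) {A : Simplex 1 Y → ℝ}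
    (hA : coboundary Y ℝ 1 A = 0) {κ : Simplex 1 Z → ℤ} {k : Simplex 0 Z → ℝ}
    (hκ : coboundary Z ℤ 1 κ = 0)
    (h : (fun s => A (f.comp s)) = (fun s => (κ s : ℝ)) + coboundary Z ℝ 0 k) :
    ∃ (κ' : Simplex 1 Y → ℤ) (k' : Simplex 0 Y → ℝ),
      A = (fun s => (κ' s : ℝ)) + coboundary Y ℝ 0 k' := by
  -- Surjectivity over ℤ extends the integral part of the decomposition, up to an integral
  -- coboundary on the subspace.
  obtain ⟨q, hq⟩ := hZ (QuotientAddGroup.mk ⟨κ, AddMonoidHom.mem_ker.2 hκ⟩)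
  obtain ⟨⟨κ', hκ'⟩, rfl⟩ := QuotientAddGroup.mk_surjective q
  have hq' : (QuotientAddGroup.mk (pullCocycle ℤ f ⟨κ', hκ'⟩) : Cohomology₁ Z ℤ)
      = QuotientAddGroup.mk ⟨κ, AddMonoidHom.mem_ker.2 hκ⟩ := hq
  rw [QuotientAddGroup.eq] at hq'
  obtain ⟨n, hn⟩ := hq'
  have hn' : ∀ s, coboundary Z ℤ 0 n s = - κ' (f.comp s) + κ s := fun s => congrFun hn s
  have hc : coboundary Y ℝ 1 (fun s => (κ' s : ℝ)) = 0 := by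
    ext s
    have h2 := congrFun (AddMonoidHom.mem_ker.1 hκ') s
    change ∑ i : Fin 3, ((-1 : ℤ) ^ (i : ℕ)) • κ' (face i s) = 0 at h2
    change ∑ i : Fin 3, ((-1 : ℤ) ^ (i : ℕ)) • (κ' (face i s) : ℝ) = 0
    simp only [zsmul_eq_mul, smul_eq_mul] at h2 ⊢
    exact_mod_cast h2
  have hD : coboundary Y ℝ 1 (A - fun s => (κ' s : ℝ)) = 0 := by rw [map_sub, hA, hc, sub_zero]
  -- A minus the extended integral cocycle is a real cocycle whose restriction is a coboundary, so
  -- injectivity over ℝ makes it one on the whole space.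
  have hinj : (QuotientAddGroup.mk (⟨_, AddMonoidHom.mem_ker.2 hD⟩ : (coboundary Y ℝ 1).ker) :
      Cohomology₁ Y ℝ) = 0 := by
    refine (injective_iff_map_eq_zero _).1 hR _ ?_
    change (QuotientAddGroup.mk (pullCocycle ℝ f ⟨_, AddMonoidHom.mem_ker.2 hD⟩) : Cohomology₁ Z ℝ)
      = 0
    rw [QuotientAddGroup.eq_zero_iff]
    refine ⟨k + fun y => (n y : ℝ), ?_⟩
    ext s
    change coboundary Z ℝ 0 (k + fun y => (n y : ℝ)) s = A (f.comp s) - (κ' (f.comp s) : ℝ)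
    have h1 := congrFun h s
    have h2 := hn' s
    rw [Pi.add_apply] at h1
    rw [coboundary_zero_apply] at h1 h2 ⊢
    simp only [Pi.add_apply]
    have h3 : ((n (pointSimplex (s (stdSimplex.vertex 1))) : ℝ)
      - (n (pointSimplex (s (stdSimplex.vertex 0))) : ℝ)) = - κ' (f.comp s) + κ s := by
      exact_mod_cast h2
    linarith
  rw [QuotientAddGroup.eq_zero_iff] at hinj
  obtain ⟨k', hk'⟩ := hinj
  refine ⟨κ', k', ?_⟩
  have h4 : coboundary Y ℝ 0 k' = A - fun s => (κ' s : ℝ) := hk'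
  rw [h4]
  abel

end Periods

/-! ### Integrals of `1`-forms along curves -/

section PathIntegrals

variable {X : Type*} [TopologicalSpace X] [ChartedSpace Four X] [IsManifold (𝓡 4) ∞ X]
  {U F : Set X} {η : OneForm X} {x y z : X}

lemma ae_comp_mul_add {P : ℝ → Prop} {p q : ℝ} (hp : p ≠ 0) (h : ∀ᵐ t, P t) :
    ∀ᵐ t, P (p * t + q) := by
  have hq : Measure.QuasiMeasurePreserving (fun t : ℝ => p * t + q) volume volume :=
    ((measurePreserving_add_right volume q).quasiMeasurePreserving).comp
      ⟨by fun_prop, by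
        rw [Real.map_volume_mul_left hp]
        exact Measure.smul_absolutelyContinuous⟩
  exact hq.ae h

lemma integral_comp_mul_add {c : ℝ → X} {a b p q : ℝ}
    (h : ∀ᵐ t, t ∈ uIcc a b → MDifferentiableAt 𝓘(ℝ, ℝ) (𝓡 4) c (p * t + q)) :
    ∫ t in a..b, η (c (p * t + q)) (velocity (𝓡 4) (fun s => c (p * s + q)) t)
      = ∫ t in (p * a + q)..(p * b + q), η (c t) (velocity (𝓡 4) c t) := by
  rw [← intervalIntegral.smul_integral_comp_mul_add
    (fun t => η (c t) (velocity (𝓡 4) c t)) p q, ← intervalIntegral.integral_smul]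
  refine intervalIntegral.integral_congr_ae ?_
  filter_upwards [h] with t ht hI
  have h1 := ht (uIoc_subset_uIcc hI)
  rw [velocity_comp_mul_add p q t h1, map_smul]

lemma integral_velocity_congr {c c' : ℝ → X} {a b : ℝ} (hab : a ≤ b) (h : EqOn c c' (Ioo a b)) :
    ∫ t in a..b, η (c t) (velocity (𝓡 4) c t) = ∫ t in a..b, η (c' t) (velocity (𝓡 4) c' t) := by
  rw [intervalIntegral.integral_of_le hab, intervalIntegral.integral_of_le hab,
    restrict_Ioc_eq_restrict_Icc, ← restrict_Ioo_eq_restrict_Icc]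
  refine setIntegral_congr_fun measurableSet_Ioo fun t ht => ?_
  exact apply_velocity_congr (fun x v => η x v)
    (h.eventuallyEq_of_mem (Ioo_mem_nhds ht.1 ht.2))

/-- The integrals of `η` along the piecewise `C¹` curves in `F` from `x` to `y`. -/
def pathIntegrals (η : OneForm X) (F : Set X) (x y : X) : Set ℝ :=
  {r | ∃ c : ℝ → X, PiecewiseC1On (𝓡 4) c 0 1 ∧ c 0 = x ∧ c 1 = y ∧ MapsTo c (Icc 0 1) F ∧
    ∫ t in (0 : ℝ)..1, η (c t) (velocity (𝓡 4) c t) = r}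

lemma mem_pathIntegrals_of_on {c : ℝ → X} {a b : ℝ} (hab : a < b)
    (hc : PiecewiseC1On (𝓡 4) c a b) (hF : MapsTo c (Icc a b) F) :
    ∫ t in a..b, η (c t) (velocity (𝓡 4) c t) ∈ pathIntegrals η F (c a) (c b) := by
  have hp : 0 < b - a := sub_pos.2 hab
  have hm : MapsTo (fun t : ℝ => (b - a) * t + a) (Icc 0 1) (Icc a b) := fun t ht =>
    ⟨by nlinarith [ht.1], by nlinarith [ht.2]⟩
  refine ⟨fun t => c ((b - a) * t + a), PiecewiseC1On.comp_mul_add (b - a) a hp (by simpa using hc),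
    by simp, by simp, fun t ht => hF (hm ht), ?_⟩
  rw [integral_comp_mul_add]
  · simp
  · filter_upwards [ae_comp_mul_add (p := b - a) (q := a) hp.ne' hc.ae_contMDiffAt] with t ht hI
    rw [uIcc_of_le zero_le_one] at hI
    exact (ht (hm hI)).2.mdifferentiableAt one_ne_zero

lemma zero_mem_pathIntegrals (hx : x ∈ F) : 0 ∈ pathIntegrals η F x x := by
  refine ⟨fun _ => x, .of_contMDiffOn zero_le_one contMDiffOn_const, rfl, rfl, fun _ _ => hx, ?_⟩
  have : ∀ t : ℝ, velocity (𝓡 4) (fun _ : ℝ => x) t = 0 := fun t => by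
    unfold velocity; rw [mfderiv_const]; rfl
  simp [this]

lemma neg_mem_pathIntegrals {r : ℝ} (h : r ∈ pathIntegrals η F x y) :
    -r ∈ pathIntegrals η F y x := by
  obtain ⟨c, hc, rfl, rfl, hF, rfl⟩ := h
  have hm : MapsTo (fun t : ℝ => -1 * t + 1) (Icc 0 1) (Icc 0 1) := fun t ht =>
    ⟨by linarith [ht.2], by linarith [ht.1]⟩
  refine ⟨fun t => c (-1 * t + 1), ?_, by simp, by simp, fun t ht => hF (hm ht), ?_⟩
  · have := PiecewiseC1On.comp_sub (c := c) (a := 0) (b := 1) 1 (by simpa using hc)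
    refine this.congr fun t _ => ?_
    congr 1; ring
  · rw [integral_comp_mul_add]
    · rw [intervalIntegral.integral_symm]; norm_num
    · filter_upwards [ae_comp_mul_add (p := -1) (q := 1) (by norm_num) hc.ae_contMDiffAt]
        with t ht hI
      rw [uIcc_of_le zero_le_one] at hI
      exact (ht (hm hI)).2.mdifferentiableAt one_ne_zero

lemma add_mem_pathIntegrals (h : η.EvalSmoothOn U) (hFU : F ⊆ U) {r r' : ℝ}
    (hr : r ∈ pathIntegrals η F x y) (hr' : r' ∈ pathIntegrals η F y z) :
    r + r' ∈ pathIntegrals η F x z := by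
  obtain ⟨c, hc, rfl, rfl, hF, rfl⟩ := hr
  obtain ⟨c', hc', h0, rfl, hF', rfl⟩ := hr'
  have hj := hc.join hc' h0.symm
  have hm := mapsTo_joinCurves h0.symm hF hF'
  have h1 := mem_pathIntegrals_of_on (η := η) two_pos hj hm
  have e0 : joinCurves c c' 0 = c 0 := by simp [joinCurves]
  have e2 : joinCurves c c' 2 = c' 1 := by norm_num [joinCurves]
  rw [e0, e2] at h1
  convert h1 using 1
  have hi := h.intervalIntegrable hj (hm.mono_right hFU)
  rw [← intervalIntegral.integral_add_adjacent_intervals (b := 1)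
    (hi.mono_set (by rw [uIcc_of_le zero_le_one, uIcc_of_le zero_le_two]; gcongr; norm_num))
    (hi.mono_set (by rw [uIcc_of_le one_le_two, uIcc_of_le zero_le_two]; gcongr; norm_num)),
    integral_velocity_congr zero_le_one ((joinCurves_eqOn_left c c').mono Ioo_subset_Icc_self),
    integral_velocity_congr one_le_two ((joinCurves_eqOn_right h0.symm).mono Ioo_subset_Icc_self),
    integral_comp_mul_add]
  · norm_num
  · filter_upwards [ae_comp_mul_add (p := 1) (q := -1) one_ne_zero hc'.ae_contMDiffAt] with t ht hI
    rw [uIcc_of_le one_le_two] at hI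
    exact (ht ⟨by linarith [hI.1], by linarith [hI.2]⟩).2.mdifferentiableAt one_ne_zero

end PathIntegrals

/-! ### Periods of closed `1`-forms -/

section FormAtlas

variable {X : Type*} [TopologicalSpace X] [ChartedSpace Four X] [IsManifold (𝓡 4) ∞ X]
  {U F : Set X} {η : OneForm X}

/-- `T` consists of the restrictions of local primitives `k i` of `η`. -/
structure IsFormAtlas (η : OneForm X) (T : PrimitiveAtlas U) (k : U → X → ℝ) : Prop where
  fn_eq : ∀ i y, T.fn i y = k i y
  smooth : ∀ i, ∀ y ∈ T.dom i, ContMDiffAt (𝓡 4) 𝓘(ℝ, ℝ) 1 (k i) y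
  deriv : ∀ i, ∀ y ∈ T.dom i, ∀ v, mvfderiv (𝓡 4) (k i) y v = η y v

/-- Two primitives of the same form differ by a constant along the segments of a chart. -/
lemma eventually_sub_eq {D : Set X} (hD : IsOpen D) {k k' : X → ℝ}
    (hk : ∀ x ∈ D, ContMDiffAt (𝓡 4) 𝓘(ℝ, ℝ) 1 k x ∧ ∀ v, mvfderiv (𝓡 4) k x v = η x v)
    (hk' : ∀ x ∈ D, ContMDiffAt (𝓡 4) 𝓘(ℝ, ℝ) 1 k' x ∧ ∀ v, mvfderiv (𝓡 4) k' x v = η x v)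
    {x₀ : X} (hx₀ : x₀ ∈ D) : ∀ᶠ x in 𝓝 x₀, k' x - k x = k' x₀ - k x₀ := by
  set e := chartAt Four x₀ with he
  have hx₀e : x₀ ∈ e.source := mem_chart_source Four x₀
  obtain ⟨r, hr, hball⟩ := Metric.isOpen_iff.1 (e.isOpen_inter_preimage_symm hD) (e x₀)
    ⟨e.map_source hx₀e, by simpa [e.left_inv hx₀e] using hx₀⟩
  filter_upwards [eventually_chart_ball x₀ hr] with x hx
  have h1 := eq_of_hasDerivAt_zero (z := fun t => k' (chartSegment x₀ x t)
    - k (chartSegment x₀ x t)) (fun t ht => by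
      obtain ⟨-, -, h3, h4⟩ := chartSegment_mem hball hx.2 ht
      have h5 := hasDerivAt_comp_velocity ((hk _ h3).1.mdifferentiableAt one_ne_zero)
        (h4.mdifferentiableAt one_ne_zero)
      have h6 := hasDerivAt_comp_velocity ((hk' _ h3).1.mdifferentiableAt one_ne_zero)
        (h4.mdifferentiableAt one_ne_zero)
      refine (h6.sub h5).congr_deriv ?_
      rw [(hk _ h3).2, (hk' _ h3).2, sub_self])
  simpa only [chartSegment_zero, chartSegment_one hx.1] using h1

lemma exists_formAtlas (hU : IsOpen U) (h : η.EvalSmoothOn U) (hcl : IsExteriorDerivOn η 0 U) :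
    ∃ (T : PrimitiveAtlas U) (k : U → X → ℝ), IsFormAtlas η T k := by
  choose k r hr hball hk using fun i : U => exists_local_primitive hU h hcl i.2
  have hD : ∀ i : U, IsOpen ((chartAt Four (i : X)).source ∩
      chartAt Four (i : X) ⁻¹' Metric.ball (chartAt Four (i : X) (i : X)) (r i)) := fun i =>
    (chartAt Four (i : X)).isOpen_inter_preimage Metric.isOpen_ball
  refine ⟨⟨fun i => Subtype.val ⁻¹' ((chartAt Four (i : X)).source ∩
      chartAt Four (i : X) ⁻¹' Metric.ball (chartAt Four (i : X) (i : X)) (r i)),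
    fun i y => k i y, fun i => (hD i).preimage continuous_subtype_val,
    fun i => ⟨mem_chart_source Four _, Metric.mem_ball_self (hr i)⟩, fun i j y hy => ?_⟩, k,
    fun _ _ => rfl, fun i y hy => (hk i y hy.1 hy.2).1, fun i y hy => (hk i y hy.1 hy.2).2⟩
  have := eventually_sub_eq (x₀ := (y : X)) ((hD i).inter (hD j)) (fun x hx => hk i x hx.1.1 hx.1.2)
    (fun x hx => hk j x hx.2.1 hx.2.2) hy
  exact continuous_subtype_val.continuousAt.eventually this

variable {T : PrimitiveAtlas U} {k : U → X → ℝ}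

/-- The topological primitive along a C¹ simplex is the integral of the form: on short subintervals
the integral and the local primitive along the curve have the same derivative almost everywhere. The
coordinate p 1 is the parameter of the simplex in [0, 1]. -/
lemma IsFormAtlas.isPrimitive (hT : IsFormAtlas η T k) (h : η.EvalSmoothOn U) {s : Simplex 1 U}
    {c : ℝ → X} (hc : PiecewiseC1On (𝓡 4) c 0 1) (hs : ∀ p, (s p : X) = c (p 1)) :
    T.IsPrimitive s fun p => ∫ t in (0 : ℝ)..p 1, η (c t) (velocity (𝓡 4) c t) := by
  have hp1 : ∀ p : stdSimplex ℝ (Fin 2), p 1 ∈ Icc (0 : ℝ) 1 := fun p =>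
    mem_Icc_of_mem_stdSimplex p.2 1
  have hcs : ∀ t ∈ Icc (0 : ℝ) 1, ∃ p : stdSimplex ℝ (Fin 2), p 1 = t := fun t ht =>
    ⟨stdSimplexHomeomorphUnitInterval.symm ⟨t, ht⟩,
      congrArg Subtype.val (stdSimplexHomeomorphUnitInterval.apply_symm_apply ⟨t, ht⟩)⟩
  have hcU : MapsTo c (Icc 0 1) U := fun t ht => by
    obtain ⟨p, rfl⟩ := hcs t ht
    rw [← hs]; exact (s p).2
  obtain ⟨hΦ, hΦ'⟩ := h.primitive hc hcU
  set Φ : ℝ → ℝ := fun s => ∫ t in (0 : ℝ)..s, η (c t) (velocity (𝓡 4) c t) with hΦdef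
  intro p i hi
  -- a neighbourhood of `p` whose points are mapped to the domain
  obtain ⟨V, hV, hVd⟩ : ∃ V : Set X, IsOpen V ∧ Subtype.val ⁻¹' V = T.dom i := by
    obtain ⟨V, hV, h⟩ := isOpen_induced_iff.1 (T.isOpen_dom i)
    exact ⟨V, hV, h⟩
  have hpV : c (p 1) ∈ V := by
    rw [← hs]
    have : s p ∈ Subtype.val ⁻¹' V := by rw [hVd]; exact hi
    exact this
  obtain ⟨ε, hε, hball⟩ := Metric.mem_nhdsWithin_iff.1
    ((hc.continuousOn (p 1) (hp1 p)).preimage_mem_nhdsWithin (hV.mem_nhds hpV))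
  have hcont : Continuous fun q : stdSimplex ℝ (Fin 2) => q 1 :=
    (continuous_apply 1).comp continuous_subtype_val
  have key : ∀ x y, x ∈ Icc (0 : ℝ) 1 → y ∈ Icc (0 : ℝ) 1 → x ≤ y → Icc x y ⊆ Metric.ball (p 1) ε →
      Φ y - k i (c y) = Φ x - k i (c x) := by
    intro x y hx hy hxy hsub
    have hmem : ∀ t ∈ Icc x y, ∃ hU : c t ∈ U, (⟨c t, hU⟩ : U) ∈ T.dom i := fun t ht => by
      have h1 : t ∈ Icc (0 : ℝ) 1 := ⟨hx.1.trans ht.1, ht.2.trans hy.2⟩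
      refine ⟨hcU h1, ?_⟩
      rw [← hVd]
      exact hball ⟨hsub ht, h1⟩
    have h1 : PiecewiseC1On 𝓘(ℝ, ℝ) (fun t => k i (c t)) x y := by
      refine (hc.mono hx.1 hxy hy.2).comp (A := {z | ∃ hU : z ∈ U, (⟨z, hU⟩ : U) ∈ T.dom i})
        (fun z hz => ?_) hmem
      obtain ⟨hz1, hz2⟩ := hz
      exact (hT.smooth i ⟨z, hz1⟩ hz2).contMDiffWithinAt
    refine ((hΦ.mono hx.1 hxy hy.2).add h1.neg).eq_of_deriv_eq_zero ?_
    filter_upwards [hΦ', hc.ae_contMDiffAt] with t h2 h3 hI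
    have hI' : t ∈ Icc (0 : ℝ) 1 := ⟨hx.1.trans hI.1, hI.2.trans hy.2⟩
    obtain ⟨hz1, hz2⟩ := hmem t hI
    have h4 := hasDerivAt_comp_velocity ((hT.smooth i ⟨c t, hz1⟩ hz2).mdifferentiableAt one_ne_zero)
      ((h3 hI').2.mdifferentiableAt one_ne_zero)
    have h5 := hT.deriv i ⟨c t, hz1⟩ hz2 (velocity (𝓡 4) c t)
    simp only at h5
    rw [h5] at h4
    refine (((h2 hI').add h4.neg).congr_deriv ?_).deriv
    exact add_neg_cancel _
  filter_upwards [hcont.continuousAt.eventually (Metric.ball_mem_nhds (p 1) hε)] with q hq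
  rw [hT.fn_eq, hT.fn_eq, hs, hs]
  have hconv : ∀ x y, x ∈ Metric.ball (p 1) ε → y ∈ Metric.ball (p 1) ε →
      Icc x y ⊆ Metric.ball (p 1) ε := fun x y hx hy => by
    have := (convex_ball (p 1) ε).ordConnected
    exact this.out hx hy
  rcases le_total (p 1) (q 1) with hpq | hpq
  · exact key _ _ (hp1 p) (hp1 q) hpq (hconv _ _ (Metric.mem_ball_self hε) hq)
  · exact (key _ _ (hp1 q) (hp1 p) hpq (hconv _ _ hq (Metric.mem_ball_self hε))).symm

lemma IsFormAtlas.period_eq_integral (hT : IsFormAtlas η T k) (h : η.EvalSmoothOn U)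
    {s : Simplex 1 U} {c : ℝ → X} (hc : PiecewiseC1On (𝓡 4) c 0 1) (hs : ∀ p, (s p : X) = c (p 1)) :
    T.period s = ∫ t in (0 : ℝ)..1, η (c t) (velocity (𝓡 4) c t) := by
  rw [(hT.isPrimitive h hc hs).period_eq]
  simp

/-- A curve as a singular simplex. -/
def pathSimplex (c : ℝ → X) (hc : ContinuousOn c (Icc 0 1)) (hF : MapsTo c (Icc 0 1) F) :
    Simplex 1 F where
  toFun p := ⟨c (p 1), hF (mem_Icc_of_mem_stdSimplex p.2 1)⟩
  continuous_toFun := by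
    refine Continuous.subtype_mk (hc.comp_continuous
      ((continuous_apply 1).comp continuous_subtype_val) fun p => ?_) _
    exact mem_Icc_of_mem_stdSimplex p.2 1

lemma pathSimplex_zero {c : ℝ → X} (hc : ContinuousOn c (Icc 0 1)) (hF : MapsTo c (Icc 0 1) F) :
    (pathSimplex c hc hF (stdSimplex.vertex 0) : X) = c 0 := by
  simp [pathSimplex]

lemma pathSimplex_one {c : ℝ → X} (hc : ContinuousOn c (Icc 0 1)) (hF : MapsTo c (Icc 0 1) F) :
    (pathSimplex c hc hF (stdSimplex.vertex 1) : X) = c 1 := by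
  simp [pathSimplex]

lemma Simplex.curve_apply {Y : Type*} [TopologicalSpace Y] (s : Simplex 1 Y)
    (p : stdSimplex ℝ (Fin 2)) : s.curve (p 1) = s p := by
  have h1 : (p 1 : ℝ) ∈ Icc (0 : ℝ) 1 := mem_Icc_of_mem_stdSimplex p.2 1
  rw [Simplex.curve, projIcc_of_mem _ h1]
  congr 1
  rw [Homeomorph.symm_apply_eq]
  rfl

end FormAtlas

/-! ### Existence of phases with integral periods. -/

section ExistsPhase

variable {X : Type*} [TopologicalSpace X] [ChartedSpace Four X] [IsManifold (𝓡 4) ∞ X]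
  {U F : Set X} {η : OneForm X}

/-- If the integrals of `η` over all loops in `F` are multiples of `2π/l`, then so are its
integrals over all cycles. -/
lemma exists_int_sum_integral (h : η.EvalSmoothOn U) (hFU : F ⊆ U) {y₀ : X}
    (hpath : ∀ y ∈ F, (pathIntegrals η F y₀ y).Nonempty) (l : ℝ)
    (hloop : ∀ r ∈ pathIntegrals η F y₀ y₀, ∃ n : ℤ, l * r = 2 * Real.pi * n) (e : Cycle₁ F)
    (he : ∀ s ∈ e.1.support, PiecewiseC1 (𝓡 4) fun t => (s.curve t : X)) :
    ∃ n : ℤ, l * η.integralCycle e = 2 * Real.pi * n := by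
  choose P hP using hpath
  set P' : Simplex 0 F → ℝ := fun y => P (y (stdSimplex.vertex 0)) (y _).2 with hP'
  -- Each simplex of the cycle is closed up by chosen paths from the base point. The corrections
  -- form a coboundary and disappear when summed over the cycle.
  have key : ∀ s : Simplex 1 F, ∃ n : ℤ, s ∈ e.1.support →
      l * η.integral (fun t => (s.curve t : X)) = l * coboundary F ℝ 0 P' s + 2 * Real.pi * n := by
    intro s
    by_cases hs : s ∈ e.1.support
    swap
    · exact ⟨0, fun h => absurd h hs⟩
    have h0 : ((s.curve 0 : F) : X) = s (stdSimplex.vertex 0) := by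
      rw [← Simplex.curve_apply]; simp
    have h1 : ((s.curve 1 : F) : X) = s (stdSimplex.vertex 1) := by
      rw [← Simplex.curve_apply]; simp
    have h2 : η.integral (fun t => (s.curve t : X)) ∈
        pathIntegrals η F (s (stdSimplex.vertex 0)) (s (stdSimplex.vertex 1)) :=
      ⟨_, he s hs, h0, h1, fun t _ => (s.curve t).2, rfl⟩
    obtain ⟨n, hn⟩ := hloop _ (add_mem_pathIntegrals h hFU (add_mem_pathIntegrals h hFU
      (hP _ (s (stdSimplex.vertex 0)).2) h2)
      (neg_mem_pathIntegrals (hP _ (s (stdSimplex.vertex 1)).2)))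
    refine ⟨n, fun _ => ?_⟩
    rw [coboundary_zero_apply, ← hn]
    simp only [hP', pointSimplex, ContinuousMap.const_apply]
    ring
  choose n hn using key
  refine ⟨e.1.sum fun s k => k * n s, ?_⟩
  have h1 := evalChain_coboundary_of_cycle P' e
  rw [evalChain_eq_sum] at h1
  rw [OneForm.integralCycle, Finsupp.mul_sum]
  calc (e.1.sum fun s k => l * ((k : ℝ) * η.integral fun t => (s.curve t : X)))
      = e.1.sum fun s k => l * ((k : ℝ) * coboundary F ℝ 0 P' s) + 2 * Real.pi * ((k : ℝ) * n s) := by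
        refine Finset.sum_congr rfl fun s hs => ?_
        have := hn s hs
        linear_combination (e.1 s : ℝ) * this
    _ = _ := by
        rw [Finsupp.sum_add, ← Finsupp.mul_sum, h1, ← Finsupp.mul_sum, mul_zero, zero_add]
        congr 1
        simp only [Finsupp.sum]
        push_cast
        rfl

variable {T : PrimitiveAtlas U} {k : U → X → ℝ}

lemma IsFormAtlas.evalChain_period (hT : IsFormAtlas η T k) (h : η.EvalSmoothOn U) (hFU : F ⊆ U)
    (e : Cycle₁ F) (he : ∀ s ∈ e.1.support, PiecewiseC1 (𝓡 4) fun t => (s.curve t : X)) :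
    evalChain (fun s => T.period (ContinuousMap.comp ⟨Set.inclusion hFU, continuous_inclusion hFU⟩ s))
      e.1 = η.integralCycle e := by
  rw [evalChain_eq_sum, OneForm.integralCycle]
  refine Finset.sum_congr rfl fun s hs => ?_
  refine congrArg (fun x => (e.1 s : ℝ) * x) (hT.period_eq_integral h (he s hs) fun p => ?_)
  rw [Simplex.curve_apply]; rfl

lemma integralCycle_add {η' : OneForm X} {U' : Set X} (h : η.EvalSmoothOn U)
    (h' : η'.EvalSmoothOn U') (hFU : F ⊆ U) (hFU' : F ⊆ U') (e : Cycle₁ F)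
    (he : ∀ s ∈ e.1.support, PiecewiseC1 (𝓡 4) fun t => (s.curve t : X)) :
    OneForm.integralCycle (fun x => η x + η' x) e = η.integralCycle e + η'.integralCycle e := by
  simp only [OneForm.integralCycle]
  rw [← Finsupp.sum_add]
  refine Finset.sum_congr rfl fun s hs => ?_
  simp only [OneForm.integral, ← mul_add]
  refine congrArg (fun x => (e.1 s : ℝ) * x) ?_
  rw [← intervalIntegral.integral_add
    (h.intervalIntegrable (he s hs) fun t _ => hFU (s.curve t).2)
    (h'.intervalIntegrable (he s hs) fun t _ => hFU' (s.curve t).2)]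
  rfl

/-- A closed form whose integrals over the cycles of `F` are multiples of `2π/m` is the differential
of a phase, if `H¹(U) → H¹(F)` is surjective for integral and injective for real coefficients. -/
lemma exists_phase (hU : IsOpen U) (h : η.EvalSmoothOn U) (hcl : IsExteriorDerivOn η 0 U)
    (hFU : F ⊆ U)
    (hZ : Function.Surjective
      (Cohomology₁.pull ℤ (⟨Set.inclusion hFU, continuous_inclusion hFU⟩ : C(F, U))))
    (hR : Function.Injective
      (Cohomology₁.pull ℝ (⟨Set.inclusion hFU, continuous_inclusion hFU⟩ : C(F, U)))) {y₀ : X}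
    (hy₀ : y₀ ∈ F) (hpath : ∀ y ∈ F, (pathIntegrals η F y₀ y).Nonempty) {ι : Type*}
    {e : ι → Cycle₁ F} (he : ∀ i, ∀ s ∈ (e i).1.support, PiecewiseC1 (𝓡 4) fun t => (s.curve t : X))
    (hgen : AddSubgroup.closure (range fun i => Cycle₁.cls (e i)) = ⊤) (m : ℕ)
    (hint : ∀ i, ∃ n : ℤ, m * η.integralCycle (e i) = 2 * Real.pi * n) :
    ∃ f, IsPhase m η U f := by
  set j : C(F, U) := ⟨Set.inclusion hFU, continuous_inclusion hFU⟩ with hj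
  obtain ⟨T, k, hT⟩ := exists_formAtlas hU h hcl
  have hpi : (2 * Real.pi) ≠ 0 := by positivity
  -- Periods in 2πℤ/m become integers after this normalization.
  set A : Simplex 1 U → ℝ := fun s => m / (2 * Real.pi) * T.period s with hA
  have hAc : coboundary U ℝ 1 A = 0 := by
    ext s
    have h1 := congrFun T.coboundary_period s
    change ∑ i : Fin 3, ((-1 : ℤ) ^ (i : ℕ)) • T.period (face i s) = 0 at h1
    change ∑ i : Fin 3, ((-1 : ℤ) ^ (i : ℕ)) • (m / (2 * Real.pi) * T.period (face i s)) = 0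
    have h2 := congrArg (fun x => m / (2 * Real.pi) * x) h1
    simp only [Finset.mul_sum, mul_zero] at h2
    rw [← h2]
    refine Finset.sum_congr rfl fun i _ => ?_
    simp only [zsmul_eq_mul]
    ring
  have hAF : coboundary F ℝ 1 (fun s => A (j.comp s)) = 0 := by
    have := coboundary_pullCochain ℝ j 1 A
    rw [hAc, map_zero] at this
    exact this
  have hAe : ∀ z : Cycle₁ F, evalChain (fun s => A (j.comp s)) z.1
      = m / (2 * Real.pi) * evalChain (fun s => T.period (j.comp s)) z.1 := by
    intro z
    rw [evalChain_eq_sum, evalChain_eq_sum, Finsupp.mul_sum]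
    refine Finset.sum_congr rfl fun s _ => ?_
    simp only [hA]
    ring
  have hintF : ∀ z : Cycle₁ F, ∃ n : ℤ, evalChain (fun s => A (j.comp s)) z.1 = n := by
    intro z
    have := evalChain_mem hAF hgen (G := (Int.castAddHom ℝ).range) (fun i => by
      obtain ⟨n, hn⟩ := hint i
      refine ⟨n, ?_⟩
      rw [hAe, hT.evalChain_period h hFU (e i) (he i), Int.coe_castAddHom]
      field_simp
      linarith) z
    obtain ⟨n, hn⟩ := this
    exact ⟨n, hn.symm⟩
  obtain ⟨κ, k₁, hκ, hdec⟩ := exists_integral_cocycle hAF hintF (y₀ := (⟨y₀, hy₀⟩ : F)) (by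
    rintro ⟨y, hy⟩
    obtain ⟨r, c, hc, hc0, hc1, hcF, -⟩ := hpath y hy
    exact ⟨pathSimplex c hc.continuousOn hcF,
      Subtype.ext ((pathSimplex_zero hc.continuousOn hcF).trans hc0),
      Subtype.ext ((pathSimplex_one hc.continuousOn hcF).trans hc1)⟩)
  obtain ⟨κ', k', hdec'⟩ := exists_integral_decomposition j hZ hR hAc hκ hdec
  -- the phase
  set f : X → ℂ := fun x => open Classical in if hx : x ∈ U then
    Complex.exp (Complex.I * (2 * Real.pi * k' (pointSimplex ⟨x, hx⟩) : ℝ)) else 1 with hf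
  have hfU : ∀ x (hx : x ∈ U), f x
      = Complex.exp (Complex.I * (2 * Real.pi * k' (pointSimplex ⟨x, hx⟩) : ℝ)) := fun x hx => by
    simp only [hf, dif_pos hx]
  have hcurve : ∀ c : ℝ → X, PiecewiseC1On (𝓡 4) c 0 1 → MapsTo c (Icc 0 1) U →
      f (c 1) = f (c 0) * Complex.exp (Complex.I *
        (m * ∫ t in (0 : ℝ)..1, η (c t) (velocity (𝓡 4) c t) : ℝ)) := by
    intro c hc hcU
    have h0 := hcU (left_mem_Icc.2 zero_le_one)
    have h1 := hcU (right_mem_Icc.2 zero_le_one)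
    set s := pathSimplex c hc.continuousOn hcU
    have e0 : s (stdSimplex.vertex 0) = ⟨c 0, h0⟩ := Subtype.ext (pathSimplex_zero hc.continuousOn hcU)
    have e1 : s (stdSimplex.vertex 1) = ⟨c 1, h1⟩ := Subtype.ext (pathSimplex_one hc.continuousOn hcU)
    have h2 := congrFun hdec' s
    rw [Pi.add_apply, coboundary_zero_apply, e0, e1] at h2
    have h3 := hT.period_eq_integral h hc (s := s) fun p => rfl
    have h4 : A s = m / (2 * Real.pi) * ∫ t in (0 : ℝ)..1, η (c t) (velocity (𝓡 4) c t) := by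
      simp only [hA, h3]
    rw [hfU _ h0, hfU _ h1, ← Complex.exp_add, Complex.exp_eq_exp_iff_exists_int]
    refine ⟨-κ' s, ?_⟩
    have h5 : m * ∫ t in (0 : ℝ)..1, η (c t) (velocity (𝓡 4) c t) = 2 * Real.pi * A s := by
      rw [h4]; field_simp
    rw [h5, h2]
    push_cast
    ring
  refine ⟨f, fun x hx => ?_, fun c t hct hc => ?_⟩
  · rw [hfU x hx, mul_comm, Complex.norm_exp_ofReal_mul_I]
  · obtain ⟨k, r, hr, hball, hk⟩ := exists_local_primitive hU h hcl hct
    -- The formula for the variation along chart segments identifies f with the exponential of a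
    -- local primitive, which turns it into a statement about derivatives.
    have hloc : ∀ᶠ x in 𝓝 (c t), f x = f (c t) * Complex.exp (Complex.I * (m * (k x - k (c t)) : ℝ)) := by
      filter_upwards [eventually_chart_ball (c t) hr] with x hx
      have hseg := fun t ht => chartSegment_mem (t := t) hball hx.2 ht
      have hC : PiecewiseC1On (𝓡 4) (chartSegment (c t) x) 0 1 :=
        .of_contMDiffOn zero_le_one fun τ hτ => (hseg τ hτ).2.2.2.contMDiffWithinAt
      have h1 := hcurve _ hC fun τ hτ => (hseg τ hτ).2.2.1
      rw [chartSegment_zero, chartSegment_one hx.1] at h1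
      have h2 : ∫ τ in (0 : ℝ)..1, η (chartSegment (c t) x τ)
          (velocity (𝓡 4) (chartSegment (c t) x) τ) = k x - k (c t) := by
        have h3 := intervalIntegral.integral_eq_sub_of_hasDerivAt (a := 0) (b := 1)
          (f := fun τ => k (chartSegment (c t) x τ)) (f' := fun τ => η (chartSegment (c t) x τ)
            (velocity (𝓡 4) (chartSegment (c t) x) τ)) (fun τ hτ => by
              rw [uIcc_of_le zero_le_one] at hτ
              obtain ⟨q1, q2, q3, q4⟩ := hseg τ hτ
              have h5 := hasDerivAt_comp_velocity ((hk _ q1 q2).1.mdifferentiableAt one_ne_zero)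
                (q4.mdifferentiableAt one_ne_zero)
              rwa [(hk _ q1 q2).2] at h5)
          (h.intervalIntegrable hC fun τ hτ => (hseg τ hτ).2.2.1)
        rw [h3, chartSegment_zero, chartSegment_one hx.1]
      rw [h1, h2]
    have hk0 := hk (c t) (mem_chart_source Four _) (Metric.mem_ball_self hr)
    have h5 := hasDerivAt_comp_velocity (hk0.1.mdifferentiableAt one_ne_zero) hc
    rw [hk0.2] at h5
    have h6 := (((h5.sub_const (k (c t))).const_mul (m : ℝ)).ofReal_comp.const_mul Complex.I).cexp
    have h7 := h6.const_mul (f (c t))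
    refine (h7.congr_of_eventuallyEq (hc.continuousAt.eventually hloc)).congr_deriv ?_
    simp
    ring

end ExistsPhase

/-! ### Holonomy and the existence of angular coordinates -/

section Holonomy

variable {X : Type*} [TopologicalSpace X] [T2Space X] [ChartedSpace Four X] [IsManifold (𝓡 4) ∞ X]
  {L : X → Type*} [TopologicalSpace (TotalSpace ℂ L)] [∀ x, NormedAddCommGroup (L x)]
  [∀ x, InnerProductSpace ℂ (L x)] [FiberBundle ℂ L] [VectorBundle ℝ ℂ L] [VectorBundle ℂ ℂ L]
  [ContMDiffVectorBundle ∞ ℂ L (𝓡 4)]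
  {nabla : CovariantDerivative (𝓡 4) ℂ L} {Ω : TwoTensor X} {s : (x : X) → L x} {U F : Set X}

/-- A lift with angle ψ is horizontal exactly when ψ' = -α, so the holonomy along a loop is exp(-∫
α). -/
lemma mem_holonomy_iff (h : IsPrequantum nabla Ω) (hU : IsOpen U) (hs : IsUnitSection s U)
    (hFU : F ⊆ U) (a : Circle) : a ∈ holonomy nabla F ↔
      ∃ x ∈ F, ∃ r ∈ pathIntegrals (potential nabla s) F x x, a = Circle.exp (-r) := by
  have hα := evalSmoothOn_potential h hU hs
  constructor
  · rintro ⟨c, hc, hcF, hΓ, hloop⟩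
    obtain ⟨hcp, φ, hφ, hpair, hder⟩ := exists_pairing_lift h hU hs (PiecewiseC1.on hc)
      fun t ht => ⟨(hcF t ht).1, hFU (hcF t ht).2⟩
    have hm : MapsTo (fun t => (c t).proj) (Icc 0 1) F := fun t ht => (hcF t ht).2
    obtain ⟨hA, hA'⟩ := hα.primitive hcp (hm.mono_right hFU)
    have hproj : (c 1).proj = (c 0).proj := by rw [hloop]; rfl
    refine ⟨(c 0).proj, hm ⟨le_rfl, zero_le_one⟩, _, ⟨_, hcp, rfl, hproj, hm, rfl⟩, ?_⟩
    have h1 := (hφ.add hA).eq_of_deriv_eq_zero (by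
      filter_upwards [hder, hA', hΓ] with t h1 h2 h3 hI
      obtain ⟨φ', h4, -, h5⟩ := h1 hI
      rw [h3 hI] at h5
      exact ((h4.add (h2 hI)).congr_deriv h5.symm).deriv)
    rw [intervalIntegral.integral_same, add_zero] at h1
    have h2 : (Circle.exp (φ 1) : ℂ) = a * Circle.exp (φ 0) := by
      rw [← hpair 1 ⟨zero_le_one, le_rfl⟩, ← hpair 0 ⟨le_rfl, zero_le_one⟩, hloop, pairing_rot]
    have h3 : Circle.exp (φ 1) = a * Circle.exp (φ 0) := Subtype.ext h2
    rw [show φ 1 = φ 0 + -∫ t in (0 : ℝ)..1, potential nabla s (c t).proj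
      (velocity (𝓡 4) (fun t => (c t).proj) t) by linarith, Circle.exp_add, mul_comm] at h3
    exact (mul_right_cancel h3).symm
  · rintro ⟨x, hx, r, ⟨c, hc, hc0, hc1, hm, hr⟩, rfl⟩
    obtain ⟨hA, hA'⟩ := hα.primitive hc (hm.mono_right hFU)
    refine ⟨fun t => liftPoint s (c t) (-∫ τ in (0 : ℝ)..t, potential nabla s (c τ)
      (velocity (𝓡 4) c τ)), hc.liftPoint hs hA.neg (hm.mono_right hFU), fun t ht =>
        ⟨liftPoint_mem hs (hFU (hm ht)) _, hm ht⟩, ?_, ?_⟩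
    · filter_upwards [hc.ae_contMDiffAt, hA.neg.ae_contMDiffAt, hA'] with t h1 h2 h3 hI
      rw [(connectionForm_liftPoint h hU hs (h1 hI).2 (h2 hI).2 (h3 hI).neg (hFU (hm hI))).2]
      exact neg_add_cancel _
    · have e : ∀ y, y = x → ∀ t, liftPoint s y t = liftPoint s x t := fun y hy t => by rw [hy]
      change liftPoint s (c 1) _ = rot _ (liftPoint s (c 0) _)
      rw [e _ hc0, e _ hc1, hr, intervalIntegral.integral_same, neg_zero]
      simp [rot, liftPoint]
      rfl

lemma circle_exp_neg_pow_eq_one_iff (r : ℝ) (m : ℕ) :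
    Circle.exp (-r) ^ m = 1 ↔ ∃ n : ℤ, m * r = 2 * Real.pi * n := by
  rw [← Circle.exp_natCast_mul, mul_neg, Circle.exp_neg, inv_eq_one, Circle.exp_eq_one]
  exact exists_congr fun n => by rw [mul_comm (n : ℝ)]

variable {B : Type*} [TopologicalSpace B] [ChartedSpace Plane B] {μ : X → B}

lemma mem_BS_iff (h : IsPrequantum nabla Ω) (hU : IsOpen U) (hs : IsUnitSection s U) {b : B}
    (hb : μ ⁻¹' {b} ⊆ U) (m : ℕ) : b ∈ BS nabla μ m ↔ ∀ x ∈ μ ⁻¹' {b},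
      ∀ r ∈ pathIntegrals (potential nabla s) (μ ⁻¹' {b}) x x,
        ∃ n : ℤ, m * r = 2 * Real.pi * n := by
  constructor
  · intro hB x hx r hr
    rw [← circle_exp_neg_pow_eq_one_iff]
    exact hB _ ((mem_holonomy_iff h hU hs hb _).2 ⟨x, hx, r, hr, rfl⟩)
  · intro hB a ha
    obtain ⟨x, hx, r, hr, rfl⟩ := (mem_holonomy_iff h hU hs hb _).1 ha
    exact (circle_exp_neg_pow_eq_one_iff r m).2 (hB x hx r hr)

end Holonomy

/-! ### Short curves in fibers, and the angular coordinate at a Bohr–Sommerfeld point. -/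

section Setting

variable {X : Type*} [TopologicalSpace X] [T2Space X] [ChartedSpace Four X] [IsManifold (𝓡 4) ∞ X]
  {L : X → Type*} [TopologicalSpace (TotalSpace ℂ L)] [∀ x, NormedAddCommGroup (L x)]
  [∀ x, InnerProductSpace ℂ (L x)] [FiberBundle ℂ L] [VectorBundle ℝ ℂ L] [VectorBundle ℂ ℂ L]
  [ContMDiffVectorBundle ∞ ℂ L (𝓡 4)]
  {B : Type*} [TopologicalSpace B] [ChartedSpace Plane B] [IsManifold (𝓡 2) ∞ B]
  {Ω : TwoTensor X} {nabla : CovariantDerivative (𝓡 4) ℂ L} {g : Metric X}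
  {μ : X → B} {Brg : Set B} {b : B} {W : Set B} {R : ℝ} {γ : OneForm X} {ζ : B → Plane}
  {σ δ K : ℝ} {s : (x : X) → L x} {m : ℕ}

lemma IsFibration.isOpen_preimage (hf : IsFibration Ω μ Brg) (ht : IsTuple Ω μ Brg b W R γ ζ σ δ K) :
    IsOpen (μ ⁻¹' W) := ht.isOpen.preimage hf.smooth.continuous

lemma Conditions.exists_fiber_curve (hc : Conditions L g μ Brg b W R γ ζ σ δ K) {x y : X}
    (hx : μ x ∈ W) (hr : ‖ζ (μ x)‖ < 3 * R) (hy : μ y = μ x) :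
    ∃ c : ℝ → X, PiecewiseC1On (𝓡 4) c 0 1 ∧ c 0 = x ∧ c 1 = y ∧
      MapsTo c (Icc 0 1) (μ ⁻¹' {μ x}) ∧ lengthOn (𝓡 4) g.norm c 0 1 < ENNReal.ofReal δ := by
  refine exists_curve_of_lengthDist_lt (lt_of_le_of_lt ?_ hc.diam_fiber)
  refine le_trans ?_ (le_iSup₂ (f := fun w (_ : w ∈ {w ∈ W | ‖ζ w‖ < 3 * R}) =>
    lengthDiam (𝓡 4) g.norm (μ ⁻¹' {w})) (μ x) ⟨hx, hr⟩)
  exact (le_iSup₂ (f := fun y' (_ : y' ∈ μ ⁻¹' {μ x}) => lengthDist (𝓡 4) g.norm (μ ⁻¹' {μ x}) x y')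
    y hy).trans (le_iSup₂ (f := fun x' (_ : x' ∈ μ ⁻¹' {μ x}) => ⨆ y' ∈ μ ⁻¹' {μ x},
      lengthDist (𝓡 4) g.norm (μ ⁻¹' {μ x}) x' y') x rfl)

lemma Conditions.exists_core_curve (hc : Conditions L g μ Brg b W R γ ζ σ δ K) {x y : X}
    (hx : μ x ∈ W) (hrx : ‖ζ (μ x)‖ ≤ σ) (hy : μ y ∈ W) (hry : ‖ζ (μ y)‖ ≤ σ) :
    ∃ c : ℝ → X, PiecewiseC1On (𝓡 4) c 0 1 ∧ c 0 = x ∧ c 1 = y ∧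
      MapsTo c (Icc 0 1) {x | μ x ∈ W ∧ ‖ζ (μ x)‖ ≤ σ} ∧
      lengthOn (𝓡 4) g.norm c 0 1 < ENNReal.ofReal δ := by
  refine exists_curve_of_lengthDist_lt (lt_of_le_of_lt ?_ hc.diam_core)
  exact (le_iSup₂ (f := fun y' (_ : y' ∈ {x | μ x ∈ W ∧ ‖ζ (μ x)‖ ≤ σ}) =>
      lengthDist (𝓡 4) g.norm {x | μ x ∈ W ∧ ‖ζ (μ x)‖ ≤ σ} x y') y ⟨hy, hry⟩).trans
    (le_iSup₂ (f := fun x' (_ : x' ∈ {x | μ x ∈ W ∧ ‖ζ (μ x)‖ ≤ σ}) =>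
      ⨆ y' ∈ {x | μ x ∈ W ∧ ‖ζ (μ x)‖ ≤ σ},
        lengthDist (𝓡 4) g.norm {x | μ x ∈ W ∧ ‖ζ (μ x)‖ ≤ σ} x' y') x ⟨hx, hrx⟩)

lemma Conditions.pathIntegrals_nonempty (hc : Conditions L g μ Brg b W R γ ζ σ δ K) {x y : X}
    (η : OneForm X) (hx : μ x ∈ W) (hr : ‖ζ (μ x)‖ < 3 * R) (hy : μ y = μ x) :
    (pathIntegrals η (μ ⁻¹' {μ x}) x y).Nonempty := by
  obtain ⟨c, h1, h2, h3, h4, -⟩ := hc.exists_fiber_curve hx hr hy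
  exact ⟨_, c, h1, h2, h3, h4, rfl⟩

/-- The existence criterion for phases is applied to η = α + γ, with the fiber over b as the
subspace that detects periods. -/
lemma Conditions.exists_angle (hc : Conditions L g μ Brg b W R γ ζ σ δ K)
    (hp : IsPrequantum nabla Ω) (hf : IsFibration Ω μ Brg) (ht : IsTuple Ω μ Brg b W R γ ζ σ δ K)
    (hb : b ∈ BS nabla μ m) {p : TotalSpace ℂ L} (hpb : μ p.proj = b) :
    ∃ θ, IsAngle nabla m γ (μ ⁻¹' W) θ ∧ approxMap μ ζ θ p = (1, 0) := by
  have hU := hf.isOpen_preimage ht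
  obtain ⟨s, hs⟩ := exists_unitSection hp hc.trivial
  have hFU : μ ⁻¹' {b} ⊆ μ ⁻¹' W := preimage_mono (singleton_subset_iff.2 ht.mem)
  obtain ⟨e, he, hgen, -, -, hvan⟩ := hc.cycles
  have hev := evalSmoothOn_totalForm hp hU hs ht.smooth_γ
  have hα := evalSmoothOn_potential hp hU hs
  have hζb : ‖ζ b‖ < 3 * R := by rw [ht.ζ_b, norm_zero]; linarith [ht.R_pos]
  subst hpb
  have hpath : ∀ η : OneForm X, ∀ y ∈ μ ⁻¹' {μ p.proj},
      (pathIntegrals η (μ ⁻¹' {μ p.proj}) p.proj y).Nonempty := fun η y hy =>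
    hc.pathIntegrals_nonempty η ht.mem hζb hy
  obtain ⟨f, hfp⟩ := exists_phase hU hev (closed_totalForm hp hU hs ht.smooth_γ ht.primitive) hFU
    (hc.cohomology ht.mem).1.2 (hc.cohomology ht.mem).2.1 (y₀ := p.proj) rfl (hpath _)
    (e := fun i => e i ⟨μ p.proj, ht.mem⟩) (fun i => he i ⟨μ p.proj, ht.mem⟩)
    (hgen ⟨μ p.proj, ht.mem⟩) m (fun i => by
      have h1 := integralCycle_add hα (ht.smooth_γ.evalSmoothOn hU) hFU hFU
        (e i ⟨μ p.proj, ht.mem⟩) (he i ⟨μ p.proj, ht.mem⟩)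
      -- On the generating cycles of X_b the form γ contributes nothing, so only the holonomy of ∇
      -- is left, which the condition BS_m controls.
      have h2 := (hvan ⟨μ p.proj, ht.mem⟩ rfl).1 i
      rw [h2, add_zero] at h1
      change ∃ n : ℤ, (m : ℝ) * OneForm.integralCycle
        (fun x => potential nabla s x + γ x) (e i ⟨μ p.proj, ht.mem⟩) = _
      rw [h1]
      exact exists_int_sum_integral hα hFU (hpath _) m
        ((mem_BS_iff hp hU hs hFU m).1 hb p.proj rfl) _ (he i ⟨μ p.proj, ht.mem⟩))
  have hθ := hfp.isAngle hp hU hs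
  set θ : TotalSpace ℂ L → Circle := fun u => toCircle (pairing s u ^ m * f u.proj)
  -- The defining conditions are invariant under multiplication by a constant, which is used to
  -- normalize the value at p.
  refine ⟨fun u => θ u * (θ p)⁻¹, ⟨fun u hu hx a => ?_, fun c t hev hct => ?_⟩, ?_⟩
  · rw [hθ.equivariant u hu hx a, mul_assoc]
  · have h1 := (hθ.deriv c t hev hct).mul_const (((θ p)⁻¹ : Circle) : ℂ)
    refine (h1.congr_deriv ?_)
    rw [Circle.coe_mul]; ring
  · simp [approxMap, ht.ζ_b]

end Setting

/-! ### The base of the fibration -/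

section Base

lemma isPreconnected_ball_diff_center {E : Type*} [NormedAddCommGroup E] [InnerProductSpace ℝ E]
    (h : 1 < Module.rank ℝ E) {r : ℝ} (hr : 0 < r) :
    IsPreconnected (Metric.ball (0 : E) r \ {0}) := by
  have h1 : OpenPartialHomeomorph.univBall (0 : E) r '' {0}ᶜ = Metric.ball (0 : E) r \ {0} := by
    have hinj := (OpenPartialHomeomorph.univBall (0 : E) r).injOn
    have htgt := (OpenPartialHomeomorph.univBall (0 : E) r).image_source_eq_target
    rw [OpenPartialHomeomorph.univBall_source] at hinj htgt
    rw [OpenPartialHomeomorph.univBall_target _ hr] at htgt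
    rw [compl_eq_univ_sdiff, hinj.image_sdiff, htgt]
    simp
  rw [← h1]
  exact (isConnected_compl_singleton_of_one_lt_rank h 0).isPreconnected.image _
    (OpenPartialHomeomorph.continuous_univBall 0 r).continuousOn

variable {X : Type*} [TopologicalSpace X] [ChartedSpace Four X] [IsManifold (𝓡 4) ∞ X]
  {B : Type*} [TopologicalSpace B] [T2Space B] [ChartedSpace Plane B]
  {Ω : TwoTensor X} {μ : X → B} {Brg : Set B} {b : B} {W : Set B} {R : ℝ} {γ : OneForm X}
  {ζ : B → Plane} {σ δ K ρ : ℝ} {w : B}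

lemma IsTuple.contMDiffAt_ζ (ht : IsTuple Ω μ Brg b W R γ ζ σ δ K) (hw : w ∈ W) (hb : w ≠ b) :
    ContMDiffAt (𝓡 2) 𝓘(ℝ, Plane) ∞ ζ w :=
  (ht.smooth_ζ w ⟨hw, hb⟩).contMDiffAt
    ((ht.isOpen.sdiff isClosed_singleton).mem_nhds ⟨hw, hb⟩)

lemma IsTuple.nhds_le_map_of_ne (ht : IsTuple Ω μ Brg b W R γ ζ σ δ K) (hw : w ∈ W) (hb : w ≠ b) :
    𝓝 (ζ w) ≤ map ζ (𝓝 w) := by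
  have h1 := ht.contMDiffAt_ζ hw hb
  have h2 := ht.local_diffeo_ζ w ⟨hw, hb⟩
  have hm := h1.mdifferentiableAt (by simp)
  rw [hm.mfderiv] at h2
  have h3 := (contMDiffAt_iff.1 h1).2
  simp only [mfld_simps, chartAt_self_eq, Function.id_comp] at h2 h3
  rw [fderivWithin_univ] at h2
  rw [contDiffWithinAt_univ] at h3
  set e := chartAt Plane w
  have h4 := (h3.hasStrictFDerivAt (by simp)).map_nhds_eq_of_surj
    (LinearMap.range_eq_top.2 h2.surjective)
  have h5 : e.symm (e w) = w := e.left_inv (mem_chart_source _ w)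
  simp only [Function.comp_apply, h5] at h4
  rw [← h4, ← Filter.map_map]
  exact Filter.map_mono (e.symm_map_nhds_eq (mem_chart_source _ w)).le

/-- If ζ vanished at w ≠ b, it would map a small neighbourhood of w onto a neighbourhood of 0. By
continuity the latter contains the values of ζ near b, and injectivity off b would make b an
isolated point of the surface. -/
lemma IsTuple.ζ_ne_zero (ht : IsTuple Ω μ Brg b W R γ ζ σ δ K) (hw : w ∈ W) (hb : w ≠ b) :
    ζ w ≠ 0 := by
  intro h0
  obtain ⟨O, O', hO, hO', hwO, hbO, hd⟩ := t2_separation hb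
  have h1 : ζ '' (O ∩ W) ∈ 𝓝 (0 : Plane) := by
    rw [← h0]
    exact ht.nhds_le_map_of_ne hw hb
      (image_mem_map ((hO.inter ht.isOpen).mem_nhds ⟨hwO, hw⟩))
  have h2 : Tendsto ζ (𝓝 b) (𝓝 0) := by
    have := (ht.continuous_ζ.continuousAt (ht.isOpen.mem_nhds ht.mem)).tendsto
    rwa [ht.ζ_b] at this
  have h3 : {b} ∈ 𝓝 b := by
    filter_upwards [h2 h1, hO'.mem_nhds hbO, ht.isOpen.mem_nhds ht.mem] with y hy hyO hyW
    by_contra hyb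
    obtain ⟨z, ⟨hzO, hzW⟩, hz⟩ := hy
    have hzb : z ≠ b := fun h => hd.le_bot ⟨h ▸ hzO, hbO⟩
    have := ht.injective_ζ ⟨hzW, hzb⟩ ⟨hyW, hyb⟩ hz
    exact hd.le_bot ⟨hzO, this ▸ hyO⟩
  have h4 := (chartAt Plane b).image_mem_nhds (mem_chart_source _ b) h3
  rw [image_singleton] at h4
  exact (NeBot.ne (inferInstance : (𝓝[≠] (chartAt Plane b b)).NeBot))
    ((isOpen_singleton_iff_punctured_nhds _).1 (isOpen_singleton_iff_nhds_eq_pure _ |>.2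
      (le_antisymm (le_pure_iff.2 h4) (pure_le_nhds _))))

lemma IsTuple.eq_of_ζ_eq_zero (ht : IsTuple Ω μ Brg b W R γ ζ σ δ K) (hw : w ∈ W) (h : ζ w = 0) :
    w = b := by
  by_contra hb
  exact ht.ζ_ne_zero hw hb h

lemma IsTuple.injOn_ζ (ht : IsTuple Ω μ Brg b W R γ ζ σ δ K) : InjOn ζ W := by
  intro x hx y hy h
  by_cases hxb : x = b
  · rw [hxb, ht.ζ_b] at h
    rw [hxb, ht.eq_of_ζ_eq_zero hy h.symm]
  by_cases hyb : y = b
  · rw [hyb, ht.ζ_b] at h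
    rw [hyb, ht.eq_of_ζ_eq_zero hx h]
  exact ht.injective_ζ ⟨hx, hxb⟩ ⟨hy, hyb⟩ h

/-- Away from b this is the inverse function theorem. At b the map is only continuous: for a compact
neighbourhood D the image of D minus its interior avoids a small ball around 0, so the image of the
punctured interior meets the punctured ball in a nonempty, open and relatively closed set. The
punctured ball is connected and hence covered. -/
lemma IsTuple.nhds_le_map (ht : IsTuple Ω μ Brg b W R γ ζ σ δ K) (hw : w ∈ W) :
    𝓝 (ζ w) ≤ map ζ (𝓝 w) := by
  rcases ne_or_eq w b with hb | rfl
  · exact ht.nhds_le_map_of_ne hw hb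
  have := ChartedSpace.locallyCompactSpace Plane B
  intro V hV
  obtain ⟨D, hD, hDV, hDc⟩ := local_compact_nhds (inter_mem (show ζ ⁻¹' V ∈ 𝓝 w from hV) (ht.isOpen.mem_nhds hw))
  have hDW : D ⊆ W := fun y hy => (hDV hy).2
  have hζD := ht.continuous_ζ.mono hDW
  have h1 : IsCompact (ζ '' (D \ interior D)) :=
    (hDc.diff isOpen_interior).image_of_continuousOn (hζD.mono sdiff_subset)
  have h2 : (0 : Plane) ∉ ζ '' (D \ interior D) := by
    rintro ⟨y, hy, h0⟩
    rw [ht.eq_of_ζ_eq_zero (hDW hy.1) h0] at hy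
    exact hy.2 (mem_interior_iff_mem_nhds.2 hD)
  obtain ⟨r, hr, hball⟩ := Metric.isOpen_iff.1 h1.isClosed.isOpen_compl 0 h2
  have hζ0 : Tendsto ζ (𝓝 w) (𝓝 0) := by
    have := (ht.continuous_ζ.continuousAt (ht.isOpen.mem_nhds hw)).tendsto
    rwa [ht.ζ_b] at this
  obtain ⟨y, ⟨hyD, hyr⟩, hyw⟩ : ∃ y, (y ∈ D ∧ ζ y ∈ Metric.ball 0 r) ∧ y ≠ w := by
    by_contra! hcon
    have h3 : {w} ∈ 𝓝 w := by
      filter_upwards [hD, hζ0 (Metric.ball_mem_nhds 0 hr)] with y hy hy' using hcon y ⟨hy, hy'⟩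
    have h4 := (chartAt Plane w).image_mem_nhds (mem_chart_source _ w) h3
    rw [image_singleton] at h4
    exact (NeBot.ne (inferInstance : (𝓝[≠] (chartAt Plane w w)).NeBot))
      ((isOpen_singleton_iff_punctured_nhds _).1 (isOpen_singleton_iff_nhds_eq_pure _ |>.2
        (le_antisymm (le_pure_iff.2 h4) (pure_le_nhds _))))
  have hrank : 1 < Module.rank ℝ Plane := Module.one_lt_rank_of_one_lt_finrank (by simp)
  have hsub : Metric.ball (0 : Plane) r \ {0} ⊆ ζ '' D := by
    refine Subset.trans ((isPreconnected_ball_diff_center hrank hr).subset_of_closure_inter_subset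
      (u := ζ '' (interior D \ {w})) ?_ ?_ ?_) (image_mono (sdiff_subset.trans interior_subset))
    · rw [isOpen_iff_mem_nhds]
      rintro _ ⟨z, hz, rfl⟩
      exact ht.nhds_le_map_of_ne (hDW (interior_subset hz.1)) hz.2
        (image_mem_map ((isOpen_interior.sdiff isClosed_singleton).mem_nhds hz))
    · refine ⟨ζ y, ⟨hyr, ht.ζ_ne_zero (hDW hyD) hyw⟩, y, ⟨?_, hyw⟩, rfl⟩
      by_contra hyi
      exact hball hyr ⟨y, ⟨hyD, hyi⟩, rfl⟩
    · rintro ξ ⟨hξ, hξr, hξ0⟩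
      have h3 : ξ ∈ ζ '' D := by
        have := closure_mono (image_mono (f := ζ) (sdiff_subset.trans interior_subset)) hξ
        rwa [(hDc.image_of_continuousOn hζD).isClosed.closure_eq] at this
      obtain ⟨z, hz, rfl⟩ := h3
      refine ⟨z, ⟨?_, fun hzw => hξ0 ?_⟩, rfl⟩
      · by_contra hzi
        exact hball hξr ⟨z, ⟨hz, hzi⟩, rfl⟩
      · rw [mem_singleton_iff.1 hzw, ht.ζ_b]; rfl
  rw [ht.ζ_b]
  filter_upwards [Metric.ball_mem_nhds (0 : Plane) hr] with ξ hξ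
  by_cases h0 : ξ = 0
  · have h3 : w ∈ ζ ⁻¹' V := mem_of_mem_nhds hV
    rwa [h0, ← ht.ζ_b]
  · obtain ⟨z, hz, rfl⟩ := hsub ⟨hξ, h0⟩
    exact (hDV hz).1

/-- The inverse of ζ is continuous because ζ is open, and A lies in the ball contained in ζ(W). -/
lemma IsTuple.isCompact_closedBall (ht : IsTuple Ω μ Brg b W R γ ζ σ δ K)
    (hball : Metric.closedBall (0 : Plane) (3 * R) ⊆ ζ '' W) {A : Set Plane} (hA : IsClosed A)
    (hAR : A ⊆ Metric.closedBall (0 : Plane) (3 * R)) : IsCompact {w ∈ W | ζ w ∈ A} := by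
  have : Nonempty B := ⟨b⟩
  have hinv : ∀ w ∈ W, Function.invFunOn ζ W (ζ w) = w := fun w hw =>
    ht.injOn_ζ.leftInvOn_invFunOn hw
  have h1 : ContinuousOn (Function.invFunOn ζ W) A := by
    intro ξ hξ
    obtain ⟨w, hw, rfl⟩ := hball (hAR hξ)
    refine ContinuousAt.continuousWithinAt fun V hV => ?_
    rw [hinv w hw] at hV
    have h0 : ζ '' (V ∩ W) ∈ 𝓝 (ζ w) := ht.nhds_le_map hw (image_mem_map
      (inter_mem hV (ht.isOpen.mem_nhds hw)))
    refine mem_map.2 (mem_of_superset h0 ?_)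
    rintro _ ⟨y, ⟨hyV, hyW⟩, rfl⟩
    rw [mem_preimage, hinv y hyW]; exact hyV
  have h2 : IsCompact A := (ProperSpace.isCompact_closedBall 0 (3 * R)).of_isClosed_subset hA hAR
  convert h2.image_of_continuousOn h1 using 1
  ext w
  constructor
  · rintro ⟨hw, hwA⟩
    exact ⟨_, hwA, hinv w hw⟩
  · rintro ⟨ξ, hξ, rfl⟩
    obtain ⟨w, hw, rfl⟩ := hball (hAR hξ)
    rw [hinv w hw]; exact ⟨hw, hξ⟩

lemma IsTuple.isCompact_preimage (ht : IsTuple Ω μ Brg b W R γ ζ σ δ K) (hf : IsFibration Ω μ Brg)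
    (hball : Metric.closedBall (0 : Plane) (3 * R) ⊆ ζ '' W) {A : Set Plane} (hA : IsClosed A)
    (hAR : A ⊆ Metric.closedBall (0 : Plane) (3 * R)) : IsCompact {x | μ x ∈ W ∧ ζ (μ x) ∈ A} :=
  hf.proper.isCompact_preimage (ht.isCompact_closedBall hball hA hAR)

end Base


/-! ### Pointwise estimates -/

section Pointwise

variable {X : Type*} [TopologicalSpace X] [ChartedSpace Four X] [IsManifold (𝓡 4) ∞ X]

lemma Metric.inner_self_pos (g : Metric X) {x : X} {v : TangentSpace (𝓡 4) x} (hv : v ≠ 0) :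
    0 < g.inner x v v := g.pos x v hv

lemma Metric.det_gram_pos (g : Metric X) (x₀ : X) {x : X} (hx : x ∈ (chartAt Four x₀).source) :
    0 < Matrix.det (Matrix.of fun i j : Fin 4 =>
      g.inner x (chartField x₀ (EuclideanSpace.single i 1) x)
        (chartField x₀ (EuclideanSpace.single j 1) x)) := by
  refine Matrix.PosDef.det_pos (Matrix.PosDef.of_dotProduct_mulVec_pos ?_ fun a ha => ?_)
  · ext i j
    exact g.symm x _ _
  · have h1 : chartField x₀ (WithLp.toLp 2 a) x ≠ 0 := by
      intro h0
      apply ha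
      have h2 : chartDeriv x₀ x (chartField x₀ (WithLp.toLp 2 a) x) = WithLp.toLp 2 a := by
        have h3 := isInvertible_mfderiv_chartAt hx
        exact DFunLike.congr_fun h3.self_comp_inverse (WithLp.toLp 2 a)
      rw [h0, map_zero] at h2
      have h4 := congrArg WithLp.ofLp h2
      exact h4.symm
    have h2 := g.inner_self_pos h1
    have h3 : chartField x₀ (WithLp.toLp 2 a) x
        = ∑ i, a i • chartField x₀ (EuclideanSpace.single i 1) x := chartField_eq_sum x₀ x _
    have h4 : ∀ w, g.inner x (chartField x₀ (WithLp.toLp 2 a) x) w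
        = ∑ i, a i * g.inner x (chartField x₀ (EuclideanSpace.single i 1) x) w := by
      intro w
      rw [h3, map_sum, sum_apply]
      refine Finset.sum_congr rfl fun i _ => ?_
      rw [map_smul]; rfl
    have h5 : ∀ w, g.inner x w (chartField x₀ (WithLp.toLp 2 a) x)
        = ∑ i, a i * g.inner x w (chartField x₀ (EuclideanSpace.single i 1) x) := by
      intro w
      rw [h3, map_sum]
      exact Finset.sum_congr rfl fun i _ => by rw [map_smul]; rfl
    rw [h4] at h2
    simp_rw [h5] at h2
    simpa [dotProduct, Matrix.mulVec, mul_comm] using h2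

/-- The Gram determinant in a chart is continuous and positive. This is needed to see that X_b has
no interior. -/
lemma Metric.IsVolume.ne_zero_of_isOpen {g : Metric X} {ν : @Measure X (borel X)}
    (hν : g.IsVolume ν) {O : Set X} (hO : IsOpen O) (hne : O.Nonempty) : ν O ≠ 0 := by
  obtain ⟨x₀, hx₀⟩ := hne
  set e := chartAt Four x₀
  set A := O ∩ e.source
  have hA : IsOpen A := hO.inter e.open_source
  intro h0
  have h1 : ν A = 0 := measure_mono_null inter_subset_left h0
  have hAm : MeasurableSet[borel X] A := by
    borelize X
    exact hA.measurableSet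
  rw [hν x₀ A inter_subset_right hAm] at h1
  have hopen : IsOpen (e '' A) := e.isOpen_image_of_subset_source hA inter_subset_right
  set D : Four → ℝ := fun y => Matrix.det (Matrix.of fun i j : Fin 4 =>
      g.inner (e.symm y) (chartField x₀ (EuclideanSpace.single i 1) (e.symm y))
        (chartField x₀ (EuclideanSpace.single j 1) (e.symm y))) with hD
  have htgt : ∀ y ∈ e '' A, y ∈ e.target := by
    rintro _ ⟨x, hx, rfl⟩; exact e.map_source hx.2
  have h2 : ∫⁻ y in e '' A, ENNReal.ofReal √(D y) = 0 := by
    rw [← h1]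
    refine setLIntegral_congr_fun hopen.measurableSet fun y hy => ?_
    have h3 := fun a => mfderiv_chartAt_symm_apply (htgt y hy) a
    simp only [hD]
    congr 3
    ext i j
    simp only [Matrix.of_apply]
    rw [h3, h3]
  have hcont : ContinuousOn D e.target := by
    intro y hy
    refine ContinuousAt.continuousWithinAt ?_
    simp only [hD, Matrix.det_apply]
    refine tendsto_finsetSum _ fun τ _ => Tendsto.const_smul (tendsto_finsetProd _ fun i _ => ?_) _
    have hs := e.map_target hy
    exact ((g.contMDiffAt_inner (smoothFieldAt_chartField hs _)
      (smoothFieldAt_chartField hs _)).continuousAt.comp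
        (contMDiffAt_chartAt_symm hy).continuousAt)
  have hmeas : AEMeasurable (fun y => ENNReal.ofReal √(D y)) (volume.restrict (e '' A)) :=
    ((Real.continuous_sqrt.comp_continuousOn (hcont.mono htgt)).aemeasurable
      hopen.measurableSet).ennreal_ofReal
  rw [lintegral_eq_zero_iff' hmeas, Filter.EventuallyEq, ae_restrict_iff' hopen.measurableSet] at h2
  have h4 : volume (e '' A) = 0 := by
    refine measure_mono_null (fun y hy => ?_) (ae_iff.1 h2)
    rw [mem_ofPred_eq, Classical.not_imp]
    refine ⟨hy, (ENNReal.ofReal_pos.2 (Real.sqrt_pos.2 ?_)).ne'⟩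
    exact g.det_gram_pos x₀ (e.map_target (htgt y hy))
  exact (hopen.measure_pos volume ⟨e x₀, x₀, ⟨hx₀, mem_chart_source _ x₀⟩, rfl⟩).ne' h4

variable {B : Type*} [TopologicalSpace B] [ChartedSpace Plane B]
  {Ω : TwoTensor X} {g : Metric X} {μ : X → B} {Brg : Set B} {b : B} {W : Set B} {R : ℝ}
  {γ : OneForm X} {ζ : B → Plane} {σ δ K ρ : ℝ} {x : X}

/-- Positivity of g makes its restriction to the kernel nondegenerate; no regularity of μ at x is
needed. -/
lemma exists_orthogonal_decomposition (g : Metric X) (μ : X → B) (v : TangentSpace (𝓡 4) x) :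
    ∃ v₁ ∈ vert μ x, ∃ v₂ ∈ horiz g μ x, v = v₁ + v₂ ∧
      g.norm x v ^ 2 = g.norm x v₁ ^ 2 + g.norm x v₂ ^ 2 := by
  set β : LinearMap.BilinForm ℝ (TangentSpace (𝓡 4) x) := LinearMap.mk₂ ℝ (fun u w => g.inner x u w)
    (fun u u' w => by rw [map_add]; rfl) (fun c u w => by rw [map_smul]; rfl)
    (fun u w w' => map_add _ _ _) (fun c u w => map_smul _ _ _) with hβ
  have hβa : ∀ u w, β u w = g.inner x u w := fun _ _ => rfl
  have hrefl : β.IsRefl := fun u w h => by rw [hβa] at h ⊢; rw [g.symm x, h]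
  set V : Submodule ℝ (TangentSpace (𝓡 4) x) := LinearMap.ker (mfderiv (𝓡 4) (𝓡 2) μ x).toLinearMap
  have hfin : FiniteDimensional ℝ (TangentSpace (𝓡 4) x) :=
    inferInstanceAs (FiniteDimensional ℝ Four)
  have hnd : (β.restrict V).Nondegenerate := by
    have key : ∀ u : V, g.inner x u u = 0 → u = 0 := fun u hu => by
      by_contra hne
      exact (g.inner_self_pos (v := (u : TangentSpace (𝓡 4) x)) (fun h => hne (Subtype.ext h))).ne' hu
    exact ⟨fun u hu => key u (hu u), fun u hu => key u (hu u)⟩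
  have hc := LinearMap.BilinForm.isCompl_orthogonal_of_restrict_nondegenerate hrefl hnd
  obtain ⟨v₁, h1, v₂, h2, h⟩ := Submodule.mem_sup.1 (hc.sup_eq_top ▸ Submodule.mem_top : v ∈ V ⊔ _)
  have h2' : v₂ ∈ horiz g μ x := fun w hw => by rw [g.symm x]; exact h2 w hw
  refine ⟨v₁, h1, v₂, h2', h.symm, ?_⟩
  have h3 := h2' v₁ h1
  simp only [Metric.norm_sq]
  rw [← h, map_add, map_add]
  change g.inner x v₁ v₁ + g.inner x v₂ v₁ + (g.inner x v₁ v₂ + g.inner x v₂ v₂) = _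
  rw [g.symm x v₁ v₂, h3]; ring

lemma IsTuple.ne_of_pos (ht : IsTuple Ω μ Brg b W R γ ζ σ δ K) (hr : 0 < ‖ζ (μ x)‖) : μ x ≠ b := by
  intro h
  rw [h, ht.ζ_b, norm_zero] at hr
  exact lt_irrefl _ hr

lemma mvfderiv_add_vert {v₁ v₂ : TangentSpace (𝓡 4) x}
    (hζ : MDifferentiableAt (𝓡 2) 𝓘(ℝ, Plane) ζ (μ x)) (hμ : MDifferentiableAt (𝓡 4) (𝓡 2) μ x)
    (h : v₁ ∈ vert μ x) :
    mvfderiv (𝓡 4) (ζ ∘ μ) x (v₁ + v₂) = mvfderiv (𝓡 4) (ζ ∘ μ) x v₂ := by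
  have h1 : mvfderiv (𝓡 4) (ζ ∘ μ) x v₁ = 0 := by
    refine (mfderiv_comp_apply x hζ hμ v₁).trans ?_
    rw [show mfderiv (𝓡 4) (𝓡 2) μ x v₁ = 0 from h, map_zero]
    rfl
  rw [map_add, h1, zero_add]

variable [T2Space B]

lemma IsTuple.mdifferentiableAt_ζ (ht : IsTuple Ω μ Brg b W R γ ζ σ δ K) (hx : μ x ∈ W)
    (hr : 0 < ‖ζ (μ x)‖) : MDifferentiableAt (𝓡 2) 𝓘(ℝ, Plane) ζ (μ x) :=
  (ht.contMDiffAt_ζ hx (ht.ne_of_pos hr)).mdifferentiableAt (by simp)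

lemma IsTuple.contMDiffAt_comp (ht : IsTuple Ω μ Brg b W R γ ζ σ δ K) (hf : IsFibration Ω μ Brg)
    (hx : μ x ∈ W) (hr : 0 < ‖ζ (μ x)‖) : ContMDiffAt (𝓡 4) 𝓘(ℝ, Plane) ∞ (ζ ∘ μ) x :=
  (ht.contMDiffAt_ζ hx (ht.ne_of_pos hr)).comp x (hf.smooth x)

lemma IsFibration.mdifferentiableAt (hf : IsFibration Ω μ Brg) (x : X) :
    MDifferentiableAt (𝓡 4) (𝓡 2) μ x := (hf.smooth x).mdifferentiableAt (by simp)

variable {L : X → Type*} [TopologicalSpace (TotalSpace ℂ L)] [∀ x, NormedAddCommGroup (L x)]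
  [∀ x, InnerProductSpace ℂ (L x)] [FiberBundle ℂ L] [VectorBundle ℝ ℂ L] [VectorBundle ℂ ℂ L]
  [ContMDiffVectorBundle ∞ ℂ L (𝓡 4)]

/-- The model metric is bounded by the metric of the circle bundle, for tangent vectors outside the
core. -/
lemma Conditions.model_le (hc : Conditions L g μ Brg b W R γ ζ σ δ K)
    (ht : IsTuple Ω μ Brg b W R γ ζ σ δ K) (hf : IsFibration Ω μ Brg) (hx : μ x ∈ W)
    (hσ : σ ≤ ‖ζ (μ x)‖) (hR : ‖ζ (μ x)‖ < 3 * R) (v : TangentSpace (𝓡 4) x) (Γ : ℝ) :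
    (Γ + γ x v) ^ 2 / (1 + ‖ζ (μ x)‖ ^ 2) + ‖mvfderiv (𝓡 4) (ζ ∘ μ) x v‖ ^ 2
      ≤ (1 + δ) ^ 2 * (Γ ^ 2 + g.norm x v ^ 2) := by
  have hr : 0 < ‖ζ (μ x)‖ := ht.σ_pos.trans_le hσ
  have hδ := ht.δ_pos
  obtain ⟨v₁, h1, v₂, h2, rfl, hsq⟩ := exists_orthogonal_decomposition g μ v
  rw [mvfderiv_add_vert (ht.mdifferentiableAt_ζ hx hr) (hf.mdifferentiableAt x) h1, hsq, map_add]
  have h3 := (hc.g_horiz x hx hσ hR v₂ h2).1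
  have h4 := (hc.γ_horiz x hx hr hR v₂ h2).1
  have h5 := (hc.γ_vert x hx hσ hR).2 v₁ h1
  change _ + baseNorm μ ζ x v₂ ^ 2 ≤ _
  generalize baseNorm μ ζ x v₂ = n at *
  generalize ‖ζ (μ x)‖ = r at *
  have hn1 := g.norm_nonneg x v₁
  have hn2 := g.norm_nonneg x v₂
  generalize g.norm x v₁ = n₁ at *
  generalize g.norm x v₂ = n₂ at *
  generalize γ x v₁ = γ₁ at *
  generalize γ x v₂ = γ₂ at *
  have h6 : n ^ 2 ≤ (1 + δ) * n₂ ^ 2 := by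
    rwa [inv_mul_le_iff₀ (by positivity)] at h3
  have h7 : γ₂ ^ 2 ≤ δ ^ 2 * n₂ ^ 2 := by
    rw [← mul_pow, ← sq_abs]; exact pow_le_pow_left₀ (abs_nonneg _) h4 2
  -- Cauchy–Schwarz for (Γ, n₁) against (1, √(1+δ) r). This is where the factor 1 + r² of the model
  -- comes from.
  have h8 : (Γ + γ₁) ^ 2 ≤ (1 + (1 + δ) * r ^ 2) * (Γ ^ 2 + n₁ ^ 2) := by
    have hq : 0 < 1 + (1 + δ) * r ^ 2 := by positivity
    have h9 : 2 * Γ * γ₁ ≤ (1 + δ) * r ^ 2 * Γ ^ 2 + n₁ ^ 2 := by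
      have hp : 0 < (1 + δ) * r ^ 2 := by positivity
      have h10 : (γ₁ ^ 2) / ((1 + δ) * r ^ 2) ≤ n₁ ^ 2 := by
        rw [div_le_iff₀ hp]; linarith
      have h11 : 2 * Γ * γ₁ ≤ (1 + δ) * r ^ 2 * Γ ^ 2 + γ₁ ^ 2 / ((1 + δ) * r ^ 2) := by
        have : 0 ≤ ((1 + δ) * r ^ 2 * Γ - γ₁) ^ 2 / ((1 + δ) * r ^ 2) := by positivity
        have h12 : ((1 + δ) * r ^ 2 * Γ - γ₁) ^ 2 / ((1 + δ) * r ^ 2)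
            = (1 + δ) * r ^ 2 * Γ ^ 2 + γ₁ ^ 2 / ((1 + δ) * r ^ 2) - 2 * Γ * γ₁ := by
          field_simp; ring
        linarith
      linarith
    nlinarith
  -- The horizontal contribution γ₂ is of size δ n₂ and is split off by Young's inequality with
  -- weight δ.
  have h13 : (Γ + (γ₁ + γ₂)) ^ 2 ≤ (1 + δ) * (Γ + γ₁) ^ 2 + (δ + 1) * δ * n₂ ^ 2 := by
    have h14 : 2 * (Γ + γ₁) * γ₂ ≤ δ * (Γ + γ₁) ^ 2 + δ * n₂ ^ 2 := by
      have : 0 ≤ (δ * (Γ + γ₁) - γ₂) ^ 2 / δ := by positivity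
      have h15 : (δ * (Γ + γ₁) - γ₂) ^ 2 / δ = δ * (Γ + γ₁) ^ 2 - 2 * (Γ + γ₁) * γ₂ + γ₂ ^ 2 / δ := by
        field_simp; ring
      have h16 : γ₂ ^ 2 / δ ≤ δ * n₂ ^ 2 := by
        rw [div_le_iff₀ hδ]; linarith
      linarith
    nlinarith
  have h17 : (Γ + (γ₁ + γ₂)) ^ 2 / (1 + r ^ 2)
      ≤ (1 + δ) ^ 2 * (Γ ^ 2 + n₁ ^ 2) + (δ + 1) * δ * n₂ ^ 2 := by
    rw [div_le_iff₀ (by positivity)]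
    have h18 : 1 + (1 + δ) * r ^ 2 ≤ (1 + δ) * (1 + r ^ 2) := by nlinarith
    have h19 : (Γ + γ₁) ^ 2 ≤ (1 + δ) * (1 + r ^ 2) * (Γ ^ 2 + n₁ ^ 2) :=
      h8.trans (by gcongr)
    have h20 : (1 + δ) * (Γ + γ₁) ^ 2 ≤ (1 + δ) * ((1 + δ) * (1 + r ^ 2) * (Γ ^ 2 + n₁ ^ 2)) := by
      gcongr
    have h21 : 0 ≤ (δ + 1) * δ * n₂ ^ 2 * r ^ 2 := by positivity
    nlinarith
  -- The coefficients of n₂² add up to (1+δ)δ + (1+δ) = (1+δ)².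
  nlinarith

lemma Conditions.baseNorm_sq_le (hc : Conditions L g μ Brg b W R γ ζ σ δ K)
    (ht : IsTuple Ω μ Brg b W R γ ζ σ δ K) (hf : IsFibration Ω μ Brg) (hx : μ x ∈ W)
    (hσ : σ ≤ ‖ζ (μ x)‖) (hR : ‖ζ (μ x)‖ < 3 * R) (v : TangentSpace (𝓡 4) x) :
    ‖mvfderiv (𝓡 4) (ζ ∘ μ) x v‖ ^ 2 ≤ (1 + δ) * g.norm x v ^ 2 := by
  have hr : 0 < ‖ζ (μ x)‖ := ht.σ_pos.trans_le hσ
  have hδ := ht.δ_pos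
  obtain ⟨v₁, h1, v₂, h2, rfl, hsq⟩ := exists_orthogonal_decomposition g μ v
  rw [mvfderiv_add_vert (ht.mdifferentiableAt_ζ hx hr) (hf.mdifferentiableAt x) h1, hsq]
  have h3 := (hc.g_horiz x hx hσ hR v₂ h2).1
  rw [inv_mul_le_iff₀ (by positivity)] at h3
  refine h3.trans ?_
  have := sq_nonneg (g.norm x v₁)
  gcongr; linarith

/-- The vertical part contributes √δ and the horizontal part δ ≤ √δ. -/
lemma Conditions.abs_le_of_pos (hc : Conditions L g μ Brg b W R γ ζ σ δ K)
    (ht : IsTuple Ω μ Brg b W R γ ζ σ δ K) (hx : μ x ∈ W) (hr : 0 < ‖ζ (μ x)‖)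
    (hσ : ‖ζ (μ x)‖ ≤ σ) (v : TangentSpace (𝓡 4) x) : |γ x v| ≤ 2 * √δ * g.norm x v := by
  have hδ := ht.δ_pos
  have hR : ‖ζ (μ x)‖ < 3 * R := by linarith [ht.σ_lt, ht.R_pos]
  obtain ⟨v₁, h1, v₂, h2, rfl, hsq⟩ := exists_orthogonal_decomposition g μ v
  have h4 := (hc.γ_horiz x hx hr hR v₂ h2).1
  have h5 := hc.γ_vert_small x hx (ht.regular ⟨hx, ht.ne_of_pos hr⟩) hσ v₁ h1
  have hs : √δ ^ 2 = δ := Real.sq_sqrt hδ.le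
  have hs1 : δ ≤ √δ := by
    rw [Real.le_sqrt hδ.le hδ.le]; nlinarith [ht.δ_lt]
  have h6 : |γ x v₁| ≤ √δ * g.norm x v₁ := by
    refine abs_le_of_sq_le_sq ?_ (by have := g.norm_nonneg x v₁; positivity)
    rw [mul_pow, hs]; exact h5
  have hle : ∀ n, 0 ≤ n → n ^ 2 ≤ g.norm x (v₁ + v₂) ^ 2 → n ≤ g.norm x (v₁ + v₂) := fun n hn h =>
    le_of_sq_le_sq h (g.norm_nonneg _ _)
  have h7 := hle _ (g.norm_nonneg x v₁) (by nlinarith)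
  have h8 := hle _ (g.norm_nonneg x v₂) (by nlinarith)
  rw [map_add]
  calc |γ x v₁ + γ x v₂| ≤ |γ x v₁| + |γ x v₂| := abs_add_le _ _
    _ ≤ √δ * g.norm x (v₁ + v₂) + √δ * g.norm x (v₁ + v₂) := by
        refine add_le_add (h6.trans (by gcongr)) (h4.trans (mul_le_mul hs1 h8 (g.norm_nonneg _ _)
          (Real.sqrt_nonneg _)))
    _ = _ := by ring

/-- The bounds on γ are only assumed over r > 0. They extend to X_b by continuity, because X_b has
measure zero by the volume condition and its complement is therefore dense. -/
lemma Conditions.abs_le_of_le (hc : Conditions L g μ Brg b W R γ ζ σ δ K)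
    (ht : IsTuple Ω μ Brg b W R γ ζ σ δ K) (hf : IsFibration Ω μ Brg) (hx : μ x ∈ W)
    (hσ : ‖ζ (μ x)‖ ≤ σ) (v : TangentSpace (𝓡 4) x) : |γ x v| ≤ 2 * √δ * g.norm x v := by
  rcases (norm_nonneg (ζ (μ x))).eq_or_lt with h0 | hr
  swap
  · exact hc.abs_le_of_pos ht hx hr hσ v
  have hU : IsOpen (μ ⁻¹' W) := ht.isOpen.preimage hf.smooth.continuous
  have hxb : μ x = b := ht.eq_of_ζ_eq_zero hx (norm_eq_zero.1 h0.symm)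
  have hcl : x ∈ closure {y | μ y ≠ b} := by
    obtain ⟨ν, hν, hvol⟩ := hc.volume
    have h1 := (hvol {0} (by simp [ht.R_pos]) (measurableSet_singleton 0)).2
    simp only [measure_singleton, mul_zero, nonpos_iff_eq_zero, mul_eq_zero, ENNReal.ofReal_eq_zero,
      not_le.2 ht.K_pos, false_or] at h1
    by_contra hcl
    refine hν.ne_zero_of_isOpen (O := (closure {y | μ y ≠ b})ᶜ) isClosed_closure.isOpen_compl
      ⟨x, hcl⟩ (measure_mono_null (fun y hy => ?_) h1)
    have hyb : μ y = b := by
      by_contra h; exact hy (subset_closure h)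
    exact ⟨hyb ▸ ht.mem, by rw [hyb, ht.ζ_b]; rfl⟩
  have hxs := mem_chart_source Four x
  set a := chartDeriv x x v with ha
  have hva : chartField x a x = v := chartField_mfderiv hxs v
  have hV := smoothFieldAt_chartField hxs a
  have hc1 : ContinuousAt (fun y => |γ y (chartField x a y)|) x :=
    ((ht.smooth_γ.evalSmoothOn hU x hx _ hV).continuousAt).abs
  have hc2 : ContinuousAt (fun y => 2 * √δ * g.norm y (chartField x a y)) x :=
    continuousAt_const.mul (Real.continuous_sqrt.continuousAt.comp
      (g.contMDiffAt_inner hV hV).continuousAt)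
  have hne : (𝓝[{y | μ y ≠ b}] x).NeBot := mem_closure_iff_nhdsWithin_neBot.1 hcl
  have key := le_of_tendsto_of_tendsto (b := 𝓝[{y | μ y ≠ b}] x)
    (hc1.tendsto.mono_left nhdsWithin_le_nhds)
    (hc2.tendsto.mono_left nhdsWithin_le_nhds) (by
      have h2 : ContinuousAt (fun y => ‖ζ (μ y)‖) x :=
        ((ht.continuous_ζ.continuousAt (ht.isOpen.mem_nhds hx)).comp
          hf.smooth.continuous.continuousAt).norm
      filter_upwards [nhdsWithin_le_nhds (hU.mem_nhds hx), self_mem_nhdsWithin,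
        nhdsWithin_le_nhds (h2.eventually (Iio_mem_nhds (h0 ▸ ht.σ_pos)))] with y hy hyb hyσ
      exact hc.abs_le_of_pos ht hy (norm_pos_iff.2 (ht.ζ_ne_zero hy hyb)) (le_of_lt hyσ) _)
  simp only [hva] at key
  exact key

/-- A crude bound for γ on the whole region: √(1+δ) · 3R ≤ 6R from the vertical part, at most 1 from
the horizontal part, and at most 2 in the core. -/
lemma Conditions.abs_le (hc : Conditions L g μ Brg b W R γ ζ σ δ K)
    (ht : IsTuple Ω μ Brg b W R γ ζ σ δ K) (hf : IsFibration Ω μ Brg) (hx : μ x ∈ W)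
    (hR : ‖ζ (μ x)‖ < 3 * R) (v : TangentSpace (𝓡 4) x) :
    |γ x v| ≤ (6 * R + 2) * g.norm x v := by
  have hδ := ht.δ_pos
  have hR0 := ht.R_pos
  have hδ1 := ht.δ_lt
  have hn := g.norm_nonneg x v
  rcases le_total ‖ζ (μ x)‖ σ with hσ | hσ
  · refine (hc.abs_le_of_le ht hf hx hσ v).trans ?_
    gcongr
    have : √δ ≤ 1 := Real.sqrt_le_one.2 hδ1.le
    linarith
  obtain ⟨v₁, h1, v₂, h2, rfl, hsq⟩ := exists_orthogonal_decomposition g μ v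
  have h4 := (hc.γ_horiz x hx (ht.σ_pos.trans_le hσ) hR v₂ h2).1
  have h5 := (hc.γ_vert x hx hσ hR).2 v₁ h1
  have hle : ∀ n, 0 ≤ n → n ^ 2 ≤ g.norm x (v₁ + v₂) ^ 2 → n ≤ g.norm x (v₁ + v₂) := fun n hn h =>
    le_of_sq_le_sq h (g.norm_nonneg _ _)
  have h7 := hle _ (g.norm_nonneg x v₁) (by nlinarith)
  have h8 := hle _ (g.norm_nonneg x v₂) (by nlinarith)
  have hn1 := g.norm_nonneg x v₁
  have hn2 := g.norm_nonneg x v₂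
  have h6 : |γ x v₁| ≤ 6 * R * g.norm x v₁ := by
    refine abs_le_of_sq_le_sq (h5.trans ?_) (by positivity)
    rw [mul_pow]
    gcongr
    have : ‖ζ (μ x)‖ ^ 2 ≤ (3 * R) ^ 2 := pow_le_pow_left₀ (norm_nonneg _) hR.le 2
    nlinarith [sq_nonneg ‖ζ (μ x)‖]
  rw [map_add]
  calc |γ x v₁ + γ x v₂| ≤ |γ x v₁| + |γ x v₂| := abs_add_le _ _
    _ ≤ 6 * R * g.norm x (v₁ + v₂) + 1 * g.norm x (v₁ + v₂) := by
        refine add_le_add (h6.trans (by gcongr)) (h4.trans (by gcongr))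
    _ ≤ _ := by nlinarith

/-- The choice l = aG/(1+G²) minimizes (a - lG)² + l², with minimum a²/(1+G²). Here G is the value
of γ on a unit vertical vector and q its value on the horizontal part, which only enters as an
error. Both coefficients come out as (1+δ)², and 1 + 4δ - (1+δ)² = δ(2-δ) ≥ 0. -/
lemma lift_cost_le {δ a G q n k r : ℝ} (hδ : 0 < δ) (hδ1 : δ < 1) (hq : q ^ 2 ≤ δ ^ 2 * k ^ 2)
    (h3 : n ^ 2 ≤ (1 + δ) * k ^ 2) (hγe : (1 + δ)⁻¹ * r ^ 2 ≤ G ^ 2) :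
    (a - (a * G / (1 + G ^ 2) * G + q)) ^ 2 + (a * G / (1 + G ^ 2)) ^ 2 + n ^ 2
      ≤ (1 + 4 * δ) * (a ^ 2 / (1 + r ^ 2) + k ^ 2) := by
  set l := a * G / (1 + G ^ 2)
  have hG : 0 < 1 + G ^ 2 := by positivity
  have e1 : a - (l * G + q) = a / (1 + G ^ 2) - q := by
    simp only [l]; field_simp; ring
  have e2 : l ^ 2 + (a / (1 + G ^ 2)) ^ 2 = a ^ 2 / (1 + G ^ 2) := by
    simp only [l]; field_simp; ring
  have h7 : a ^ 2 / (1 + G ^ 2) ≤ (1 + δ) * (a ^ 2 / (1 + r ^ 2)) := by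
    rw [inv_mul_le_iff₀ (by positivity)] at hγe
    have : 1 + r ^ 2 ≤ (1 + δ) * (1 + G ^ 2) := by nlinarith
    rw [← mul_div_assoc, div_le_div_iff₀ hG (by positivity)]
    nlinarith [sq_nonneg a]
  rw [e1]
  set p := a / (1 + G ^ 2)
  have h8 : (p - q) ^ 2 ≤ (1 + δ) * p ^ 2 + (δ ^ 2 + δ) * k ^ 2 := by
    have h9 : -(2 * p * q) ≤ δ * p ^ 2 + q ^ 2 / δ := by
      have : 0 ≤ (δ * p + q) ^ 2 / δ := by positivity
      have e3 : (δ * p + q) ^ 2 / δ = δ * p ^ 2 + 2 * p * q + q ^ 2 / δ := by field_simp; ring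
      linarith
    have h10 : q ^ 2 / δ ≤ δ * k ^ 2 := by rw [div_le_iff₀ hδ]; linarith
    nlinarith
  have h11 : 0 ≤ a ^ 2 / (1 + r ^ 2) := by positivity
  have h12 : (1 + δ) * p ^ 2 + l ^ 2 ≤ (1 + δ) * ((1 + δ) * (a ^ 2 / (1 + r ^ 2))) := by
    have : (1 + δ) * p ^ 2 + l ^ 2 ≤ (1 + δ) * (a ^ 2 / (1 + G ^ 2)) := by
      rw [← e2]; nlinarith [sq_nonneg l]
    exact this.trans (by gcongr)
  have h13 : 0 ≤ δ * (2 - δ) * (a ^ 2 / (1 + r ^ 2)) := by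
    have : 0 ≤ 2 - δ := by linarith
    positivity
  have h14 : 0 ≤ δ * (2 - δ) * k ^ 2 := by
    have : 0 ≤ 2 - δ := by linarith
    positivity
  nlinarith [h13, h14, h12, h8, h3]

/-- Tangent vectors of the model can be lifted to vectors which are not much longer. -/
lemma Conditions.exists_lift_vector (hc : Conditions L g μ Brg b W R γ ζ σ δ K)
    (ht : IsTuple Ω μ Brg b W R γ ζ σ δ K) (hf : IsFibration Ω μ Brg) (hx : μ x ∈ W)
    (hσ : σ ≤ ‖ζ (μ x)‖) (hR : ‖ζ (μ x)‖ < 3 * R) (a : ℝ) (h : Plane) :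
    ∃ v, mvfderiv (𝓡 4) (ζ ∘ μ) x v = h ∧
      (a - γ x v) ^ 2 + g.norm x v ^ 2 ≤ (1 + 4 * δ) * (a ^ 2 / (1 + ‖ζ (μ x)‖ ^ 2) + ‖h‖ ^ 2) := by
  have hr : 0 < ‖ζ (μ x)‖ := ht.σ_pos.trans_le hσ
  have hδ := ht.δ_pos
  have hδ1 := ht.δ_lt
  have hζ := ht.mdifferentiableAt_ζ hx hr
  have hμ := hf.mdifferentiableAt x
  obtain ⟨w, hw⟩ : ∃ w, mvfderiv (𝓡 4) (ζ ∘ μ) x w = h := by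
    obtain ⟨w', hw'⟩ := (ht.local_diffeo_ζ (μ x) ⟨hx, ht.ne_of_pos hr⟩).surjective h
    obtain ⟨w, rfl⟩ := hf.regular x (ht.regular ⟨hx, ht.ne_of_pos hr⟩) w'
    refine ⟨w, ?_⟩
    exact (mfderiv_comp_apply x hζ hμ w).trans hw'
  obtain ⟨w₁, hw₁, v₂, h2, rfl, -⟩ := exists_orthogonal_decomposition g μ w
  rw [mvfderiv_add_vert hζ hμ hw₁] at hw
  -- A unit vertical vector on which γ has almost the size r.
  obtain ⟨e, he, he1, hγe⟩ := (hc.γ_vert x hx hσ hR).1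
  have h3 := (hc.g_horiz x hx hσ hR v₂ h2).2
  have h4 := (hc.γ_horiz x hx hr hR v₂ h2).2
  have hb : baseNorm μ ζ x v₂ = ‖h‖ := by rw [← hw]; rfl
  rw [hb] at h3 h4
  set G := γ x e
  set l := a * G / (1 + G ^ 2)
  have hle : l • e ∈ vert μ x := by
    change mfderiv (𝓡 4) (𝓡 2) μ x (l • e) = 0
    rw [map_smul, show mfderiv (𝓡 4) (𝓡 2) μ x e = 0 from he, smul_zero]
  refine ⟨l • e + v₂, by rw [mvfderiv_add_vert hζ hμ hle, hw], ?_⟩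
  have hsq : g.norm x (l • e + v₂) ^ 2 = l ^ 2 + g.norm x v₂ ^ 2 := by
    have h5 := h2 _ hle
    have h6 : g.inner x (l • e) (l • e) = l ^ 2 * g.inner x e e := by
      rw [map_smul, map_smul]
      change l * (l * g.inner x e e) = _
      ring
    simp only [Metric.norm_sq]
    rw [map_add, map_add]
    change g.inner x (l • e) (l • e) + g.inner x v₂ (l • e)
      + (g.inner x (l • e) v₂ + g.inner x v₂ v₂) = _
    rw [g.symm x (l • e) v₂, h5, h6, ← g.norm_sq x e, he1]; ring
  rw [hsq, map_add, map_smul, smul_eq_mul]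
  have hq : γ x v₂ ^ 2 ≤ δ ^ 2 * ‖h‖ ^ 2 := by
    rw [← mul_pow, ← sq_abs]; exact pow_le_pow_left₀ (abs_nonneg _) h4 2
  have hl := lift_cost_le hδ hδ1 (a := a) hq h3 hγe
  rw [add_assoc]  at hl
  exact hl

end Pointwise


/-! ### Curves of bounded length stay in the fibration -/

section Escape

lemma PiecewiseC1On.reverse {E H M : Type*} [NormedAddCommGroup E] [NormedSpace ℝ E]
    [TopologicalSpace H] {I : ModelWithCorners ℝ E H} [TopologicalSpace M] [ChartedSpace H M]
    {c : ℝ → M} {a b : ℝ} (h : PiecewiseC1On I c a b) :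
    PiecewiseC1On I (fun t => c (a + b - t)) a b :=
  PiecewiseC1On.comp_sub (a + b) (by convert h using 1 <;> ring)

lemma lengthOn_reverse {E H M : Type*} [NormedAddCommGroup E] [NormedSpace ℝ E]
    [TopologicalSpace H] {I : ModelWithCorners ℝ E H} [TopologicalSpace M] [ChartedSpace H M]
    {N : (x : M) → TangentSpace I x → ℝ} (hN : Homogeneous N)
    {c : ℝ → M} {a b : ℝ} (h : PiecewiseC1On I c a b) :
    lengthOn I N (fun t => c (a + b - t)) a b = lengthOn I N c a b := by
  have himg : (fun t : ℝ => (-1) * t + (a + b)) '' Icc a b = Icc a b := by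
    ext t; constructor
    · rintro ⟨s, hs, rfl⟩; constructor <;> simp only <;> linarith [hs.1, hs.2]
    · intro ht; exact ⟨a + b - t, ⟨by linarith [ht.2], by linarith [ht.1]⟩, by ring⟩
  rw [← lengthOn_comp_mul_add hN (neg_ne_zero.2 one_ne_zero) h himg]
  congr 1; ext t; congr 1; ring

variable {X : Type*} [TopologicalSpace X] [ChartedSpace Four X] [IsManifold (𝓡 4) ∞ X]

lemma enorm_comp_sub_le {E : Type*} [NormedAddCommGroup E] [NormedSpace ℝ E] {G : X → E}
    {A : Set X} (g : Metric X) {k : ℝ} (hk0 : 0 ≤ k) (hG : ∀ x ∈ A, ContMDiffAt (𝓡 4) 𝓘(ℝ, E) 1 G x)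
    (hk : ∀ x ∈ A, ∀ v, ‖mvfderiv (𝓡 4) G x v‖ ≤ k * g.norm x v) {c : ℝ → X} {a b : ℝ}
    (hc : PiecewiseC1On (𝓡 4) c a b) (hA : MapsTo c (Icc a b) A) :
    ‖G (c b) - G (c a)‖ₑ ≤ ENNReal.ofReal k * lengthOn (𝓡 4) g.norm c a b := by
  have h1 : PiecewiseC1On 𝓘(ℝ, E) (fun t => G (c t)) a b :=
    hc.comp (fun x hx => (hG x hx).contMDiffWithinAt) hA
  refine h1.enorm_sub_le.trans ?_
  rw [lengthOn, ← lintegral_const_mul' _ _ ENNReal.ofReal_ne_top]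
  refine lintegral_mono_ae ?_
  rw [ae_restrict_iff' measurableSet_Icc]
  filter_upwards [hc.ae_contMDiffAt] with t ht htI
  rw [(hasDerivAt_comp_velocity ((hG _ (hA htI)).mdifferentiableAt (by simp))
    ((ht htI).2.mdifferentiableAt (by simp))).deriv, ← ENNReal.ofReal_mul hk0,
    ← ofReal_norm]
  exact ENNReal.ofReal_le_ofReal (hk _ (hA htI) _)

variable {B : Type*} [TopologicalSpace B] [T2Space B] [ChartedSpace Plane B]
  {Ω : TwoTensor X} {g : Metric X} {μ : X → B} {Brg : Set B} {b : B} {W : Set B} {R : ℝ}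
  {γ : OneForm X} {ζ : B → Plane} {σ δ K ρ ℓ : ℝ} {x : X}
  {L : X → Type*} [TopologicalSpace (TotalSpace ℂ L)] [∀ x, NormedAddCommGroup (L x)]
  [∀ x, InnerProductSpace ℂ (L x)] [FiberBundle ℂ L] [VectorBundle ℝ ℂ L] [VectorBundle ℂ ℂ L]
  [ContMDiffVectorBundle ∞ ℂ L (𝓡 4)] {c : ℝ → X} {t₀ t₁ : ℝ}

lemma IsTuple.continuousOn_norm (ht : IsTuple Ω μ Brg b W R γ ζ σ δ K) (hf : IsFibration Ω μ Brg) :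
    ContinuousOn (fun x => ‖ζ (μ x)‖) (μ ⁻¹' W) :=
  (ht.continuous_ζ.comp hf.smooth.continuous.continuousOn (mapsTo_preimage _ _)).norm

lemma Conditions.norm_mvfderiv_le (hc : Conditions L g μ Brg b W R γ ζ σ δ K)
    (ht : IsTuple Ω μ Brg b W R γ ζ σ δ K) (hf : IsFibration Ω μ Brg) (hx : μ x ∈ W)
    (hσ : σ ≤ ‖ζ (μ x)‖) (hR : ‖ζ (μ x)‖ < 3 * R) (v : TangentSpace (𝓡 4) x) :
    ‖mvfderiv (𝓡 4) (ζ ∘ μ) x v‖ ≤ √(1 + δ) * g.norm x v := by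
  have hδ := ht.δ_pos
  refine le_of_sq_le_sq ?_ (mul_nonneg (Real.sqrt_nonneg _) (g.norm_nonneg _ _))
  rw [mul_pow, Real.sq_sqrt (by linarith)]
  exact hc.baseNorm_sq_le ht hf hx hσ hR v

/-- After the last time at which r ≤ ρ, the curve stays outside the core, where ζ ∘ μ is Lipschitz
with constant √(1+δ). -/
lemma Conditions.norm_le_of_mapsTo (hc : Conditions L g μ Brg b W R γ ζ σ δ K)
    (ht : IsTuple Ω μ Brg b W R γ ζ σ δ K) (hf : IsFibration Ω μ Brg)
    (hcp : PiecewiseC1On (𝓡 4) c t₀ t₁) (hρ : ‖ζ (μ (c t₀))‖ ≤ ρ) (hσ : σ ≤ ρ) (hℓ0 : 0 ≤ ℓ)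
    (hℓ : lengthOn (𝓡 4) g.norm c t₀ t₁ ≤ ENNReal.ofReal ℓ)
    (hA : ∀ t ∈ Icc t₀ t₁, μ (c t) ∈ W ∧ ‖ζ (μ (c t))‖ < 3 * R) :
    ‖ζ (μ (c t₁))‖ ≤ ρ + √(1 + δ) * ℓ := by
  have hδ := ht.δ_pos
  rcases le_or_gt ‖ζ (μ (c t₁))‖ ρ with h1 | h1
  · have : 0 ≤ √(1 + δ) * ℓ := by positivity
    linarith
  have hcont : ContinuousOn (fun t => ‖ζ (μ (c t))‖) (Icc t₀ t₁) :=
    (ht.continuousOn_norm hf).comp hcp.continuousOn fun t h => (hA t h).1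
  obtain ⟨τ, hτ⟩ := (((isCompact_Icc (a := t₀) (b := t₁)).of_isClosed_subset
    (hcont.preimage_isClosed_of_isClosed isClosed_Icc (isClosed_Iic (a := ρ)))
    inter_subset_left)).exists_isGreatest ⟨t₀, ⟨le_rfl, hcp.le⟩, hρ⟩
  have hτI := hτ.1.1
  obtain ⟨τ', hτ', hτ'ρ⟩ := intermediate_value_Icc hτI.2 (hcont.mono (Icc_subset_Icc_left hτI.1))
    ⟨hτ.1.2, h1.le⟩
  have hττ : τ' = τ := le_antisymm (hτ.2 ⟨⟨hτI.1.trans hτ'.1, hτ'.2⟩, hτ'ρ.le⟩) hτ'.1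
  rw [hττ] at hτ'ρ
  simp only at hτ'ρ
  have hbig : ∀ t ∈ Icc τ t₁, σ ≤ ‖ζ (μ (c t))‖ := by
    intro t htI
    rcases htI.1.eq_or_lt with rfl | h2
    · rw [hτ'ρ]; exact hσ
    · by_contra! h3
      exact absurd (hτ.2 ⟨⟨hτI.1.trans htI.1, htI.2⟩, (h3.le.trans hσ : _ ≤ ρ)⟩) (not_le.2 h2)
  have h2 := enorm_comp_sub_le (G := ζ ∘ μ) (A := {x | μ x ∈ W ∧ σ ≤ ‖ζ (μ x)‖ ∧ ‖ζ (μ x)‖ < 3 * R}) g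
    (Real.sqrt_nonneg (1 + δ))
    (fun x hx => (ht.contMDiffAt_comp hf hx.1 (ht.σ_pos.trans_le hx.2.1)).of_le (by simp))
    (fun x hx v => hc.norm_mvfderiv_le ht hf hx.1 hx.2.1 hx.2.2 v) (hcp.mono hτI.1 hτI.2 le_rfl)
    (fun t htI => ⟨(hA t ⟨hτI.1.trans htI.1, htI.2⟩).1, hbig t htI,
      (hA t ⟨hτI.1.trans htI.1, htI.2⟩).2⟩)
  have h3 : ‖ζ (μ (c t₁)) - ζ (μ (c τ))‖ₑ ≤ ENNReal.ofReal (√(1 + δ) * ℓ) := by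
    refine h2.trans ?_
    rw [ENNReal.ofReal_mul (Real.sqrt_nonneg _)]
    gcongr
    exact (lengthOn_mono hτI.1 le_rfl).trans hℓ
  rw [← ofReal_norm, ENNReal.ofReal_le_ofReal_iff (by positivity)] at h3
  have := norm_le_norm_add_norm_sub (ζ (μ (c τ))) (ζ (μ (c t₁)))
  rw [hτ'ρ, norm_sub_rev] at this
  linarith

/-- The region r ≤ ρ₁ with ρ₁ < 3R is closed in all of X, since the ball of radius 3R is contained
in ζ(W). At the first time outside the open region r < ρ₁ the curve would still be in this closed
region, and the growth estimate puts it back strictly inside. -/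
lemma Conditions.mem_of_length_le (hc : Conditions L g μ Brg b W R γ ζ σ δ K)
    (ht : IsTuple Ω μ Brg b W R γ ζ σ δ K) (hf : IsFibration Ω μ Brg)
    (hcp : PiecewiseC1On (𝓡 4) c t₀ t₁) (hW : μ (c t₀) ∈ W) (hρ : ‖ζ (μ (c t₀))‖ ≤ ρ) (hσ : σ ≤ ρ)
    (hℓ0 : 0 ≤ ℓ) (hℓ : lengthOn (𝓡 4) g.norm c t₀ t₁ ≤ ENNReal.ofReal ℓ)
    (hR : ρ + √(1 + δ) * ℓ < 3 * R) :
    ∀ t ∈ Icc t₀ t₁, μ (c t) ∈ W ∧ ‖ζ (μ (c t))‖ ≤ ρ + √(1 + δ) * ℓ := by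
  obtain ⟨ρ₁, h1, h2⟩ := exists_between hR
  have hU : IsOpen (μ ⁻¹' W) := ht.isOpen.preimage hf.smooth.continuous
  have hopen : IsOpen {x | μ x ∈ W ∧ ‖ζ (μ x)‖ < ρ₁} :=
    (ht.continuousOn_norm hf).isOpen_inter_preimage hU isOpen_Iio
  have hclosed : IsCompact {w ∈ W | ζ w ∈ Metric.closedBall 0 ρ₁} :=
    ht.isCompact_closedBall hc.ball_subset Metric.isClosed_closedBall
      (Metric.closedBall_subset_closedBall h2.le)
  have hclosed' : IsClosed {x | μ x ∈ W ∧ ‖ζ (μ x)‖ ≤ ρ₁} := by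
    have := hclosed.isClosed.preimage hf.smooth.continuous
    simpa [preimage, mem_closedBall_zero_iff] using this
  have key : ∀ t ∈ Icc t₀ t₁, (∀ τ ∈ Icc t₀ t, μ (c τ) ∈ W ∧ ‖ζ (μ (c τ))‖ ≤ ρ₁) →
      ‖ζ (μ (c t))‖ ≤ ρ + √(1 + δ) * ℓ := fun t htI hA =>
    hc.norm_le_of_mapsTo ht hf (hcp.mono le_rfl htI.1 htI.2) hρ hσ hℓ0
      ((lengthOn_mono le_rfl htI.2).trans hℓ) fun τ hτ => ⟨(hA τ hτ).1, (hA τ hτ).2.trans_lt h2⟩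
  have hall : ∀ t ∈ Icc t₀ t₁, μ (c t) ∈ W ∧ ‖ζ (μ (c t))‖ < ρ₁ := by
    by_contra! hcon
    obtain ⟨t', ht', hbad'⟩ := hcon
    have hbadc : IsClosed (Icc t₀ t₁ ∩ c ⁻¹' {x | μ x ∈ W ∧ ‖ζ (μ x)‖ < ρ₁}ᶜ) :=
      hcp.continuousOn.preimage_isClosed_of_isClosed isClosed_Icc hopen.isClosed_compl
    obtain ⟨τ, hτ⟩ := (isCompact_Icc.of_isClosed_subset hbadc inter_subset_left).exists_isLeast
      ⟨t', ht', fun h => absurd h.2 (not_lt.2 (hbad' h.1))⟩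
    have hτI := hτ.1.1
    have hbefore : ∀ s ∈ Icc t₀ τ, s ≠ τ → μ (c s) ∈ W ∧ ‖ζ (μ (c s))‖ < ρ₁ := by
      intro s hs hne
      by_contra h
      exact hne (le_antisymm hs.2 (hτ.2 ⟨⟨hs.1, hs.2.trans hτI.2⟩, h⟩))
    have hlt : t₀ < τ := by
      rcases hτI.1.eq_or_lt with h | h
      · exfalso
        refine hτ.1.2 ?_
        rw [← h]
        refine ⟨hW, lt_of_le_of_lt hρ (lt_of_le_of_lt ?_ h1)⟩
        have : 0 ≤ √(1 + δ) * ℓ := by positivity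
        linarith
      · exact h
    have hτmem : c τ ∈ {x | μ x ∈ W ∧ ‖ζ (μ x)‖ ≤ ρ₁} := by
      have h3 : Tendsto c (𝓝[Ico t₀ τ] τ) (𝓝 (c τ)) :=
        ((hcp.continuousOn τ hτI).mono fun s hs => ⟨hs.1, hs.2.le.trans hτI.2⟩).tendsto
      have h4 : (𝓝[Ico t₀ τ] τ).NeBot := by
        rw [nhdsWithin_Ico_eq_nhdsLT hlt]; infer_instance
      refine hclosed'.mem_of_tendsto h3 ?_
      filter_upwards [self_mem_nhdsWithin] with s hs
      have := hbefore s ⟨hs.1, hs.2.le⟩ hs.2.ne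
      exact ⟨this.1, this.2.le⟩
    refine hτ.1.2 ⟨hτmem.1, lt_of_le_of_lt (key τ hτI fun s hs => ?_) h1⟩
    by_cases hne : s = τ
    · rw [hne]; exact hτmem
    · exact ⟨(hbefore s hs hne).1, (hbefore s hs hne).2.le⟩
  exact fun t htI => ⟨(hall t htI).1, key t htI fun τ hτ =>
    ⟨(hall τ ⟨hτ.1, hτ.2.trans htI.2⟩).1, (hall τ ⟨hτ.1, hτ.2.trans htI.2⟩).2.le⟩⟩

lemma Conditions.mem_of_length_le_right (hc : Conditions L g μ Brg b W R γ ζ σ δ K)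
    (ht : IsTuple Ω μ Brg b W R γ ζ σ δ K) (hf : IsFibration Ω μ Brg)
    (hcp : PiecewiseC1On (𝓡 4) c t₀ t₁) (hW : μ (c t₁) ∈ W) (hρ : ‖ζ (μ (c t₁))‖ ≤ ρ) (hσ : σ ≤ ρ)
    (hℓ0 : 0 ≤ ℓ) (hℓ : lengthOn (𝓡 4) g.norm c t₀ t₁ ≤ ENNReal.ofReal ℓ)
    (hR : ρ + √(1 + δ) * ℓ < 3 * R) :
    ∀ t ∈ Icc t₀ t₁, μ (c t) ∈ W ∧ ‖ζ (μ (c t))‖ ≤ ρ + √(1 + δ) * ℓ := by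
  intro t htI
  have h1 : t₀ + t₁ - t₀ = t₁ := by ring
  have := hc.mem_of_length_le ht hf hcp.reverse (by simpa only [h1] using hW)
    (by simpa only [h1] using hρ) hσ hℓ0 (by rwa [lengthOn_reverse g.homogeneous_norm hcp]) hR
    (t₀ + t₁ - t) ⟨by linarith [htI.2], by linarith [htI.1]⟩
  simpa only [sub_sub_cancel] using this

end Escape


/-! ### The retraction of the plane which collapses a disc -/

section Retraction

lemma contDiff_max_zero_sq : ContDiff ℝ 1 fun t : ℝ => max t 0 ^ 2 := by
  have h : ∀ t : ℝ, HasDerivAt (fun t : ℝ => max t 0 ^ 2) (2 * max t 0) t := by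
    intro t
    rcases lt_trichotomy t 0 with ht | rfl | ht
    · rw [max_eq_right ht.le, mul_zero]
      refine (hasDerivAt_const t (0 : ℝ)).congr_of_eventuallyEq ?_
      filter_upwards [Iio_mem_nhds ht] with s hs
      rw [max_eq_right (le_of_lt hs)]; norm_num
    · rw [max_self, mul_zero, hasDerivAt_iff_hasFDerivAt]
      have h1 : (fun t : ℝ => max t 0 ^ 2) =O[𝓝 0] fun t => ‖t - 0‖ ^ 2 := by
        refine Asymptotics.IsBigO.of_bound 1 (Eventually.of_forall fun t => ?_)
        rw [one_mul, sub_zero, norm_pow, norm_pow, norm_norm]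
        refine pow_le_pow_left₀ (norm_nonneg _) ?_ 2
        rw [Real.norm_eq_abs, Real.norm_eq_abs, abs_of_nonneg (le_max_right _ _)]
        exact max_le (le_abs_self t) (abs_nonneg t)
      have h2 : HasFDerivAt (fun t : ℝ => max t 0 ^ 2) (0 : ℝ →L[ℝ] ℝ) 0 := h1.hasFDerivAt one_lt_two
      have h3 : ContinuousLinearMap.toSpanSingleton ℝ (0 : ℝ) = (0 : ℝ →L[ℝ] ℝ) := by ext; simp
      rw [h3]; exact h2
    · rw [max_eq_left ht.le]
      have h1 := (hasDerivAt_id t).pow 2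
      refine (h1.congr_deriv (by simp)).congr_of_eventuallyEq ?_
      filter_upwards [Ioi_mem_nhds ht] with s hs
      rw [max_eq_left (le_of_lt (mem_Ioi.1 hs))]; rfl
  rw [contDiff_one_iff_deriv]
  refine ⟨fun t => (h t).differentiableAt, ?_⟩
  rw [funext fun t => (h t).deriv]
  fun_prop

variable {E : Type*} [NormedAddCommGroup E] [InnerProductSpace ℝ E] {σ : ℝ}

/-- A `C¹` map of a Euclidean space which is constant on the ball of radius `σ`, does not increase
distances and moves points by at most `2 σ`. -/
def collapse (σ : ℝ) (ξ : E) : E := (max (1 - σ / ‖ξ‖) 0 ^ 2) • ξ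

lemma collapse_of_le {ξ : E} (h : ‖ξ‖ ≤ σ) : collapse σ ξ = 0 := by
  rcases eq_or_ne ξ 0 with rfl | h0
  · simp [collapse]
  · have : 1 - σ / ‖ξ‖ ≤ 0 := by
      rw [sub_nonpos, one_le_div (norm_pos_iff.2 h0)]; exact h
    simp [collapse, max_eq_right this]

lemma collapse_of_ge (hσ : 0 < σ) {ξ : E} (h : σ ≤ ‖ξ‖) :
    collapse σ ξ = ((1 - σ / ‖ξ‖) ^ 2) • ξ := by
  have : 0 ≤ 1 - σ / ‖ξ‖ := by
    rw [sub_nonneg, div_le_one (hσ.trans_le h)]; exact h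
  rw [collapse, max_eq_left this]

lemma contDiff_collapse (hσ : 0 < σ) : ContDiff ℝ 1 (collapse σ : E → E) := by
  rw [contDiff_iff_contDiffAt]
  intro ξ
  rcases eq_or_ne ξ 0 with rfl | h0
  · refine (contDiffAt_const (c := (0 : E))).congr_of_eventuallyEq ?_
    filter_upwards [Metric.ball_mem_nhds (0 : E) hσ] with ξ hξ
    exact collapse_of_le (mem_ball_zero_iff.1 hξ).le
  · exact (contDiff_max_zero_sq.contDiffAt.comp ξ (contDiffAt_const.sub
      (contDiffAt_const.div (contDiffAt_norm ℝ h0) (norm_ne_zero_iff.2 h0)))).smul contDiffAt_id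

lemma norm_sub_collapse_le (hσ : 0 < σ) (ξ : E) : ‖ξ - collapse σ ξ‖ ≤ 2 * σ := by
  rcases le_total ‖ξ‖ σ with h | h
  · rw [collapse_of_le h, sub_zero]; linarith
  · have hr := hσ.trans_le h
    rw [collapse_of_ge hσ h, show ∀ k : ℝ, ξ - k • ξ = (1 - k) • ξ from fun k => by rw [sub_smul, one_smul], norm_smul, Real.norm_eq_abs]
    have h1 : σ / ‖ξ‖ ≤ 1 := (div_le_one hr).2 h
    have h2 : 0 < σ / ‖ξ‖ := by positivity
    rw [abs_of_nonneg (by nlinarith)]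
    have h3 : σ / ‖ξ‖ * ‖ξ‖ = σ := by field_simp
    nlinarith

/-- In polar coordinates the map sends the radius a to a - 2σ + σ²/a, which is increasing with slope
at most 1 for a ≥ σ. The angular part is scaled by factors at most 1. -/
lemma norm_collapse_sub_le_aux (hσ : 0 < σ) {ξ η : E} (h : ‖η‖ ≤ ‖ξ‖) (hη : σ ≤ ‖η‖) :
    ‖collapse σ ξ - collapse σ η‖ ≤ ‖ξ - η‖ := by
  have hb := hσ.trans_le hη
  have ha := hb.trans_le h
  rw [collapse_of_ge hσ (hη.trans h), collapse_of_ge hσ hη]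
  refine le_of_sq_le_sq ?_ (norm_nonneg _)
  have h1 := real_inner_le_norm ξ η
  set p := 1 - σ / ‖ξ‖ with hp
  set q := 1 - σ / ‖η‖ with hq
  rw [norm_sub_sq_real, norm_sub_sq_real, real_inner_smul_left, real_inner_smul_right, norm_smul,
    norm_smul, Real.norm_of_nonneg (sq_nonneg p), Real.norm_of_nonneg (sq_nonneg q)]
  generalize inner ℝ ξ η = i at *
  have hp1 : p * ‖ξ‖ = ‖ξ‖ - σ := by rw [hp]; field_simp
  have hq1 : q * ‖η‖ = ‖η‖ - σ := by rw [hq]; field_simp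
  generalize ‖ξ‖ = a at *
  generalize ‖η‖ = b at *
  have hp0 : 0 ≤ p := by rw [hp, sub_nonneg, div_le_one ha]; exact hη.trans h
  have hq0 : 0 ≤ q := by rw [hq, sub_nonneg, div_le_one hb]; exact hη
  have hp2 : p ≤ 1 := by rw [hp]; have : 0 < σ / a := by positivity
                         linarith
  have hq2 : q ≤ 1 := by rw [hq]; have : 0 < σ / b := by positivity
                         linarith
  have hpq : p ^ 2 * q ^ 2 ≤ 1 := mul_le_one₀ (pow_le_one₀ hp0 hp2) (sq_nonneg _) (pow_le_one₀ hq0 hq2)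
  have hqp : q ≤ p := by
    rw [hp, hq]
    have : σ / a ≤ σ / b := by gcongr
    linarith
  have h2 : 0 ≤ p ^ 2 * a - q ^ 2 * b := by
    have : p ^ 2 * a = p * (a - σ) := by rw [← hp1]; ring
    have : q ^ 2 * b = q * (b - σ) := by rw [← hq1]; ring
    nlinarith
  have h3 : p ^ 2 * a - q ^ 2 * b ≤ a - b := by
    have e1 : p ^ 2 * a = a - σ - σ * p := by
      have : p ^ 2 * a = p * (a - σ) := by rw [← hp1]; ring
      rw [this, mul_sub, hp1]; ring
    have e2 : q ^ 2 * b = b - σ - σ * q := by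
      have : q ^ 2 * b = q * (b - σ) := by rw [← hq1]; ring
      rw [this, mul_sub, hq1]; ring
    rw [e1, e2]
    nlinarith
  have h4 : (p ^ 2 * a - q ^ 2 * b) ^ 2 ≤ (a - b) ^ 2 := pow_le_pow_left₀ h2 h3 2
  nlinarith [mul_le_mul_of_nonneg_left h1 (sub_nonneg.2 hpq)]

lemma norm_collapse_of_ge (hσ : 0 < σ) {ξ : E} (h : σ ≤ ‖ξ‖) :
    ‖collapse σ ξ‖ ≤ ‖ξ‖ - σ := by
  have ha := hσ.trans_le h
  rw [collapse_of_ge hσ h, norm_smul, Real.norm_of_nonneg (sq_nonneg _)]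
  have h1 : (1 - σ / ‖ξ‖) * ‖ξ‖ = ‖ξ‖ - σ := by field_simp
  rw [sq, mul_assoc, h1]
  have : 0 < σ / ‖ξ‖ := by positivity
  nlinarith

lemma norm_collapse_sub_le_of_norm_le (hσ : 0 < σ) {ξ η : E} (h : ‖η‖ ≤ ‖ξ‖) :
    ‖collapse σ ξ - collapse σ η‖ ≤ ‖ξ - η‖ := by
  rcases le_total σ ‖η‖ with hη | hη
  · exact norm_collapse_sub_le_aux hσ h hη
  · rw [collapse_of_le hη, sub_zero]
    rcases le_total ‖ξ‖ σ with hξ | hξ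
    · rw [collapse_of_le hξ, norm_zero]; exact norm_nonneg _
    · have := norm_sub_norm_le ξ η
      linarith [norm_collapse_of_ge hσ hξ]

lemma lipschitzWith_collapse (hσ : 0 < σ) : LipschitzWith 1 (collapse σ : E → E) := by
  refine LipschitzWith.of_dist_le_mul fun ξ η => ?_
  rw [NNReal.coe_one, one_mul, dist_eq_norm, dist_eq_norm]
  rcases le_total ‖η‖ ‖ξ‖ with h | h
  · exact norm_collapse_sub_le_of_norm_le hσ h
  · rw [norm_sub_rev, norm_sub_rev ξ]
    exact norm_collapse_sub_le_of_norm_le hσ h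

/-- Controls the change of the weight of the model when the radius changes by at most 2e. -/
lemma one_add_sq_le {r s e : ℝ} (he : 0 < e) (he1 : e ≤ 1) (hr : 0 ≤ r)
    (h : r ≤ s + 2 * e) : 1 + r ^ 2 ≤ (1 + 6 * e) * (1 + s ^ 2) := by
  have h1 : r ^ 2 ≤ (s + 2 * e) ^ 2 := pow_le_pow_left₀ hr h 2
  nlinarith [sq_nonneg (s - 1), mul_nonneg he.le (sq_nonneg (s - 1)), mul_nonneg he.le (sub_nonneg.2 he1)]

end Retraction

/-! ### Mapping curves of the circle bundle to the model. -/

section LowerBound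

variable {X : Type*} [TopologicalSpace X] [T2Space X] [ChartedSpace Four X] [IsManifold (𝓡 4) ∞ X]
  {B : Type*} [TopologicalSpace B] [T2Space B] [ChartedSpace Plane B]
  {Ω : TwoTensor X} {g : Metric X} {μ : X → B} {Brg : Set B} {b : B} {W : Set B} {R : ℝ}
  {γ : OneForm X} {ζ : B → Plane} {σ δ K ρ ℓ : ℝ} {x : X}
  {L : X → Type*} [TopologicalSpace (TotalSpace ℂ L)] [∀ x, NormedAddCommGroup (L x)]
  [∀ x, InnerProductSpace ℂ (L x)] [FiberBundle ℂ L] [VectorBundle ℝ ℂ L] [VectorBundle ℂ ℂ L]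
  [ContMDiffVectorBundle ∞ ℂ L (𝓡 4)] {nabla : CovariantDerivative (𝓡 4) ℂ L}
  {θ : TotalSpace ℂ L → Circle} {s : (x : X) → L x} {m : ℕ} {U : Set X}

/-- At b the map ζ is only continuous, but there the collapsing map is locally constant. -/
lemma IsTuple.contMDiffAt_collapse (ht : IsTuple Ω μ Brg b W R γ ζ σ δ K) (hf : IsFibration Ω μ Brg)
    (hx : μ x ∈ W) : ContMDiffAt (𝓡 4) 𝓘(ℝ, Plane) 1 (collapse σ ∘ (ζ ∘ μ)) x := by
  rcases (norm_nonneg (ζ (μ x))).eq_or_lt with h0 | hr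
  · have hU : IsOpen (μ ⁻¹' W) := ht.isOpen.preimage hf.smooth.continuous
    refine (contMDiffAt_const (c := (0 : Plane))).congr_of_eventuallyEq ?_
    have h1 := (ht.continuousOn_norm hf).continuousAt (hU.mem_nhds hx)
    filter_upwards [h1.eventually (Iio_mem_nhds (show ‖ζ (μ x)‖ < σ from h0 ▸ ht.σ_pos))] with y hy
    exact collapse_of_le (le_of_lt hy)
  · exact (contDiff_collapse ht.σ_pos).contMDiff.contMDiffAt.comp x
      ((ht.contMDiffAt_comp hf hx hr).of_le (by simp))

lemma IsTuple.mvfderiv_collapse_of_lt (ht : IsTuple Ω μ Brg b W R γ ζ σ δ K)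
    (hf : IsFibration Ω μ Brg) (hx : μ x ∈ W) (hσ : ‖ζ (μ x)‖ < σ) (v : TangentSpace (𝓡 4) x) :
    mvfderiv (𝓡 4) (collapse σ ∘ (ζ ∘ μ)) x v = 0 := by
  have hU : IsOpen (μ ⁻¹' W) := ht.isOpen.preimage hf.smooth.continuous
  have h1 := (ht.continuousOn_norm hf).continuousAt (hU.mem_nhds hx)
  have h2 : collapse σ ∘ (ζ ∘ μ) =ᶠ[𝓝 x] fun _ => 0 := by
    filter_upwards [h1.eventually (Iio_mem_nhds hσ)] with y hy
    exact collapse_of_le (le_of_lt hy)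
  have h3 : mvfderiv (𝓡 4) (collapse σ ∘ (ζ ∘ μ)) x = mvfderiv (𝓡 4) (fun _ : X => (0 : Plane)) x :=
    h2.mfderiv_eq
  rw [h3, mvfderiv_const]; rfl

lemma IsTuple.norm_mvfderiv_collapse_le (ht : IsTuple Ω μ Brg b W R γ ζ σ δ K)
    (hf : IsFibration Ω μ Brg) (hx : μ x ∈ W) (hr : 0 < ‖ζ (μ x)‖) (v : TangentSpace (𝓡 4) x) :
    ‖mvfderiv (𝓡 4) (collapse σ ∘ (ζ ∘ μ)) x v‖ ≤ ‖mvfderiv (𝓡 4) (ζ ∘ μ) x v‖ := by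
  have hd : DifferentiableAt ℝ (collapse σ) ((ζ ∘ μ) x) :=
    ((contDiff_collapse ht.σ_pos).differentiable (by simp)).differentiableAt
  have h1 : mvfderiv (𝓡 4) (collapse σ ∘ (ζ ∘ μ)) x v
      = fderiv ℝ (collapse σ) ((ζ ∘ μ) x) (mvfderiv (𝓡 4) (ζ ∘ μ) x v) := by
    have := mfderiv_comp_apply x hd.mdifferentiableAt
      ((ht.contMDiffAt_comp hf hx hr).mdifferentiableAt (by simp)) v
    rw [mfderiv_eq_fderiv] at this
    exact this
  rw [h1]
  refine ((fderiv ℝ (collapse σ) ((ζ ∘ μ) x)).le_opNorm _).trans ?_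
  have := norm_fderiv_le_of_lipschitz ℝ (lipschitzWith_collapse (E := Plane) ht.σ_pos)
    (x₀ := (ζ ∘ μ) x)
  rw [NNReal.coe_one] at this
  exact mul_le_of_le_one_left (norm_nonneg _) this

/-- Inside the core the planar derivative vanishes and γ is of size 2√δ, which Young's inequality
absorbs. Outside, the unretracted estimate applies, and moving points by 2σ changes the weight at
most by the factor 1 + 6σ. -/
lemma Conditions.collapse_le (hc : Conditions L g μ Brg b W R γ ζ σ δ K)
    (ht : IsTuple Ω μ Brg b W R γ ζ σ δ K) (hf : IsFibration Ω μ Brg) (hσ1 : σ ≤ 1) (hx : μ x ∈ W)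
    (hR : ‖ζ (μ x)‖ < 3 * R) (v : TangentSpace (𝓡 4) x) (Γ : ℝ) :
    (Γ + γ x v) ^ 2 / (1 + ‖collapse σ (ζ (μ x))‖ ^ 2)
        + ‖mvfderiv (𝓡 4) (collapse σ ∘ (ζ ∘ μ)) x v‖ ^ 2
      ≤ (1 + 6 * σ) * ((1 + 4 * δ) * (Γ ^ 2 + g.norm x v ^ 2)) := by
  have hδ := ht.δ_pos
  have hσ0 := ht.σ_pos
  have hn := g.norm_nonneg x v
  rcases lt_or_ge ‖ζ (μ x)‖ σ with hσ | hσ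
  · rw [ht.mvfderiv_collapse_of_lt hf hx hσ, collapse_of_le hσ.le]
    have h1 := hc.abs_le_of_le ht hf hx hσ.le v
    have h2 : γ x v ^ 2 ≤ 4 * δ * g.norm x v ^ 2 := by
      have := pow_le_pow_left₀ (abs_nonneg _) h1 2
      rw [sq_abs, mul_pow, mul_pow, Real.sq_sqrt hδ.le] at this
      linarith
    simp only [norm_zero, ne_eq, OfNat.ofNat_ne_zero, not_false_eq_true, zero_pow, add_zero, div_one]
    generalize γ x v = q at *
    generalize g.norm x v = n at *
    have h3 : (Γ + q) ^ 2 ≤ (1 + 4 * δ) * (Γ ^ 2 + n ^ 2) := by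
      have h4 : 2 * Γ * q ≤ 4 * δ * Γ ^ 2 + n ^ 2 := by
        have h5 : 0 ≤ (4 * δ * Γ - q) ^ 2 / (4 * δ) := by positivity
        have e : (4 * δ * Γ - q) ^ 2 / (4 * δ) = 4 * δ * Γ ^ 2 - 2 * Γ * q + q ^ 2 / (4 * δ) := by
          field_simp; ring
        have h6 : q ^ 2 / (4 * δ) ≤ n ^ 2 := by rw [div_le_iff₀ (by positivity)]; linarith
        linarith
      nlinarith
    refine h3.trans (le_mul_of_one_le_left (by positivity) (by linarith))
  · have h1 := hc.model_le ht hf hx hσ hR v Γ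
    have h2 := ht.norm_mvfderiv_collapse_le hf hx (hσ0.trans_le hσ) v
    have h3 : 1 + ‖ζ (μ x)‖ ^ 2 ≤ (1 + 6 * σ) * (1 + ‖collapse σ (ζ (μ x))‖ ^ 2) := by
      refine one_add_sq_le hσ0 hσ1 (norm_nonneg _) ?_
      have := norm_sub_norm_le (ζ (μ x)) (collapse σ (ζ (μ x)))
      linarith [norm_sub_collapse_le hσ0 (ζ (μ x))]
    generalize ‖collapse σ (ζ (μ x))‖ = s at *
    have hk := pow_le_pow_left₀ (norm_nonneg _) h2 2
    generalize ‖mvfderiv (𝓡 4) (collapse σ ∘ (ζ ∘ μ)) x v‖ = k at *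
    generalize ‖mvfderiv (𝓡 4) (ζ ∘ μ) x v‖ = k' at *
    generalize ‖ζ (μ x)‖ = r at *
    generalize g.norm x v = n at *
    generalize Γ + γ x v = a at *
    have h4 : a ^ 2 / (1 + s ^ 2) ≤ (1 + 6 * σ) * (a ^ 2 / (1 + r ^ 2)) := by
      rw [← mul_div_assoc, div_le_div_iff₀ (by positivity) (by positivity)]
      nlinarith [sq_nonneg a]
    have h5 : k ^ 2 ≤ (1 + 6 * σ) * k' ^ 2 := hk.trans
      (le_mul_of_one_le_left (sq_nonneg _) (by linarith))
    have h6 : (1 + δ) ^ 2 * (Γ ^ 2 + n ^ 2) ≤ (1 + 4 * δ) * (Γ ^ 2 + n ^ 2) := by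
      gcongr; nlinarith [ht.δ_lt]
    calc _ ≤ (1 + 6 * σ) * (a ^ 2 / (1 + r ^ 2) + k' ^ 2) := by linarith
      _ ≤ _ := by gcongr; exact h1.trans h6

/-- Since θ = h(s, ·)^m f, an argument of θ along the curve is m times the angle relative to `s`
plus m times the primitive of η. -/
lemma IsAngle.exists_lift (hθ : IsAngle nabla m γ U θ) (h : IsPrequantum nabla Ω) (hU : IsOpen U)
    (hs : IsUnitSection s U) (hγ : γ.SmoothOn U) (hd : IsExteriorDerivOn γ Ω U)
    {c : ℝ → TotalSpace ℂ L} {a b : ℝ} (hc : PiecewiseC1On ((𝓡 4).prod 𝓘(ℝ, ℂ)) c a b)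
    (hA : ∀ t ∈ Icc a b, c t ∈ circleBundle L ∧ (c t).proj ∈ U) :
    ∃ T : ℝ → ℝ, PiecewiseC1On 𝓘(ℝ, ℝ) T a b ∧ (∀ t ∈ Icc a b, Circle.exp (T t) = θ (c t)) ∧
      ∀ᵐ t, t ∈ Icc a b → HasDerivAt T
        (m * (connectionForm nabla (c t) (velocity ((𝓡 4).prod 𝓘(ℝ, ℂ)) c t)
          + γ (c t).proj (velocity (𝓡 4) (fun τ => (c τ).proj) t))) t := by
  obtain ⟨hcp, φ, hφ, hpair, hder⟩ := exists_pairing_lift h hU hs hc hA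
  have hev := evalSmoothOn_totalForm h hU hs hγ
  have hcl := closed_totalForm h hU hs hγ hd
  have hf := hθ.isPhase h hU hs
  have hm : MapsTo (fun t => (c t).proj) (Icc a b) U := fun t ht => (hA t ht).2
  obtain ⟨hI, hI'⟩ := hev.primitive hcp hm
  set I : ℝ → ℝ := fun s' => ∫ t in a..s', totalForm nabla s γ (c t).proj
    (velocity (𝓡 4) (fun t => (c t).proj) t) with hIdef
  set t₀ := Complex.arg (θ ⟨(c a).proj, s (c a).proj⟩)
  refine ⟨fun t => m * φ t + (m * I t + t₀), (hφ.const_mul _).add ((hI.const_mul _).add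
    ((PiecewiseC1On.affine 0 t₀ a b hc.le).congr fun t _ => by simp)), fun t ht => ?_, ?_⟩
  · have h1 := hf.apply_curve hU hev hcl (hcp.mono le_rfl ht.1 ht.2)
      (hm.mono_left (Icc_subset_Icc_right ht.2))
    have h2 := hθ.apply_eq hs (hA t ht).1 (hA t ht).2
    refine Subtype.ext ?_
    rw [h2, h1, hpair t ht, Circle.coe_exp, Circle.coe_exp, ← Complex.exp_nat_mul]
    have h3 : ((θ ⟨(c a).proj, s (c a).proj⟩ : Circle) : ℂ) = Complex.exp (t₀ * Complex.I) := by
      rw [← Circle.coe_exp, Circle.exp_arg]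
    rw [h3, ← Complex.exp_add, ← Complex.exp_add]
    congr 1
    simp only [hIdef]
    push_cast
    ring
  · filter_upwards [hder, hI'] with t h1 h2 ht
    obtain ⟨φ', h3, -, h5⟩ := h1 ht
    refine ((h3.const_mul (m : ℝ)).add (((h2 ht).const_mul (m : ℝ)).add_const t₀)).congr_deriv ?_
    rw [h5, totalForm_apply]; ring

/-- An upper bound for the distance in the model. -/
lemma Conditions.modelDist_le (hc : Conditions L g μ Brg b W R γ ζ σ δ K)
    (ht : IsTuple Ω μ Brg b W R γ ζ σ δ K) (hf : IsFibration Ω μ Brg) (h : IsPrequantum nabla Ω)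
    (hm : 0 < m) (hσ1 : σ ≤ 1) (hθ : IsAngle nabla m γ (μ ⁻¹' W) θ) {c : ℝ → TotalSpace ℂ L}
    (hcp : PiecewiseC1On ((𝓡 4).prod 𝓘(ℝ, ℂ)) c 0 1)
    (hA : ∀ t ∈ Icc (0 : ℝ) 1, c t ∈ circleBundle L ∧ μ (c t).proj ∈ W ∧
      ‖ζ (μ (c t).proj)‖ < 3 * R) :
    modelDist m (approxMap μ ζ θ (c 0)) (approxMap μ ζ θ (c 1)) ≤ ENNReal.ofReal (4 * σ) +
      ENNReal.ofReal √((1 + 6 * σ) * (1 + 4 * δ)) *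
        lengthOn ((𝓡 4).prod 𝓘(ℝ, ℂ)) (hatNorm g nabla) c 0 1 := by
  have hU : IsOpen (μ ⁻¹' W) := ht.isOpen.preimage hf.smooth.continuous
  obtain ⟨s, hs⟩ := exists_unitSection h hc.trivial
  obtain ⟨T, hT, hTθ, hT'⟩ := hθ.exists_lift h hU hs ht.smooth_γ ht.primitive hcp
    fun t htI => ⟨(hA t htI).1, (hA t htI).2.1⟩
  obtain ⟨hcb, -⟩ := exists_pairing_lift h hU hs hcp fun t htI => ⟨(hA t htI).1, (hA t htI).2.1⟩
  set P : X → Plane := collapse σ ∘ (ζ ∘ μ) with hP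
  have hPc : PiecewiseC1On 𝓘(ℝ, Plane) (fun t => P (c t).proj) 0 1 := hcb.comp (A := μ ⁻¹' W)
    (fun x hx => (ht.contMDiffAt_collapse hf hx).contMDiffWithinAt) fun t htI => (hA t htI).2.1
  set C : ℝ → ℝ × Plane := fun t => (T t, P (c t).proj) with hC
  have hCc : PiecewiseC1On 𝓘(ℝ, ℝ × Plane) C 0 1 := hT.prodMk hPc
  have h01 : (0 : ℝ) ∈ Icc (0 : ℝ) 1 ∧ (1 : ℝ) ∈ Icc (0 : ℝ) 1 := by simp
  -- At each end point the collapsed curve is off by at most 2σ; this accounts for the term 4σ.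
  have hseg : ∀ t ∈ Icc (0 : ℝ) 1, lengthDist 𝓘(ℝ, ℝ × Plane) (modelNorm m) univ
      (T t, ζ (μ (c t).proj)) (C t) ≤ ENNReal.ofReal (2 * σ) := by
    intro t htI
    refine (lengthDist_model_le_segment m hm _ _ _ _).trans (ENNReal.ofReal_le_ofReal ?_)
    rw [sub_self, abs_zero, zero_add, norm_sub_rev]
    exact norm_sub_collapse_le ht.σ_pos _
  have hlen : lengthOn 𝓘(ℝ, ℝ × Plane) (modelNorm m) C 0 1 ≤
      ENNReal.ofReal √((1 + 6 * σ) * (1 + 4 * δ)) *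
        lengthOn ((𝓡 4).prod 𝓘(ℝ, ℂ)) (hatNorm g nabla) c 0 1 := by
    rw [lengthOn, lengthOn, ← lintegral_const_mul' _ _ ENNReal.ofReal_ne_top]
    refine lintegral_mono_ae ?_
    rw [ae_restrict_iff' measurableSet_Icc]
    filter_upwards [hT', hcb.ae_contMDiffAt, hcp.ae_contMDiffAt] with t h1 h2 h3 htI
    rw [← ENNReal.ofReal_mul (Real.sqrt_nonneg _)]
    refine ENNReal.ofReal_le_ofReal ?_
    have hd := (h1 htI).prodMk (hasDerivAt_comp_velocity
      ((ht.contMDiffAt_collapse hf (hA t htI).2.1).mdifferentiableAt (by simp))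
      ((h2 htI).2.mdifferentiableAt (by simp)))
    have hv : velocity 𝓘(ℝ, ℝ × Plane) C t = _ := (velocity_eq_deriv C t).trans hd.deriv
    have key := hc.collapse_le ht hf hσ1 (hA t htI).2.1 (hA t htI).2.2
      (velocity (𝓡 4) (fun τ => (c τ).proj) t)
      (connectionForm nabla (c t) (velocity ((𝓡 4).prod 𝓘(ℝ, ℂ)) c t))
    have hm' : (0 : ℝ) < m := by exact_mod_cast hm
    rw [hv, hatNorm, ← Real.sqrt_mul (by have := ht.σ_pos; have := ht.δ_pos; positivity)]
    rw [Metric.norm_sq, ← mul_assoc] at key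
    rw [dproj_velocity ((h3 htI).2.mdifferentiableAt (by simp))]
    refine Real.sqrt_le_sqrt (le_trans (le_of_eq ?_) key)
    change (m * _) ^ 2 / ((m : ℝ) ^ 2 * (1 + ‖P (c t).proj‖ ^ 2)) + _ = _
    rw [mul_pow, mul_div_mul_left _ _ (by positivity)]
    rfl
  have h1 := lengthDist_le (A := univ) (homogeneous_modelNorm m) hCc (mapsTo_univ _ _)
  refine (modelDist_le_of_lift (hTθ 0 h01.1) (hTθ 1 h01.2)).trans ?_
  change lengthDist 𝓘(ℝ, ℝ × Plane) (modelNorm m) univ (T 0, ζ (μ (c 0).proj))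
    (T 1, ζ (μ (c 1).proj)) ≤ _
  calc _ ≤ _ := lengthDist_triangle (homogeneous_modelNorm m) _ (C 0) _
    _ ≤ ENNReal.ofReal (2 * σ) + (ENNReal.ofReal √((1 + 6 * σ) * (1 + 4 * δ)) *
        lengthOn ((𝓡 4).prod 𝓘(ℝ, ℂ)) (hatNorm g nabla) c 0 1 + ENNReal.ofReal (2 * σ)) := by
        refine add_le_add (hseg 0 h01.1) ((lengthDist_triangle (homogeneous_modelNorm m) _
          (C 1) _).trans (add_le_add (h1.trans hlen) ?_))
        rw [lengthDist_comm (homogeneous_modelNorm m)]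
        exact hseg 1 h01.2
    _ = _ := by
        rw [show 4 * σ = 2 * σ + 2 * σ by ring, ENNReal.ofReal_add (by linarith [ht.σ_pos])
          (by linarith [ht.σ_pos])]
        ring

end LowerBound

/-! ### Lifting segments of the model -/

section LiftCurve

variable {X : Type*} [TopologicalSpace X] [T2Space X] [ChartedSpace Four X] [IsManifold (𝓡 4) ∞ X]
  {Ω : TwoTensor X} {g : Metric X} {γ : OneForm X}
  {L : X → Type*} [TopologicalSpace (TotalSpace ℂ L)] [∀ x, NormedAddCommGroup (L x)]
  [∀ x, InnerProductSpace ℂ (L x)] [FiberBundle ℂ L] [VectorBundle ℝ ℂ L] [VectorBundle ℂ ℂ L]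
  [ContMDiffVectorBundle ∞ ℂ L (𝓡 4)] {nabla : CovariantDerivative (𝓡 4) ℂ L}
  {θ : TotalSpace ℂ L → Circle} {s : (x : X) → L x} {m : ℕ} {U : Set X} {c : ℝ → X} {t₀ t₁ : ℝ}

lemma IsAngle.apply_liftPoint_curve (hθ : IsAngle nabla m γ U θ) (h : IsPrequantum nabla Ω)
    (hU : IsOpen U) (hs : IsUnitSection s U) (hγ : γ.SmoothOn U) (hd : IsExteriorDerivOn γ Ω U)
    (hc : PiecewiseC1On (𝓡 4) c t₀ t₁) (hA : MapsTo c (Icc t₀ t₁) U) (ψ₀ ψ₁ : ℝ) :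
    θ (liftPoint s (c t₁) ψ₁) = Circle.exp (m * (ψ₁ - ψ₀ +
      ∫ t in t₀..t₁, totalForm nabla s γ (c t) (velocity (𝓡 4) c t))) *
        θ (liftPoint s (c t₀) ψ₀) := by
  have h1 := (hθ.isPhase h hU hs).apply_curve hU (evalSmoothOn_totalForm h hU hs hγ)
    (closed_totalForm h hU hs hγ hd) hc hA
  rw [hθ.apply_liftPoint hs (hA ⟨hc.le, le_rfl⟩), hθ.apply_liftPoint hs (hA ⟨le_rfl, hc.le⟩)]
  have h2 : θ ⟨c t₁, s (c t₁)⟩ = θ ⟨c t₀, s (c t₀)⟩ * Circle.exp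
      (m * ∫ t in t₀..t₁, totalForm nabla s γ (c t) (velocity (𝓡 4) c t)) := by
    refine Subtype.ext ?_
    rw [h1, Circle.coe_mul, Circle.coe_exp, mul_comm Complex.I]
  rw [h2, mul_add, mul_sub, Circle.exp_add, Circle.exp_sub, div_eq_mul_inv]
  set z := Circle.exp (m * ψ₀)
  calc _ = _ := by
        rw [mul_comm (θ _) (Circle.exp _), ← mul_assoc]
    _ = Circle.exp (m * ψ₁) * (z⁻¹ * z) * Circle.exp (m * ∫ t in t₀..t₁,
          totalForm nabla s γ (c t) (velocity (𝓡 4) c t)) * θ ⟨c t₀, s (c t₀)⟩ := by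
        rw [inv_mul_cancel, mul_one]
    _ = _ := by
        simp only [mul_assoc]
        rw [mul_left_comm z]

/-- A curve in the base can be lifted in such a way that the angular coordinate changes at a
constant rate. -/
lemma IsAngle.exists_lift_curve (hθ : IsAngle nabla m γ U θ) (h : IsPrequantum nabla Ω)
    (hU : IsOpen U) (hs : IsUnitSection s U) (hγ : γ.SmoothOn U) (hd : IsExteriorDerivOn γ Ω U)
    (g : Metric X) (hc : PiecewiseC1On (𝓡 4) c t₀ t₁) (hA : MapsTo c (Icc t₀ t₁) U) (a : ℝ)
    {u : TotalSpace ℂ L} (hu : u ∈ circleBundle L) (hu0 : u.proj = c t₀) :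
    ∃ û ∈ circleBundle L, û.proj = c t₁ ∧ θ û = Circle.exp (m * (a * (t₁ - t₀))) * θ u ∧
      hatDist g nabla u û ≤ ∫⁻ t in Icc t₀ t₁,
        ENNReal.ofReal √((a - γ (c t) (velocity (𝓡 4) c t)) ^ 2
          + g.norm (c t) (velocity (𝓡 4) c t) ^ 2) := by
  obtain ⟨ψ₀, hψ₀⟩ := exists_liftPoint hs hu (hu0 ▸ hA ⟨le_rfl, hc.le⟩)
  rw [hu0] at hψ₀
  obtain ⟨hI, hI'⟩ := (evalSmoothOn_totalForm h hU hs hγ).primitive hc hA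
  set I : ℝ → ℝ := fun s' => ∫ t in t₀..s', totalForm nabla s γ (c t) (velocity (𝓡 4) c t) with hIdef
  -- With ψ' = a - η along the curve, Γ = ψ' + α = a - γ, so Γ + γ has the constant value a.
  set ψ : ℝ → ℝ := fun t => (a * t + (ψ₀ - a * t₀)) + -I t with hψ
  have hψc : PiecewiseC1On 𝓘(ℝ, ℝ) ψ t₀ t₁ := (PiecewiseC1On.affine a _ t₀ t₁ hc.le).add hI.neg
  have hψ0 : ψ t₀ = ψ₀ := by simp [hψ, hIdef]
  refine ⟨liftPoint s (c t₁) (ψ t₁), liftPoint_mem hs (hA ⟨hc.le, le_rfl⟩) _, rfl, ?_, ?_⟩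
  · rw [hθ.apply_liftPoint_curve h hU hs hγ hd hc hA ψ₀, hψ₀]
    congr 3
    simp only [hψ, hIdef]; ring
  · have h1 := hatDist_liftPoint_le h hU hs g hc hψc
      (ψ' := fun t => a - totalForm nabla s γ (c t) (velocity (𝓡 4) c t)) (by
        filter_upwards [hI'] with t ht htI
        have h2 := (((hasDerivAt_id t).const_mul a).add_const (ψ₀ - a * t₀)).add (ht htI).neg
        exact h2.congr_deriv (by simp [sub_eq_add_neg])) hA
    rw [hψ0, ← hψ₀] at h1
    refine h1.trans (le_of_eq (lintegral_congr fun t => ?_))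
    rw [totalForm_apply]
    congr 4; ring

lemma IsAngle.exists_lift_curve_of_le (hθ : IsAngle nabla m γ U θ) (h : IsPrequantum nabla Ω)
    (hU : IsOpen U) (hs : IsUnitSection s U) (hγ : γ.SmoothOn U) (hd : IsExteriorDerivOn γ Ω U)
    {C : ℝ} (hC : 0 ≤ C) (hc : PiecewiseC1On (𝓡 4) c 0 1) (hA : MapsTo c (Icc 0 1) U)
    (hb : ∀ t ∈ Icc (0 : ℝ) 1, ∀ v, |γ (c t) v| ≤ C * g.norm (c t) v) (a : ℝ)
    {u : TotalSpace ℂ L} (hu : u ∈ circleBundle L) (hu0 : u.proj = c 0) :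
    ∃ û ∈ circleBundle L, û.proj = c 1 ∧ θ û = Circle.exp (m * a) * θ u ∧
      hatDist g nabla u û ≤ ENNReal.ofReal |a| + ENNReal.ofReal (1 + C) *
        lengthOn (𝓡 4) g.norm c 0 1 := by
  obtain ⟨û, h1, h2, h3, h4⟩ := hθ.exists_lift_curve h hU hs hγ hd g hc hA a hu hu0
  refine ⟨û, h1, h2, by rw [h3, sub_zero, mul_one], h4.trans ?_⟩
  have e : ENNReal.ofReal |a| = ∫⁻ _ in Icc (0 : ℝ) 1, ENNReal.ofReal |a| := by simp
  rw [e, lengthOn, ← lintegral_const_mul' _ _ ENNReal.ofReal_ne_top, ← lintegral_add_left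
    measurable_const]
  refine setLIntegral_mono' measurableSet_Icc fun t ht => ?_
  have hn := g.norm_nonneg (c t) (velocity (𝓡 4) c t)
  rw [← ENNReal.ofReal_mul (by linarith), ← ENNReal.ofReal_add (abs_nonneg _) (by positivity)]
  refine ENNReal.ofReal_le_ofReal ?_
  refine (Real.sqrt_le_left (by positivity)).2 ?_
  have h5 := hb t ht (velocity (𝓡 4) c t)
  generalize γ (c t) (velocity (𝓡 4) c t) = q at *
  generalize g.norm (c t) (velocity (𝓡 4) c t) = n at *
  have h6 : |a - q| ≤ |a| + C * n := (abs_sub _ _).trans (by linarith)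
  have h7 := pow_le_pow_left₀ (abs_nonneg _) h6 2
  rw [sq_abs] at h7
  have := abs_nonneg a
  have h8 : 0 ≤ (|a| + C * n) * n := by positivity
  nlinarith

end LiftCurve

/-! ### Local lifts along a submersion. -/

section LocalLift

variable {X : Type*} [TopologicalSpace X] [ChartedSpace Four X] [IsManifold (𝓡 4) ∞ X]

lemma Metric.inner_chartField (g : Metric X) (x₀ x : X) (a : Four) :
    g.inner x (chartField x₀ a x) (chartField x₀ a x) = ∑ i, ∑ j, a i * a j *
      g.inner x (chartField x₀ (EuclideanSpace.single i 1) x)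
        (chartField x₀ (EuclideanSpace.single j 1) x) := by
  have h3 := chartField_eq_sum x₀ x a
  have h4 : ∀ w, g.inner x (chartField x₀ a x) w
      = ∑ i, a i * g.inner x (chartField x₀ (EuclideanSpace.single i 1) x) w := by
    intro w
    rw [h3, map_sum, sum_apply]
    refine Finset.sum_congr rfl fun i _ => ?_
    rw [map_smul]; rfl
  have h5 : ∀ w, g.inner x w (chartField x₀ a x)
      = ∑ i, a i * g.inner x w (chartField x₀ (EuclideanSpace.single i 1) x) := by
    intro w
    rw [h3, map_sum]
    exact Finset.sum_congr rfl fun i _ => by rw [map_smul]; rfl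
  rw [h4]
  refine Finset.sum_congr rfl fun i _ => ?_
  rw [h5, Finset.mul_sum]
  exact Finset.sum_congr rfl fun j _ => by ring

/-- A submersion admits local curves over segments with nearly constant prescribed velocity. -/
lemma exists_local_lift {E : Type*} [NormedAddCommGroup E] [NormedSpace ℝ E] [FiniteDimensional ℝ E]
    {F : X → E} {x₀ : X} (hF : ContMDiffAt (𝓡 4) 𝓘(ℝ, E) ∞ F x₀)
    (hsurj : Function.Surjective (mvfderiv (𝓡 4) F x₀)) (v₀ : TangentSpace (𝓡 4) x₀)
    (g : Metric X) {γ : OneForm X} {U : Set X} (hU : IsOpen U) (hγ : γ.EvalSmoothOn U) (hx₀ : x₀ ∈ U)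
    (a : ℝ) {M : ℝ} (hM : (a - γ x₀ v₀) ^ 2 + g.norm x₀ v₀ ^ 2 < M) :
    ∃ N ∈ 𝓝 x₀, ∃ τ₀ > 0, ∀ x ∈ N, ∃ c : ℝ → X, c 0 = x ∧ ∀ τ ∈ Icc 0 τ₀,
      ContMDiffAt 𝓘(ℝ, ℝ) (𝓡 4) 1 c τ ∧ c τ ∈ U ∧ F (c τ) = F x + τ • mvfderiv (𝓡 4) F x₀ v₀ ∧
      (a - γ (c τ) (velocity (𝓡 4) c τ)) ^ 2 + g.norm (c τ) (velocity (𝓡 4) c τ) ^ 2 ≤ M := by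
  set e := chartAt Four x₀ with he
  have hxs : x₀ ∈ e.source := mem_chart_source Four x₀
  set y₀ := e x₀ with hy₀
  have hy₀t : y₀ ∈ e.target := e.map_source hxs
  have hey : e.symm y₀ = x₀ := e.left_inv hxs
  set F' : Four → E := F ∘ e.symm with hF'
  have hF'c : ContDiffAt ℝ ∞ F' y₀ := by
    rw [← contMDiffAt_iff_contDiffAt]
    exact ContMDiffAt.comp y₀ (hey.symm ▸ hF) (contMDiffAt_chartAt_symm hy₀t)
  set D := fderiv ℝ F' y₀ with hD
  have hDapp : ∀ v, D (chartDeriv x₀ x₀ v) = mvfderiv (𝓡 4) F x₀ v := by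
    intro v
    have h1 : F =ᶠ[𝓝 x₀] F' ∘ e := by
      filter_upwards [e.open_source.mem_nhds hxs] with x hx
      simp only [hF', Function.comp_apply, e.left_inv hx]
    have h2 := mfderiv_comp_apply x₀ (hF'c.differentiableAt (by simp)).mdifferentiableAt
      ((contMDiffAt_chartAt hxs).mdifferentiableAt (by simp)) v
    rw [mfderiv_eq_fderiv] at h2
    have h3 : mvfderiv (𝓡 4) F x₀ = mvfderiv (𝓡 4) (F' ∘ e) x₀ := h1.mfderiv_eq
    rw [h3]
    exact h2.symm
  obtain ⟨A, hA⟩ := D.toLinearMap.exists_rightInverse_of_surjective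
    (LinearMap.range_eq_top.2 fun w => by
      obtain ⟨v, hv⟩ := hsurj w
      exact ⟨_, (hDapp v).trans hv⟩)
  set A' : E →L[ℝ] Four := LinearMap.toContinuousLinearMap A
  have hDA : ∀ w, D (A' w) = w := fun w => LinearMap.congr_fun hA w
  -- Straightening coordinates: D ∘ Θ = F' identically and Θ has derivative the identity at y₀. So Θ
  -- is a local diffeomorphism that turns F into the linear map D, and straight lines move F at an
  -- exactly constant velocity.
  set Θ : Four → Four := fun y => A' (F' y) + y - A' (D y) with hΘ
  have hΘc : ContDiffAt ℝ 1 Θ y₀ :=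
    ((A'.contDiff.contDiffAt.comp y₀ (hF'c.of_le (by simp))).add contDiffAt_id).sub
      (A'.comp D).contDiff.contDiffAt
  have hΘd : HasFDerivAt Θ ((ContinuousLinearEquiv.refl ℝ Four : Four ≃L[ℝ] Four) : Four →L[ℝ] Four)
      y₀ := by
    have h1 := ((A'.hasFDerivAt.comp y₀ (hF'c.differentiableAt (by simp)).hasFDerivAt).add
      (hasFDerivAt_id y₀)).sub (A'.comp D).hasFDerivAt
    refine HasFDerivAt.congr_fderiv (f := Θ) h1 ?_
    ext1 v
    simp [hD]
  have hDΘ : ∀ y, D (Θ y) = F' y := by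
    intro y
    simp only [hΘ, map_sub, map_add, hDA]
    abel
  set P := hΘc.toOpenPartialHomeomorph Θ hΘd one_ne_zero with hP
  have hPc : ∀ y, P y = Θ y := fun y => rfl
  have hyP : y₀ ∈ P.source := hΘc.mem_toOpenPartialHomeomorph_source hΘd one_ne_zero
  set Z := Θ y₀ with hZ
  have hZt : Z ∈ P.target := P.map_source hyP
  have hPZ : P.symm Z = y₀ := P.left_inv hyP
  have hΨc : ContDiffAt ℝ 1 P.symm Z := hΘc.to_localInverse hΘd one_ne_zero
  have hΨd : fderiv ℝ P.symm Z = ContinuousLinearMap.id ℝ Four := by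
    have := P.hasFDerivAt_symm hZt (hPZ.symm ▸ hΘd)
    exact this.fderiv
  set w₀ := chartDeriv x₀ x₀ v₀ with hw₀
  -- The cost at z of the velocity of the straight line in the direction w₀. It is less than M at Z,
  -- hence at most M nearby by continuity.
  set Q : Four → ℝ := fun z => (a - chartForm γ x₀ (P.symm z) (fderiv ℝ P.symm z w₀)) ^ 2
    + ∑ i, ∑ j, (fderiv ℝ P.symm z w₀) i * (fderiv ℝ P.symm z w₀) j *
      g.inner (e.symm (P.symm z)) (chartField x₀ (EuclideanSpace.single i 1) (e.symm (P.symm z)))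
        (chartField x₀ (EuclideanSpace.single j 1) (e.symm (P.symm z))) with hQ
  have hQapp : ∀ z, Q z = (a - γ (e.symm (P.symm z))
        (chartField x₀ (fderiv ℝ P.symm z w₀) (e.symm (P.symm z)))) ^ 2
      + g.norm (e.symm (P.symm z))
        (chartField x₀ (fderiv ℝ P.symm z w₀) (e.symm (P.symm z))) ^ 2 := by
    intro z
    rw [Metric.norm_sq, Metric.inner_chartField]
    simp only [hQ]
    rw [chartForm_apply]
  have hQZ : Q Z < M := by
    rw [hQapp, hΨd]
    have h1 : ∀ x (_ : x = x₀), (a - γ x (chartField x₀ w₀ x)) ^ 2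
        + g.norm x (chartField x₀ w₀ x) ^ 2 < M := by
      rintro x rfl
      rw [hw₀, chartField_mfderiv hxs]; exact hM
    exact h1 _ (by rw [hPZ, hey])
  have hΨcont : ContinuousAt P.symm Z := P.continuousAt_symm hZt
  have hfd : ContinuousAt (fun z => fderiv ℝ P.symm z w₀) Z :=
    (hΨc.fderiv_right (m := 0) (by simp)).continuousAt.clm_apply continuousAt_const
  have hUy : e.symm y₀ ∈ U := hey.symm ▸ hx₀
  have hesymm : ContinuousAt (fun z => e.symm (P.symm z)) Z :=
    ContinuousAt.comp (g := e.symm) (hPZ.symm ▸ e.continuousAt_symm hy₀t) hΨcont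
  have hQc : ContinuousAt Q Z := by
    refine ContinuousAt.add (ContinuousAt.pow (continuousAt_const.sub (ContinuousAt.clm_apply
      (ContinuousAt.comp (g := chartForm γ x₀) ?_ hΨcont) hfd)) 2) ?_
    · rw [hPZ]
      exact (differentiableAt_chartForm hγ hy₀t hUy).continuousAt
    · refine tendsto_finsetSum _ fun i _ => tendsto_finsetSum _ fun j _ => ?_
      have hcoord : ∀ i : Fin 4, ContinuousAt (fun z => (fderiv ℝ P.symm z w₀) i) Z := fun i =>
        (EuclideanSpace.proj (𝕜 := ℝ) i).continuous.continuousAt.comp hfd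
      refine ((hcoord i).mul (hcoord j)).mul ?_
      refine ContinuousAt.comp (g := fun x => g.inner x
        (chartField x₀ (EuclideanSpace.single i 1) x)
        (chartField x₀ (EuclideanSpace.single j 1) x)) ?_ hesymm
      rw [hPZ, hey]
      exact (g.contMDiffAt_inner (smoothFieldAt_chartField hxs _)
        (smoothFieldAt_chartField hxs _)).continuousAt
  have hev : ∀ᶠ z in 𝓝 Z, z ∈ P.target ∧ ContDiffAt ℝ 1 P.symm z ∧ P.symm z ∈ e.target ∧
      e.symm (P.symm z) ∈ U ∧ Q z ≤ M := by
    refine (P.open_target.eventually_mem hZt).and ((hΨc.eventually (by simp)).and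
      ((hΨcont.eventually (hPZ.symm ▸ e.open_target.mem_nhds hy₀t)).and
      ((hesymm.eventually ?_).and ((hQc.eventually (Iio_mem_nhds hQZ)).mono fun z hz => le_of_lt hz))))
    change ∀ᶠ y in 𝓝 (e.symm (P.symm Z)), y ∈ U
    rw [hPZ]; exact hU.mem_nhds hUy
  obtain ⟨η, hη, hball⟩ := Metric.eventually_nhds_iff_ball.1 hev
  -- Half of the radius is reserved for the starting point and half for the motion along w₀.
  refine ⟨{x | x ∈ e.source ∧ e x ∈ P.source ∧ Θ (e x) ∈ Metric.ball Z (η / 2)}, ?_,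
    η / (2 * (‖w₀‖ + 1)), by positivity, ?_⟩
  · have h1 := e.continuousAt hxs
    have h2 : ContinuousAt (fun x => Θ (e x)) x₀ :=
      ContinuousAt.comp (g := Θ) hΘc.continuousAt h1
    exact inter_mem (e.open_source.mem_nhds hxs) (inter_mem
      (h1.eventually (P.open_source.mem_nhds hyP)) (h2.eventually (Metric.ball_mem_nhds _ (by positivity))))
  · rintro x ⟨hx1, hx2, hx3⟩
    set z : ℝ → Four := fun τ => Θ (e x) + τ • w₀ with hz
    have hzd : ∀ τ, HasDerivAt z w₀ τ := fun τ => by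
      have := ((hasDerivAt_id τ).smul_const w₀).const_add (Θ (e x))
      exact this.congr_deriv (one_smul _ _)
    refine ⟨fun τ => e.symm (P.symm (z τ)), ?_, fun τ hτ => ?_⟩
    · simp only [hz, zero_smul, add_zero]
      rw [← hPc, P.left_inv hx2, e.left_inv hx1]
    have hzb : z τ ∈ Metric.ball Z η := by
      rw [Metric.mem_ball] at hx3 ⊢
      have h1 : dist (z τ) (Θ (e x)) ≤ τ * ‖w₀‖ := by
        rw [dist_eq_norm, hz]; simp [norm_smul, abs_of_nonneg hτ.1]
      have h2 : τ * ‖w₀‖ ≤ η / 2 := by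
        have h3 := hτ.2
        rw [le_div_iff₀ (by positivity)] at h3
        nlinarith [hτ.1, norm_nonneg w₀]
      linarith [dist_triangle (z τ) (Θ (e x)) Z]
    obtain ⟨h1, h2, h3, h4, h5⟩ := hball _ hzb
    have hcd : HasDerivAt (fun τ => P.symm (z τ)) (fderiv ℝ P.symm (z τ) w₀) τ :=
      (h2.differentiableAt one_ne_zero).hasFDerivAt.comp_hasDerivAt τ (hzd τ)
    have hcc : ContDiffAt ℝ 1 (fun τ => P.symm (z τ)) τ := by
      refine ContDiffAt.comp τ h2 ?_
      exact (contDiff_const.add (contDiff_id.smul contDiff_const)).contDiffAt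
    have hvel : velocity (𝓡 4) (fun τ => e.symm (P.symm (z τ))) τ
        = chartField x₀ (fderiv ℝ P.symm (z τ) w₀) (e.symm (P.symm (z τ))) := by
      rw [← mfderiv_chartAt_symm_apply h3, ← hcd.deriv, ← velocity_eq_deriv]
      exact velocity_comp (mdifferentiableAt_chartAt_symm h3)
        (hcc.differentiableAt one_ne_zero).mdifferentiableAt
    refine ⟨((contMDiffAt_chartAt_symm h3).of_le (by simp)).comp τ hcc.contMDiffAt, h4, ?_, ?_⟩
    · change F' (P.symm (z τ)) = _
      have h6 : Θ (P.symm (z τ)) = z τ := P.right_inv h1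
      rw [← hDΘ, h6, hz]
      simp only [map_add, map_smul, hDΘ, hw₀, hDapp]
      simp only [hF', Function.comp_apply, e.left_inv hx1]
    · rw [hvel]
      rw [hQapp] at h5
      exact h5

end LocalLift


/-! ### Lifting segments of the plane to the circle bundle -/

section SegmentLift

variable {X : Type*} [TopologicalSpace X] [ChartedSpace Four X] [IsManifold (𝓡 4) ∞ X]

/-- Local lifts with a positive duration exist near each point, and a minimum of finitely many
durations is positive, so compactness gives a common one. -/
lemma exists_uniform_lift {E : Type*} [NormedAddCommGroup E] [NormedSpace ℝ E]
    [FiniteDimensional ℝ E] {F : X → E} {K U : Set X} (hK : IsCompact K) (hKU : K ⊆ U)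
    (hF : ∀ x ∈ K, ContMDiffAt (𝓡 4) 𝓘(ℝ, E) ∞ F x)
    (hsurj : ∀ x ∈ K, Function.Surjective (mvfderiv (𝓡 4) F x))
    (g : Metric X) {γ : OneForm X} (hU : IsOpen U) (hγ : γ.EvalSmoothOn U) (a : ℝ) (k : E) {M : ℝ}
    (hM : ∀ x ∈ K, ∃ v, mvfderiv (𝓡 4) F x v = k ∧ (a - γ x v) ^ 2 + g.norm x v ^ 2 < M) :
    ∃ τ₀ > 0, ∀ x ∈ K, ∃ c : ℝ → X, c 0 = x ∧ ∀ τ ∈ Icc 0 τ₀,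
      ContMDiffAt 𝓘(ℝ, ℝ) (𝓡 4) 1 c τ ∧ c τ ∈ U ∧ F (c τ) = F x + τ • k ∧
      (a - γ (c τ) (velocity (𝓡 4) c τ)) ^ 2 + g.norm (c τ) (velocity (𝓡 4) c τ) ^ 2 ≤ M := by
  refine hK.induction_on (p := fun A => ∃ τ₀ : ℝ, τ₀ > 0 ∧ ∀ x ∈ A, ∃ c : ℝ → X, c 0 = x ∧
    ∀ τ ∈ Icc 0 τ₀, ContMDiffAt 𝓘(ℝ, ℝ) (𝓡 4) 1 c τ ∧ c τ ∈ U ∧ F (c τ) = F x + τ • k ∧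
      (a - γ (c τ) (velocity (𝓡 4) c τ)) ^ 2 + g.norm (c τ) (velocity (𝓡 4) c τ) ^ 2 ≤ M)
    ⟨1, one_pos, by simp⟩ ?_ ?_ ?_
  · rintro A A' hA ⟨τ₀, h0, h⟩
    exact ⟨τ₀, h0, fun x hx => h x (hA hx)⟩
  · rintro A A' ⟨τ₀, h0, h⟩ ⟨τ₁, h1, h'⟩
    refine ⟨min τ₀ τ₁, lt_min h0 h1, ?_⟩
    rintro x (hx | hx)
    · obtain ⟨c, hc, hc'⟩ := h x hx
      exact ⟨c, hc, fun τ hτ => hc' τ ⟨hτ.1, hτ.2.trans (min_le_left _ _)⟩⟩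
    · obtain ⟨c, hc, hc'⟩ := h' x hx
      exact ⟨c, hc, fun τ hτ => hc' τ ⟨hτ.1, hτ.2.trans (min_le_right _ _)⟩⟩
  · intro x hx
    obtain ⟨v, hv, hv'⟩ := hM x hx
    obtain ⟨N, hN, τ₀, h0, h⟩ := exists_local_lift (hF x hx) (hsurj x hx) v g hU hγ (hKU hx) a hv'
    rw [hv] at h
    exact ⟨N, mem_nhdsWithin_of_mem_nhds hN, τ₀, h0, h⟩

variable {L : X → Type*} [TopologicalSpace (TotalSpace ℂ L)] [∀ x, NormedAddCommGroup (L x)]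
  [∀ x, InnerProductSpace ℂ (L x)] [FiberBundle ℂ L] [VectorBundle ℝ ℂ L] [VectorBundle ℂ ℂ L]
  [ContMDiffVectorBundle ∞ ℂ L (𝓡 4)] {nabla : CovariantDerivative (𝓡 4) ℂ L}

lemma lengthOn_proj_le (g : Metric X) (nabla : CovariantDerivative (𝓡 4) ℂ L)
    {c : ℝ → TotalSpace ℂ L} {a b : ℝ} (hc : PiecewiseC1On ((𝓡 4).prod 𝓘(ℝ, ℂ)) c a b) :
    PiecewiseC1On (𝓡 4) (fun t => (c t).proj) a b ∧
    lengthOn (𝓡 4) g.norm (fun t => (c t).proj) a b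
      ≤ lengthOn ((𝓡 4).prod 𝓘(ℝ, ℂ)) (hatNorm g nabla) c a b := by
  refine ⟨hc.comp (G := fun u : TotalSpace ℂ L => u.proj) (A := univ)
    (contMDiff_proj L).contMDiffOn (mapsTo_univ _ _), ?_⟩
  refine lintegral_mono_ae ((ae_restrict_iff' measurableSet_Icc).2 ?_)
  filter_upwards [hc.ae_contMDiffAt] with t h htI
  refine ENNReal.ofReal_le_ofReal (Real.sqrt_le_sqrt ?_)
  have h1 := dproj_velocity ((h htI).2.mdifferentiableAt (by simp))
  change _ ≤ connectionForm nabla (c t) _ ^ 2 + g.inner (c t).proj _ _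
  rw [h1]
  exact le_add_of_nonneg_left (sq_nonneg _)

lemma Metric.dist_proj_le_hatDist (g : Metric X) (nabla : CovariantDerivative (𝓡 4) ℂ L)
    (u u' : TotalSpace ℂ L) : g.dist u.proj u'.proj ≤ hatDist g nabla u u' := by
  refine le_iInf₂ fun c hc => ?_
  obtain ⟨h1, h2⟩ := lengthOn_proj_le g nabla (PiecewiseC1.on hc.1)
  have h3 := lengthDist_le (A := univ) g.homogeneous_norm h1 (mapsTo_univ _ _)
  rw [hc.2.1, hc.2.2.1] at h3
  exact h3.trans h2

variable [T2Space X] {B : Type*} [TopologicalSpace B] [T2Space B] [ChartedSpace Plane B]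
  [IsManifold (𝓡 2) ∞ B]
  {Ω : TwoTensor X} {g : Metric X} {μ : X → B} {Brg : Set B} {b : B} {W : Set B} {R : ℝ}
  {γ : OneForm X} {ζ : B → Plane} {σ δ K ρ : ℝ} {θ : TotalSpace ℂ L → Circle} {m : ℕ}
  {ξ k : Plane} {u : TotalSpace ℂ L}

lemma hatDist_self (hu : u ∈ circleBundle L) : hatDist g nabla u u = 0 :=
  lengthDist_self (homogeneous_hatNorm g nabla) hu

lemma hatDist_triangle (u u' u'' : TotalSpace ℂ L) :
    hatDist g nabla u u'' ≤ hatDist g nabla u u' + hatDist g nabla u' u'' :=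
  lengthDist_triangle (homogeneous_hatNorm g nabla) u u' u''

/-- The preimage of the segment is compact because μ is proper, so the lifts have a uniform
duration. They are concatenated in n + 1 equal steps, each followed by a lift to the circle bundle
with constant angular rate. -/
lemma Conditions.exists_lift_outside (hc : Conditions L g μ Brg b W R γ ζ σ δ K)
    (ht : IsTuple Ω μ Brg b W R γ ζ σ δ K) (hf : IsFibration Ω μ Brg) (hp : IsPrequantum nabla Ω)
    (hθ : IsAngle nabla m γ (μ ⁻¹' W) θ)
    (hseg : ∀ s ∈ Icc (0 : ℝ) 1, σ ≤ ‖ξ + s • k‖ ∧ ρ ≤ ‖ξ + s • k‖ ∧ ‖ξ + s • k‖ < 3 * R)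
    (hρ : 0 ≤ ρ) (a : ℝ) {M : ℝ} (hM : (1 + 4 * δ) * (a ^ 2 / (1 + ρ ^ 2) + ‖k‖ ^ 2) < M)
    (hu : u ∈ circleBundle L) (huW : μ u.proj ∈ W) (hξ : ζ (μ u.proj) = ξ) :
    ∃ û ∈ circleBundle L, μ û.proj ∈ W ∧ ζ (μ û.proj) = ξ + k ∧ θ û = Circle.exp (m * a) * θ u ∧
      hatDist g nabla u û ≤ ENNReal.ofReal √M := by
  have hU := hf.isOpen_preimage ht
  obtain ⟨s, hs⟩ := exists_unitSection hp hc.trivial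
  have hδ := ht.δ_pos
  set A : Set Plane := (fun s : ℝ => ξ + s • k) '' Icc 0 1 with hA
  have hAc : IsCompact A := isCompact_Icc.image (by fun_prop)
  have hAR : A ⊆ Metric.closedBall 0 (3 * R) := by
    rintro _ ⟨s, hs, rfl⟩
    simpa using (hseg s hs).2.2.le
  have hK := ht.isCompact_preimage hf hc.ball_subset hAc.isClosed hAR
  have hKr : ∀ x, μ x ∈ W ∧ ζ (μ x) ∈ A →
      σ ≤ ‖ζ (μ x)‖ ∧ ρ ≤ ‖ζ (μ x)‖ ∧ ‖ζ (μ x)‖ < 3 * R := by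
    rintro x ⟨-, s, hs, h⟩
    rw [← h]; exact hseg s hs
  obtain ⟨τ₀, hτ₀, hlift⟩ := exists_uniform_lift (F := ζ ∘ μ) hK (fun x hx => hx.1)
    (fun x hx => ht.contMDiffAt_comp hf hx.1 (ht.σ_pos.trans_le (hKr x hx).1))
    (fun x hx h => by
      obtain ⟨v, hv, -⟩ := hc.exists_lift_vector ht hf hx.1 (hKr x hx).1 (hKr x hx).2.2 0 h
      exact ⟨v, hv⟩)
    g hU (ht.smooth_γ.evalSmoothOn hU) a k (M := M) (fun x hx => by
      obtain ⟨v, hv, hv'⟩ := hc.exists_lift_vector ht hf hx.1 (hKr x hx).1 (hKr x hx).2.2 a k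
      refine ⟨v, hv, hv'.trans_lt (lt_of_le_of_lt ?_ hM)⟩
      have := (hKr x hx).2.1
      gcongr)
  obtain ⟨n, hn⟩ := exists_nat_one_div_lt hτ₀
  have hn0 : (0 : ℝ) < (n : ℝ) + 1 := by positivity
  have step : ∀ j : ℕ, j ≤ n + 1 → ∃ û ∈ circleBundle L, μ û.proj ∈ W ∧
      ζ (μ û.proj) = ξ + (j / ((n : ℝ) + 1)) • k ∧
      θ û = Circle.exp (m * (a * (j / ((n : ℝ) + 1)))) * θ u ∧
      hatDist g nabla u û ≤ ENNReal.ofReal (√M * (j / ((n : ℝ) + 1))) := by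
    intro j
    induction j with
    | zero => exact fun _ => ⟨u, hu, huW, by simp [hξ], by simp, by simp [hatDist_self hu]⟩
    | succ j ih =>
      intro hj
      obtain ⟨v, hv, hvW, hvζ, hvθ, hvd⟩ := ih (by omega)
      have hj1 : (j : ℝ) / ((n : ℝ) + 1) ∈ Icc (0 : ℝ) 1 := by
        refine ⟨by positivity, (div_le_one hn0).2 ?_⟩
        have : j ≤ n + 1 := by omega
        exact_mod_cast this
      obtain ⟨c, hc0, hcτ⟩ := hlift v.proj ⟨hvW, _, hj1, hvζ.symm⟩
      have hτ : (0 : ℝ) ≤ 1 / ((n : ℝ) + 1) := by positivity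
      have hcτ' := fun τ (h : τ ∈ Icc 0 (1 / ((n : ℝ) + 1))) => hcτ τ ⟨h.1, h.2.trans hn.le⟩
      have hcp : PiecewiseC1On (𝓡 4) c 0 (1 / ((n : ℝ) + 1)) :=
        PiecewiseC1On.of_contMDiffOn hτ fun τ h => (hcτ' τ h).1.contMDiffWithinAt
      obtain ⟨û, hû, hûp, hûθ, hûd⟩ := hθ.exists_lift_curve hp hU hs ht.smooth_γ ht.primitive g hcp
        (fun τ h => (hcτ' τ h).2.1) a hv hc0.symm
      have hend := hcτ' _ ⟨hτ, le_rfl⟩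
      refine ⟨û, hû, by rw [hûp]; exact hend.2.1, ?_, ?_, ?_⟩
      · rw [hûp]
        refine hend.2.2.1.trans ?_
        change ζ (μ v.proj) + _ = _
        rw [hvζ, add_assoc, ← add_smul, ← add_div]
        push_cast; rfl
      · rw [hûθ, hvθ, ← mul_assoc, ← Circle.exp_add]
        congr 2
        push_cast; ring
      · refine (hatDist_triangle _ _ _).trans ((add_le_add hvd hûd).trans ?_)
        have h1 : ∫⁻ t in Icc 0 (1 / ((n : ℝ) + 1)), ENNReal.ofReal
            √((a - γ (c t) (velocity (𝓡 4) c t)) ^ 2 + g.norm (c t) (velocity (𝓡 4) c t) ^ 2)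
            ≤ ∫⁻ t in Icc 0 (1 / ((n : ℝ) + 1)), ENNReal.ofReal √M :=
          setLIntegral_mono measurable_const fun t h =>
            ENNReal.ofReal_le_ofReal (Real.sqrt_le_sqrt (hcτ' t h).2.2.2)
        rw [setLIntegral_const, Real.volume_Icc, sub_zero,
          ← ENNReal.ofReal_mul (Real.sqrt_nonneg _)] at h1
        refine (add_le_add le_rfl h1).trans ?_
        rw [← ENNReal.ofReal_add (by positivity) (by positivity)]
        refine ENNReal.ofReal_le_ofReal (le_of_eq ?_)
        push_cast; ring
  obtain ⟨û, h1, h2, h3, h4, h5⟩ := step (n + 1) le_rfl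
  have h6 : ((n + 1 : ℕ) : ℝ) / ((n : ℝ) + 1) = 1 := by push_cast; exact div_self hn0.ne'
  rw [h6] at h3 h4 h5
  exact ⟨û, h1, h2, by simpa using h3, by simpa using h4, by simpa using h5⟩

/-- A path of length less than δ in the core is lifted while the angle advances by a. The factor 3
is 1 + C for the bound |γ| ≤ 2|v| in the core. -/
lemma Conditions.exists_lift_core (hc : Conditions L g μ Brg b W R γ ζ σ δ K)
    (ht : IsTuple Ω μ Brg b W R γ ζ σ δ K) (hf : IsFibration Ω μ Brg) (hp : IsPrequantum nabla Ω)
    (hθ : IsAngle nabla m γ (μ ⁻¹' W) θ) (hu : u ∈ circleBundle L) (huW : μ u.proj ∈ W)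
    (huσ : ‖ζ (μ u.proj)‖ ≤ σ) {y : X} (hy : μ y ∈ W) (hyσ : ‖ζ (μ y)‖ ≤ σ) (a : ℝ) :
    ∃ û ∈ circleBundle L, û.proj = y ∧ θ û = Circle.exp (m * a) * θ u ∧
      hatDist g nabla u û ≤ ENNReal.ofReal (|a| + 3 * δ) := by
  have hU := hf.isOpen_preimage ht
  obtain ⟨s, hs⟩ := exists_unitSection hp hc.trivial
  obtain ⟨c, hcp, hc0, hc1, hcm, hcl⟩ := hc.exists_core_curve huW huσ hy hyσ
  have hδ := ht.δ_pos
  obtain ⟨û, h1, h2, h3, h4⟩ := hθ.exists_lift_curve_of_le hp hU hs ht.smooth_γ ht.primitive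
    (C := 2) (g := g) zero_le_two hcp (fun t htI => (hcm htI).1) (fun t htI v => by
      refine (hc.abs_le_of_le ht hf (hcm htI).1 (hcm htI).2 v).trans ?_
      have h5 : √δ ≤ 1 := Real.sqrt_le_one.2 ht.δ_lt.le
      have h6 := g.norm_nonneg (c t) v
      nlinarith) a hu hc0.symm
  refine ⟨û, h1, h2.trans hc1, h3, h4.trans ?_⟩
  rw [ENNReal.ofReal_add (abs_nonneg a) (by positivity), ENNReal.ofReal_mul (by norm_num)]
  refine add_le_add le_rfl (mul_le_mul' (ENNReal.ofReal_le_ofReal (by norm_num)) hcl.le)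

lemma Conditions.exists_lift_subsegment (hc : Conditions L g μ Brg b W R γ ζ σ δ K)
    (ht : IsTuple Ω μ Brg b W R γ ζ σ δ K) (hf : IsFibration Ω μ Brg) (hp : IsPrequantum nabla Ω)
    (hθ : IsAngle nabla m γ (μ ⁻¹' W) θ)
    (hseg : ∀ s ∈ Icc (0 : ℝ) 1, ρ ≤ ‖ξ + s • k‖ ∧ ‖ξ + s • k‖ < 3 * R)
    (hρ : 0 ≤ ρ) (a : ℝ) {s₁ s₂ : ℝ} (h0 : 0 ≤ s₁) (h12 : s₁ ≤ s₂) (h1 : s₂ ≤ 1)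
    (hσ : s₁ < s₂ → ∀ s ∈ Ioo s₁ s₂, σ ≤ ‖ξ + s • k‖)
    (hu : u ∈ circleBundle L) (huW : μ u.proj ∈ W) (hξ : ζ (μ u.proj) = ξ + s₁ • k) :
    ∃ û ∈ circleBundle L, μ û.proj ∈ W ∧ ζ (μ û.proj) = ξ + s₂ • k ∧
      θ û = Circle.exp (m * (a * (s₂ - s₁))) * θ u ∧
      hatDist g nabla u û ≤
        ENNReal.ofReal ((1 + 2 * δ) * √(a ^ 2 / (1 + ρ ^ 2) + ‖k‖ ^ 2) * (s₂ - s₁) + δ / 2) := by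
  have hδ := ht.δ_pos
  rcases h12.eq_or_lt with rfl | hlt
  · exact ⟨u, hu, huW, hξ, by simp, by simp [hatDist_self hu]⟩
  -- The hypothesis concerns the open interval, because at its end points the segment may just touch
  -- the core; closedness gives the rest.
  have hσ' : ∀ s ∈ Icc s₁ s₂, σ ≤ ‖ξ + s • k‖ := by
    have hcl : IsClosed {s : ℝ | σ ≤ ‖ξ + s • k‖} := isClosed_le continuous_const (by fun_prop)
    rw [← closure_Ioo hlt.ne]
    exact fun s hs => closure_minimal (hσ hlt) hcl hs
  set S := √(a ^ 2 / (1 + ρ ^ 2) + ‖k‖ ^ 2) with hS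
  have hS2 : S ^ 2 = a ^ 2 / (1 + ρ ^ 2) + ‖k‖ ^ 2 := Real.sq_sqrt (by positivity)
  have hS0 : 0 ≤ S := Real.sqrt_nonneg _
  have hΔ : 0 < s₂ - s₁ := sub_pos.2 hlt
  have hQ : 0 ≤ (1 + 2 * δ) * S * (s₂ - s₁) := by positivity
  obtain ⟨û, h2, h3, h4, h5, h6⟩ := hc.exists_lift_outside ht hf hp hθ (ξ := ξ + s₁ • k)
    (k := (s₂ - s₁) • k) (ρ := ρ) (fun s hs => by
      have h7 : ξ + s₁ • k + s • (s₂ - s₁) • k = ξ + (s₁ + s * (s₂ - s₁)) • k := by module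
      rw [h7]
      have h8 : s₁ + s * (s₂ - s₁) ∈ Icc s₁ s₂ := ⟨by nlinarith [hs.1], by nlinarith [hs.2]⟩
      exact ⟨hσ' _ h8, hseg _ ⟨h0.trans h8.1, h8.2.trans h1⟩⟩) hρ (a * (s₂ - s₁))
    -- The estimate for lifts needs a strict bound. Here (1+2δ)² ≥ 1 + 4δ, and the summand δ/2
    -- provides the strictness.
    (M := ((1 + 2 * δ) * S * (s₂ - s₁) + δ / 2) ^ 2) (by
      have h9 : (a * (s₂ - s₁)) ^ 2 / (1 + ρ ^ 2) + ‖(s₂ - s₁) • k‖ ^ 2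
          = (S * (s₂ - s₁)) ^ 2 := by
        rw [norm_smul, Real.norm_eq_abs, mul_pow, mul_pow, sq_abs, mul_pow, hS2]; ring
      rw [h9]
      have h10 : 0 ≤ (S * (s₂ - s₁)) ^ 2 := sq_nonneg _
      have h11 : ((1 + 2 * δ) * S * (s₂ - s₁)) ^ 2 = (1 + 4 * δ + 4 * δ ^ 2) *
        (S * (s₂ - s₁)) ^ 2 := by ring
      have h12 : 0 ≤ δ ^ 2 * (S * (s₂ - s₁)) ^ 2 := by positivity
      have h13 : 0 < δ ^ 2 := by positivity
      have h14 : 0 ≤ δ * ((1 + 2 * δ) * S * (s₂ - s₁)) := by positivity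
      linarith [add_sq ((1 + 2 * δ) * S * (s₂ - s₁)) (δ / 2)]) hu huW hξ
  rw [Real.sqrt_sq (by positivity)] at h6
  exact ⟨û, h2, h3, by rw [h4]; module, h5, h6⟩

/-- The part of the segment between its first and its last time in the core is replaced by a short
path in the core. The error 4δ is δ/2 for each of the two outer parts and 3δ for the core. -/
lemma Conditions.exists_lift_segment (hc : Conditions L g μ Brg b W R γ ζ σ δ K)
    (ht : IsTuple Ω μ Brg b W R γ ζ σ δ K) (hf : IsFibration Ω μ Brg) (hp : IsPrequantum nabla Ω)
    (hθ : IsAngle nabla m γ (μ ⁻¹' W) θ)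
    (hseg : ∀ s ∈ Icc (0 : ℝ) 1, ρ ≤ ‖ξ + s • k‖ ∧ ‖ξ + s • k‖ < 3 * R)
    (hρ : 0 ≤ ρ) (a : ℝ) (hu : u ∈ circleBundle L) (huW : μ u.proj ∈ W) (hξ : ζ (μ u.proj) = ξ) :
    ∃ û ∈ circleBundle L, μ û.proj ∈ W ∧ ζ (μ û.proj) = ξ + k ∧
      θ û = Circle.exp (m * a) * θ u ∧ hatDist g nabla u û ≤
        ENNReal.ofReal ((1 + 2 * δ + σ) * √(a ^ 2 / (1 + ρ ^ 2) + ‖k‖ ^ 2) + 4 * δ) := by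
  have hδ := ht.δ_pos
  have hσ0 := ht.σ_pos
  set S := √(a ^ 2 / (1 + ρ ^ 2) + ‖k‖ ^ 2) with hS
  have hS0 : 0 ≤ S := Real.sqrt_nonneg _
  set C : Set ℝ := {s ∈ Icc (0 : ℝ) 1 | ‖ξ + s • k‖ ≤ σ} with hC
  rcases C.eq_empty_or_nonempty with hE | hne
  · obtain ⟨û, h1, h2, h3, h4, h5⟩ := hc.exists_lift_subsegment ht hf hp hθ hseg hρ a le_rfl
      zero_le_one le_rfl (fun _ s hs => by
        by_contra hlt
        have : s ∈ C := ⟨⟨hs.1.le, hs.2.le⟩, (not_le.1 hlt).le⟩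
        rw [hE] at this; exact this) hu huW (by simpa using hξ)
    rw [sub_zero, mul_one] at h4 h5
    refine ⟨û, h1, h2, by simpa using h3, h4, h5.trans (ENNReal.ofReal_le_ofReal ?_)⟩
    nlinarith [mul_nonneg hσ0.le hS0]
  have hCc : IsCompact C := isCompact_Icc.inter_right
    (isClosed_le (by fun_prop) continuous_const : IsClosed {s : ℝ | ‖ξ + s • k‖ ≤ σ})
  obtain ⟨s₁, hs₁, hmin⟩ := hCc.exists_isLeast hne
  obtain ⟨s₂, hs₂, hmax⟩ := hCc.exists_isGreatest hne
  have h12 : s₁ ≤ s₂ := hmin hs₂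
  obtain ⟨u₁, h1, h2, h3, h4, h5⟩ := hc.exists_lift_subsegment ht hf hp hθ hseg hρ a le_rfl
    hs₁.1.1 hs₁.1.2 (fun _ s hs => by
        by_contra hlt
        have : s ∈ C := ⟨⟨hs.1.le, hs.2.le.trans hs₁.1.2⟩, (not_le.1 hlt).le⟩
        linarith [hmin this, hs.2]) hu huW (by simpa using hξ)
  -- The path in the core may end at any point over the last parameter in the core, since the lift
  -- of the remaining part can start anywhere in the fiber.
  obtain ⟨w, hwW, hwζ⟩ := hc.ball_subset (show ξ + s₂ • k ∈ Metric.closedBall (0 : Plane) (3 * R) by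
    simpa using (hseg s₂ hs₂.1).2.le)
  obtain ⟨y, rfl⟩ := (hf.connected w).nonempty
  obtain ⟨u₂, h1', h2', h4', h5'⟩ := hc.exists_lift_core ht hf hp hθ h1 h2 (by rw [h3]; exact hs₁.2)
    (y := y) hwW (by rw [hwζ]; exact hs₂.2) (a * (s₂ - s₁))
  subst h2'
  obtain ⟨u₃, h1'', h2'', h3'', h4'', h5''⟩ := hc.exists_lift_subsegment ht hf hp hθ hseg hρ a
    hs₂.1.1 hs₂.1.2 le_rfl (fun _ s hs => by
        by_contra hlt
        have : s ∈ C := ⟨⟨hs₂.1.1.trans hs.1.le, hs.2.le⟩, (not_le.1 hlt).le⟩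
        linarith [hmax this, hs.1]) h1' hwW hwζ
  refine ⟨u₃, h1'', h2'', by simpa using h3'', ?_, ?_⟩
  · rw [h4'', h4', h4, ← mul_assoc, ← Circle.exp_add, ← mul_assoc, ← Circle.exp_add]
    congr 2; ring
  refine (hatDist_triangle _ u₁ _).trans ((add_le_add h5 ((hatDist_triangle _ u₂ _).trans
    (add_le_add h5' h5''))).trans ?_)
  have hρσ : ρ ≤ σ := (hseg s₁ hs₁.1).1.trans hs₁.2
  -- If the segment meets the core, then ρ ≤ σ and the weight of the angle is close to 1, so
  -- rotating inside the core costs hardly more than in the model.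
  have ha : |a| ≤ (1 + σ) * S := by
    refine abs_le_of_sq_le_sq ?_ (by positivity)
    rw [mul_pow, Real.sq_sqrt (by positivity)]
    have h6 : a ^ 2 / (1 + ρ ^ 2) * (1 + ρ ^ 2) = a ^ 2 := div_mul_cancel₀ _ (by positivity)
    have h7 : (0 : ℝ) ≤ a ^ 2 / (1 + ρ ^ 2) := by positivity
    have h8 : 1 + ρ ^ 2 ≤ (1 + σ) ^ 2 := by nlinarith
    nlinarith [sq_nonneg ‖k‖, mul_le_mul_of_nonneg_left h8 h7, sq_nonneg (1 + σ),
      mul_nonneg (sq_nonneg (1 + σ)) (sq_nonneg ‖k‖)]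
  have e1 : 0 ≤ s₁ := hs₁.1.1
  have e2 : 0 ≤ s₂ - s₁ := sub_nonneg.2 h12
  have e3 : 0 ≤ 1 - s₂ := sub_nonneg.2 hs₂.1.2
  have e4 : s₁ - 0 = s₁ := sub_zero _
  rw [e4, ← ENNReal.ofReal_add (by positivity) (by positivity),
    ← ENNReal.ofReal_add (by positivity) (by positivity)]
  refine ENNReal.ofReal_le_ofReal ?_
  rw [abs_mul, abs_of_nonneg e2]
  have h9 := mul_le_mul_of_nonneg_right ha e2
  have h10 : (1 + σ) * S * (s₂ - s₁) ≤ (1 + 2 * δ + σ) * S * (s₂ - s₁) := by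
    gcongr ?_ * _ * _; linarith
  have h11 : (1 + 2 * δ) * S * s₁ ≤ (1 + 2 * δ + σ) * S * s₁ := by
    gcongr ?_ * _ * _; linarith
  have h12 : (1 + 2 * δ) * S * (1 - s₂) ≤ (1 + 2 * δ + σ) * S * (1 - s₂) := by
    gcongr ?_ * _ * _; linarith
  linarith

end SegmentLift

/-! ### Products of roots of unity -/

section RootsOfUnity

/-- The `m`-th roots of unity in the unit circle. -/
def circleRoots (m : ℕ) : Finset Circle :=
  (Polynomial.nthRootsFinset m (1 : ℂ)).preimage Circle.coeHom Circle.coe_injective.injOn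

lemma card_circleRoots_le (m : ℕ) : (circleRoots m).card ≤ m := by
  rw [← Finset.card_image_of_injective (circleRoots m) (f := Circle.coeHom) Circle.coe_injective]
  refine (Finset.card_le_card (Finset.image_subset_iff.2 fun z hz => ?_)).trans
    ((Multiset.toFinset_card_le _).trans (Polynomial.card_nthRoots m (1 : ℂ)))
  exact Finset.mem_preimage.1 hz

lemma mem_circleRoots {m : ℕ} (hm : 0 < m) (z : Circle) : z ∈ circleRoots m ↔ z ^ m = 1 := by
  have h1 : z ∈ circleRoots m ↔ (z : ℂ) ∈ Polynomial.nthRootsFinset m (1 : ℂ) :=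
    Finset.mem_preimage
  rw [h1, Polynomial.mem_nthRootsFinset hm, ← Circle.coe_pow, Circle.coe_eq_one]

/-- The elements of the group generated by a set `T` of `m`-th roots of unity are products of at
most `m²` elements of `T`. -/
lemma induction_of_mem_closure {m : ℕ} (hm : 0 < m) {T : Set Circle} (hT : ∀ t ∈ T, t ^ m = 1)
    {Q : Circle → ℕ → Prop} (one : Q 1 0) (mul : ∀ a b i j, Q a i → Q b j → Q (a * b) (i + j))
    (mono : ∀ a i j, i ≤ j → Q a i → Q a j) (hQ : ∀ t ∈ T, Q t 1) {w : Circle}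
    (hw : w ∈ Subgroup.closure T) : Q w (m * m) := by
  classical
  set Z := circleRoots m
  have hTZ : ∀ t ∈ T, t ∈ Z := fun t ht => (mem_circleRoots hm t).2 (hT t ht)
  -- The group is abelian and inverses are (m-1)-th powers, so every element is a product of powers
  -- of elements of T. The exponents can then be reduced modulo m.
  have hk : ∃ k : Circle → ℕ, (∀ t, t ∉ T → k t = 0) ∧ w = ∏ t ∈ Z, t ^ k t := by
    induction hw using Subgroup.closure_induction with
    | mem x hx =>
      refine ⟨fun t => if t = x then 1 else 0, fun t ht => if_neg (by rintro rfl; exact ht hx), ?_⟩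
      rw [Finset.prod_eq_single_of_mem x (hTZ x hx) fun t _ h => by simp [h]]
      simp
    | one => exact ⟨fun _ => 0, fun _ _ => rfl, by simp⟩
    | mul x y _ _ hx hy =>
      obtain ⟨k, hk, rfl⟩ := hx
      obtain ⟨k', hk', rfl⟩ := hy
      refine ⟨k + k', fun t ht => by simp [hk t ht, hk' t ht], ?_⟩
      rw [← Finset.prod_mul_distrib]
      exact Finset.prod_congr rfl fun t _ => by rw [Pi.add_apply, pow_add]
    | inv x _ hx =>
      obtain ⟨k, hk, rfl⟩ := hx
      refine ⟨fun t => (m - 1) * k t, fun t ht => by simp [hk t ht], ?_⟩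
      rw [← Finset.prod_inv_distrib]
      refine Finset.prod_congr rfl fun t ht => ?_
      rw [inv_eq_iff_mul_eq_one, pow_mul, ← mul_pow, ← pow_succ', Nat.sub_add_cancel hm,
        (mem_circleRoots hm t).1 ht, one_pow]
  obtain ⟨k, hk, rfl⟩ := hk
  have hpow : ∀ t ∈ T, ∀ j, Q (t ^ j) j := by
    intro t ht j
    induction j with
    | zero => simpa using one
    | succ j ih => rw [pow_succ]; exact mul _ _ _ _ ih (hQ t ht)
  have hprod : ∀ S ⊆ Z, Q (∏ t ∈ S, t ^ k t) (∑ t ∈ S, k t % m) := by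
    intro S
    induction S using Finset.induction with
    | empty => exact fun _ => by simpa using one
    | insert t S htS ih =>
      intro h
      rw [Finset.prod_insert htS, Finset.sum_insert htS]
      refine mul _ _ _ _ ?_ (ih ((Finset.subset_insert t S).trans h))
      by_cases ht : t ∈ T
      · rw [pow_eq_pow_mod _ (hT t ht)]
        exact hpow t ht _
      · simpa [hk t ht] using one
  refine mono _ _ _ ?_ (hprod Z subset_rfl)
  calc ∑ t ∈ Z, k t % m ≤ ∑ t ∈ Z, m := Finset.sum_le_sum fun t _ => (Nat.mod_lt _ hm).le
    _ = Z.card * m := by simp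
    _ ≤ m * m := Nat.mul_le_mul_right _ (card_circleRoots_le m)

/-- A proper subgroup of the group of m-th roots of unity has order l < m, and its elements are l-th
roots of unity by Lagrange's theorem. -/
lemma exists_pow_eq_one_of_notMem_closure {m : ℕ} (hm : 0 < m) {T : Set Circle}
    (hT : ∀ t ∈ T, t ^ m = 1) {w : Circle} (hw : w ^ m = 1) (h : w ∉ Subgroup.closure T) :
    ∃ l, 1 ≤ l ∧ l < m ∧ ∀ z ∈ Subgroup.closure T, z ^ l = 1 := by
  set Z := circleRoots m
  have hpow : ∀ z ∈ Subgroup.closure T, z ^ m = 1 := by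
    intro z hz
    have h1 : Subgroup.closure T ≤ (powMonoidHom m : Circle →* Circle).ker :=
      (Subgroup.closure_le _).2 fun t ht => MonoidHom.mem_ker.2 (hT t ht)
    exact MonoidHom.mem_ker.1 (h1 hz)
  have hsub : (Subgroup.closure T : Set Circle) ⊂ (Z : Set Circle) := by
    refine (ssubset_iff_of_subset fun z hz => ?_).2 ⟨w, ?_, h⟩
    · exact Finset.mem_coe.2 ((mem_circleRoots hm z).2 (hpow z hz))
    · exact Finset.mem_coe.2 ((mem_circleRoots hm w).2 hw)
  have hfin : (Subgroup.closure T : Set Circle).Finite := Z.finite_toSet.subset hsub.subset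
  have : Finite (Subgroup.closure T) := hfin.to_subtype
  refine ⟨Nat.card (Subgroup.closure T), Nat.card_pos, ?_, fun z hz => ?_⟩
  · have h1 := Set.ncard_lt_ncard hsub Z.finite_toSet
    rw [Set.ncard_coe_finset] at h1
    exact h1.trans_le (card_circleRoots_le m)
  · exact congrArg Subtype.val (pow_card_eq_one' (x := (⟨z, hz⟩ : Subgroup.closure T)))

end RootsOfUnity

/-! ### Shifts of the phase along curves -/

section PhaseShift

variable {X : Type*} [TopologicalSpace X] [ChartedSpace Four X] [IsManifold (𝓡 4) ∞ X]

lemma exists_fine_subdivision (g : Metric X) {c : ℝ → X} (hc : PiecewiseC1On (𝓡 4) c 0 1) {κ : ℝ}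
    (hκ : 0 < κ) : ∃ (n : ℕ) (τ : ℕ → ℝ), Monotone τ ∧ τ 0 = 0 ∧ τ n = 1 ∧
      ∀ i, lengthOn (𝓡 4) g.norm c (τ i) (τ (i + 1)) ≤ ENNReal.ofReal κ := by
  have hQ := g.continuous_norm.continuousOn (s := TotalSpace.proj ⁻¹' (univ : Set X))
  obtain ⟨n, hn⟩ := exists_nat_gt ((lengthOn (𝓡 4) g.norm c 0 1).toReal / κ)
  have hn0 : (0 : ℝ) < n := lt_of_le_of_lt (by positivity) hn
  obtain ⟨τ, h1, h2, h3, h4⟩ := exists_subdivision g.norm_nonneg hQ hc (mapsTo_univ _ _)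
    (n := n) (by exact_mod_cast hn0) (ENNReal.ofReal_toReal
      (lengthOn_ne_top g.norm_nonneg hQ hc (mapsTo_univ _ _))).ge
  refine ⟨n, τ, h1, h2, h3, fun i => (h4 i).trans (ENNReal.ofReal_le_ofReal ?_)⟩
  rw [div_le_iff₀ hn0]
  rw [div_lt_iff₀ hκ] at hn
  linarith

lemma abs_integral_le_of_length_le (g : Metric X) {η : OneForm X} {c : ℝ → X}
    {a b C ℓ : ℝ} (hab : a ≤ b) (hC : 0 ≤ C) (hℓ0 : 0 ≤ ℓ)
    (hb : ∀ t ∈ Icc a b, ∀ v, |η (c t) v| ≤ C * g.norm (c t) v)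
    (hℓ : lengthOn (𝓡 4) g.norm c a b ≤ ENNReal.ofReal ℓ) :
    |∫ t in a..b, η (c t) (velocity (𝓡 4) c t)| ≤ C * ℓ := by
  have h1 : ENNReal.ofReal |∫ t in a..b, η (c t) (velocity (𝓡 4) c t)|
      ≤ ENNReal.ofReal (C * ℓ) := by
    rw [intervalIntegral.integral_of_le hab, ← integral_Icc_eq_integral_Ioc, ← Real.norm_eq_abs,
      ofReal_norm]
    refine (enorm_integral_le_lintegral_enorm _).trans ?_
    rw [ENNReal.ofReal_mul hC]
    refine le_trans ?_ (mul_le_mul' le_rfl hℓ)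
    rw [lengthOn, ← lintegral_const_mul' _ _ ENNReal.ofReal_ne_top]
    refine setLIntegral_mono' measurableSet_Icc fun t ht => ?_
    rw [← ENNReal.ofReal_mul hC, ← ofReal_norm, Real.norm_eq_abs]
    exact ENNReal.ofReal_le_ofReal (hb t ht _)
  exact (ENNReal.ofReal_le_ofReal_iff (by positivity)).1 h1

variable {L : X → Type*} [TopologicalSpace (TotalSpace ℂ L)] [∀ x, NormedAddCommGroup (L x)]
  [∀ x, InnerProductSpace ℂ (L x)] [FiberBundle ℂ L] [VectorBundle ℝ ℂ L] [VectorBundle ℂ ℂ L]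
  [ContMDiffVectorBundle ∞ ℂ L (𝓡 4)] {nabla : CovariantDerivative (𝓡 4) ℂ L} {g : Metric X}
  {s : (x : X) → L x} {θ : TotalSpace ℂ L → Circle} {κ κ' f f' : ℝ} {x y z : X} {U : Set X}
  {γ : OneForm X} {m : ℕ} {Ω : TwoTensor X}

variable (nabla g s θ) in
/-- The phases by which the fibers of the circle bundle over two points, identified with the help
of a section, can be shifted such that the angular coordinate does not change and that points are
moved by at most `κ`. -/
def phaseShifts (κ : ℝ) (x y : X) : Set ℝ :=
  {f | ∀ ψ, θ (liftPoint s y (ψ + f)) = θ (liftPoint s x ψ) ∧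
    hatDist g nabla (liftPoint s x ψ) (liftPoint s y (ψ + f)) ≤ ENNReal.ofReal κ}

lemma add_mem_phaseShifts (hκ : 0 ≤ κ) (hκ' : 0 ≤ κ') (h : f ∈ phaseShifts nabla g s θ κ x y)
    (h' : f' ∈ phaseShifts nabla g s θ κ' y z) : f + f' ∈ phaseShifts nabla g s θ (κ + κ') x z := by
  intro ψ
  rw [← add_assoc]
  refine ⟨(h' _).1.trans (h ψ).1, ?_⟩
  rw [ENNReal.ofReal_add hκ hκ']
  exact (lengthDist_triangle (homogeneous_hatNorm g nabla) _ _ _).trans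
    (add_le_add (h ψ).2 (h' _).2)

lemma neg_mem_phaseShifts (h : f ∈ phaseShifts nabla g s θ κ x y) :
    -f ∈ phaseShifts nabla g s θ κ y x := by
  intro ψ
  have h1 := h (ψ + -f)
  rw [neg_add_cancel_right] at h1
  refine ⟨h1.1.symm, ?_⟩
  rw [hatDist, lengthDist_comm (homogeneous_hatNorm g nabla)]
  exact h1.2

lemma liftPoint_add (s : (x : X) → L x) (x : X) (ψ f : ℝ) :
    liftPoint s x (ψ + f) = rot (Circle.exp f) (liftPoint s x ψ) := by
  rw [liftPoint, liftPoint, rot, rot, rot, add_comm, Circle.exp_add, Circle.coe_mul, mul_smul]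

variable [T2Space X]

/-- Lifting a path with θ constant means ψ' = -η, hence Γ = -γ. The speed of the lift is then at
most 1 + C times that of the path. -/
lemma IsAngle.neg_integral_mem_phaseShifts (hθ : IsAngle nabla m γ U θ) (h : IsPrequantum nabla Ω)
    (hU : IsOpen U) (hs : IsUnitSection s U) (hγ : γ.SmoothOn U) (hd : IsExteriorDerivOn γ Ω U)
    {C ℓ a b : ℝ} (hC : 0 ≤ C) {c : ℝ → X} (hc : PiecewiseC1On (𝓡 4) c a b)
    (hA : MapsTo c (Icc a b) U) (hb : ∀ t ∈ Icc a b, ∀ v, |γ (c t) v| ≤ C * g.norm (c t) v)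
    (hℓ : lengthOn (𝓡 4) g.norm c a b ≤ ENNReal.ofReal ℓ) :
    -(∫ t in a..b, totalForm nabla s γ (c t) (velocity (𝓡 4) c t))
      ∈ phaseShifts nabla g s θ ((1 + C) * ℓ) (c a) (c b) := by
  intro ψ
  refine ⟨?_, ?_⟩
  · rw [hθ.apply_liftPoint_curve h hU hs hγ hd hc hA ψ]
    simp
  obtain ⟨hI, hI'⟩ := (evalSmoothOn_totalForm h hU hs hγ).primitive hc hA
  have h1 := hatDist_liftPoint_le h hU hs g hc ((PiecewiseC1On.affine 0 ψ a b hc.le).add hI.neg)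
    (ψ' := fun t => - totalForm nabla s γ (c t) (velocity (𝓡 4) c t)) (by
      filter_upwards [hI'] with t ht htI
      have h2 := (((hasDerivAt_id t).const_mul 0).add_const ψ).add (ht htI).neg
      exact h2.congr_deriv (by simp)) hA
  simp only [zero_mul, zero_add, intervalIntegral.integral_same, neg_zero, add_zero] at h1
  refine h1.trans ?_
  rw [ENNReal.ofReal_mul (by linarith)]
  refine le_trans ?_ (mul_le_mul' le_rfl hℓ)
  rw [lengthOn, ← lintegral_const_mul' _ _ ENNReal.ofReal_ne_top]
  refine setLIntegral_mono' measurableSet_Icc fun t ht => ?_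
  have hn := g.norm_nonneg (c t) (velocity (𝓡 4) c t)
  rw [← ENNReal.ofReal_mul (by linarith)]
  refine ENNReal.ofReal_le_ofReal ((Real.sqrt_le_left (by positivity)).2 ?_)
  have h5 := hb t ht (velocity (𝓡 4) c t)
  rw [totalForm_apply]
  generalize γ (c t) (velocity (𝓡 4) c t) = q at *
  generalize g.norm (c t) (velocity (𝓡 4) c t) = n at *
  have h7 := pow_le_pow_left₀ (abs_nonneg _) h5 2
  rw [sq_abs] at h7
  have h8 : 0 ≤ C * n ^ 2 := by positivity
  nlinarith

lemma IsAngle.exp_pow_eq_one (hθ : IsAngle nabla m γ U θ) (hs : IsUnitSection s U)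
    (hx : x ∈ U) (h : f ∈ phaseShifts nabla g s θ κ x x) : Circle.exp f ^ m = 1 := by
  have h1 := (h 0).1
  rw [liftPoint_add, hθ.equivariant _ (liftPoint_mem hs hx 0) hx] at h1
  exact mul_eq_right.1 h1

end PhaseShift

/-! ### The fibers of the angular coordinate over a fiber of `μ` -/

section Fiber

lemma mem_pathIntegrals_of_le {X : Type*} [TopologicalSpace X] [ChartedSpace Four X]
    [IsManifold (𝓡 4) ∞ X] {η : OneForm X} {F : Set X} {c : ℝ → X} {a b : ℝ}
    (hc : PiecewiseC1On (𝓡 4) c a b) (hF : MapsTo c (Icc a b) F) :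
    ∫ t in a..b, η (c t) (velocity (𝓡 4) c t) ∈ pathIntegrals η F (c a) (c b) := by
  rcases hc.le.eq_or_lt with rfl | h
  · rw [intervalIntegral.integral_same]
    exact zero_mem_pathIntegrals (hF ⟨le_rfl, le_rfl⟩)
  · exact mem_pathIntegrals_of_on h hc hF

variable {X : Type*} [TopologicalSpace X] [T2Space X] [ChartedSpace Four X] [IsManifold (𝓡 4) ∞ X]
  {L : X → Type*} [TopologicalSpace (TotalSpace ℂ L)] [∀ x, NormedAddCommGroup (L x)]
  [∀ x, InnerProductSpace ℂ (L x)] [FiberBundle ℂ L] [VectorBundle ℝ ℂ L] [VectorBundle ℂ ℂ L]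
  [ContMDiffVectorBundle ∞ ℂ L (𝓡 4)] {nabla : CovariantDerivative (𝓡 4) ℂ L}
  {B : Type*} [TopologicalSpace B] [T2Space B] [ChartedSpace Plane B] [IsManifold (𝓡 2) ∞ B]
  {Ω : TwoTensor X} {g : Metric X} {μ : X → B} {Brg : Set B} {b : B} {W : Set B} {R : ℝ}
  {γ : OneForm X} {ζ : B → Plane} {σ δ K : ℝ} {θ : TotalSpace ℂ L → Circle} {m : ℕ}
  {s : (x : X) → L x} {x : X}

/-- The fiber X_b may be singular, so γ need not be closed on it and its integrals are not
determined by homology. But m times the integral over a loop is quantized, because this holds for η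
by the existence of θ and for α by BS_m. Integrals over short loops therefore vanish, and every loop
decomposes into short ones since X_b has diameter less than δ. -/
lemma Conditions.integral_eq_zero (hc : Conditions L g μ Brg b W R γ ζ σ δ K)
    (ht : IsTuple Ω μ Brg b W R γ ζ σ δ K) (hf : IsFibration Ω μ Brg) (hp : IsPrequantum nabla Ω)
    (hθ : IsAngle nabla m γ (μ ⁻¹' W) θ) (hb : b ∈ BS nabla μ m) (hm : 0 < m) (hδm : m * δ ≤ 1)
    {c : ℝ → X} (hcp : PiecewiseC1On (𝓡 4) c 0 1) (hcb : MapsTo c (Icc 0 1) (μ ⁻¹' {b}))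
    (hloop : c 1 = c 0) : ∫ t in (0 : ℝ)..1, γ (c t) (velocity (𝓡 4) c t) = 0 := by
  have hU := hf.isOpen_preimage ht
  obtain ⟨s, hs⟩ := exists_unitSection hp hc.trivial
  have hFU : μ ⁻¹' {b} ⊆ μ ⁻¹' W := preimage_mono (singleton_subset_iff.2 ht.mem)
  have hγ := ht.smooth_γ.evalSmoothOn hU
  have hα := evalSmoothOn_potential hp hU hs
  have hδ := ht.δ_pos
  have hmδ : (0 : ℝ) < m := by exact_mod_cast hm
  have hζ : ∀ y ∈ μ ⁻¹' {b}, ‖ζ (μ y)‖ = 0 := fun y hy => by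
    rw [mem_singleton_iff.1 hy, ht.ζ_b, norm_zero]
  have hbound : ∀ y ∈ μ ⁻¹' {b}, ∀ v, |γ y v| ≤ 2 * g.norm y v := fun y hy v => by
    refine (hc.abs_le_of_le ht hf (hFU hy) (by rw [hζ y hy]; exact ht.σ_pos.le) v).trans ?_
    have h5 : √δ ≤ 1 := Real.sqrt_le_one.2 ht.δ_lt.le
    have h6 := g.norm_nonneg y v
    nlinarith
  -- An element of 2πℤ of absolute value at most 6mδ ≤ 6 < 2π is zero. The bound 6δ allows for three
  -- paths, each contributing 2δ.
  have hquant : ∀ y ∈ μ ⁻¹' {b}, ∀ r ∈ pathIntegrals γ (μ ⁻¹' {b}) y y, |r| ≤ 6 * δ → r = 0 := by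
    rintro y hy r ⟨d, hd, hd0, hd1, hdF, rfl⟩ hr
    obtain ⟨n₁, hn₁⟩ := (mem_BS_iff hp hU hs hFU m).1 hb y hy _ ⟨d, hd, hd0, hd1, hdF, rfl⟩
    have h1 := hθ.apply_liftPoint_curve hp hU hs ht.smooth_γ ht.primitive hd (hdF.mono_right hFU) 0 0
    rw [hd0, hd1, sub_self, zero_add] at h1
    obtain ⟨n₂, hn₂⟩ := Circle.exp_eq_one.1 (right_eq_mul.1 h1)
    have h2 : ∫ t in (0 : ℝ)..1, totalForm nabla s γ (d t) (velocity (𝓡 4) d t)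
        = (∫ t in (0 : ℝ)..1, potential nabla s (d t) (velocity (𝓡 4) d t))
          + ∫ t in (0 : ℝ)..1, γ (d t) (velocity (𝓡 4) d t) :=
      intervalIntegral.integral_add (hα.intervalIntegrable hd (hdF.mono_right hFU))
        (hγ.intervalIntegrable hd (hdF.mono_right hFU))
    set r := ∫ t in (0 : ℝ)..1, γ (d t) (velocity (𝓡 4) d t)
    have h3 : m * r = 2 * Real.pi * ((n₂ - n₁ : ℤ) : ℝ) := by
      rw [h2, mul_add, hn₁] at hn₂
      push_cast; linarith
    have h4 : |m * r| < 2 * Real.pi := by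
      rw [abs_mul, abs_of_pos hmδ]
      have := mul_le_mul_of_nonneg_left hr hmδ.le
      nlinarith [Real.pi_gt_three]
    rw [h3, abs_mul, abs_of_pos Real.two_pi_pos] at h4
    have h5 : |((n₂ - n₁ : ℤ) : ℝ)| < 1 := by
      by_contra hcon
      nlinarith [Real.two_pi_pos, not_lt.1 hcon]
    have h6 : n₂ - n₁ = 0 := Int.abs_lt_one_iff.1 (by exact_mod_cast h5)
    rw [h6, Int.cast_zero, mul_zero] at h3
    exact (mul_eq_zero.1 h3).resolve_left hmδ.ne'
  obtain ⟨n, τ, hτ, hτ0, hτn, hℓ⟩ := exists_fine_subdivision g hcp hδ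
  have hτ01 : ∀ i ≤ n, τ i ∈ Icc (0 : ℝ) 1 := fun i hi =>
    ⟨hτ0 ▸ hτ (Nat.zero_le i), hτn ▸ hτ hi⟩
  have h0 := hcb ⟨le_rfl, zero_le_one⟩
  have hshort : ∀ y ∈ μ ⁻¹' {b}, ∃ r ∈ pathIntegrals γ (μ ⁻¹' {b}) (c 0) y, |r| ≤ 2 * δ := by
    intro y hy
    have h0' : μ (c 0) = b := h0
    obtain ⟨d, hd, hd0, hd1, hdF, hdl⟩ := hc.exists_fiber_curve (x := c 0) (y := y) (hFU h0)
      (by rw [hζ _ h0]; linarith [ht.R_pos]) (hy.trans h0'.symm)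
    rw [h0'] at hdF
    exact ⟨_, ⟨d, hd, hd0, hd1, hdF, rfl⟩, abs_integral_le_of_length_le g zero_le_one zero_le_two
      hδ.le (fun t htI v => hbound _ (hdF htI) v) hdl.le⟩
  -- Up to each division point, the integral along the loop is the one along any path with small
  -- integral; consecutive ones are compared by a short triangle.
  have claim : ∀ i ≤ n, ∀ r ∈ pathIntegrals γ (μ ⁻¹' {b}) (c 0) (c (τ i)), |r| ≤ 2 * δ →
      ∫ t in (0 : ℝ)..τ i, γ (c t) (velocity (𝓡 4) c t) = r := by
    intro i
    induction i with
    | zero =>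
      intro _ r hr hr'
      rw [hτ0] at hr ⊢
      rw [intervalIntegral.integral_same, hquant _ h0 r hr (by linarith)]
    | succ i ih =>
      intro hi r hr hr'
      have hi1 := hτ01 i (by omega)
      have hi2 := hτ01 (i + 1) hi
      have hi12 := hτ (Nat.le_succ i)
      obtain ⟨q, hq, hq'⟩ := hshort _ (hcb hi1)
      have hpc := hcp.mono hi1.1 hi12 hi2.2
      have hpF : MapsTo c (Icc (τ i) (τ (i + 1))) (μ ⁻¹' {b}) :=
        hcb.mono_left (Icc_subset_Icc hi1.1 hi2.2)
      have h1 := mem_pathIntegrals_of_le (η := γ) hpc hpF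
      have h2 := abs_integral_le_of_length_le g (η := γ) hi12 zero_le_two hδ.le
        (fun t htI v => hbound _ (hpF htI) v) (hℓ i)
      have h3 := hquant _ h0 _ (add_mem_pathIntegrals hγ hFU (add_mem_pathIntegrals hγ hFU hq h1)
        (neg_mem_pathIntegrals hr)) (by
          refine (abs_add_le _ _).trans ?_
          rw [abs_neg]
          linarith [abs_add_le q (∫ t in τ i..τ (i + 1), γ (c t) (velocity (𝓡 4) c t))])
      have h4 := ih (by omega) q hq hq'
      have h5 := intervalIntegral.integral_add_adjacent_intervals
        (hγ.intervalIntegrable (hcp.mono le_rfl hi1.1 hi1.2)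
          ((hcb.mono_left (Icc_subset_Icc le_rfl hi1.2)).mono_right hFU))
        (hγ.intervalIntegrable hpc (hpF.mono_right hFU))
      linarith
  have := claim n le_rfl 0 (by rw [hτn, hloop]; exact zero_mem_pathIntegrals h0) (by
    rw [abs_zero]; positivity)
  rwa [hτn] at this

/-- Since η is closed and the classes of the generating cycles are constant in H₁(U), its periods on
X_{μ x} and on X_b agree. On X_b the form γ integrates to zero over loops, so the periods of η there
are those of α. -/
lemma Conditions.mem_BS_of_fiber (hc : Conditions L g μ Brg b W R γ ζ σ δ K)
    (ht : IsTuple Ω μ Brg b W R γ ζ σ δ K) (hf : IsFibration Ω μ Brg) (hp : IsPrequantum nabla Ω)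
    (hθ : IsAngle nabla m γ (μ ⁻¹' W) θ) (hb : b ∈ BS nabla μ m) (hm : 0 < m) (hδm : m * δ ≤ 1)
    (hs : IsUnitSection s (μ ⁻¹' W)) (hxW : μ x ∈ W) (hr : ‖ζ (μ x)‖ < 3 * R) {l : ℕ}
    (hloop : ∀ r ∈ pathIntegrals (totalForm nabla s γ) (μ ⁻¹' {μ x}) x x,
      ∃ n : ℤ, l * r = 2 * Real.pi * n) : b ∈ BS nabla μ l := by
  have hU := hf.isOpen_preimage ht
  have hFU : μ ⁻¹' {b} ⊆ μ ⁻¹' W := preimage_mono (singleton_subset_iff.2 ht.mem)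
  have hFU' : μ ⁻¹' {μ x} ⊆ μ ⁻¹' W := preimage_mono (singleton_subset_iff.2 hxW)
  have hγ := ht.smooth_γ.evalSmoothOn hU
  have hα := evalSmoothOn_potential hp hU hs
  have hev := evalSmoothOn_totalForm hp hU hs ht.smooth_γ
  obtain ⟨e, he, hgen, hcls, -, -⟩ := hc.cycles
  obtain ⟨T, k, hT⟩ := exists_formAtlas hU hev (closed_totalForm hp hU hs ht.smooth_γ ht.primitive)
  -- The numbers whose l-fold lies in 2πℤ form a group, so membership of periods is checked on
  -- generators.
  set G : AddSubgroup ℝ := (AddSubgroup.zmultiples (2 * Real.pi)).comap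
    (AddMonoidHom.mulLeft (l : ℝ)) with hG
  have hGmem : ∀ r, r ∈ G ↔ ∃ n : ℤ, l * r = 2 * Real.pi * n := by
    intro r
    rw [hG, AddSubgroup.mem_comap, AddSubgroup.mem_zmultiples_iff]
    refine exists_congr fun n => ?_
    rw [AddMonoidHom.coe_mulLeft, zsmul_eq_mul, mul_comm]
    exact eq_comm
  have hcycle : ∀ i, (totalForm nabla s γ).integralCycle (e i ⟨b, ht.mem⟩) ∈ G := by
    intro i
    have h1 := hT.evalChain_period hev hFU (e i ⟨b, ht.mem⟩) (he i ⟨b, ht.mem⟩)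
    have h2 := hT.evalChain_period hev hFU' (e i ⟨μ x, hxW⟩) (he i ⟨μ x, hxW⟩)
    have h3 := evalChain_eq_of_cls_eq T.coboundary_period (hcls i ⟨μ x, hxW⟩ ⟨b, ht.mem⟩)
    have h4 : ∀ w : W, evalChain T.period (Cycle₁.push (fiberIncl μ w.2) (e i w)).1
        = evalChain (fun s => T.period ((fiberIncl μ w.2).comp s)) (e i w).1 :=
      fun w => evalChain_pushChain _ _ _
    rw [h4, h4] at h3
    rw [← h1]
    refine ((hGmem _).2 ?_ : evalChain (fun s => T.period ((fiberIncl μ ht.mem).comp s)) _ ∈ G)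
    rw [← h3]
    obtain ⟨n, hn⟩ := exists_int_sum_integral hev hFU'
      (fun y hy => hc.pathIntegrals_nonempty _ hxW hr hy) l hloop (e i ⟨μ x, hxW⟩) (he i ⟨μ x, hxW⟩)
    exact ⟨n, (congrArg (fun r => (l : ℝ) * r) h2).trans hn⟩
  refine (mem_BS_iff hp hU hs hFU l).2 ?_
  rintro y hy r ⟨c, hcp, hc0, hc1, hcF, rfl⟩
  have hcU := hcF.mono_right hFU
  set z : Simplex 1 (μ ⁻¹' {b}) := pathSimplex c hcp.continuousOn hcF
  have hz : Finsupp.single z (1 : ℤ) ∈ Cycle₁ (μ ⁻¹' {b}) := by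
    have e0 : z (stdSimplex.vertex 0) = z (stdSimplex.vertex 1) := Subtype.ext
      ((pathSimplex_zero hcp.continuousOn hcF).trans (hc0.trans (hc1.symm.trans
        (pathSimplex_one hcp.continuousOn hcF).symm)))
    rw [AddMonoidHom.mem_ker, boundary_single, e0, sub_self]
  have h1 := evalChain_mem (A := fun s => T.period ((fiberIncl μ ht.mem).comp s)) (by
    have := coboundary_pullCochain ℝ (fiberIncl μ ht.mem) 1 T.period
    rw [T.coboundary_period, map_zero] at this
    exact this) (hgen ⟨b, ht.mem⟩) (G := G) (fun i => by
      have := hT.evalChain_period hev hFU (e i ⟨b, ht.mem⟩) (he i ⟨b, ht.mem⟩)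
      have h2 := hcycle i
      rw [← this] at h2
      exact h2) ⟨_, hz⟩
  rw [evalChain_single, Int.cast_one, one_mul, hT.period_eq_integral hev hcp fun p => rfl] at h1
  obtain ⟨n, hn⟩ := (hGmem _).1 h1
  have h2 : ∫ t in (0 : ℝ)..1, totalForm nabla s γ (c t) (velocity (𝓡 4) c t)
      = (∫ t in (0 : ℝ)..1, potential nabla s (c t) (velocity (𝓡 4) c t))
        + ∫ t in (0 : ℝ)..1, γ (c t) (velocity (𝓡 4) c t) :=
    intervalIntegral.integral_add (hα.intervalIntegrable hcp hcU) (hγ.intervalIntegrable hcp hcU)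
  rw [h2, hc.integral_eq_zero ht hf hp hθ hb hm hδm hcp hcF (hc1.trans hc0.symm), add_zero] at hn
  exact ⟨n, hn⟩

/-- Points of the circle bundle over the same fiber of `μ` that are not distinguished by the
angular coordinate are close to each other. -/
lemma Conditions.hatDist_le_of_fiber (hc : Conditions L g μ Brg b W R γ ζ σ δ K)
    (ht : IsTuple Ω μ Brg b W R γ ζ σ δ K) (hf : IsFibration Ω μ Brg) (hp : IsPrequantum nabla Ω)
    (hθ : IsAngle nabla m γ (μ ⁻¹' W) θ) (hb : b ∈ strictBS nabla μ m) (hm : 0 < m)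
    (hδm : m * δ ≤ 1) {u û : TotalSpace ℂ L} (hu : u ∈ circleBundle L) (hû : û ∈ circleBundle L)
    (huW : μ u.proj ∈ W) (hr : ‖ζ (μ u.proj)‖ < 3 * R) (hproj : μ û.proj = μ u.proj)
    (huû : θ û = θ u) :
    hatDist g nabla u û ≤ ENNReal.ofReal ((3 * (m * m) + 1) * ((6 * R + 3) * δ)) := by
  have hU := hf.isOpen_preimage ht
  obtain ⟨s, hs⟩ := exists_unitSection hp hc.trivial
  have hδ := ht.δ_pos
  have hR := ht.R_pos
  set x := u.proj with hx
  set F := μ ⁻¹' {μ x} with hF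
  have hFU : F ⊆ μ ⁻¹' W := preimage_mono (singleton_subset_iff.2 huW)
  have hev := evalSmoothOn_totalForm hp hU hs ht.smooth_γ
  have hbound : ∀ y ∈ F, ∀ v, |γ y v| ≤ (6 * R + 2) * g.norm y v := fun y hy v =>
    hc.abs_le ht hf (hFU hy) (by rw [show μ y = μ x from hy]; exact hr) v
  -- The cost of following a path of length at most δ in the fiber with θ constant: 1 + C for the
  -- bound C = 6R + 2 on γ.
  set κ := (6 * R + 3) * δ with hκ
  have hκ0 : 0 ≤ κ := by positivity
  have hκe : (1 + (6 * R + 2)) * δ = κ := by rw [hκ]; ring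
  have hshift : ∀ {c : ℝ → X} {t₀ t₁ : ℝ}, PiecewiseC1On (𝓡 4) c t₀ t₁ → MapsTo c (Icc t₀ t₁) F →
      lengthOn (𝓡 4) g.norm c t₀ t₁ ≤ ENNReal.ofReal δ →
      -(∫ t in t₀..t₁, totalForm nabla s γ (c t) (velocity (𝓡 4) c t))
        ∈ phaseShifts nabla g s θ κ (c t₀) (c t₁) := fun hc' hcF hcl => by
    rw [← hκe]
    exact hθ.neg_integral_mem_phaseShifts hp hU hs ht.smooth_γ ht.primitive (by positivity) hc'
      (hcF.mono_right hFU) (fun t htI => hbound _ (hcF htI)) hcl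
  have hshort : ∀ y ∈ F, (phaseShifts nabla g s θ κ x y).Nonempty := by
    intro y hy
    obtain ⟨d, hd, hd0, hd1, hdF, hdl⟩ := hc.exists_fiber_curve huW hr hy
    have := hshift hd hdF hdl.le
    rw [hd0, hd1] at this
    exact ⟨_, this⟩
  have hxF : x ∈ F := rfl
  -- The phases picked up by cheap motions from x back to x; 3κ allows for a triangle of three short
  -- paths.
  set T : Set Circle := Circle.exp '' phaseShifts nabla g s θ (3 * κ) x x with hT
  have hTm : ∀ t ∈ T, t ^ m = 1 := by
    rintro _ ⟨f, hf, rfl⟩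
    exact hθ.exp_pow_eq_one hs huW hf
  -- A loop is cut into pieces of length at most δ. Joining the division points to x by short paths
  -- writes its phase as a product of phases of short triangles.
  have hholonomy : ∀ r ∈ pathIntegrals (totalForm nabla s γ) F x x,
      Circle.exp (-r) ∈ Subgroup.closure T := by
    rintro r ⟨c, hcp, hc0, hc1, hcF, rfl⟩
    obtain ⟨n, τ, hτ, hτ0, hτn, hℓ⟩ := exists_fine_subdivision g hcp hδ
    have hτ01 : ∀ i ≤ n, τ i ∈ Icc (0 : ℝ) 1 := fun i hi =>
      ⟨hτ0 ▸ hτ (Nat.zero_le i), hτn ▸ hτ hi⟩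
    have mono : ∀ {κ' f}, κ' ≤ 3 * κ → f ∈ phaseShifts nabla g s θ κ' x x →
        Circle.exp f ∈ Subgroup.closure T := fun {κ' f} h hf =>
      Subgroup.subset_closure ⟨f, fun ψ => ⟨(hf ψ).1, (hf ψ).2.trans (ENNReal.ofReal_le_ofReal h)⟩,
        rfl⟩
    have claim : ∀ i ≤ n, ∀ f ∈ phaseShifts nabla g s θ κ x (c (τ i)),
        Circle.exp (-(∫ t in (0 : ℝ)..τ i, totalForm nabla s γ (c t) (velocity (𝓡 4) c t)) - f)
          ∈ Subgroup.closure T := by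
      intro i
      induction i with
      | zero =>
        intro _ f hf
        rw [hτ0, hc0] at hf
        rw [hτ0, intervalIntegral.integral_same, neg_zero, zero_sub]
        exact mono (by linarith) (neg_mem_phaseShifts hf)
      | succ i ih =>
        intro hi f hf
        have hi1 := hτ01 i (by omega)
        have hi2 := hτ01 (i + 1) hi
        have hi12 := hτ (Nat.le_succ i)
        obtain ⟨q, hq⟩ := hshort _ (hcF hi1)
        have hpc := hcp.mono hi1.1 hi12 hi2.2
        have hpF : MapsTo c (Icc (τ i) (τ (i + 1))) F :=
          hcF.mono_left (Icc_subset_Icc hi1.1 hi2.2)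
        have h1 := hshift hpc hpF (hℓ i)
        have h2 := mono (by linarith) (add_mem_phaseShifts (by linarith) hκ0
          (add_mem_phaseShifts hκ0 hκ0 hq h1) (neg_mem_phaseShifts hf))
        have h3 := Subgroup.mul_mem _ (ih (by omega) q hq) h2
        rw [← Circle.exp_add] at h3
        have h5 := intervalIntegral.integral_add_adjacent_intervals
          (hev.intervalIntegrable (hcp.mono le_rfl hi1.1 hi1.2)
            ((hcF.mono_left (Icc_subset_Icc le_rfl hi1.2)).mono_right hFU))
          (hev.intervalIntegrable hpc (hpF.mono_right hFU))
        rw [← h5]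
        convert h3 using 2
        ring
    have h0 : (0 : ℝ) ∈ phaseShifts nabla g s θ κ x (c (τ n)) := by
      rw [hτn, hc1]
      intro ψ
      rw [add_zero]
      exact ⟨rfl, by rw [hatDist_self (liftPoint_mem hs huW ψ)]; exact zero_le⟩
    have := claim n le_rfl 0 h0
    rwa [hτn, sub_zero] at this
  -- If some m-th root of unity were missing, the holonomy of η on this fiber would be killed by
  -- some l < m, and b would lie in BS_l, contrary to strictness.
  have hroots : ∀ z : Circle, z ^ m = 1 → z ∈ Subgroup.closure T := by
    intro z hz
    by_contra hcon
    obtain ⟨l, hl1, hlm, hl⟩ := exists_pow_eq_one_of_notMem_closure hm hTm hz hcon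
    refine hb.2 l hl1 hlm (hc.mem_BS_of_fiber ht hf hp hθ hb.1 hm hδm hs huW hr fun r hr' => ?_)
    exact (circle_exp_neg_pow_eq_one_iff r l).1 (hl _ (hholonomy r hr'))
  obtain ⟨f, hf'⟩ := hshort û.proj hproj
  obtain ⟨ψ, hψ⟩ := exists_liftPoint hs hu huW
  obtain ⟨ψ', hψ'⟩ := exists_liftPoint hs hû (show μ û.proj ∈ W by rw [hproj]; exact huW)
  have hyW : û.proj ∈ μ ⁻¹' W := by
    change μ û.proj ∈ W
    rw [hproj]; exact huW
  -- After a short path from x to the base point of û, the two points differ by a rotation that θ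
  -- does not see, hence by an m-th root of unity.
  set z := Circle.exp (ψ' - (ψ + f)) with hz
  have hûz : û = liftPoint s û.proj (ψ + f + (ψ' - (ψ + f))) := by
    rw [add_sub_cancel]; exact hψ'
  have hzm : z ^ m = 1 := by
    have h1 := (hf' ψ).1
    rw [← hψ, ← huû] at h1
    rw [liftPoint_add] at hûz
    have h2 := congrArg θ hûz
    rw [hθ.equivariant _ (liftPoint_mem hs hyW _) hyW, h1] at h2
    exact right_eq_mul.1 h2
  -- Costs add under composition of shifts, so every root of unity costs at most m² · 3κ; the path
  -- to the other base point adds one more κ.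
  have hcost := induction_of_mem_closure hm hTm (Q := fun a n => ∀ φ, hatDist g nabla
    (liftPoint s x φ) (rot a (liftPoint s x φ)) ≤ ENNReal.ofReal (n * (3 * κ)))
    (fun φ => by
      have : rot 1 (liftPoint s x φ) = liftPoint s x φ := by
        rw [rot, Circle.coe_one, one_smul]
      rw [this, hatDist_self (liftPoint_mem hs huW φ)]; exact zero_le)
    (fun a a' i j hi hj φ => by
      obtain ⟨f, rfl⟩ : ∃ f, Circle.exp f = a' := ⟨_, Circle.exp_arg a'⟩
      have h1 : rot (a * Circle.exp f) (liftPoint s x φ) = rot a (liftPoint s x (φ + f)) := by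
        rw [liftPoint_add, rot, rot, rot, Circle.coe_mul, mul_smul]
      have h2 := hj φ
      rw [← liftPoint_add] at h2
      rw [h1]
      refine (hatDist_triangle _ _ _).trans ((add_le_add h2 (hi _)).trans ?_)
      rw [← ENNReal.ofReal_add (by positivity) (by positivity)]
      refine ENNReal.ofReal_le_ofReal (le_of_eq ?_)
      push_cast; ring)
    (fun a i j hij hi φ => (hi φ).trans (ENNReal.ofReal_le_ofReal (by gcongr)))
    (by
      rintro _ ⟨f, hf, rfl⟩ φ
      rw [← liftPoint_add, Nat.cast_one, one_mul]
      exact (hf φ).2) (hroots z hzm)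
  have h3 := (hf' (ψ + (ψ' - (ψ + f)))).2
  have h4 := hcost ψ
  rw [← liftPoint_add] at h4
  have h5 : liftPoint s û.proj (ψ + (ψ' - (ψ + f)) + f) = û := by
    rw [hûz]
    change liftPoint s û.proj _ = liftPoint s û.proj _
    congr 1; ring
  rw [h5] at h3
  rw [hψ]
  refine (hatDist_triangle _ _ _).trans ((add_le_add h4 h3).trans ?_)
  rw [← ENNReal.ofReal_add (by positivity) hκ0]
  refine ENNReal.ofReal_le_ofReal (le_of_eq ?_)
  push_cast; ring

end Fiber

/-! ### Comparison of the distances -/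

section Comparison

/-- The radius bound from compactness is irrelevant here, because the angular term is dropped. -/
lemma norm_sub_le_length_model {m : ℕ} (hm : 0 < m) {c : ℝ → ℝ × Plane} {a b ℓ : ℝ}
    (hc : PiecewiseC1On 𝓘(ℝ, ℝ × Plane) c a b) (hℓ0 : 0 ≤ ℓ)
    (hℓ : lengthOn 𝓘(ℝ, ℝ × Plane) (modelNorm m) c a b ≤ ENNReal.ofReal ℓ) :
    ‖(c b).2 - (c a).2‖ ≤ ℓ := by
  obtain ⟨ρ, hρ⟩ := isCompact_Icc.exists_bound_of_continuousOn
    (continuous_snd.comp_continuousOn hc.continuousOn)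
  refine le_trans (Real.le_sqrt_of_sq_le ?_) (sqrt_le_length_model hm hc hρ hℓ0 hℓ)
  exact le_add_of_nonneg_left (by positivity)

/-- Averaging the estimates from the two ends of the curve gives half of the length. -/
lemma norm_le_of_length_model {m : ℕ} (hm : 0 < m) {c : ℝ → ℝ × Plane} {ρ ℓ : ℝ}
    (hc : PiecewiseC1On 𝓘(ℝ, ℝ × Plane) c 0 1) (hℓ0 : 0 ≤ ℓ)
    (hℓ : lengthOn 𝓘(ℝ, ℝ × Plane) (modelNorm m) c 0 1 ≤ ENNReal.ofReal ℓ)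
    (h0 : ‖(c 0).2‖ ≤ ρ) (h1 : ‖(c 1).2‖ ≤ ρ) {t : ℝ} (ht : t ∈ Icc (0 : ℝ) 1) :
    ‖(c t).2‖ ≤ ρ + ℓ / 2 := by
  have h2 := lengthOn_add (I := 𝓘(ℝ, ℝ × Plane)) (N := modelNorm m) (c := c) ht.1 ht.2
  have hfin : lengthOn 𝓘(ℝ, ℝ × Plane) (modelNorm m) c 0 1 ≠ ⊤ :=
    ne_top_of_le_ne_top ENNReal.ofReal_ne_top hℓ
  rw [h2] at hfin hℓ
  obtain ⟨hA, hB⟩ := ENNReal.add_ne_top.1 hfin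
  have h3 := norm_sub_le_length_model hm (hc.mono le_rfl ht.1 ht.2) ENNReal.toReal_nonneg
    (ENNReal.ofReal_toReal hA).ge
  have h4 := norm_sub_le_length_model hm (hc.mono ht.1 ht.2 le_rfl) ENNReal.toReal_nonneg
    (ENNReal.ofReal_toReal hB).ge
  have h5 := ENNReal.toReal_le_of_le_ofReal hℓ0 hℓ
  rw [ENNReal.toReal_add hA hB] at h5
  have h6 := norm_add_le ((c t).2 - (c 0).2) (c 0).2
  have h7 := norm_sub_le (c 1).2 ((c 1).2 - (c t).2)
  rw [sub_add_cancel] at h6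
  rw [sub_sub_cancel] at h7
  linarith

/-- Comparison of the weights of a short segment. -/
lemma sqrt_segment_le {a k e r m ρ : ℝ} (he : 0 < e) (he1 : e ≤ 1) (hm : 0 < m) (hr : 0 ≤ r)
    (hρ : r - e ≤ ρ) (hk : √(a ^ 2 / (m ^ 2 * (1 + (r + e) ^ 2)) + k ^ 2) ≤ e) :
    √((a / m) ^ 2 / (1 + ρ ^ 2) + k ^ 2) ≤ (1 + 3 * e) * e := by
  have h1 := one_add_sq_le he he1 (r := r + e) (s := ρ) (by linarith) (by linarith)
  rw [Real.sqrt_le_left he.le] at hk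
  refine Real.sqrt_le_iff.2 ⟨by positivity, ?_⟩
  have h2 : (a / m) ^ 2 / (1 + ρ ^ 2)
      ≤ (1 + 6 * e) * (a ^ 2 / (m ^ 2 * (1 + (r + e) ^ 2))) := by
    rw [div_pow, div_div, mul_div_assoc', div_le_div_iff₀ (by positivity) (by positivity)]
    have := mul_le_mul_of_nonneg_left h1 (show 0 ≤ a ^ 2 * m ^ 2 by positivity)
    nlinarith
  have h3 : k ^ 2 ≤ (1 + 6 * e) * k ^ 2 := by nlinarith [sq_nonneg k]
  calc _ ≤ (1 + 6 * e) * (a ^ 2 / (m ^ 2 * (1 + (r + e) ^ 2)) + k ^ 2) := by linarith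
    _ ≤ (1 + 6 * e) * e ^ 2 := by gcongr
    _ ≤ _ := by nlinarith [sq_nonneg (e * e)]

variable {X : Type*} [TopologicalSpace X] [T2Space X] [ChartedSpace Four X] [IsManifold (𝓡 4) ∞ X]
  {L : X → Type*} [TopologicalSpace (TotalSpace ℂ L)] [∀ x, NormedAddCommGroup (L x)]
  [∀ x, InnerProductSpace ℂ (L x)] [FiberBundle ℂ L] [VectorBundle ℝ ℂ L] [VectorBundle ℂ ℂ L]
  [ContMDiffVectorBundle ∞ ℂ L (𝓡 4)] {nabla : CovariantDerivative (𝓡 4) ℂ L}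
  {B : Type*} [TopologicalSpace B] [T2Space B] [ChartedSpace Plane B] [IsManifold (𝓡 2) ∞ B]
  {Ω : TwoTensor X} {g : Metric X} {μ : X → B} {Brg : Set B} {b : B} {W : Set B} {R : ℝ}
  {γ : OneForm X} {ζ : B → Plane} {σ δ K ρ ℓ : ℝ} {θ : TotalSpace ℂ L → Circle} {m : ℕ}
  {u û : TotalSpace ℂ L}

/-- The model curve is cut into n arcs of length at most e, each arc is replaced by its chord, and
the chords are lifted one after the other. The last term is the diameter bound for the fibers of the
approximation map. -/
lemma Conditions.hatDist_le_of_curve (hc : Conditions L g μ Brg b W R γ ζ σ δ K)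
    (ht : IsTuple Ω μ Brg b W R γ ζ σ δ K) (hf : IsFibration Ω μ Brg) (hp : IsPrequantum nabla Ω)
    (hθ : IsAngle nabla m γ (μ ⁻¹' W) θ) (hb : b ∈ strictBS nabla μ m) (hm : 0 < m)
    (hδm : m * δ ≤ 1) (hu : u ∈ circleBundle L) (hû : û ∈ circleBundle L)
    (huW : μ u.proj ∈ W) (hûW : μ û.proj ∈ W) {c : ℝ → ℝ × Plane}
    (hcp : PiecewiseC1On 𝓘(ℝ, ℝ × Plane) c 0 1) (h0 : Circle.exp (c 0).1 = θ u)
    (h0' : (c 0).2 = ζ (μ u.proj)) (h1 : Circle.exp (c 1).1 = θ û) (h1' : (c 1).2 = ζ (μ û.proj))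
    {n : ℕ} {e : ℝ} (hn : 0 < n) (he : 0 < e) (he1 : e ≤ 1)
    (hℓ : lengthOn 𝓘(ℝ, ℝ × Plane) (modelNorm m) c 0 1 ≤ ENNReal.ofReal (n * e))
    (hR : ∀ t ∈ Icc (0 : ℝ) 1, ‖(c t).2‖ + e < 3 * R) :
    hatDist g nabla u û ≤ ENNReal.ofReal (n * ((1 + 2 * δ + σ) * ((1 + 3 * e) * e) + 4 * δ) +
      (3 * (m * m) + 1) * ((6 * R + 3) * δ)) := by
  have hδ := ht.δ_pos
  have hσ := ht.σ_pos
  have hR0 := ht.R_pos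
  have hm0 : (0 : ℝ) < m := by exact_mod_cast hm
  have hn0 : (0 : ℝ) < n := by exact_mod_cast hn
  obtain ⟨τ, hτ, hτ0, hτn, hτℓ⟩ := exists_subdivision (modelNorm_nonneg m)
    ((continuous_modelNorm m hm).continuousOn (s := TotalSpace.proj ⁻¹' univ)) hcp
    (mapsTo_univ _ _) hn hℓ
  rw [mul_div_cancel_left₀ _ hn0.ne'] at hτℓ
  have hτ01 : ∀ i ≤ n, τ i ∈ Icc (0 : ℝ) 1 := fun i hi =>
    ⟨hτ0 ▸ hτ (Nat.zero_le i), hτn ▸ hτ hi⟩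
  set E := (1 + 2 * δ + σ) * ((1 + 3 * e) * e) + 4 * δ with hE
  have hE0 : 0 ≤ E := by positivity
  have step : ∀ i : ℕ, i ≤ n → ∃ v ∈ circleBundle L, μ v.proj ∈ W ∧ ζ (μ v.proj) = (c (τ i)).2 ∧
      θ v = Circle.exp (c (τ i)).1 ∧ hatDist g nabla u v ≤ ENNReal.ofReal (i * E) := by
    intro i
    induction i with
    | zero =>
      intro _
      exact ⟨u, hu, huW, by rw [hτ0, h0'], by rw [hτ0, h0], by simp [hatDist_self hu]⟩
    | succ i ih =>
      intro hi
      obtain ⟨v, hv, hvW, hvζ, hvθ, hvd⟩ := ih (by omega)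
      have hi1 := hτ01 i (by omega)
      have hi2 := hτ01 (i + 1) hi
      have hi12 := hτ (Nat.le_succ i)
      set k := (c (τ (i + 1))).2 - (c (τ i)).2 with hk
      set r := ‖(c (τ i)).2‖ with hr
      have hpc := hcp.mono hi1.1 hi12 hi2.2
      have hnear : ∀ t ∈ Icc (τ i) (τ (i + 1)), ‖(c t).2‖ ≤ r + e := by
        intro t htI
        have h2 := norm_sub_le_length_model hm (hpc.mono le_rfl htI.1 htI.2) he.le
          ((lengthOn_mono le_rfl htI.2).trans (hτℓ i))
        have h3 := norm_add_le ((c t).2 - (c (τ i)).2) (c (τ i)).2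
        rw [sub_add_cancel] at h3
        linarith
      have hke : ‖k‖ ≤ e := norm_sub_le_length_model hm hpc he.le (hτℓ i)
      have h4 := sqrt_le_length_model hm hpc hnear he.le (hτℓ i)
      -- Along the arc the radius is at most r + e, along the chord at least r - e. The weights at
      -- these radii differ by the factor 1 + 6e at most.
      have h5 := sqrt_segment_le (ρ := max (r - e) 0) he he1 hm0 (norm_nonneg _)
        (le_max_left _ _) h4
      obtain ⟨v', h6, h7, h8, h9, h10⟩ := hc.exists_lift_segment ht hf hp hθ
        (ρ := max (r - e) 0) (k := k) (fun t htI => by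
          have h11 : ‖t • k‖ ≤ e := by
            rw [norm_smul, Real.norm_eq_abs, abs_of_nonneg htI.1]
            nlinarith [htI.2, norm_nonneg k]
          have h12 := norm_sub_le ((c (τ i)).2 + t • k) (t • k)
          rw [add_sub_cancel_right] at h12
          exact ⟨max_le (by linarith) (norm_nonneg _),
            (norm_add_le _ _).trans_lt (by linarith [hR _ hi1])⟩) (le_max_right _ _)
        (((c (τ (i + 1))).1 - (c (τ i)).1) / m) hv hvW hvζ
      refine ⟨v', h6, h7, by rw [h8, hk, add_sub_cancel], ?_, ?_⟩
      · rw [h9, hvθ, ← Circle.exp_add, mul_div_cancel₀ _ hm0.ne', sub_add_cancel]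
      · refine (hatDist_triangle _ v _).trans ((add_le_add hvd h10).trans ?_)
        rw [← ENNReal.ofReal_add (by positivity) (by positivity)]
        refine ENNReal.ofReal_le_ofReal ?_
        have h13 := mul_le_mul_of_nonneg_left h5 (show 0 ≤ 1 + 2 * δ + σ by positivity)
        push_cast
        linarith
  obtain ⟨v, hv, hvW, hvζ, hvθ, hvd⟩ := step n le_rfl
  rw [hτn] at hvζ hvθ
  rw [h1'] at hvζ
  -- The lift ends at a point with the same values of θ and ζ ∘ μ as û; as ζ is injective, both
  -- points lie over the same fiber of μ.
  have h2 := hc.hatDist_le_of_fiber ht hf hp hθ hb hm hδm hv hû hvW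
    (by rw [hvζ, ← h1']; linarith [hR 1 ⟨zero_le_one, le_rfl⟩])
    (ht.injOn_ζ hûW hvW hvζ.symm) (by rw [hvθ, h1])
  refine (hatDist_triangle _ v _).trans ((add_le_add hvd h2).trans ?_)
  rw [← ENNReal.ofReal_add (by positivity) (by positivity)]

/-- The projected curve is halved, and each half is kept in the region by starting from the end
point that it contains. Thus only half of the length counts against 3R. -/
lemma Conditions.modelDist_le_of_hatDist_lt (hc : Conditions L g μ Brg b W R γ ζ σ δ K)
    (ht : IsTuple Ω μ Brg b W R γ ζ σ δ K) (hf : IsFibration Ω μ Brg) (hp : IsPrequantum nabla Ω)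
    (hθ : IsAngle nabla m γ (μ ⁻¹' W) θ) (hm : 0 < m) (hσ1 : σ ≤ 1)
    (huW : μ u.proj ∈ W) (hûW : μ û.proj ∈ W) (hσ : σ ≤ ρ)
    (hu : ‖ζ (μ u.proj)‖ ≤ ρ) (hû : ‖ζ (μ û.proj)‖ ≤ ρ) (hℓ0 : 0 ≤ ℓ)
    (hR : ρ + √(1 + δ) * (ℓ / 2) < 3 * R) (hd : hatDist g nabla u û < ENNReal.ofReal ℓ) :
    modelDist m (approxMap μ ζ θ u) (approxMap μ ζ θ û) ≤
      ENNReal.ofReal (4 * σ + √((1 + 6 * σ) * (1 + 4 * δ)) * ℓ) := by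
  have hσ0 := ht.σ_pos
  have hδ := ht.δ_pos
  obtain ⟨c, hcp, rfl, rfl, hcS, hcl⟩ := exists_curve_of_lengthDist_lt hd
  obtain ⟨hpp, hpl⟩ := lengthOn_proj_le g nabla hcp
  obtain ⟨τ, hτ, hτ0, hτ2, hτℓ⟩ := exists_subdivision g.norm_nonneg
    (g.continuous_norm.continuousOn (s := TotalSpace.proj ⁻¹' (univ : Set X))) hpp
    (mapsTo_univ _ _) two_pos (hpl.trans hcl.le)
  have hτ1 : τ 1 ∈ Icc (0 : ℝ) 1 := ⟨hτ0 ▸ hτ zero_le_one, hτ2 ▸ hτ one_le_two⟩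
  have e0 := hτℓ 0
  have e1 := hτℓ 1
  rw [zero_add, hτ0, Nat.cast_two] at e0
  rw [one_add_one_eq_two, hτ2, Nat.cast_two] at e1
  have hleft := hc.mem_of_length_le ht hf (hpp.mono le_rfl hτ1.1 hτ1.2) huW hu hσ (by positivity)
    e0 hR
  have hright := hc.mem_of_length_le_right ht hf (hpp.mono hτ1.1 hτ1.2 le_rfl) hûW hû hσ
    (by positivity) e1 hR
  refine (hc.modelDist_le ht hf hp hm hσ1 hθ hcp fun t htI => ⟨hcS htI, ?_⟩).trans ?_
  · rcases le_total t (τ 1) with h | h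
    · exact ⟨(hleft t ⟨htI.1, h⟩).1, (hleft t ⟨htI.1, h⟩).2.trans_lt hR⟩
    · exact ⟨(hright t ⟨h, htI.2⟩).1, (hright t ⟨h, htI.2⟩).2.trans_lt hR⟩
  · rw [ENNReal.ofReal_add (by positivity) (by positivity), ENNReal.ofReal_mul (p := √_) (by positivity)]
    exact add_le_add le_rfl (mul_le_mul' le_rfl hcl.le)

/-- The actual length of a curve shorter than R is used, which keeps the inequality for the radius
strict. -/
lemma Conditions.mem_of_dist_lt (hc : Conditions L g μ Brg b W R γ ζ σ δ K)
    (ht : IsTuple Ω μ Brg b W R γ ζ σ δ K) (hf : IsFibration Ω μ Brg)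
    (hR : σ + √(1 + δ) * R < 3 * R) {x y : X} (hx : μ x = b)
    (hd : g.dist x y < ENNReal.ofReal R) : μ y ∈ W ∧ ‖ζ (μ y)‖ < √(1 + δ) * R + σ := by
  obtain ⟨c, hcp, rfl, rfl, -, hcl⟩ := exists_curve_of_lengthDist_lt hd
  have hδ := ht.δ_pos
  have hfin := ne_top_of_lt hcl
  have hlt := (ENNReal.lt_ofReal_iff_toReal_lt hfin).1 hcl
  have hmul : √(1 + δ) * (lengthOn (𝓡 4) g.norm c 0 1).toReal < √(1 + δ) * R :=
    mul_lt_mul_of_pos_left hlt (by positivity)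
  have h1 := hc.mem_of_length_le ht hf hcp (by rw [hx]; exact ht.mem)
    (by rw [hx, ht.ζ_b, norm_zero]; exact ht.σ_pos.le) le_rfl ENNReal.toReal_nonneg
    (ENNReal.ofReal_toReal hfin).ge (by linarith) 1 ⟨zero_le_one, le_rfl⟩
  exact ⟨h1.1, h1.2.trans_lt (by linarith)⟩

lemma IsAngle.continuousOn {s : (x : X) → L x} {U : Set X} (hθ : IsAngle nabla m γ U θ)
    (h : IsPrequantum nabla Ω) (hU : IsOpen U) (hs : IsUnitSection s U) (hγ : γ.SmoothOn U)
    (hd : IsExteriorDerivOn γ Ω U) : ContinuousOn θ {u | u ∈ circleBundle L ∧ u.proj ∈ U} := by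
  have hev := evalSmoothOn_totalForm h hU hs hγ
  have hcl := closed_totalForm h hU hs hγ hd
  have h1 : ContinuousOn (fun u => (θ u : ℂ)) {u | u ∈ circleBundle L ∧ u.proj ∈ U} := by
    have h2 : ContinuousOn (fun u : TotalSpace ℂ L => pairing s u ^ m * θ ⟨u.proj, s u.proj⟩)
        {u | u ∈ circleBundle L ∧ u.proj ∈ U} := by
      intro u hu
      have h3 := (contMDiffAt_pairing h (hs.smooth u.proj hu.2)).continuousAt
      have h4 := ((hθ.isPhase h hU hs).contMDiffAt hU hev hcl hu.2).continuousAt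
      have h5 : ContinuousAt (fun u : TotalSpace ℂ L => u.proj) u :=
        (FiberBundle.continuous_proj ℂ L).continuousAt
      exact ((h3.pow m).mul (ContinuousAt.comp (f := fun u : TotalSpace ℂ L => u.proj) h4
        h5)).continuousWithinAt
    exact h2.congr fun u hu => hθ.apply_eq hs hu.1 hu.2
  have h6 : Topology.IsInducing (fun z : Circle => (z : ℂ)) := ⟨rfl⟩
  exact h6.continuousOn_iff.2 h1

lemma IsTuple.continuousOn_approxMap {s : (x : X) → L x} (ht : IsTuple Ω μ Brg b W R γ ζ σ δ K)
    (hf : IsFibration Ω μ Brg) (hθ : IsAngle nabla m γ (μ ⁻¹' W) θ) (h : IsPrequantum nabla Ω)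
    (hs : IsUnitSection s (μ ⁻¹' W)) :
    ContinuousOn (approxMap μ ζ θ) {u | u ∈ circleBundle L ∧ u.proj ∈ μ ⁻¹' W} := by
  refine (hθ.continuousOn h (hf.isOpen_preimage ht) hs ht.smooth_γ ht.primitive).prodMk ?_
  refine ht.continuous_ζ.comp (f := fun u : TotalSpace ℂ L => μ u.proj)
    (hf.smooth.continuous.comp (FiberBundle.continuous_proj ℂ L)).continuousOn fun u hu => hu.2

end Comparison

/-! ### The main estimates -/

section MainEstimates

lemma sqrt_one_add_le {δ : ℝ} (hδ : 0 ≤ δ) : √(1 + δ) ≤ 1 + δ :=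
  Real.sqrt_le_iff.2 ⟨by linarith, by nlinarith⟩

lemma radius_le {R σ δ e : ℝ} (hR : 28 ≤ R) (he1 : e ≤ 1) (hδ : 0 < δ)
    (hδe : 1000 * R * δ ≤ e) (hσe : 1000 * R * σ ≤ e) : √(1 + δ) * R + σ ≤ R + 1 / 250 := by
  have h1 := mul_le_mul_of_nonneg_right (sqrt_one_add_le hδ.le) (show 0 ≤ R by linarith)
  have h2 : σ ≤ 1 / 1000 := by nlinarith
  linarith

lemma le_one_div_of_mul_le {R δ e : ℝ} (hR : 28 ≤ R) (he1 : e ≤ 1) (hδe : 1000 * R * δ ≤ e) :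
    δ ≤ 1 / 28000 := by nlinarith

/-- On lengths up to 4R the multiplicative error is O((σ + δ)R), hence at most a fraction of e. -/
lemma sqrt_mul_le {R σ δ e ℓ : ℝ} (hR : 28 ≤ R) (he1 : e ≤ 1) (hδ : 0 < δ) (hσ : 0 < σ)
    (hδe : 1000 * R * δ ≤ e) (hσe : 1000 * R * σ ≤ e) (hℓ0 : 0 ≤ ℓ) (hℓ : ℓ ≤ 4 * R) :
    4 * σ + √((1 + 6 * σ) * (1 + 4 * δ)) * ℓ ≤ ℓ + e / 2 := by
  have h1 : √((1 + 6 * σ) * (1 + 4 * δ)) ≤ (1 + 6 * σ) * (1 + 4 * δ) :=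
    Real.sqrt_le_iff.2 ⟨by positivity, by
      have : 1 ≤ (1 + 6 * σ) * (1 + 4 * δ) := by nlinarith [mul_pos hσ hδ]
      nlinarith⟩
  have h2 := le_one_div_of_mul_le hR he1 hδe
  have h3 : (1 + 6 * σ) * (1 + 4 * δ) ≤ 1 + (30 * σ + 4 * δ) := by nlinarith
  have h4 := mul_le_mul_of_nonneg_right (h1.trans h3) hℓ0
  have h5 : (30 * σ + 4 * δ) * ℓ ≤ (30 * σ + 4 * δ) * (4 * R) := by gcongr
  have h6 : σ ≤ R * σ := by nlinarith
  nlinarith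

/-- Three errors are added: the relative errors in δ and σ, the relative error 6s from replacing
arcs by chords, and the additive errors (4n + C)δ, for which δ has to be small compared with 1/n. -/
lemma segments_cost_le {R σ δ e ℓ s C : ℝ} {n : ℕ} (hR : 28 ≤ R) (he1 : e ≤ 1)
    (hδ : 0 < δ) (hσ : 0 < σ) (hδe : 1000 * R * δ ≤ e) (hσe : 1000 * R * σ ≤ e) (hs : 0 ≤ s)
    (hns : n * s = ℓ) (hℓ : ℓ ≤ 4 * R) (hsR : 250 * R * s ≤ e) (hn : 8 * (4 * n + C) * δ ≤ e) :
    n * ((1 + 2 * δ + σ) * ((1 + 3 * s) * s) + 4 * δ) + C * δ ≤ ℓ + e / 2 := by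
  have hℓ0 : 0 ≤ ℓ := by rw [← hns]; positivity
  have h1 := le_one_div_of_mul_le hR he1 hδe
  have h2 := le_one_div_of_mul_le hR he1 hσe
  have h3 : (1 + 2 * δ + σ) * (1 + 3 * s) ≤ 1 + (2 * δ + σ + 6 * s) := by nlinarith
  have h4 := mul_le_mul_of_nonneg_right h3 hℓ0
  have h5 : (2 * δ + σ + 6 * s) * ℓ ≤ (2 * δ + σ + 6 * s) * (4 * R) := by gcongr
  have h6 : n * ((1 + 2 * δ + σ) * ((1 + 3 * s) * s) + 4 * δ) + C * δ
      = (1 + 2 * δ + σ) * (1 + 3 * s) * ℓ + (4 * n + C) * δ := by rw [← hns]; ring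
  rw [h6]
  have h7 : 0 < R * δ := mul_pos (by linarith) hδ
  linarith

variable {X : Type*} [TopologicalSpace X] [T2Space X] [ChartedSpace Four X] [IsManifold (𝓡 4) ∞ X]
  {L : X → Type*} [TopologicalSpace (TotalSpace ℂ L)] [∀ x, NormedAddCommGroup (L x)]
  [∀ x, InnerProductSpace ℂ (L x)] [FiberBundle ℂ L] [VectorBundle ℝ ℂ L] [VectorBundle ℂ ℂ L]
  [ContMDiffVectorBundle ∞ ℂ L (𝓡 4)] {nabla : CovariantDerivative (𝓡 4) ℂ L}
  {B : Type*} [TopologicalSpace B] [T2Space B] [ChartedSpace Plane B] [IsManifold (𝓡 2) ∞ B]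
  {Ω : TwoTensor X} {g : Metric X} {μ : X → B} {Brg : Set B} {b : B} {W : Set B} {R : ℝ}
  {γ : OneForm X} {ζ : B → Plane} {σ δ K e : ℝ} {θ : TotalSpace ℂ L → Circle} {m : ℕ}
  {u û p : TotalSpace ℂ L}

lemma Conditions.modelDist_lt (hc : Conditions L g μ Brg b W R γ ζ σ δ K)
    (ht : IsTuple Ω μ Brg b W R γ ζ σ δ K) (hf : IsFibration Ω μ Brg) (hp : IsPrequantum nabla Ω)
    (hθ : IsAngle nabla m γ (μ ⁻¹' W) θ) (hm : 0 < m) (hR : 28 ≤ R) (he : 0 < e) (he1 : e ≤ 1)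
    (hδe : 1000 * R * δ ≤ e) (hσe : 1000 * R * σ ≤ e) (huW : μ u.proj ∈ W) (hûW : μ û.proj ∈ W)
    (hu : ‖ζ (μ u.proj)‖ < √(1 + δ) * R + σ) (hû : ‖ζ (μ û.proj)‖ < √(1 + δ) * R + σ) :
    modelDist m (approxMap μ ζ θ u) (approxMap μ ζ θ û)
      < hatDist g nabla u û + ENNReal.ofReal e := by
  have hδ := ht.δ_pos
  have hσ := ht.σ_pos
  have hR1 := radius_le hR he1 hδ hδe hσe
  have hδ1 := le_one_div_of_mul_le hR he1 hδe
  have hσ1 := le_one_div_of_mul_le hR he1 hσe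
  -- If the distance in the circle bundle exceeds the diameter bound of the model region, there is
  -- nothing to prove. Otherwise the lengths are at most 2R + 4, and half of that still fits below
  -- 3R.
  rcases le_or_gt (ENNReal.ofReal (Real.pi + 2 * (√(1 + δ) * R + σ))) (hatDist g nabla u û)
    with h | h
  · refine (BohrSommerfeld.modelDist_le m hm _ _).trans_lt ?_
    refine lt_of_lt_of_le ?_ (add_le_add h le_rfl)
    rw [← ENNReal.ofReal_add (by positivity) he.le]
    refine (ENNReal.ofReal_lt_ofReal_iff (by positivity)).2 ?_
    have : ‖ζ (μ û.proj) - ζ (μ u.proj)‖ ≤ _ := norm_sub_le _ _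
    change Real.pi + ‖ζ (μ û.proj) - ζ (μ u.proj)‖ < _
    linarith
  have hfin := ne_top_of_lt h
  have hdlt := (ENNReal.lt_ofReal_iff_toReal_lt hfin).1 h
  set d := (hatDist g nabla u û).toReal with hd
  have hd0 : 0 ≤ d := ENNReal.toReal_nonneg
  have hdeq : hatDist g nabla u û = ENNReal.ofReal d := (ENNReal.ofReal_toReal hfin).symm
  have hℓ : d + e / 4 ≤ 2 * R + 4 := by linarith [Real.pi_lt_d2]
  have h1 := hc.modelDist_le_of_hatDist_lt ht hf hp hθ hm (by linarith) huW hûW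
    (ρ := √(1 + δ) * R + σ) (ℓ := d + e / 4) (le_add_of_nonneg_left (by positivity)) hu.le hû.le
    (by positivity) (by
      have := mul_le_mul (sqrt_one_add_le hδ.le) (show (d + e / 4) / 2 ≤ R + 2 by linarith)
        (by positivity) (by positivity)
      nlinarith) (by
      rw [hdeq]; exact (ENNReal.ofReal_lt_ofReal_iff (by positivity)).2 (by linarith))
  refine h1.trans_lt ?_
  rw [hdeq, ← ENNReal.ofReal_add hd0 he.le]
  refine (ENNReal.ofReal_lt_ofReal_iff (by positivity)).2 ?_
  have := sqrt_mul_le hR he1 hδ hσ hδe hσe (ℓ := d + e / 4) (by positivity) (by linarith)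
  linarith

lemma Conditions.hatDist_lt (hc : Conditions L g μ Brg b W R γ ζ σ δ K)
    (ht : IsTuple Ω μ Brg b W R γ ζ σ δ K) (hf : IsFibration Ω μ Brg) (hp : IsPrequantum nabla Ω)
    (hθ : IsAngle nabla m γ (μ ⁻¹' W) θ) (hb : b ∈ strictBS nabla μ m) (hm : 0 < m)
    (hδm : m * δ ≤ 1) (hR : 28 ≤ R) (he : 0 < e) (he1 : e ≤ 1)
    (hδe : 1000 * R * δ ≤ e) (hσe : 1000 * R * σ ≤ e) {n : ℕ} (hn : 1000 * R ^ 2 ≤ n * e)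
    (hnδ : 8 * (4 * n + (3 * (m * m) + 1) * (6 * R + 3)) * δ ≤ e)
    (huS : u ∈ circleBundle L) (hûS : û ∈ circleBundle L)
    (huW : μ u.proj ∈ W) (hûW : μ û.proj ∈ W)
    (hu : ‖ζ (μ u.proj)‖ < √(1 + δ) * R + σ) (hû : ‖ζ (μ û.proj)‖ < √(1 + δ) * R + σ) :
    hatDist g nabla u û
      < modelDist m (approxMap μ ζ θ u) (approxMap μ ζ θ û) + ENNReal.ofReal e := by
  have hδ := ht.δ_pos
  have hσ := ht.σ_pos
  have hR0 := ht.R_pos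
  have hR1 := radius_le hR he1 hδ hδe hσe
  have hle := BohrSommerfeld.modelDist_le m hm (approxMap μ ζ θ u) (approxMap μ ζ θ û)
  have hfin := ne_top_of_le_ne_top ENNReal.ofReal_ne_top hle
  set d := (modelDist m (approxMap μ ζ θ u) (approxMap μ ζ θ û)).toReal with hd
  have hd0 : 0 ≤ d := ENNReal.toReal_nonneg
  have hdeq : modelDist m (approxMap μ ζ θ u) (approxMap μ ζ θ û) = ENNReal.ofReal d :=
    (ENNReal.ofReal_toReal hfin).symm
  have hdle : d ≤ Real.pi + 2 * (√(1 + δ) * R + σ) := by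
    refine (ENNReal.toReal_le_of_le_ofReal (by positivity) hle).trans ?_
    have : ‖ζ (μ û.proj) - ζ (μ u.proj)‖ ≤ _ := norm_sub_le _ _
    change Real.pi + ‖ζ (μ û.proj) - ζ (μ u.proj)‖ ≤ _
    linarith
  -- The margin e/8 provides an actual curve; together with the error e/2 of the lift it stays below
  -- e.
  set ℓ := d + e / 8 with hℓdef
  have hℓ : ℓ ≤ 2 * R + 4 := by linarith [Real.pi_lt_d2]
  have hℓ0 : 0 < ℓ := by positivity
  obtain ⟨c, hcp, h0, h0', h1, h1', hcl⟩ := exists_curve_of_modelDist_lt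
    (show modelDist m (approxMap μ ζ θ u) (approxMap μ ζ θ û) < ENNReal.ofReal ℓ by
      rw [hdeq]; exact (ENNReal.ofReal_lt_ofReal_iff hℓ0).2 (by linarith))
  have hn0 : 0 < (n : ℝ) := by
    by_contra hcon
    nlinarith [not_lt.1 hcon]
  have hns : (n : ℝ) * (ℓ / n) = ℓ := mul_div_cancel₀ _ hn0.ne'
  have hs0 : 0 < ℓ / n := by positivity
  -- Uses ℓ ≤ 2R + 4 ≤ 4R and 1000 R² ≤ n e.
  have hsR : 250 * R * (ℓ / n) ≤ e := by
    rw [mul_div_assoc', div_le_iff₀ hn0]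
    nlinarith
  have hs1 : ℓ / n ≤ 1 := by nlinarith
  have h2 := hc.hatDist_le_of_curve ht hf hp hθ hb hm hδm huS hûS huW hûW hcp h0 h0' h1 h1'
    (by exact_mod_cast hn0) hs0 hs1 (by rw [hns]; exact hcl.le) fun t htI => by
      have := norm_le_of_length_model hm hcp hℓ0.le hcl.le
        (show ‖(c 0).2‖ ≤ √(1 + δ) * R + σ by rw [h0']; exact hu.le)
        (show ‖(c 1).2‖ ≤ √(1 + δ) * R + σ by rw [h1']; exact hû.le) htI
      linarith
  refine h2.trans_lt ?_
  rw [hdeq, ← ENNReal.ofReal_add hd0 he.le]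
  refine (ENNReal.ofReal_lt_ofReal_iff (by positivity)).2 ?_
  have h3 := segments_cost_le (C := (3 * (m * m) + 1) * (6 * R + 3)) hR he1 hδ hσ hδe hσe hs0.le
    hns (by linarith) hsR hnδ
  rw [← mul_assoc (3 * ((m : ℝ) * m) + 1)]
  linarith

/-- The target ball is slightly larger than the image of the ball around p, so the radial segment to
y is shortened before it is lifted from p. A final rotation, which does not move the base point,
adjusts θ. -/
lemma Conditions.exists_modelDist_lt (hc : Conditions L g μ Brg b W R γ ζ σ δ K)
    (ht : IsTuple Ω μ Brg b W R γ ζ σ δ K) (hf : IsFibration Ω μ Brg) (hp : IsPrequantum nabla Ω)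
    (hθ : IsAngle nabla m γ (μ ⁻¹' W) θ) (hm : 0 < m) (hR : 28 ≤ R) (he : 0 < e) (he1 : e ≤ 1)
    (hδe : 1000 * R * δ ≤ e) (hσe : 1000 * R * σ ≤ e) (hpS : p ∈ circleBundle L)
    (hpb : μ p.proj = b) {y : Circle × Plane} (hy : ‖y.2‖ < √(1 + δ) * R + σ) :
    ∃ u, (u ∈ circleBundle L ∧ g.dist p.proj u.proj < ENNReal.ofReal R) ∧
      modelDist m (approxMap μ ζ θ u) y < ENNReal.ofReal e := by
  have hδ := ht.δ_pos
  have hσ := ht.σ_pos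
  have hR1 := radius_le hR he1 hδ hδe hσe
  have hδ1 := le_one_div_of_mul_le hR he1 hδe
  have hσ1 := le_one_div_of_mul_le hR he1 hσe
  have hR0 : 0 < R := by linarith
  have hm0 : (m : ℝ) ≠ 0 := by exact_mod_cast hm.ne'
  -- Shortening by the factor 1 - q saves about qR = e/4, more than all errors in δ and σ, and
  -- displaces y by less than e.
  set q := e / (4 * R) with hq
  have hq0 : 0 < q := by positivity
  have hqR : q * R = e / 4 := by rw [hq]; field_simp
  have hq1 : q < 1 := by nlinarith
  have hnorm : ‖(1 - q) • y.2‖ = (1 - q) * ‖y.2‖ := by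
    rw [norm_smul, Real.norm_eq_abs, abs_of_pos (by linarith)]
  have hpζ : ζ (μ p.proj) = 0 := by rw [hpb, ht.ζ_b]
  obtain ⟨v, hv, hvW, hvζ, -, hvd⟩ := hc.exists_lift_segment ht hf hp hθ (ξ := 0)
    (k := (1 - q) • y.2) (ρ := 0) (fun t htI => by
      refine ⟨norm_nonneg _, ?_⟩
      rw [zero_add, norm_smul, hnorm, Real.norm_eq_abs, abs_of_nonneg htI.1]
      have h1 : (1 - q) * ‖y.2‖ ≤ 1 * ‖y.2‖ := by gcongr; linarith
      have h2 : t * ((1 - q) * ‖y.2‖) ≤ 1 * ((1 - q) * ‖y.2‖) := by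
        have : 0 ≤ (1 - q) * ‖y.2‖ := by rw [← hnorm]; exact norm_nonneg _
        gcongr; exact htI.2
      linarith) le_rfl 0 hpS (by rw [hpb]; exact ht.mem) hpζ
  obtain ⟨τ, hτ⟩ : ∃ τ, Circle.exp τ = y.1 / θ v := ⟨_, Circle.exp_arg _⟩
  set a := Circle.exp (τ / m) with ha
  have ham : a ^ m * θ v = y.1 := by
    rw [ha, ← Circle.exp_nsmul, nsmul_eq_mul, mul_div_cancel₀ _ hm0, hτ, div_mul_cancel]
  refine ⟨rot a v, ⟨?_, ?_⟩, ?_⟩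
  · change ‖(a : ℂ) • v.2‖ = 1
    rw [norm_smul, Circle.norm_coe, one_mul]
    exact hv
  · change g.dist p.proj v.proj < _
    refine (g.dist_proj_le_hatDist nabla p v).trans_lt (hvd.trans_lt ?_)
    refine (ENNReal.ofReal_lt_ofReal_iff hR0).2 ?_
    have h1 : √((0 : ℝ) ^ 2 / (1 + 0 ^ 2) + ‖(1 - q) • y.2‖ ^ 2) = (1 - q) * ‖y.2‖ := by
      rw [hnorm, zero_pow two_ne_zero, zero_div, zero_add]
      exact Real.sqrt_sq (mul_nonneg (by linarith) (norm_nonneg _))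
    rw [h1]
    have h2 : √(1 + δ) * R + σ ≤ R + (R * δ + σ) := by
      have := mul_le_mul_of_nonneg_right (sqrt_one_add_le hδ.le) hR0.le
      linarith
    have h3 : (1 - q) * ‖y.2‖ ≤ R + (R * δ + σ) - e / 4 := by
      have h4 : (1 - q) * ‖y.2‖ ≤ (1 - q) * (R + (R * δ + σ)) := by
        gcongr
        linarith
      have h5 : 0 ≤ q * (R * δ + σ) := by positivity
      linarith [hqR]
    have h6 : (2 * δ + σ) * ((1 - q) * ‖y.2‖) ≤ (2 * δ + σ) * (2 * R) :=
      mul_le_mul_of_nonneg_left (by linarith [mul_nonneg hq0.le (norm_nonneg y.2)]) (by positivity)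
    nlinarith
  · have h1 : approxMap μ ζ θ (rot a v) = (y.1, (1 - q) • y.2) := by
      refine Prod.ext ?_ ?_
      · exact (hθ.equivariant v hv hvW a).trans ham
      · exact hvζ.trans (zero_add _)
    rw [h1]
    obtain ⟨t, hty⟩ : ∃ t, Circle.exp t = y.1 := ⟨_, Circle.exp_arg _⟩
    refine ((modelDist_le_of_lift (p := (y.1, (1 - q) • y.2)) hty hty).trans
      (lengthDist_model_le_segment m hm t t _ _)).trans_lt ?_
    refine (ENNReal.ofReal_lt_ofReal_iff he).2 ?_
    have h2 : y.2 - (1 - q) • y.2 = q • y.2 := by module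
    change |t - t| + ‖y.2 - (1 - q) • y.2‖ < e
    rw [sub_self, abs_zero, zero_add, h2, norm_smul, Real.norm_eq_abs, abs_of_pos hq0]
    have h3 : q * ‖y.2‖ ≤ q * (2 * R) := by gcongr; linarith
    linarith [hqR]

lemma Conditions.isEquivariantBorelIsometry (hc : Conditions L g μ Brg b W R γ ζ σ δ K)
    (ht : IsTuple Ω μ Brg b W R γ ζ σ δ K) (hf : IsFibration Ω μ Brg) (hp : IsPrequantum nabla Ω)
    (hθ : IsAngle nabla m γ (μ ⁻¹' W) θ) (hb : b ∈ strictBS nabla μ m) (hm : 0 < m)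
    (hδm : m * δ ≤ 1) (hR : 28 ≤ R) (he : 0 < e) (he1 : e ≤ 1)
    (hδe : 1000 * R * δ ≤ e) (hσe : 1000 * R * σ ≤ e) {n : ℕ} (hn : 1000 * R ^ 2 ≤ n * e)
    (hnδ : 8 * (4 * n + (3 * (m * m) + 1) * (6 * R + 3)) * δ ≤ e) (hpS : p ∈ circleBundle L)
    (hpb : μ p.proj = b) :
    IsEquivariantBorelIsometry rot (modelRot m) (hatDist g nabla) (modelDist m)
      {u | u ∈ circleBundle L ∧ g.dist p.proj u.proj < ENNReal.ofReal R}
      (univ ×ˢ Metric.ball (0 : Plane) (√(1 + δ) * R + σ)) e (approxMap μ ζ θ) := by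
  have hR1 := radius_le hR he1 ht.δ_pos hδe hσe
  obtain ⟨s, hs⟩ := exists_unitSection hp hc.trivial
  have hmem : ∀ u : TotalSpace ℂ L, g.dist p.proj u.proj < ENNReal.ofReal R →
      μ u.proj ∈ W ∧ ‖ζ (μ u.proj)‖ < √(1 + δ) * R + σ := fun u hu =>
    hc.mem_of_dist_lt ht hf (by linarith) hpb hu
  refine ⟨fun u hu => ⟨mem_univ _, ?_⟩, fun a u hu => ⟨⟨?_, hu.2⟩, ?_⟩, ?_,
    fun u hu u' hu' => ⟨?_, ?_⟩, fun y hy => ?_⟩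
  · exact mem_ball_zero_iff.2 (hmem u hu.2).2
  · change ‖(a : ℂ) • u.2‖ = 1
    rw [norm_smul, Circle.norm_coe, one_mul]
    exact hu.1
  · exact Prod.ext (hθ.equivariant u hu.1 (hmem u hu.2).1 a) rfl
  · exact ((ht.continuousOn_approxMap hf hθ hp hs).mono fun u hu =>
      ⟨hu.1, (hmem u hu.2).1⟩).domRestrict.borel_measurable
  · exact hc.modelDist_lt ht hf hp hθ hm hR he he1 hδe hσe (hmem u hu.2).1 (hmem u' hu'.2).1
      (hmem u hu.2).2 (hmem u' hu'.2).2
  · exact hc.hatDist_lt ht hf hp hθ hb hm hδm hR he he1 hδe hσe hn hnδ hu.1 hu'.1 (hmem u hu.2).1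
      (hmem u' hu'.2).1 (hmem u hu.2).2 (hmem u' hu'.2).2
  · exact hc.exists_modelDist_lt ht hf hp hθ hm hR he he1 hδe hσe hpS hpb
      (mem_ball_zero_iff.1 hy.2)

lemma IsEquivariantBorelIsometry.mono {P Q : Type*} [TopologicalSpace P] [TopologicalSpace Q]
    {rot : Circle → P → P} {rot₀ : Circle → Q → Q} {d : P → P → ℝ≥0∞} {d₀ : Q → Q → ℝ≥0∞}
    {D : Set P} {D₀ : Set Q} {ε ε' : ℝ} {φ : P → Q}
    (h : IsEquivariantBorelIsometry rot rot₀ d d₀ D D₀ ε φ) (hε : ε ≤ ε') :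
    IsEquivariantBorelIsometry rot rot₀ d d₀ D D₀ ε' φ where
  mapsTo := h.mapsTo
  equivariant := h.equivariant
  borel := h.borel
  almost_isometric u hu u' hu' :=
    ⟨(h.almost_isometric u hu u' hu').1.trans_le (add_le_add le_rfl (ENNReal.ofReal_le_ofReal hε)),
      (h.almost_isometric u hu u' hu').2.trans_le (add_le_add le_rfl (ENNReal.ofReal_le_ofReal hε))⟩
  almost_onto y hy := by
    obtain ⟨u, hu, h'⟩ := h.almost_onto y hy
    exact ⟨u, hu, h'.trans_le (ENNReal.ofReal_le_ofReal hε)⟩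

/-- As (3 - 2√2)⁻¹ = 3 + 2√2, the bound equals 16 + 12√2, and √2 ≥ 1. Only R ≥ 28 is used in the
estimates. -/
lemma le_of_four_sqrt_two_mul_inv_le {R : ℝ} (hR : 4 * √2 * (3 - 2 * √2)⁻¹ ≤ R) : 28 ≤ R := by
  have h1 : √2 ^ 2 = 2 := Real.sq_sqrt zero_le_two
  have h2 : (3 - 2 * √2)⁻¹ = 3 + 2 * √2 := by
    refine inv_eq_of_mul_eq_one_right ?_
    nlinarith
  have h3 : 1 ≤ √2 := Real.one_le_sqrt.2 one_le_two
  rw [h2] at hR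
  nlinarith

end MainEstimates

end BohrSommerfeld

end

theorem theorem4p13 (m : ℕ) (hm : 0 < m) (R ε : ℝ)
    (hR : 4 * √2 * (3 - 2 * √2)⁻¹ ≤ R) (hε : 0 < ε) :
    ∃ δ₀ : ℝ, 0 < δ₀ ∧ ∃ σ₀ : ℝ, 0 < σ₀ ∧
      ∀ (X : Type*) [TopologicalSpace X] [T2Space X] [SecondCountableTopology X]
        [ChartedSpace Four X] [IsManifold (𝓡 4) ∞ X]
        (B : Type*) [TopologicalSpace B] [T2Space B] [SecondCountableTopology B]
        [ChartedSpace Plane B] [IsManifold (𝓡 2) ∞ B]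
        (L : X → Type*) [TopologicalSpace (TotalSpace ℂ L)] [∀ x, NormedAddCommGroup (L x)]
        [∀ x, InnerProductSpace ℂ (L x)] [FiberBundle ℂ L] [VectorBundle ℝ ℂ L]
        [VectorBundle ℂ ℂ L] [ContMDiffVectorBundle ∞ ℂ L (𝓡 4)]
        (Ω : TwoTensor X) (nabla : CovariantDerivative (𝓡 4) ℂ L) (g : BohrSommerfeld.Metric X)
        (μ : X → B) (Brg : Set B) (b : B) (W : Set B) (γ : OneForm X) (ζ : B → Plane)
        (σ δ K : ℝ) (p : TotalSpace ℂ L),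
        IsSymplectic Ω → IsPrequantum nabla Ω → IsFibration Ω μ Brg →
        IsTuple Ω μ Brg b W R γ ζ σ δ K → Conditions L g μ Brg b W R γ ζ σ δ K →
        b ∈ strictBS nabla μ m → p ∈ circleBundle L → μ p.proj = b → δ ≤ δ₀ → σ ≤ σ₀ →
          {x | g.dist p.proj x < ENNReal.ofReal R} ⊆ μ ⁻¹' W ∧
          (∃ θ, IsAngle nabla m γ (μ ⁻¹' W) θ ∧ approxMap μ ζ θ p = (1, 0)) ∧
          ∀ θ, IsAngle nabla m γ (μ ⁻¹' W) θ →
            IsEquivariantBorelIsometry rot (modelRot m) (hatDist g nabla) (modelDist m)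
              {u | u ∈ circleBundle L ∧ g.dist p.proj u.proj < ENNReal.ofReal R}
              (univ ×ˢ Metric.ball (0 : Plane) (√(1 + δ) * R + σ)) ε (approxMap μ ζ θ) := by
  have hR28 := le_of_four_sqrt_two_mul_inv_le hR
  have hR0 : 0 < R := by linarith
  -- The estimates are proved for errors at most 1; a smaller error is stronger.
  set e := min ε 1 with he
  have he0 : 0 < e := lt_min hε one_pos
  have he1 : e ≤ 1 := min_le_right _ _
  -- The number of arcs is fixed before δ₀, in terms of R and e alone, so that δ₀ can absorb the
  -- additive error of every arc.
  obtain ⟨n, hn⟩ := exists_nat_ge (1000 * R ^ 2 / e)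
  rw [div_le_iff₀ he0] at hn
  -- The sum of the three requirements on δ: relative errors, quantization of periods, and additive
  -- errors of the lifts and of the fibers.
  set A := 1000 * R + m + 8 * (4 * n + (3 * (m * m) + 1) * (6 * R + 3)) with hA
  have hA0 : 0 < A := by positivity
  refine ⟨e / A, by positivity, e / (1000 * R), by positivity, ?_⟩
  intro X _ _ _ _ _ B _ _ _ _ _ L _ _ _ _ _ _ _ Ω nabla g μ Brg b W γ ζ σ δ K p _ hp hf ht hc hb
    hpS hpb hδ hσ
  have hδ0 := ht.δ_pos
  have hAδ : A * δ ≤ e := by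
    rw [mul_comm]; exact (le_div_iff₀ hA0).1 hδ
  have hle : ∀ x, x ≤ A → x * δ ≤ e := fun x hx =>
    (mul_le_mul_of_nonneg_right hx hδ0.le).trans hAδ
  have h1 : 1000 * R * δ ≤ e := hle _ (by
    have : 0 ≤ m + 8 * (4 * n + (3 * (m * m) + 1) * (6 * R + 3)) := by positivity
    linarith)
  have h2 : m * δ ≤ 1 := (hle _ (by
    have : 0 ≤ 1000 * R + 8 * (4 * n + (3 * (m * m) + 1) * (6 * R + 3)) := by positivity
    linarith)).trans he1
  have h3 : 8 * (4 * n + (3 * (m * m) + 1) * (6 * R + 3)) * δ ≤ e := hle _ (by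
    have : 0 ≤ 1000 * R + m := by positivity
    linarith)
  have h4 : 1000 * R * σ ≤ e := by
    rw [mul_comm]; exact (le_div_iff₀ (by positivity)).1 hσ
  refine ⟨fun x hx => (hc.mem_of_dist_lt ht hf ?_ hpb hx).1, hc.exists_angle hp hf ht hb.1 hpb,
    fun θ hθ => (hc.isEquivariantBorelIsometry ht hf hp hθ hb hm h2 hR28 he0 he1 h1 h4 hn h3 hpS
      hpb).mono (min_le_left _ _)⟩
  linarith [radius_le hR28 he1 hδ0 h1 h4]
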